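/- Let $n\ge 1$, let $(M,\sigma)$ be a compact $2n$-dimensional symplectic manifold (without boundary), oriented by $\sigma^n$, let $G$ be a compact Lie group whose Lie algebra $\mathfrak g$ carries an $\mathrm{Ad}$-invariant scalar product $\mathrm{tr}(\cdot,\cdot)$, and let $\pi:P\to M$ be a smooth principal $G$-bundle with adjoint bundle $\mathrm{Ad}P=P\times_G\mathfrak g$. Let $\mathcal C(P)$ be the space of principal connections on $P$, an affine space modelled on the space $\Omega^1(M,\mathrm{Ad}P)$ with its $C^\infty$-topology, and let $\mathrm{Gau}(P)$ be the group of gauge transformations (the $G$-equivariant diffeomorphisms of $P$ covering $\mathrm{id}_M$), with Lie algebra $\mathfrak{gau}(P)=\Gamma^\infty(\mathrm{Ad}P)$. It acts naturally from the left by $\varphi\cdot\Gamma=(\varphi^{-1})^*\Gamma$ on connection one-forms and by $\varphi\cdot\eta=(\varphi^{-1})^*\eta$ on $\Omega^k(M,\mathrm{Ad}P)$ (viewed as tensorial forms on $P$). For $\xi\in\mathfrak{gau}(P)$ let $\xi^*_\Gamma\in\Omega^1(M,\mathrm{Ad}P)$ be the derivative at $t=0$ of $\varphi_t\cdot\Gamma$,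 where $\varphi_t$ is any smooth curve of gauge transformations with $\varphi_0=\mathrm{id}$ and velocity $\xi$ at $t=0$, such as $\varphi_t=\exp(t\xi)$. Then: 1. The $2$-form $$\Omega(\alpha,\beta)=\int_M \mathrm{tr}(\alpha\wedge\beta)\wedge\sigma^{n-1},\qquad \alpha,\beta\in\Omega^1(M,\mathrm{Ad}P),$$ is a symplectic structure on $\mathcal C(P)$: it is smooth, skew-symmetric, bilinear, closed and weakly non-degenerate. 2. The action of $\mathrm{Gau}(P)$ on $\mathcal C(P)$ leaves $\Omega$ invariant: the tangent map of $\Gamma\mapsto\varphi\cdot\Gamma$ is $\alpha\mapsto\varphi\cdot\alpha$, and $\Omega(\varphi\cdot\alpha,\varphi\cdot\beta)=\Omega(\alpha,\beta)$. 3. The curvature $\mathrm{curv}\,\Gamma=d\Gamma+\tfrac12[\Gamma\wedge\Gamma]$ lies in $\Omega^2(M,\mathrm{Ad}P)$, and the integration pairing $\langle\eta,\xi\rangle=\int_M\mathrm{tr}(\xi,\eta)$ between $\eta\in\Omega^{2n}(M,\mathrm{Ad}P)$ and $\xi\in\mathfrak{gau}(P)$ is bilinear, weakly non-degenerate and $\mathrm{Gau}(P)$-invariant,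 so that the action on $\Omega^{2n}(M,\mathrm{Ad}P)$ corresponds to the coadjoint action. With respect to this pairing, the action of $\mathrm{Gau}(P)$ on $(\mathcal C(P),\Omega)$ has the momentum map $$\mathcal J:\mathcal C(P)\to\Omega^{2n}(M,\mathrm{Ad}P),\qquad \mathcal J(\Gamma)=\mathrm{curv}\,\Gamma\wedge\sigma^{n-1},$$ that is, $\mathcal J$ is smooth and, for all $\Gamma\in\mathcal C(P)$, $\xi\in\mathfrak{gau}(P)$ and $\beta\in\Omega^1(M,\mathrm{Ad}P)$, $$\Omega(\xi^*_\Gamma,\beta)=\frac{d}{dt}\Big|_{t=0}\langle\mathcal J(\Gamma+t\beta),\xi\rangle .$$ 4. $\mathcal J$ is equivariant: $\mathcal J(\varphi\cdot\Gamma)=\varphi\cdot\mathcal J(\Gamma)$ for all $\varphi\in\mathrm{Gau}(P)$ and $\Gamma\in\mathcal C(P)$. Here smoothness of maps between topological vector spaces is meant in the sense of Michal–Bastiani, and wedge products are defined by sums over shuffles without further factors. -/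

import Mathlib

open scoped Manifold ContDiff Topology
open Set Filter

noncomputable section

namespace GaugeTheory

universe u v

/-! ### Exterior algebra of vector-valued alternating forms -/

section Algebra

variable {E : Type*} [NormedAddCommGroup E] [NormedSpace ℝ E]
  {F : Type*} [NormedAddCommGroup F] [NormedSpace ℝ F]
  {V : Type*} [NormedAddCommGroup V] [NormedSpace ℝ V]
  {W : Type*} [NormedAddCommGroup W] [NormedSpace ℝ W]
  {Z : Type*} [NormedAddCommGroup Z] [NormedSpace ℝ Z]

/-- The multilinear map `(X₁, …, X_{k+l}) ↦ b (α (X₁, …, X_k), β (X_{k+1}, …, X_{k+l}))`. -/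
def tensorPair {k l : ℕ} (b : V →L[ℝ] W →L[ℝ] Z) (α : E [⋀^Fin k]→L[ℝ] V)
    (β : E [⋀^Fin l]→L[ℝ] W) : ContinuousMultilinearMap ℝ (fun _ : Fin (k + l) => E) Z where
  toFun X := b (α fun i => X (Fin.castAdd l i)) (β fun j => X (Fin.natAdd k j))
  map_update_add' := by
    intro inst X i x y
    have hinst : inst = instDecidableEqFin (k + l) := Subsingleton.elim _ _
    subst hinst
    induction i using Fin.addCases with
    | left i =>
      have h1 : ∀ z, (fun j => Function.update X (Fin.castAdd l i) z (Fin.castAdd l j)) =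
          Function.update (fun j => X (Fin.castAdd l j)) i z := fun z =>
        Function.update_comp_eq_of_injective X (Fin.castAdd_injective k l) i z
      have h2 : ∀ z, (fun j => Function.update X (Fin.castAdd l i) z (Fin.natAdd k j)) =
          fun j => X (Fin.natAdd k j) := fun z => by
        funext j
        refine Function.update_of_ne ?_ _ _
        intro h
        have := congrArg Fin.val h
        simp only [Fin.val_natAdd, Fin.val_castAdd] at this
        omega
      simp only [h1, h2, ContinuousAlternatingMap.map_update_add, map_add,
        add_apply]
    | right i =>
      have h1 : ∀ z, (fun j => Function.update X (Fin.natAdd k i) z (Fin.natAdd k j)) =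
          Function.update (fun j => X (Fin.natAdd k j)) i z := fun z =>
        Function.update_comp_eq_of_injective X (Fin.natAdd_injective l k) i z
      have h2 : ∀ z, (fun j => Function.update X (Fin.natAdd k i) z (Fin.castAdd l j)) =
          fun j => X (Fin.castAdd l j) := fun z => by
        funext j
        refine Function.update_of_ne ?_ _ _
        intro h
        have := congrArg Fin.val h
        simp only [Fin.val_natAdd, Fin.val_castAdd] at this
        omega
      simp only [h1, h2, ContinuousAlternatingMap.map_update_add, map_add]
  map_update_smul' := by
    intro inst X i c x
    have hinst : inst = instDecidableEqFin (k + l) := Subsingleton.elim _ _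
    subst hinst
    induction i using Fin.addCases with
    | left i =>
      have h1 : ∀ z, (fun j => Function.update X (Fin.castAdd l i) z (Fin.castAdd l j)) =
          Function.update (fun j => X (Fin.castAdd l j)) i z := fun z =>
        Function.update_comp_eq_of_injective X (Fin.castAdd_injective k l) i z
      have h2 : ∀ z, (fun j => Function.update X (Fin.castAdd l i) z (Fin.natAdd k j)) =
          fun j => X (Fin.natAdd k j) := fun z => by
        funext j
        refine Function.update_of_ne ?_ _ _
        intro h
        have := congrArg Fin.val h
        simp only [Fin.val_natAdd, Fin.val_castAdd] at this
        omega
      simp only [h1, h2, ContinuousAlternatingMap.map_update_smul, map_smul,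
        smul_apply]
    | right i =>
      have h1 : ∀ z, (fun j => Function.update X (Fin.natAdd k i) z (Fin.natAdd k j)) =
          Function.update (fun j => X (Fin.natAdd k j)) i z := fun z =>
        Function.update_comp_eq_of_injective X (Fin.natAdd_injective l k) i z
      have h2 : ∀ z, (fun j => Function.update X (Fin.natAdd k i) z (Fin.castAdd l j)) =
          fun j => X (Fin.castAdd l j) := fun z => by
        funext j
        refine Function.update_of_ne ?_ _ _
        intro h
        have := congrArg Fin.val h
        simp only [Fin.val_natAdd, Fin.val_castAdd] at this
        omega
      simp only [h1, h2, ContinuousAlternatingMap.map_update_smul, map_smul]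
  cont := by
    have h1 : Continuous fun X : Fin (k + l) → E => α fun i => X (Fin.castAdd l i) :=
      α.cont.comp (by fun_prop)
    have h2 : Continuous fun X : Fin (k + l) → E => β fun j => X (Fin.natAdd k j) :=
      β.cont.comp (by fun_prop)
    exact b.continuous₂.comp (h1.prodMk h2)

/-- The wedge product associated with a bilinear map `b : V × W → Z`. Summing over all
permutations and dividing by `k! l!` is the same as summing over the `(k,l)`-shuffles, so no
further factor enters:
`(α ∧ β)(X₁, …, X_{k+l}) = ∑_{shuffles s} sign s · b (α (X_{s 1}, …), β (X_{s (k+1)}, …))`. -/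
def wedge {k l : ℕ} (b : V →L[ℝ] W →L[ℝ] Z) (α : E [⋀^Fin k]→L[ℝ] V)
    (β : E [⋀^Fin l]→L[ℝ] W) : E [⋀^Fin (k + l)]→L[ℝ] Z :=
  ((k.factorial * l.factorial : ℝ)⁻¹) •
    ContinuousMultilinearMap.alternatization (tensorPair b α β)

/-- The powers `σ^j = σ ∧ ⋯ ∧ σ` of a real two-form. -/
def wedgePow (s : E [⋀^Fin 2]→L[ℝ] ℝ) : (j : ℕ) → E [⋀^Fin (2 * j)]→L[ℝ] ℝ
  | 0 => ContinuousAlternatingMap.constOfIsEmpty ℝ E (Fin 0) (1 : ℝ)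
  | j + 1 => wedge (ContinuousLinearMap.mul ℝ ℝ) (wedgePow s j) s

/-- Rewriting the degree of a form along an equality of natural numbers. -/
def castDegree {k l : ℕ} (h : k = l) (α : E [⋀^Fin k]→L[ℝ] V) : E [⋀^Fin l]→L[ℝ] V :=
  h ▸ α

end Algebra

/-! ### Differential forms on manifolds

All manifolds are modelled on normed spaces `E` with the trivial model with corners `𝓘(ℝ, E)`,
hence have no boundary. In Mathlib the tangent space at every point of such a manifold is, by
definition, `E`; a `V`-valued `k`-form on `N` is thus a map `N → E [⋀^Fin k]→L[ℝ] V`. -/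

section Forms

variable {E : Type*} [NormedAddCommGroup E] [NormedSpace ℝ E]
  {N : Type*} [TopologicalSpace N] [ChartedSpace E N]
  {E' : Type*} [NormedAddCommGroup E'] [NormedSpace ℝ E']
  {N' : Type*} [TopologicalSpace N'] [ChartedSpace E' N']
  {E'' : Type*} [NormedAddCommGroup E''] [NormedSpace ℝ E'']
  {N'' : Type*} [TopologicalSpace N''] [ChartedSpace E'' N'']
  {V : Type*} [NormedAddCommGroup V] [NormedSpace ℝ V]

/-- The derivative `T_x f : T_x N → T_{f x} N'`. -/
def tangent (f : N → N') (x : N) : E →L[ℝ] E' := mfderiv 𝓘(ℝ, E) 𝓘(ℝ, E') f x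

/-- The pull-back `f^* η`. -/
def pullback {k : ℕ} (f : N → N') (η : N' → E' [⋀^Fin k]→L[ℝ] V) : N → E [⋀^Fin k]→L[ℝ] V :=
  fun x => (η (f x)).compContinuousLinearMap (tangent (E := E) (E' := E') f x)

/-- The representation of a form in the preferred chart at `x`, a form on (the chart domain in)
the model space. -/
def chartRep {k : ℕ} (x : N) (η : N → E [⋀^Fin k]→L[ℝ] V) : E → E [⋀^Fin k]→L[ℝ] V :=
  pullback (extChartAt 𝓘(ℝ, E) x).symm η

/-- A form is smooth if all its chart representations are. -/
def IsSmoothForm {k : ℕ} (η : N → E [⋀^Fin k]→L[ℝ] V) : Prop :=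
  ∀ x : N, ContDiffOn ℝ ∞ (chartRep x η) (extChartAt 𝓘(ℝ, E) x).target

/-- The exterior derivative, computed in charts. -/
def extD {k : ℕ} (η : N → E [⋀^Fin k]→L[ℝ] V) : N → E [⋀^Fin (k + 1)]→L[ℝ] V :=
  fun x => (extDeriv (chartRep x η) (extChartAt 𝓘(ℝ, E) x x)).compContinuousLinearMap
    (tangent (E := E) (E' := E) (extChartAt 𝓘(ℝ, E) x) x)

theorem tangent_comp {g : N' → N''} {f : N → N'} {x : N}
    (hg : MDifferentiableAt 𝓘(ℝ, E') 𝓘(ℝ, E'') g (f x))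
    (hf : MDifferentiableAt 𝓘(ℝ, E) 𝓘(ℝ, E') f x) :
    tangent (E := E) (E' := E'') (g ∘ f) x =
      (tangent (E := E') (E' := E'') g (f x)).comp (tangent (E := E) (E' := E') f x) :=
  mfderiv_comp x hg hf

theorem tangent_id (x : N) : tangent (E := E) (E' := E) (id : N → N) x =
    ContinuousLinearMap.id ℝ E := mfderiv_id

theorem pullback_comp {k : ℕ} {g : N' → N''} {f : N → N'}
    (hg : MDifferentiable 𝓘(ℝ, E') 𝓘(ℝ, E'') g) (hf : MDifferentiable 𝓘(ℝ, E) 𝓘(ℝ, E') f)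
    (η : N'' → E'' [⋀^Fin k]→L[ℝ] V) :
    pullback (E := E) (E' := E'') (g ∘ f) η =
      pullback (E := E) (E' := E') f (pullback (E := E') (E' := E'') g η) := by
  funext x
  simp only [pullback, tangent_comp (hg (f x)) (hf x)]
  rfl

/-- The projection of multilinear maps onto alternating maps, up to the factor `k!`. -/
def alternatizationCLM (k : ℕ) :
    ContinuousMultilinearMap ℝ (fun _ : Fin k => E) V →L[ℝ] E [⋀^Fin k]→L[ℝ] V :=
  LinearMap.mkContinuous
    { toFun := ContinuousMultilinearMap.alternatization
      map_add' := map_add _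
      map_smul' := fun c f => by
        ext X
        have h : ∀ s : Equiv.Perm (Fin k), Equiv.Perm.sign s • (c • f) (X ∘ s) =
            c • Equiv.Perm.sign s • f (X ∘ s) := fun s => by
          rw [smul_apply, smul_comm]
        have h' : (c • ContinuousMultilinearMap.alternatization f) X =
            c • ContinuousMultilinearMap.alternatization f X := rfl
        rw [RingHom.id_apply, h']
        simp only [ContinuousMultilinearMap.alternatization_apply_apply, h, Finset.smul_sum] }
    (Fintype.card (Equiv.Perm (Fin k)))
    (fun f => by
      refine ContinuousAlternatingMap.opNorm_le_bound _ (by positivity) fun X => ?_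
      simp only [LinearMap.coe_mk, AddHom.coe_mk,
        ContinuousMultilinearMap.alternatization_apply_apply]
      refine (norm_sum_le _ _).trans ?_
      have : ∀ s ∈ (Finset.univ : Finset (Equiv.Perm (Fin k))),
          ‖Equiv.Perm.sign s • f (X ∘ s)‖ ≤ ‖f‖ * ∏ i, ‖X i‖ := by
        intro s _
        have h1 : ‖Equiv.Perm.sign s • f (X ∘ s)‖ = ‖f (X ∘ s)‖ := by
          rcases Int.units_eq_one_or (Equiv.Perm.sign s) with h | h <;> simp [h]
        rw [h1]
        refine (f.le_opNorm _).trans (le_of_eq ?_)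
        congr 1
        exact Equiv.prod_comp s fun i => ‖X i‖
      refine (Finset.sum_le_card_nsmul _ _ _ this).trans (le_of_eq ?_)
      rw [nsmul_eq_mul, Finset.card_univ, mul_assoc])

theorem contDiffOn_compContinuousLinearMap {k : ℕ} {D : Type*} [NormedAddCommGroup D]
    [NormedSpace ℝ D] {s : Set D} {a : D → E' [⋀^Fin k]→L[ℝ] V} {A : D → E →L[ℝ] E'}
    (ha : ContDiffOn ℝ ∞ a s) (hA : ContDiffOn ℝ ∞ A s) :
    ContDiffOn ℝ ∞ (fun y => (a y).compContinuousLinearMap (A y)) s := by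
  have h1 : ContDiffOn ℝ ∞ (fun y => (ContinuousAlternatingMap.toContinuousMultilinearMapCLM ℝ
      (a y) : ContinuousMultilinearMap ℝ (fun _ : Fin k => E') V)) s :=
    (ContinuousAlternatingMap.toContinuousMultilinearMapCLM (𝕜 := ℝ) (E := E') (F := V)
      (ι := Fin k) ℝ).contDiff.comp_contDiffOn ha
  have h2 : ContDiffOn ℝ ∞ (fun y => ContinuousMultilinearMap.compContinuousLinearMapContinuousMultilinear
      ℝ (fun _ : Fin k => E) (fun _ : Fin k => E') V (fun _ => A y)) s :=
    (ContinuousMultilinearMap.contDiff _).comp_contDiffOn (contDiffOn_pi.2 fun _ => hA)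
  have h3 := (alternatizationCLM (E := E) (V := V) k).contDiff.comp_contDiffOn (h2.clm_apply h1)
  have h4 := h3.const_smul ((k.factorial : ℝ)⁻¹)
  refine h4.congr fun y _ => ?_
  ext X
  have h5 : ∀ s : Equiv.Perm (Fin k), Equiv.Perm.sign s • (a y) (fun i => A y (X (s i))) =
      (a y) (fun i => A y (X i)) := by
    intro s
    have h6 : (a y) (fun i => A y (X (s i))) =
        Equiv.Perm.sign s • (a y) (fun i => A y (X i)) :=
      (a y).toAlternatingMap.map_perm (fun i => A y (X i)) s
    rw [h6, smul_smul, Int.units_mul_self, one_smul]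
  simp [alternatizationCLM, ContinuousMultilinearMap.alternatization_apply_apply,
    Function.comp_def, h5, Fintype.card_perm, ← Nat.cast_smul_eq_nsmul ℝ, smul_smul,
    Nat.factorial_ne_zero]

theorem IsSmoothForm.pullback [IsManifold 𝓘(ℝ, E) ∞ N] [IsManifold 𝓘(ℝ, E') ∞ N'] {k : ℕ}
    {f : N → N'} (hf : ContMDiff 𝓘(ℝ, E) 𝓘(ℝ, E') ∞ f) {η : N' → E' [⋀^Fin k]→L[ℝ] V}
    (hη : IsSmoothForm η) : IsSmoothForm (pullback (E := E) (E' := E') f η) := by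
  intro x y0 hy0
  set c := extChartAt 𝓘(ℝ, E) x with hc
  set q0 := f (c.symm y0) with hq0
  set d := extChartAt 𝓘(ℝ, E') q0 with hd
  have hT : IsOpen c.target := isOpen_extChartAt_target x
  have hcs : ContMDiffOn 𝓘(ℝ, E) 𝓘(ℝ, E) ∞ c.symm c.target := contMDiffOn_extChartAt_symm x
  have hfc : ContMDiffOn 𝓘(ℝ, E) 𝓘(ℝ, E') ∞ (f ∘ c.symm) c.target := hf.comp_contMDiffOn hcs
  set U := c.target ∩ (f ∘ c.symm) ⁻¹' d.source with hU
  have hUo : IsOpen U := hfc.continuousOn.isOpen_inter_preimage hT (isOpen_extChartAt_source q0)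
  have hy0U : y0 ∈ U := ⟨hy0, mem_extChartAt_source (I := 𝓘(ℝ, E')) q0⟩
  set F : E → E' := d ∘ (f ∘ c.symm) with hF
  have hFM : ContMDiffOn 𝓘(ℝ, E) 𝓘(ℝ, E') ∞ F U := by
    have hds : ContMDiffOn 𝓘(ℝ, E') 𝓘(ℝ, E') ∞ d d.source := by
      rw [hd, extChartAt_source]
      exact contMDiffOn_extChartAt
    exact hds.comp (hfc.mono inter_subset_left) fun z hz => hz.2
  have hFs : ContDiffOn ℝ ∞ F U := contMDiffOn_iff_contDiffOn.1 hFM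
  have hdF : ContDiffOn ℝ ∞ (fderiv ℝ F) U :=
    ((contDiffOn_infty_iff_fderiv_of_isOpen hUo).1 hFs).2
  have hmaps : MapsTo F U d.target := fun z hz => d.map_source hz.2
  have key : ContDiffOn ℝ ∞ (fun y => (chartRep q0 η (F y)).compContinuousLinearMap
      (fderiv ℝ F y)) U :=
    contDiffOn_compContinuousLinearMap ((hη q0).comp hFs hmaps) hdF
  have heq : ∀ y ∈ U, chartRep x (GaugeTheory.pullback (E := E) (E' := E') f η) y =
      (chartRep q0 η (F y)).compContinuousLinearMap (fderiv ℝ F y) := by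
    intro y hy
    have hy1 : c.target ∈ 𝓝 y := hT.mem_nhds hy.1
    have hcy : MDifferentiableAt 𝓘(ℝ, E) 𝓘(ℝ, E) c.symm y :=
      (hcs.contMDiffAt hy1).mdifferentiableAt (by simp)
    have hfy : MDifferentiableAt 𝓘(ℝ, E) 𝓘(ℝ, E') f (c.symm y) :=
      hf.mdifferentiable (by simp) _
    have hdy : MDifferentiableAt 𝓘(ℝ, E') 𝓘(ℝ, E') d.symm (F y) := by
      have h := contMDiffOn_extChartAt_symm (n := ∞) (I := 𝓘(ℝ, E')) q0
      exact (h.contMDiffAt ((isOpen_extChartAt_target q0).mem_nhds (hmaps hy))).mdifferentiableAt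
        (by simp)
    have hFy : MDifferentiableAt 𝓘(ℝ, E) 𝓘(ℝ, E') F y :=
      (hFM.contMDiffAt (hUo.mem_nhds hy)).mdifferentiableAt (by simp)
    have hev : (f ∘ c.symm) =ᶠ[𝓝 y] (d.symm ∘ F) := by
      filter_upwards [hUo.mem_nhds hy] with z hz
      exact (d.left_inv hz.2).symm
    have h1 : (tangent (E := E) (E' := E') f (c.symm y)).comp
        (tangent (E := E) (E' := E) c.symm y) =
        (tangent (E := E') (E' := E') d.symm (F y)).comp (fderiv ℝ F y) := by
      rw [← tangent_comp hfy hcy]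
      have h2 : tangent (E := E) (E' := E') F y = fderiv ℝ F y := mfderiv_eq_fderiv
      rw [← h2, ← tangent_comp hdy hFy]
      exact hev.mfderiv_eq
    have h3 : d.symm (F y) = f (c.symm y) := d.left_inv hy.2
    have h4 : chartRep q0 η (F y) = (η (f (c.symm y))).compContinuousLinearMap
        (tangent (E := E') (E' := E') d.symm (F y)) := by
      rw [← h3]; rfl
    rw [h4]
    change ((η (f (c.symm y))).compContinuousLinearMap
      (tangent (E := E) (E' := E') f (c.symm y))).compContinuousLinearMap
        (tangent (E := E) (E' := E) c.symm y) = _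
    ext X
    have h5 := fun i => DFunLike.congr_fun h1 (X i)
    simp only [ContinuousLinearMap.comp_apply] at h5
    simp only [ContinuousAlternatingMap.compContinuousLinearMap_apply, Function.comp_def, h5]
  exact ((key.congr heq).contDiffAt (hUo.mem_nhds hy0U)).contDiffWithinAt

end Forms

/-! ### Integration over a symplectic manifold -/

section Symplectic

/-- A symplectic form on a manifold: a smooth, closed, non-degenerate real two-form. -/
structure SymplecticForm (E : Type*) [NormedAddCommGroup E] [NormedSpace ℝ E]
    (M : Type*) [TopologicalSpace M] [ChartedSpace E M] where
  form : M → E [⋀^Fin 2]→L[ℝ] ℝ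
  smooth : IsSmoothForm form
  closed : ∀ m, extD form m = 0
  nondegenerate : ∀ m X, (∀ Y, form m ![X, Y] = 0) → X = 0

variable {E : Type*} [NormedAddCommGroup E] [NormedSpace ℝ E] [FiniteDimensional ℝ E]

/-- A smooth partition of unity subordinate to the preferred charts. -/
def chartPartition (E : Type*) [NormedAddCommGroup E] [NormedSpace ℝ E] [FiniteDimensional ℝ E]
    (M : Type*) [TopologicalSpace M] [ChartedSpace E M] [IsManifold 𝓘(ℝ, E) ∞ M]
    [T2Space M] [CompactSpace M] : SmoothPartitionOfUnity M 𝓘(ℝ, E) M univ :=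
  Classical.choose (SmoothPartitionOfUnity.exists_isSubordinate_chartAt_source 𝓘(ℝ, E) M)

variable {n : ℕ} {M : Type*} [TopologicalSpace M]
  [ChartedSpace (EuclideanSpace ℝ (Fin (2 * n))) M]
  [IsManifold 𝓘(ℝ, EuclideanSpace ℝ (Fin (2 * n))) ∞ M] [T2Space M] [CompactSpace M]

/-- The coefficient of a top-degree form with respect to the standard coordinates. -/
def topCoeff (η : (EuclideanSpace ℝ (Fin (2 * n))) [⋀^Fin (2 * n)]→L[ℝ] ℝ) : ℝ :=
  η fun j => EuclideanSpace.single j 1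

/-- The integral `∫_M τ` of a top-degree form over a compact symplectic manifold, oriented by
the volume form `σ^n`: the sum over a partition of unity of the Lebesgue integrals of the
coefficients in charts, with a sign that compares the coordinate orientation with that of `σ^n`. -/
def integral (σ : SymplecticForm (EuclideanSpace ℝ (Fin (2 * n))) M)
    (τ : M → (EuclideanSpace ℝ (Fin (2 * n))) [⋀^Fin (2 * n)]→L[ℝ] ℝ) : ℝ :=
  ∑ᶠ i : M, ∫ y in (extChartAt 𝓘(ℝ, EuclideanSpace ℝ (Fin (2 * n))) i).target,
    chartPartition (EuclideanSpace ℝ (Fin (2 * n))) M i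
        ((extChartAt 𝓘(ℝ, EuclideanSpace ℝ (Fin (2 * n))) i).symm y) *
      (SignType.sign (topCoeff (chartRep i (fun m => wedgePow (σ.form m) n) y)) : ℝ) *
      topCoeff (chartRep i τ y)

end Symplectic

/-! ### Lie groups -/

section LieGroups

variable {EG : Type*} [NormedAddCommGroup EG] [NormedSpace ℝ EG] [FiniteDimensional ℝ EG]
  {G : Type*} [TopologicalSpace G] [ChartedSpace EG G] [Group G]

variable (EG) in
/-- The adjoint representation of `G` on its Lie algebra `T_1 G`, whose underlying vector space
is the model space `EG`. -/
def Ad (g : G) : EG →L[ℝ] EG := tangent (E := EG) (E' := EG) (fun h : G => g * h * g⁻¹) 1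

variable (EG G) in
/-- The Lie bracket of `T_1 G` (bracket of left-invariant vector fields), as a bilinear map. -/
def lieBracket [LieGroup 𝓘(ℝ, EG) ∞ G] : EG →L[ℝ] EG →L[ℝ] EG :=
  haveI : LieGroup 𝓘(ℝ, EG) (minSmoothness ℝ 3) G :=
    LieGroup.of_le (n := ∞) (by simpa using ENat.LEInfty.out)
  haveI : CompleteSpace EG := FiniteDimensional.complete ℝ EG
  let br : GroupLieAlgebra 𝓘(ℝ, EG) G →ₗ[ℝ] GroupLieAlgebra 𝓘(ℝ, EG) G →ₗ[ℝ]
      GroupLieAlgebra 𝓘(ℝ, EG) G :=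
    LinearMap.mk₂ ℝ (fun A B => ⁅A, B⁆) add_lie smul_lie lie_add (fun c A B => lie_smul c A B)
  LinearMap.toContinuousBilinearMap (E := EG) (F := EG) (G := EG) br

/-- An `Ad`-invariant scalar product on the Lie algebra of `G`. -/
structure AdInvariantScalarProduct (EG : Type*) [NormedAddCommGroup EG] [NormedSpace ℝ EG]
    (G : Type*) [TopologicalSpace G] [ChartedSpace EG G] [Group G] where
  toBilin : EG →L[ℝ] EG →L[ℝ] ℝ
  symm : ∀ A B, toBilin A B = toBilin B A
  pos : ∀ A, A ≠ 0 → 0 < toBilin A A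
  invariant : ∀ (g : G) A B, toBilin (Ad EG g A) (Ad EG g B) = toBilin A B

end LieGroups

/-! ### Principal bundles, connections and gauge transformations -/

/-- A smooth (right) principal `G`-bundle `P → M`: a smooth right action on `P` and a projection
to `M` which admits smooth `G`-equivariant local trivialisations over `M`; in particular the
action is free and its orbits are the fibres. -/
structure PrincipalBundle (EM EG EP : Type*) [NormedAddCommGroup EM] [NormedSpace ℝ EM]
    [NormedAddCommGroup EG] [NormedSpace ℝ EG] [NormedAddCommGroup EP] [NormedSpace ℝ EP]
    (M G P : Type*) [TopologicalSpace M] [ChartedSpace EM M]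
    [TopologicalSpace G] [ChartedSpace EG G] [Group G]
    [TopologicalSpace P] [ChartedSpace EP P] where
  proj : P → M
  act : P → G → P
  contMDiff_proj : ContMDiff 𝓘(ℝ, EP) 𝓘(ℝ, EM) ∞ proj
  contMDiff_act : ContMDiff (𝓘(ℝ, EP).prod 𝓘(ℝ, EG)) 𝓘(ℝ, EP) ∞ fun x : P × G => act x.1 x.2
  act_one : ∀ p, act p 1 = p
  act_mul : ∀ p g h, act p (g * h) = act (act p g) h
  proj_act : ∀ p g, proj (act p g) = proj p
  locally_trivial : ∀ m : M, ∃ (U : Set M) (e : OpenPartialHomeomorph P (M × G)),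
    IsOpen U ∧ m ∈ U ∧ e.source = proj ⁻¹' U ∧ e.target = U ×ˢ univ ∧
    ContMDiffOn 𝓘(ℝ, EP) (𝓘(ℝ, EM).prod 𝓘(ℝ, EG)) ∞ e e.source ∧
    ContMDiffOn (𝓘(ℝ, EM).prod 𝓘(ℝ, EG)) 𝓘(ℝ, EP) ∞ e.symm e.target ∧
    ∀ p ∈ e.source, (e p).1 = proj p ∧ ∀ g, (e (act p g)).2 = (e p).2 * g

section Bundle

variable {EM EG EP : Type*} [NormedAddCommGroup EM] [NormedSpace ℝ EM]
  [NormedAddCommGroup EG] [NormedSpace ℝ EG] [NormedAddCommGroup EP] [NormedSpace ℝ EP]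
  {M G P : Type*} [TopologicalSpace M] [ChartedSpace EM M]
  [TopologicalSpace G] [ChartedSpace EG G] [Group G]
  [TopologicalSpace P] [ChartedSpace EP P]

/-- The fundamental vector `p . A = d/dt p · exp (t A)` at `t = 0`. -/
def PrincipalBundle.fund (B : PrincipalBundle EM EG EP M G P) (p : P) (A : EG) : EP :=
  tangent (E := EG) (E' := EP) (fun g : G => B.act p g) 1 A

/-- The derivative at `p` of the right translation by `g`. -/
def PrincipalBundle.tangentAct (B : PrincipalBundle EM EG EP M G P) (g : G) (p : P) :
    EP →L[ℝ] EP :=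
  tangent (E := EP) (E' := EP) (fun q : P => B.act q g) p

/-- Forms on `M` with values in the adjoint bundle `Ad P = P ×_G 𝔤` are the tensorial forms of
type `Ad` on `P`: smooth `𝔤`-valued forms on `P` that vanish as soon as one argument is vertical,
and which satisfy `R_g^* η = Ad_{g⁻¹} η`. -/
structure IsTensorial (B : PrincipalBundle EM EG EP M G P) {k : ℕ}
    (η : P → EP [⋀^Fin k]→L[ℝ] EG) : Prop where
  smooth : IsSmoothForm η
  horizontal : ∀ p X, (∃ i A, X i = B.fund p A) → η p X = 0
  equivariant : ∀ g p X, η (B.act p g) (fun i => B.tangentAct g p (X i)) = Ad EG g⁻¹ (η p X)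

theorem chartRep_add {k : ℕ} (x : P) (η θ : P → EP [⋀^Fin k]→L[ℝ] EG) :
    chartRep x (η + θ) = chartRep x η + chartRep x θ := rfl

theorem chartRep_smul {k : ℕ} (x : P) (c : ℝ) (η : P → EP [⋀^Fin k]→L[ℝ] EG) :
    chartRep x (c • η) = c • chartRep x η := rfl

/-- The tensorial `k`-forms as a subspace of all `𝔤`-valued forms on `P`. -/
def tensorialSubmodule (B : PrincipalBundle EM EG EP M G P) (k : ℕ) :
    Submodule ℝ (P → EP [⋀^Fin k]→L[ℝ] EG) where
  carrier := {η | IsTensorial B η}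
  add_mem' := fun {η θ} hη hθ =>
    { smooth := fun x => by
        rw [chartRep_add]; exact (hη.smooth x).add (hθ.smooth x)
      horizontal := fun p X h => by
        simp [hη.horizontal p X h, hθ.horizontal p X h]
      equivariant := fun g p X => by
        simp [hη.equivariant g p X, hθ.equivariant g p X] }
  zero_mem' :=
    { smooth := fun x => contDiffOn_const (c := (0 : EP [⋀^Fin k]→L[ℝ] EG))
      horizontal := fun p X h => rfl
      equivariant := fun g p X => by simp }
  smul_mem' := fun c η hη =>
    { smooth := fun x => by
        rw [chartRep_smul]; exact (hη.smooth x).const_smul c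
      horizontal := fun p X h => by
        simp [hη.horizontal p X h]
      equivariant := fun g p X => by
        simp [hη.equivariant g p X] }

/-- The space `Ω^k(M, Ad P)`. -/
def AdForm (B : PrincipalBundle EM EG EP M G P) (k : ℕ) : Type _ := tensorialSubmodule B k

namespace AdForm

variable {B : PrincipalBundle EM EG EP M G P} {k : ℕ}

instance : AddCommGroup (AdForm B k) := inferInstanceAs (AddCommGroup (tensorialSubmodule B k))

instance : Module ℝ (AdForm B k) := inferInstanceAs (Module ℝ (tensorialSubmodule B k))

/-- The underlying form on `P`. -/
def form (η : AdForm B k) : P → EP [⋀^Fin k]→L[ℝ] EG := η.1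

theorem isTensorial (η : AdForm B k) : IsTensorial B η.form := η.2

/-- The `C^∞`-topology on `Ω^k(M, Ad P)`: uniform convergence of all derivatives of all chart
representations on compact subsets of the chart images. -/
instance : TopologicalSpace (AdForm B k) :=
  ⨅ (x : P) (i : ℕ), TopologicalSpace.induced
    (fun η : AdForm B k =>
      UniformOnFun.ofFun {K | IsCompact K ∧ K ⊆ (extChartAt 𝓘(ℝ, EP) x).target}
        (iteratedFDeriv ℝ i (chartRep x η.form)))
    inferInstance

end AdForm

/-- The space of sections of the adjoint bundle, that is, of smooth maps `ξ : P → 𝔤` with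
`ξ (p · g) = Ad_{g⁻¹} ξ(p)`. It is the Lie algebra of the group of gauge transformations, `ξ`
corresponding to the vertical invariant vector field `p ↦ p . ξ(p)`. -/
def AdSection (B : PrincipalBundle EM EG EP M G P) : Submodule ℝ (P → EG) where
  carrier := {ξ | ContMDiff 𝓘(ℝ, EP) 𝓘(ℝ, EG) ∞ ξ ∧
    ∀ g p, ξ (B.act p g) = Ad EG g⁻¹ (ξ p)}
  add_mem' := fun {ξ ζ} hξ hζ => ⟨hξ.1.add hζ.1, fun g p => by simp [hξ.2 g p, hζ.2 g p]⟩
  zero_mem' := ⟨contMDiff_const, fun g p => by simp⟩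
  smul_mem' := fun c ξ hξ => ⟨by
      have h := (contMDiff_const (c := c) (I := 𝓘(ℝ, EP)) (I' := 𝓘(ℝ, ℝ)) (M := P) (n := ∞)).smul hξ.1
      exact h, fun g p => by simp [hξ.2 g p]⟩

/-- A principal connection on `P`, given by its connection one-form. -/
@[ext]
structure Connection (B : PrincipalBundle EM EG EP M G P) where
  form : P → EP [⋀^Fin 1]→L[ℝ] EG
  smooth : IsSmoothForm form
  fund : ∀ p A, form p (fun _ => B.fund p A) = A
  equivariant : ∀ g p X, form (B.act p g) (fun i => B.tangentAct g p (X i)) =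
    Ad EG g⁻¹ (form p X)

namespace Connection

variable {B : PrincipalBundle EM EG EP M G P}

/-- The space of connections is an affine space over `Ω^1(M, Ad P)`: translation. -/
def translate (Γ : Connection B) (α : AdForm B 1) : Connection B where
  form := Γ.form + α.form
  smooth := fun x => by
    rw [chartRep_add]; exact (Γ.smooth x).add (α.isTensorial.smooth x)
  fund := fun p A => by
    simp [Γ.fund p A, α.isTensorial.horizontal p (fun _ => B.fund p A) ⟨0, A, rfl⟩]
  equivariant := fun g p X => by
    simp [Γ.equivariant g p X, α.isTensorial.equivariant g p X]

/-- The difference of two connections in `Ω^1(M, Ad P)`. -/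
def diff (Γ Γ' : Connection B) : AdForm B 1 :=
  ⟨Γ.form + (-1 : ℝ) • Γ'.form,
    { smooth := fun x => by
        rw [chartRep_add, chartRep_smul]; exact (Γ.smooth x).add ((Γ'.smooth x).const_smul (-1 : ℝ))
      horizontal := fun p X h => by
        obtain ⟨i, A, hi⟩ := h
        have hX : X = fun _ => B.fund p A := by
          funext j; rw [← hi]; congr 1; exact Subsingleton.elim _ _
        simp [hX, Γ.fund p A, Γ'.fund p A]
      equivariant := fun g p X => by
        simp [Γ.equivariant g p X, Γ'.equivariant g p X] }⟩

/-- The curvature `curv Γ = dΓ + ½ [Γ ∧ Γ]`, as a `𝔤`-valued two-form on `P`. -/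
def curvature [FiniteDimensional ℝ EG] [LieGroup 𝓘(ℝ, EG) ∞ G] (Γ : Connection B) :
    P → EP [⋀^Fin 2]→L[ℝ] EG :=
  fun p => extD Γ.form p + (1 / 2 : ℝ) • wedge (lieBracket EG G) (Γ.form p) (Γ.form p)

/-- The curve `c` in the affine space of connections has the velocity `α` at time `0`, in the
`C^∞`-topology. -/
def HasVelocity (c : ℝ → Connection B) (α : AdForm B 1) : Prop :=
  Tendsto (fun t : ℝ => t⁻¹ • diff (c t) (c 0)) (𝓝[≠] 0) (𝓝 α)

end Connection

/-- A gauge transformation: a `G`-equivariant diffeomorphism of `P` covering the identity. -/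
@[ext]
structure GaugeTransformation (B : PrincipalBundle EM EG EP M G P) where
  toDiffeo : Diffeomorph 𝓘(ℝ, EP) 𝓘(ℝ, EP) P P ∞
  proj_eq : ∀ p, B.proj (toDiffeo p) = B.proj p
  equivariant : ∀ p g, toDiffeo (B.act p g) = B.act (toDiffeo p) g

namespace GaugeTransformation

variable {B : PrincipalBundle EM EG EP M G P}

/-- Gauge transformations form a group under composition. -/
instance : Group (GaugeTransformation B) where
  mul φ ψ :=
    { toDiffeo := ψ.toDiffeo.trans φ.toDiffeo
      proj_eq := fun p => by
        simp [φ.proj_eq, ψ.proj_eq]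
      equivariant := fun p g => by
        simp [φ.equivariant, ψ.equivariant] }
  one :=
    { toDiffeo := Diffeomorph.refl 𝓘(ℝ, EP) P ∞
      proj_eq := fun p => rfl
      equivariant := fun p g => rfl }
  inv φ :=
    { toDiffeo := φ.toDiffeo.symm
      proj_eq := fun p => by
        rw [← φ.proj_eq, Diffeomorph.apply_symm_apply]
      equivariant := fun p g => by
        have h := φ.equivariant (φ.toDiffeo.symm p) g
        rw [Diffeomorph.apply_symm_apply] at h
        rw [← h, Diffeomorph.symm_apply_apply] }
  mul_assoc φ ψ χ := rfl
  one_mul φ := rfl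
  mul_one φ := rfl
  inv_mul_cancel φ := by
    apply GaugeTransformation.ext
    exact Diffeomorph.self_trans_symm φ.toDiffeo

/-- The push-forward `(φ⁻¹)^* η` of a form on `P`. -/
def push {k : ℕ} (φ : GaugeTransformation B) (η : P → EP [⋀^Fin k]→L[ℝ] EG) :
    P → EP [⋀^Fin k]→L[ℝ] EG :=
  pullback φ⁻¹.toDiffeo η

theorem mdiff (φ : GaugeTransformation B) :
    MDifferentiable 𝓘(ℝ, EP) 𝓘(ℝ, EP) φ.toDiffeo :=
  φ.toDiffeo.contMDiff.mdifferentiable (by simp)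

theorem push_mul {k : ℕ} (φ ψ : GaugeTransformation B) (η : P → EP [⋀^Fin k]→L[ℝ] EG) :
    push (φ * ψ) η = push φ (push ψ η) := by
  have h : (⇑(φ * ψ)⁻¹.toDiffeo : P → P) = ⇑ψ⁻¹.toDiffeo ∘ ⇑φ⁻¹.toDiffeo := by
    rw [mul_inv_rev]; rfl
  rw [push, h, pullback_comp (mdiff _) (mdiff _)]
  rfl

theorem push_one {k : ℕ} (η : P → EP [⋀^Fin k]→L[ℝ] EG) :
    push (1 : GaugeTransformation B) η = η := by
  funext p
  have h : (⇑(1 : GaugeTransformation B)⁻¹.toDiffeo : P → P) = id := by rw [inv_one]; rfl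
  rw [push, h, pullback, tangent_id]
  rfl

theorem mdiff_act_left (B : PrincipalBundle EM EG EP M G P) (g : G) :
    MDifferentiable 𝓘(ℝ, EP) 𝓘(ℝ, EP) fun p => B.act p g :=
  (B.contMDiff_act.comp (contMDiff_id.prodMk contMDiff_const)).mdifferentiable (by simp)

theorem mdiff_act_right (B : PrincipalBundle EM EG EP M G P) (p : P) :
    MDifferentiable 𝓘(ℝ, EG) 𝓘(ℝ, EP) fun g => B.act p g :=
  (B.contMDiff_act.comp (contMDiff_const.prodMk contMDiff_id)).mdifferentiable (by simp)

theorem tangent_fund (φ : GaugeTransformation B) (p : P) (A : EG) :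
    tangent (E := EP) (E' := EP) φ.toDiffeo p (B.fund p A) = B.fund (φ.toDiffeo p) A := by
  have h : (fun g : G => B.act (φ.toDiffeo p) g) = φ.toDiffeo ∘ fun g : G => B.act p g := by
    funext g; exact (φ.equivariant p g).symm
  have h1 : tangent (E := EP) (E' := EP) φ.toDiffeo (B.act p 1) =
      tangent (E := EP) (E' := EP) φ.toDiffeo p := by rw [B.act_one]
  rw [PrincipalBundle.fund, PrincipalBundle.fund, h,
    tangent_comp (mdiff φ _) (mdiff_act_right B p _), h1]
  rfl

theorem tangent_tangentAct (φ : GaugeTransformation B) (g : G) (p : P) (X : EP) :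
    tangent (E := EP) (E' := EP) φ.toDiffeo (B.act p g) (B.tangentAct g p X) =
      B.tangentAct g (φ.toDiffeo p) (tangent (E := EP) (E' := EP) φ.toDiffeo p X) := by
  have h : (φ.toDiffeo ∘ fun q : P => B.act q g) = (fun q : P => B.act q g) ∘ φ.toDiffeo := by
    funext q; exact φ.equivariant q g
  have h1 := tangent_comp (f := fun q : P => B.act q g) (mdiff φ (B.act p g)) (mdiff_act_left B g p)
  have h2 := tangent_comp (g := fun q : P => B.act q g) (mdiff_act_left B g (φ.toDiffeo p)) (mdiff φ p)
  rw [h] at h1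
  exact DFunLike.congr_fun (h1.symm.trans h2) X

theorem push_equivariant {k : ℕ} (φ : GaugeTransformation B) {η : P → EP [⋀^Fin k]→L[ℝ] EG}
    (hη : ∀ g p X, η (B.act p g) (fun i => B.tangentAct g p (X i)) = Ad EG g⁻¹ (η p X))
    (g : G) (p : P) (X : Fin k → EP) :
    push φ η (B.act p g) (fun i => B.tangentAct g p (X i)) = Ad EG g⁻¹ (push φ η p X) := by
  change η (φ⁻¹.toDiffeo (B.act p g)) (fun i => tangent (E := EP) (E' := EP) φ⁻¹.toDiffeo
    (B.act p g) (B.tangentAct g p (X i))) = Ad EG g⁻¹ (η (φ⁻¹.toDiffeo p)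
      (fun i => tangent (E := EP) (E' := EP) φ⁻¹.toDiffeo p (X i)))
  simp only [tangent_tangentAct]
  rw [φ⁻¹.equivariant, hη]

variable [IsManifold 𝓘(ℝ, EP) ∞ P]

theorem push_smooth {k : ℕ} (φ : GaugeTransformation B) {η : P → EP [⋀^Fin k]→L[ℝ] EG}
    (hη : IsSmoothForm η) : IsSmoothForm (push φ η) :=
  hη.pullback φ⁻¹.toDiffeo.contMDiff

/-- The natural action of gauge transformations on connections: `Γ ↦ (φ⁻¹)^* Γ`; on horizontal
distributions this is the push-forward along `φ`. -/
instance : MulAction (GaugeTransformation B) (Connection B) where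
  smul φ Γ :=
    { form := push φ Γ.form
      smooth := push_smooth φ Γ.smooth
      fund := fun p A => by
        change Γ.form (φ⁻¹.toDiffeo p) (fun _ => tangent (E := EP) (E' := EP) φ⁻¹.toDiffeo p
          (B.fund p A)) = A
        rw [tangent_fund, Γ.fund]
      equivariant := push_equivariant φ Γ.equivariant }
  one_smul Γ := Connection.ext (push_one Γ.form)
  mul_smul φ ψ Γ := Connection.ext (push_mul φ ψ Γ.form)

/-- The natural action of gauge transformations on `Ω^k(M, Ad P)`. -/
instance {k : ℕ} : MulAction (GaugeTransformation B) (AdForm B k) where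
  smul φ η := ⟨push φ η.form,
    { smooth := push_smooth φ η.isTensorial.smooth
      horizontal := fun p X h => by
        obtain ⟨i, A, hi⟩ := h
        refine η.isTensorial.horizontal (φ⁻¹.toDiffeo p)
          (fun i => tangent (E := EP) (E' := EP) φ⁻¹.toDiffeo p (X i)) ⟨i, A, ?_⟩
        simp only [hi, tangent_fund]
      equivariant := push_equivariant φ η.isTensorial.equivariant }⟩
  one_smul η := Subtype.ext (push_one η.form)
  mul_smul φ ψ η := Subtype.ext (push_mul φ ψ η.form)

end GaugeTransformation

end Bundle

/-! ### Symplectic structure and momentum map on the space of connections -/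

/-- `C^k`-maps between (real, locally convex) topological vector spaces in the sense of
Michal and Bastiani: all iterated directional derivatives up to order `k` exist and are jointly
continuous in base point and directions. -/
def IsBastianiC : ℕ → ∀ {X : Type u} {Y : Type v} [AddCommGroup X] [Module ℝ X]
    [TopologicalSpace X] [AddCommGroup Y] [Module ℝ Y] [TopologicalSpace Y], (X → Y) → Prop
  | 0, _, _, _, _, _, _, _, _, f => Continuous f
  | k + 1, X, _, _, _, _, _, _, _, f => Continuous f ∧ ∃ df : X × X → _,
      (∀ x v, Tendsto (fun t : ℝ => t⁻¹ • (f (x + t • v) - f x)) (𝓝[≠] 0) (𝓝 (df (x, v)))) ∧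
      IsBastianiC k df

/-- Smooth maps between topological vector spaces. -/
def IsBastianiSmooth {X : Type u} {Y : Type v} [AddCommGroup X] [Module ℝ X]
    [TopologicalSpace X] [AddCommGroup Y] [Module ℝ Y] [TopologicalSpace Y] (f : X → Y) : Prop :=
  ∀ k, IsBastianiC k f

section MomentumMap

variable {EM EG EP : Type*} [NormedAddCommGroup EM] [NormedSpace ℝ EM]
  [NormedAddCommGroup EG] [NormedSpace ℝ EG] [NormedAddCommGroup EP] [NormedSpace ℝ EP]
  {M G P : Type*} [TopologicalSpace M] [ChartedSpace EM M]
  [TopologicalSpace G] [ChartedSpace EG G] [Group G]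
  [TopologicalSpace P] [ChartedSpace EP P]

/-- The form on `M` to which a real basic form on `P` descends, that is, the (unique) form `τ`
with `π^* τ = η`. -/
def descend (B : PrincipalBundle EM EG EP M G P) {k : ℕ} (η : P → EP [⋀^Fin k]→L[ℝ] ℝ) :
    M → EM [⋀^Fin k]→L[ℝ] ℝ :=
  Classical.epsilon fun τ => pullback (E := EP) (E' := EM) B.proj τ = η

variable {B : PrincipalBundle EM EG EP M G P}

/-- A (weak) symplectic form on the affine space of connections: a smooth family `Ω_Γ` of
skew-symmetric bilinear forms on `Ω^1(M, Ad P)`, which is closed,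
`dΩ(α, β, γ) = D_α Ω(β, γ) - D_β Ω(α, γ) + D_γ Ω(α, β) = 0`, and weakly non-degenerate. -/
structure IsSymplecticStructure (Ω : Connection B → AdForm B 1 → AdForm B 1 → ℝ) : Prop where
  add_left : ∀ Γ α α' β, Ω Γ (α + α') β = Ω Γ α β + Ω Γ α' β
  smul_left : ∀ Γ (c : ℝ) α β, Ω Γ (c • α) β = c * Ω Γ α β
  skew : ∀ Γ α β, Ω Γ α β = -Ω Γ β α
  smooth : ∀ Γ : Connection B, IsBastianiSmooth
    fun x : AdForm B 1 × AdForm B 1 × AdForm B 1 => Ω (Γ.translate x.1) x.2.1 x.2.2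
  closed : ∀ (Γ : Connection B) (α β γ : AdForm B 1),
    deriv (fun t : ℝ => Ω (Γ.translate (t • α)) β γ) 0 -
      deriv (fun t : ℝ => Ω (Γ.translate (t • β)) α γ) 0 +
      deriv (fun t : ℝ => Ω (Γ.translate (t • γ)) α β) 0 = 0
  nondegenerate : ∀ Γ α, (∀ β, Ω Γ α β = 0) → α = 0

/-- `c` is a smooth curve of gauge transformations that starts at the identity with the velocity
`ξ`; for instance `t ↦ exp (t ξ)`. -/
structure IsGaugeCurve (c : ℝ → GaugeTransformation B) (ξ : AdSection B) : Prop where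
  smooth : ContMDiff (𝓘(ℝ, ℝ).prod 𝓘(ℝ, EP)) 𝓘(ℝ, EP) ∞
    fun x : ℝ × P => (c x.1).toDiffeo x.2
  start : c 0 = 1
  velocity : ∀ p, tangent (E := ℝ) (E' := EP) (fun t : ℝ => (c t).toDiffeo p) 0 1 =
    B.fund p (ξ.1 p)

variable [IsManifold 𝓘(ℝ, EP) ∞ P]

/-- `α` is the value at `Γ` of the fundamental vector field of `ξ`, i.e. the derivative at the
identity, in direction `ξ`, of the orbit map `φ ↦ φ · Γ`: it is the velocity of `c t · Γ` for
all curves `c` of gauge transformations representing `ξ`, and there is such a curve. -/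
def IsFundamentalVector (ξ : AdSection B) (Γ : Connection B) (α : AdForm B 1) : Prop :=
  (∃ c, IsGaugeCurve c ξ) ∧
    ∀ c, IsGaugeCurve c ξ → Connection.HasVelocity (fun t => c t • Γ) α

/-- A momentum map for the action of the gauge group on the space of connections, relative to
the two-form `Ω` and a pairing of its value space `Ω^k(M, Ad P)` with the Lie algebra of the
gauge group: a smooth map `J` such that `Ω(ξ^*, ·) = d⟨J, ξ⟩`, where `ξ^*` denotes the
fundamental vector field of `ξ`. -/
structure IsMomentumMap {k : ℕ} (Ω : Connection B → AdForm B 1 → AdForm B 1 → ℝ)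
    (pair : AdForm B k → AdSection B → ℝ) (J : Connection B → AdForm B k) : Prop where
  smooth : ∀ Γ : Connection B, IsBastianiSmooth fun α : AdForm B 1 => J (Γ.translate α)
  momentum : ∀ (Γ : Connection B) (ξ : AdSection B), ∃ α : AdForm B 1,
    IsFundamentalVector ξ Γ α ∧
      ∀ β : AdForm B 1,
        HasDerivAt (fun t : ℝ => pair (J (Γ.translate (t • β))) ξ) (Ω Γ α β) 0

/-- A weakly non-degenerate bilinear pairing of `Ω^k(M, Ad P)` with the Lie algebra of the gauge
group under which the action on `Ω^k(M, Ad P)` corresponds to the coadjoint action; the adjoint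
action on sections is `ξ ↦ ξ ∘ φ⁻¹`. -/
structure IsCoadjointPairing {k : ℕ} (pair : AdForm B k → AdSection B → ℝ) : Prop where
  add_left : ∀ η η' ξ, pair (η + η') ξ = pair η ξ + pair η' ξ
  smul_left : ∀ (c : ℝ) η ξ, pair (c • η) ξ = c * pair η ξ
  add_right : ∀ η ξ ξ', pair η (ξ + ξ') = pair η ξ + pair η ξ'
  smul_right : ∀ (c : ℝ) η ξ, pair η (c • ξ) = c * pair η ξ
  separating_left : ∀ η, (∀ ξ, pair η ξ = 0) → η = 0
  separating_right : ∀ ξ, (∀ η, pair η ξ = 0) → ξ = 0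
  invariant : ∀ (φ : GaugeTransformation B) η (ξ ξ' : AdSection B),
    (∀ p, ξ'.1 p = ξ.1 (φ⁻¹.toDiffeo p)) → pair (φ • η) ξ' = pair η ξ

end MomentumMap

section AtiyahBott

variable {n : ℕ} {EG EP : Type*}
  [NormedAddCommGroup EG] [NormedSpace ℝ EG] [NormedAddCommGroup EP] [NormedSpace ℝ EP]
  {M G P : Type*} [TopologicalSpace M] [ChartedSpace (EuclideanSpace ℝ (Fin (2 * n))) M]
  [IsManifold 𝓘(ℝ, EuclideanSpace ℝ (Fin (2 * n))) ∞ M] [T2Space M] [CompactSpace M]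
  [TopologicalSpace G] [ChartedSpace EG G] [Group G]
  [TopologicalSpace P] [ChartedSpace EP P]

/-- `Ω(α, β) = ∫_M tr(α ∧ β) ∧ σ^(n-1)`, as a two-form on the space of connections with constant
coefficients. -/
def atiyahBottForm (hn : 1 ≤ n) (σ : SymplecticForm (EuclideanSpace ℝ (Fin (2 * n))) M)
    (tr : AdInvariantScalarProduct EG G)
    (B : PrincipalBundle (EuclideanSpace ℝ (Fin (2 * n))) EG EP M G P)
    (_Γ : Connection B) (α β : AdForm B 1) : ℝ :=
  integral σ fun m => castDegree (show 1 + 1 + 2 * (n - 1) = 2 * n by omega)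
    (wedge (ContinuousLinearMap.mul ℝ ℝ)
      (descend B (fun p => wedge tr.toBilin (α.form p) (β.form p)) m)
      (wedgePow (σ.form m) (n - 1)))

/-- The integration pairing `⟨η, ξ⟩ = ∫_M tr(ξ, η)`. -/
def integrationPairing (σ : SymplecticForm (EuclideanSpace ℝ (Fin (2 * n))) M)
    (tr : AdInvariantScalarProduct EG G)
    (B : PrincipalBundle (EuclideanSpace ℝ (Fin (2 * n))) EG EP M G P)
    (η : AdForm B (2 * n)) (ξ : AdSection B) : ℝ :=
  integral σ (descend B fun p =>
    (tr.toBilin (ξ.1 p)).compContinuousAlternatingMap (η.form p))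

/-- The `𝔤`-valued `2n`-form `curv Γ ∧ σ^(n-1)` on `P` (where `σ` is pulled back to `P`). -/
def curvatureWedge [FiniteDimensional ℝ EG] [LieGroup 𝓘(ℝ, EG) ∞ G] (hn : 1 ≤ n)
    (σ : SymplecticForm (EuclideanSpace ℝ (Fin (2 * n))) M)
    (B : PrincipalBundle (EuclideanSpace ℝ (Fin (2 * n))) EG EP M G P)
    (Γ : Connection B) : P → EP [⋀^Fin (2 * n)]→L[ℝ] EG :=
  fun p => castDegree (show 2 + 2 * (n - 1) = 2 * n by omega)
    (wedge (ContinuousLinearMap.lsmul ℝ ℝ).flip (Γ.curvature p)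
      (pullback (E := EP) (E' := EuclideanSpace ℝ (Fin (2 * n))) B.proj
        (fun m => wedgePow (σ.form m) (n - 1)) p))

end AtiyahBott

end GaugeTheory

end

noncomputable section

set_option linter.unusedSectionVars false

namespace GaugeTheory

/-! ### Pull-back and exterior derivative along smooth maps from open sets of normed spaces -/

section Plots

variable {E : Type*} [NormedAddCommGroup E] [NormedSpace ℝ E]
  {N : Type*} [TopologicalSpace N] [ChartedSpace E N]
  {E' : Type*} [NormedAddCommGroup E'] [NormedSpace ℝ E']
  {N' : Type*} [TopologicalSpace N'] [ChartedSpace E' N']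
  {E'' : Type*} [NormedAddCommGroup E''] [NormedSpace ℝ E'']
  {N'' : Type*} [TopologicalSpace N''] [ChartedSpace E'' N'']
  {V : Type*} [NormedAddCommGroup V] [NormedSpace ℝ V]

/-! The form Ω has constant coefficients on an affine space, so it is closed, and its smoothness
amounts to the continuity of a bilinear map. All computations take place on P. Sections and forms
with values in Ad P are equivariant objects there, and real forms built from them with `tr` are
basic, hence pull-backs of unique forms on M. A gauge transformation covers the identity and
therefore fixes basic forms; this gives the invariance of Ω and of the pairing. Together with the
naturality of d and ∧ it also gives the equivariance of J.

Non-degeneracy. A form of top degree with values in Ad P is ξ σ^n for a section ξ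
(`exists_sectionForm_eq`), and ⟨ξ σ^n, ξ⟩ = ∫ tr(ξ, ξ) σ^n vanishes only for ξ = 0. For Ω, the test
forms β = df ⊗ ξ give Ω(α, β) = ⟨α ∧ df ∧ σ^(n-1), ξ⟩ (`atiyahBottForm_sectionForm`), so that Ω(α,
·) = 0 forces α ∧ df ∧ σ^(n-1) = 0 for all f. The identity n a ∧ i_X σ ∧ σ^(n-1) = a(X) σ^n
(`wedge_contractTwo_wedgePow`) then forces α = 0. It arises by differentiating the pull-back of σ^n
under v ↦ v + t a(v) X; the same deformation shows σ^n ≠ 0 (`wedgePow_ne_zero`).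

Momentum map. The curvature is tensorial because the derivative of Ad is the Lie bracket
(`hasFDerivAt_Ad_chart`, `Connection.curvature_fund`). From curv(Γ + β) = curv Γ + d_Γ β + ½ [β ∧ β]
the map J is a continuous polynomial of degree two, hence smooth, with derivative d_Γ β ∧ σ^(n-1) in
the direction β. The fundamental vector field is ξ^*_Γ = -d_Γ ξ, with a sign because φ acts by
pull-back along φ⁻¹ (`IsGaugeCurve.hasVelocity`). Curves with velocity ξ are products of curves
supported in local trivialisations (`exists_isGaugeCurve`). Finally, Ad-invariance gives d tr(ξ, β)
= tr(ξ, d_Γ β) + tr(d_Γ ξ ∧ β); wedging with the closed form σ^(n-1) and applying Stokes' theorem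
(`integral_extD`) yields ⟨d_Γ β ∧ σ^(n-1), ξ⟩ = Ω(-d_Γ ξ, β), the momentum map equation
(`integrationPairing_covD`). -/

theorem tangent_eq_fderiv (f : E → E') (x : E) : tangent (E := E) (E' := E') f x = fderiv ℝ f x :=
  mfderiv_eq_fderiv

theorem contDiffOn_extDeriv {k : ℕ} {τ : E → E [⋀^Fin k]→L[ℝ] V} {s : Set E} (hs : IsOpen s)
    (hτ : ContDiffOn ℝ ∞ τ s) : ContDiffOn ℝ ∞ (extDeriv τ) s := by
  have h := ContinuousLinearMap.contDiff (𝕜 := ℝ) (E := E →L[ℝ] E [⋀^Fin k]→L[ℝ] V)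
    (F := E [⋀^Fin (k + 1)]→L[ℝ] V) (n := ∞)
    (ContinuousAlternatingMap.alternatizeUncurryFinCLM ℝ E V)
  exact h.comp_contDiffOn ((contDiffOn_infty_iff_fderiv_of_isOpen hs).1 hτ).2

theorem tangent_congr {f g : N → N'} {x : N} (h : f =ᶠ[𝓝 x] g) :
    tangent (E := E) (E' := E') f x = tangent (E := E) (E' := E') g x :=
  h.mfderiv_eq

theorem pullback_apply {k : ℕ} (f : N → N') (η : N' → E' [⋀^Fin k]→L[ℝ] V) (x : N)
    (X : Fin k → E) : pullback (E := E) (E' := E') f η x X =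
      η (f x) (fun i => tangent (E := E) (E' := E') f x (X i)) := rfl

theorem pullback_congr {k : ℕ} {f g : N → N'} {x : N} (h : f =ᶠ[𝓝 x] g)
    (η : N' → E' [⋀^Fin k]→L[ℝ] V) :
    pullback (E := E) (E' := E') f η x = pullback (E := E) (E' := E') g η x := by
  simp only [pullback, tangent_congr h, h.eq_of_nhds]

theorem pullback_comp_apply {k : ℕ} {g : N' → N''} {f : N → N'} {x : N}
    (hg : MDifferentiableAt 𝓘(ℝ, E') 𝓘(ℝ, E'') g (f x))
    (hf : MDifferentiableAt 𝓘(ℝ, E) 𝓘(ℝ, E') f x) (η : N'' → E'' [⋀^Fin k]→L[ℝ] V) :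
    pullback (E := E) (E' := E'') (g ∘ f) η x =
      pullback (E := E) (E' := E') f (pullback (E := E') (E' := E'') g η) x := by
  simp only [pullback, tangent_comp hg hf]
  rfl

theorem pullback_id {k : ℕ} (η : N → E [⋀^Fin k]→L[ℝ] V) :
    pullback (E := E) (E' := E) id η = η := by
  funext x
  rw [pullback, tangent_id]
  rfl

section Charts

variable [IsManifold 𝓘(ℝ, E) ∞ N] [IsManifold 𝓘(ℝ, E') ∞ N']

theorem contMDiffOn_chart (x : N) :
    ContMDiffOn 𝓘(ℝ, E) 𝓘(ℝ, E) ∞ (extChartAt 𝓘(ℝ, E) x) (extChartAt 𝓘(ℝ, E) x).source := by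
  rw [extChartAt_source]
  exact contMDiffOn_extChartAt

theorem contMDiffOn_chart_symm (x : N) :
    ContMDiffOn 𝓘(ℝ, E) 𝓘(ℝ, E) ∞ (extChartAt 𝓘(ℝ, E) x).symm (extChartAt 𝓘(ℝ, E) x).target :=
  contMDiffOn_extChartAt_symm x

theorem mdifferentiableAt_chart {x q : N} (hq : q ∈ (extChartAt 𝓘(ℝ, E) x).source) :
    MDifferentiableAt 𝓘(ℝ, E) 𝓘(ℝ, E) (extChartAt 𝓘(ℝ, E) x) q :=
  ((contMDiffOn_chart x).contMDiffAt
    ((isOpen_extChartAt_source x).mem_nhds hq)).mdifferentiableAt (by simp)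

theorem mdifferentiableAt_chart_symm {x : N} {y : E} (hy : y ∈ (extChartAt 𝓘(ℝ, E) x).target) :
    MDifferentiableAt 𝓘(ℝ, E) 𝓘(ℝ, E) (extChartAt 𝓘(ℝ, E) x).symm y :=
  ((contMDiffOn_chart_symm x).contMDiffAt
    ((isOpen_extChartAt_target x).mem_nhds hy)).mdifferentiableAt (by simp)

theorem tangent_chart_symm_comp {x q : N} (hq : q ∈ (extChartAt 𝓘(ℝ, E) x).source) :
    (tangent (E := E) (E' := E) (extChartAt 𝓘(ℝ, E) x).symm (extChartAt 𝓘(ℝ, E) x q)).comp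
      (tangent (E := E) (E' := E) (extChartAt 𝓘(ℝ, E) x) q) = ContinuousLinearMap.id ℝ E := by
  rw [← tangent_comp (mdifferentiableAt_chart_symm ((extChartAt 𝓘(ℝ, E) x).map_source hq))
    (mdifferentiableAt_chart hq), ← tangent_id (E := E) q]
  refine tangent_congr ?_
  filter_upwards [(isOpen_extChartAt_source (I := 𝓘(ℝ, E)) x).mem_nhds hq] with z hz
  exact (extChartAt 𝓘(ℝ, E) x).left_inv hz

theorem tangent_chart_comp_symm {x : N} {y : E} (hy : y ∈ (extChartAt 𝓘(ℝ, E) x).target) :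
    (tangent (E := E) (E' := E) (extChartAt 𝓘(ℝ, E) x) ((extChartAt 𝓘(ℝ, E) x).symm y)).comp
      (tangent (E := E) (E' := E) (extChartAt 𝓘(ℝ, E) x).symm y) =
        ContinuousLinearMap.id ℝ E := by
  rw [← tangent_comp (mdifferentiableAt_chart ((extChartAt 𝓘(ℝ, E) x).map_target hy))
    (mdifferentiableAt_chart_symm hy), ← tangent_id (E := E) y]
  refine tangent_congr ?_
  filter_upwards [(isOpen_extChartAt_target (I := 𝓘(ℝ, E)) x).mem_nhds hy] with z hz
  exact (extChartAt 𝓘(ℝ, E) x).right_inv hz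

/-- Near each point, the pull-back along a plot factors through a chart. -/
theorem exists_pullback_eq_chartRep {s : E' → N} {W : Set E'} (hW : IsOpen W)
    (hs : ContMDiffOn 𝓘(ℝ, E') 𝓘(ℝ, E) ∞ s W) {y₀ : E'} (hy₀ : y₀ ∈ W) {x : N}
    (hx : s y₀ ∈ (extChartAt 𝓘(ℝ, E) x).source) :
    ∃ U ⊆ W, IsOpen U ∧ y₀ ∈ U ∧ MapsTo s U (extChartAt 𝓘(ℝ, E) x).source ∧
      ContDiffOn ℝ ∞ (extChartAt 𝓘(ℝ, E) x ∘ s) U ∧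
      ∀ (k : ℕ) (η : N → E [⋀^Fin k]→L[ℝ] V), ∀ y ∈ U, pullback (E := E') (E' := E) s η y =
        (chartRep x η (extChartAt 𝓘(ℝ, E) x (s y))).compContinuousLinearMap
          (fderiv ℝ (extChartAt 𝓘(ℝ, E) x ∘ s) y) := by
  set d := extChartAt 𝓘(ℝ, E) x with hd
  set U := W ∩ s ⁻¹' d.source with hU
  have hUo : IsOpen U := hs.continuousOn.isOpen_inter_preimage hW (isOpen_extChartAt_source x)
  have hFM : ContMDiffOn 𝓘(ℝ, E') 𝓘(ℝ, E) ∞ (d ∘ s) U :=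
    (contMDiffOn_chart x).comp (hs.mono inter_subset_left) fun z hz => hz.2
  refine ⟨U, inter_subset_left, hUo, ⟨hy₀, hx⟩, fun z hz => hz.2,
    contMDiffOn_iff_contDiffOn.1 hFM, fun k η y hy => ?_⟩
  have h1 : s =ᶠ[𝓝 y] d.symm ∘ (d ∘ s) := by
    filter_upwards [hUo.mem_nhds hy] with z hz
    exact (d.left_inv hz.2).symm
  rw [pullback_congr h1, pullback_comp_apply (g := d.symm) (f := d ∘ s)
    (mdifferentiableAt_chart_symm (d.map_source hy.2))
    ((hFM.contMDiffAt (hUo.mem_nhds hy)).mdifferentiableAt (by simp))]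
  rw [pullback, tangent_eq_fderiv]
  rfl

theorem IsSmoothForm.contDiffOn_pullback {k : ℕ} {η : N → E [⋀^Fin k]→L[ℝ] V}
    (hη : IsSmoothForm η) {s : E' → N} {W : Set E'} (hW : IsOpen W)
    (hs : ContMDiffOn 𝓘(ℝ, E') 𝓘(ℝ, E) ∞ s W) :
    ContDiffOn ℝ ∞ (GaugeTheory.pullback (E := E') (E' := E) s η) W := by
  intro y₀ hy₀
  obtain ⟨U, hUW, hUo, hyU, hmaps, hF, heq⟩ := exists_pullback_eq_chartRep (V := V) hW hs hy₀
    (mem_extChartAt_source (I := 𝓘(ℝ, E)) (s y₀))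
  have hdF := ((contDiffOn_infty_iff_fderiv_of_isOpen hUo).1 hF).2
  have key := contDiffOn_compContinuousLinearMap ((hη (s y₀)).comp hF fun z hz =>
    (extChartAt 𝓘(ℝ, E) (s y₀)).map_source (hmaps hz)) hdF
  exact ((key.congr (heq k η)).contDiffAt (hUo.mem_nhds hyU)).contDiffWithinAt

/-- Near y the plot factors through the chart at s y, where naturality of d between normed spaces
applies. Allowing a source of any dimension lets the same statement serve inverse charts, local
sections and families depending on a parameter. -/
theorem extDeriv_pullback_plot {k : ℕ} {η : N → E [⋀^Fin k]→L[ℝ] V}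
    (hη : IsSmoothForm η) {s : E' → N} {W : Set E'} (hW : IsOpen W)
    (hs : ContMDiffOn 𝓘(ℝ, E') 𝓘(ℝ, E) ∞ s W) {y : E'} (hy : y ∈ W) :
    extDeriv (pullback (E := E') (E' := E) s η) y = pullback (E := E') (E' := E) s (extD η) y := by
  obtain ⟨U, hUW, hUo, hyU, hmaps, hF, heq⟩ := exists_pullback_eq_chartRep (V := V) hW hs hy
    (mem_extChartAt_source (I := 𝓘(ℝ, E)) (s y))
  have h1 : pullback (E := E') (E' := E) s η =ᶠ[𝓝 y] fun z =>
      (chartRep (s y) η ((extChartAt 𝓘(ℝ, E) (s y) ∘ s) z)).compContinuousLinearMap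
        (fderiv ℝ (extChartAt 𝓘(ℝ, E) (s y) ∘ s) z) := by
    filter_upwards [hUo.mem_nhds hyU] with z hz using heq k η z hz
  have hT : extChartAt 𝓘(ℝ, E) (s y) (s y) ∈ (extChartAt 𝓘(ℝ, E) (s y)).target :=
    mem_extChartAt_target (I := 𝓘(ℝ, E)) (s y)
  rw [h1.extDeriv_eq, extDeriv_pullback (r := ∞) (f := extChartAt 𝓘(ℝ, E) (s y) ∘ s)
    (((hη (s y)).contDiffAt ((isOpen_extChartAt_target (s y)).mem_nhds hT)).differentiableAt
      (by simp)) (hF.contDiffAt (hUo.mem_nhds hyU)) (by simpa using ENat.LEInfty.out)]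
  rw [pullback, extD, ← tangent_eq_fderiv, tangent_comp
    (mdifferentiableAt_chart (mem_extChartAt_source (I := 𝓘(ℝ, E)) (s y)))
    ((hs.contMDiffAt (hW.mem_nhds hy)).mdifferentiableAt (by simp))]
  rfl

/-- The value of `extD` at a point is computed in the chart preferred at that point, here in the
fixed chart at x. An inverse chart is itself a plot, so naturality along plots shows that d does not
depend on the chart. -/
theorem chartRep_extD {k : ℕ} {η : N → E [⋀^Fin k]→L[ℝ] V} (hη : IsSmoothForm η) (x : N) {y : E}
    (hy : y ∈ (extChartAt 𝓘(ℝ, E) x).target) :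
    chartRep x (extD η) y = extDeriv (chartRep x η) y :=
  (extDeriv_pullback_plot hη (isOpen_extChartAt_target x) (contMDiffOn_chart_symm x) hy).symm

/-- The value of a form in terms of its chart representation. -/
theorem chartRep_comp_tangent {k : ℕ} (η : N → E [⋀^Fin k]→L[ℝ] V) {x q : N}
    (hq : q ∈ (extChartAt 𝓘(ℝ, E) x).source) :
    (chartRep x η (extChartAt 𝓘(ℝ, E) x q)).compContinuousLinearMap
      (tangent (E := E) (E' := E) (extChartAt 𝓘(ℝ, E) x) q) = η q := by
  have h := tangent_chart_symm_comp hq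
  ext X
  have h5 := fun i => DFunLike.congr_fun h (X i)
  simp only [ContinuousLinearMap.comp_apply, ContinuousLinearMap.id_apply] at h5
  simp only [chartRep, pullback, ContinuousAlternatingMap.compContinuousLinearMap_apply,
    Function.comp_def, h5, (extChartAt 𝓘(ℝ, E) x).left_inv hq]

theorem IsSmoothForm.extD {k : ℕ} {η : N → E [⋀^Fin k]→L[ℝ] V} (hη : IsSmoothForm η) :
    IsSmoothForm (extD η) := by
  intro x
  have h : ContDiffOn ℝ ∞ (extDeriv (chartRep x η)) (extChartAt 𝓘(ℝ, E) x).target :=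
    contDiffOn_extDeriv (isOpen_extChartAt_target x) (hη x)
  exact h.congr fun y hy => chartRep_extD hη x hy

omit [IsManifold 𝓘(ℝ, E') ∞ N'] in
theorem chartRep_pullback {k : ℕ} {f : N → N'} (hf : MDifferentiable 𝓘(ℝ, E) 𝓘(ℝ, E') f)
    (η : N' → E' [⋀^Fin k]→L[ℝ] V) (x : N) {y : E} (hy : y ∈ (extChartAt 𝓘(ℝ, E) x).target) :
    chartRep x (pullback (E := E) (E' := E') f η) y =
      pullback (E := E) (E' := E') (f ∘ (extChartAt 𝓘(ℝ, E) x).symm) η y := by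
  rw [pullback_comp_apply (hf _) (mdifferentiableAt_chart_symm hy)]
  rfl

/-- In the chart c at q both sides are pull-backs along the plot f ∘ c⁻¹. -/
theorem extD_pullback {k : ℕ} {f : N → N'} (hf : ContMDiff 𝓘(ℝ, E) 𝓘(ℝ, E') ∞ f)
    {η : N' → E' [⋀^Fin k]→L[ℝ] V} (hη : IsSmoothForm η) :
    extD (pullback (E := E) (E' := E') f η) = pullback (E := E) (E' := E') f (extD η) := by
  funext q
  have hq := mem_extChartAt_source (I := 𝓘(ℝ, E)) q
  have hT := mem_extChartAt_target (I := 𝓘(ℝ, E)) q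
  have hfm := hf.mdifferentiable (by simp)
  rw [← chartRep_comp_tangent (extD _) hq, ← chartRep_comp_tangent (pullback f (extD η)) hq,
    chartRep_extD (hη.pullback hf) q hT, chartRep_pullback hfm _ q hT]
  have h : chartRep q (pullback (E := E) (E' := E') f η) =ᶠ[𝓝 (extChartAt 𝓘(ℝ, E) q q)]
      pullback (E := E) (E' := E') (f ∘ (extChartAt 𝓘(ℝ, E) q).symm) η := by
    filter_upwards [(isOpen_extChartAt_target (I := 𝓘(ℝ, E)) q).mem_nhds hT] with y hy
    exact chartRep_pullback hfm η q hy
  rw [h.extDeriv_eq, extDeriv_pullback_plot hη (isOpen_extChartAt_target q)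
    (hf.comp_contMDiffOn (contMDiffOn_chart_symm q)) hT]

end Charts

end Plots

/-! ### Alternating sums and the algebra of the wedge product -/

section AltSum

variable {E : Type*} {Z : Type*} [AddCommGroup Z]

/-- The signed sum over all permutations of the arguments. -/
def altSum {N : ℕ} (Φ : (Fin N → E) → Z) (X : Fin N → E) : Z :=
  ∑ s : Equiv.Perm (Fin N), Equiv.Perm.sign s • Φ (X ∘ s)

/-- Reindexing the sum by s ↦ s r leaves the sign of r behind. -/
theorem altSum_comp_perm {N : ℕ} (Φ : (Fin N → E) → Z) (r : Equiv.Perm (Fin N)) (X : Fin N → E) :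
    altSum (fun Y => Φ (Y ∘ r)) X = Equiv.Perm.sign r • altSum Φ X := by
  rw [altSum, altSum, Finset.smul_sum, ← Equiv.sum_comp (Equiv.mulRight r)
    fun s => Equiv.Perm.sign r • Equiv.Perm.sign s • Φ (X ∘ s)]
  refine Finset.sum_congr rfl fun s _ => ?_
  rw [Equiv.coe_mulRight, Equiv.Perm.sign_mul, smul_smul, mul_comm, mul_assoc,
    Int.units_mul_self, mul_one]
  rfl

theorem altSum_congr {N : ℕ} {Φ Ψ : (Fin N → E) → Z} (h : ∀ Y, Φ Y = Ψ Y) (X : Fin N → E) :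
    altSum Φ X = altSum Ψ X := by
  rw [funext h]

theorem altSum_cast {N N' : ℕ} (h : N = N') (Φ : (Fin N → E) → Z) (X : Fin N' → E) :
    altSum (fun Y : Fin N' → E => Φ (Y ∘ Fin.cast h)) X = altSum Φ (X ∘ Fin.cast h) := by
  subst h
  rfl

/-- A signed sum over the permutations of a block of arguments can be absorbed in the signed sum
over all permutations. -/
theorem altSum_block {k N : ℕ} (f : Fin k ↪ Fin N) {Φ Ψ : (Fin N → E) → Z}
    (h : ∀ Y, Φ Y = ∑ r : Equiv.Perm (Fin k), Equiv.Perm.sign r •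
      Ψ (Y ∘ r.viaFintypeEmbedding f)) (X : Fin N → E) :
    altSum Φ X = k.factorial • altSum Ψ X := by
  have h1 : altSum Φ X = ∑ r : Equiv.Perm (Fin k), Equiv.Perm.sign r •
      altSum (fun Y => Ψ (Y ∘ r.viaFintypeEmbedding f)) X := by
    simp only [altSum, Finset.smul_sum, h]
    rw [Finset.sum_comm]
    refine Finset.sum_congr rfl fun r _ => Finset.sum_congr rfl fun s _ => ?_
    rw [smul_comm]
  rw [h1]
  -- Each r occurs with the square of its sign, so all k! terms are equal.
  simp only [altSum_comp_perm, Equiv.Perm.viaFintypeEmbedding_sign, smul_smul,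
    Int.units_mul_self, one_smul, Finset.sum_const, Finset.card_univ, Fintype.card_perm,
    Fintype.card_fin]

theorem comp_viaFintypeEmbedding {k N : ℕ} (f : Fin k ↪ Fin N) (r : Equiv.Perm (Fin k))
    (Y : Fin N → E) : (Y ∘ r.viaFintypeEmbedding f) ∘ f = (Y ∘ f) ∘ r := by
  funext i
  simp [Equiv.Perm.viaFintypeEmbedding_apply_image]

theorem comp_viaFintypeEmbedding_of_disjoint {k l N : ℕ} (f : Fin k ↪ Fin N) (g : Fin l → Fin N)
    (hfg : ∀ i j, f i ≠ g j) (r : Equiv.Perm (Fin k))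
    (Y : Fin N → E) : (Y ∘ r.viaFintypeEmbedding f) ∘ g = Y ∘ g := by
  funext i
  simp only [Function.comp_apply]
  rw [Equiv.Perm.viaFintypeEmbedding_apply_notMem_range]
  rintro ⟨j, hj⟩
  exact hfg j i hj

end AltSum

/-! ### Wedge products as antisymmetrised pairings: associativity, commutation, continuity. -/

section Wedge

variable {E : Type*} [NormedAddCommGroup E] [NormedSpace ℝ E]
  {E' : Type*} [NormedAddCommGroup E'] [NormedSpace ℝ E']
  {V : Type*} [NormedAddCommGroup V] [NormedSpace ℝ V]
  {W : Type*} [NormedAddCommGroup W] [NormedSpace ℝ W]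
  {Z : Type*} [NormedAddCommGroup Z] [NormedSpace ℝ Z]
  {U : Type*} [NormedAddCommGroup U] [NormedSpace ℝ U]
  {V' : Type*} [NormedAddCommGroup V'] [NormedSpace ℝ V']
  {W' : Type*} [NormedAddCommGroup W'] [NormedSpace ℝ W']
  {Z' : Type*} [NormedAddCommGroup Z'] [NormedSpace ℝ Z']

theorem castDegree_apply {k l : ℕ} (h : k = l) (α : E [⋀^Fin k]→L[ℝ] V) (X : Fin l → E) :
    castDegree h α X = α (X ∘ Fin.cast h) := by
  subst h
  rfl

theorem altSum_alternating {k : ℕ} (α : E [⋀^Fin k]→L[ℝ] V) (X : Fin k → E) :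
    altSum α X = k.factorial • α X := by
  have h : ∀ s : Equiv.Perm (Fin k), Equiv.Perm.sign s • α (X ∘ s) = α X := fun s => by
    have : α (X ∘ s) = Equiv.Perm.sign s • α X := α.toAlternatingMap.map_perm X s
    rw [this, smul_smul, Int.units_mul_self, one_smul]
  simp [altSum, h, Fintype.card_perm]

theorem altSum_smul {N : ℕ} (c : ℝ) (Φ : (Fin N → E) → Z) (X : Fin N → E) :
    altSum (fun Y => c • Φ Y) X = c • altSum Φ X := by
  rw [altSum, altSum, Finset.smul_sum]
  exact Finset.sum_congr rfl fun s _ => smul_comm _ _ _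

theorem altSum_sum {N : ℕ} {ι : Type*} (t : Finset ι) (Φ : ι → (Fin N → E) → Z) (X : Fin N → E) :
    altSum (fun Y => ∑ i ∈ t, Φ i Y) X = ∑ i ∈ t, altSum (Φ i) X := by
  simp only [altSum, Finset.smul_sum]
  exact Finset.sum_comm

/-- Pairing of a function of the first `k` with a function of the last `l` arguments. -/
def altPair {k l : ℕ} (b : V →L[ℝ] W →L[ℝ] Z) (Θ : (Fin k → E) → V) (γ : (Fin l → E) → W)
    (Y : Fin (k + l) → E) : Z :=
  b (Θ (Y ∘ Fin.castAdd l)) (γ (Y ∘ Fin.natAdd k))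

theorem wedge_apply {k l : ℕ} (b : V →L[ℝ] W →L[ℝ] Z) (α : E [⋀^Fin k]→L[ℝ] V)
    (β : E [⋀^Fin l]→L[ℝ] W) (X : Fin (k + l) → E) :
    wedge b α β X = (k.factorial * l.factorial : ℝ)⁻¹ • altSum (altPair b α β) X := by
  rw [wedge, ContinuousAlternatingMap.smul_apply,
    ContinuousMultilinearMap.alternatization_apply_apply]
  rfl

/-- Clearing denominators turns identities of wedge products into identities of alternating sums,
which are proved by reindexing permutations. -/
theorem factorial_smul_wedge {k l : ℕ} (b : V →L[ℝ] W →L[ℝ] Z) (α : E [⋀^Fin k]→L[ℝ] V)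
    (β : E [⋀^Fin l]→L[ℝ] W) (X : Fin (k + l) → E) :
    (k.factorial * l.factorial : ℝ) • wedge b α β X = altSum (altPair b α β) X := by
  rw [wedge_apply, smul_smul, mul_inv_cancel₀ (by positivity), one_smul]

/-- The inner permutations move only the first k arguments and extend by the identity to
permutations of all arguments, so the outer sum absorbs them. This is the mechanism behind
associativity. -/
theorem altSum_altPair_left {k l : ℕ} (b : V →L[ℝ] W →L[ℝ] Z) (Θ : (Fin k → E) → V)
    (γ : (Fin l → E) → W) (X : Fin (k + l) → E) :
    altSum (altPair b (altSum Θ) γ) X = (k.factorial : ℝ) • altSum (altPair b Θ γ) X := by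
  rw [Nat.cast_smul_eq_nsmul]
  refine altSum_block (Fin.castAddEmb l) (fun Y => ?_) X
  have h1 := comp_viaFintypeEmbedding (E := E) (Fin.castAddEmb (n := k) l)
  have h2 := comp_viaFintypeEmbedding_of_disjoint (E := E) (Fin.castAddEmb (n := k) l)
    (Fin.natAdd k) (fun i j h => by
      have := congrArg Fin.val h
      simp only [Fin.castAddEmb_apply, Fin.val_castAdd, Fin.val_natAdd] at this
      omega)
  simp only [Fin.coe_castAddEmb] at h1
  simp only [altPair, h1, h2, altSum, map_sum, sum_apply]
  refine Finset.sum_congr rfl fun r _ => ?_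
  rcases Int.units_eq_one_or (Equiv.Perm.sign r) with h | h <;> simp [h]

theorem altSum_altPair_right {k l : ℕ} (b : V →L[ℝ] W →L[ℝ] Z) (Θ : (Fin k → E) → V)
    (γ : (Fin l → E) → W) (X : Fin (k + l) → E) :
    altSum (altPair b Θ (altSum γ)) X = (l.factorial : ℝ) • altSum (altPair b Θ γ) X := by
  rw [Nat.cast_smul_eq_nsmul]
  refine altSum_block (Fin.natAddEmb k) (fun Y => ?_) X
  have h1 := comp_viaFintypeEmbedding (E := E) (Fin.natAddEmb (m := l) k)
  have h2 := comp_viaFintypeEmbedding_of_disjoint (E := E) (Fin.natAddEmb (m := l) k)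
    (Fin.castAdd l) (fun i j h => by
      have := congrArg Fin.val h
      simp only [Fin.natAddEmb_apply, Fin.val_castAdd, Fin.val_natAdd] at this
      omega)
  have h3 : ⇑(Fin.natAddEmb (m := l) k) = Fin.natAdd k := rfl
  simp only [h3] at h1
  simp only [altPair, h1, h2, altSum, map_sum]
  refine Finset.sum_congr rfl fun r _ => ?_
  rcases Int.units_eq_one_or (Equiv.Perm.sign r) with h | h <;> simp [h]

theorem altPair_smul_left {k l : ℕ} (b : V →L[ℝ] W →L[ℝ] Z) (c : ℝ) (Θ : (Fin k → E) → V)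
    (γ : (Fin l → E) → W) : altPair b (fun Y => c • Θ Y) γ = fun Y => c • altPair b Θ γ Y := by
  funext Y
  simp [altPair]

theorem altPair_smul_right {k l : ℕ} (b : V →L[ℝ] W →L[ℝ] Z) (c : ℝ) (Θ : (Fin k → E) → V)
    (γ : (Fin l → E) → W) : altPair b Θ (fun Y => c • γ Y) = fun Y => c • altPair b Θ γ Y := by
  funext Y
  simp [altPair]

/-- Associativity of the wedge product. -/
theorem wedge_assoc {k l m : ℕ} {b₁ : V' →L[ℝ] U →L[ℝ] Z} {b₂ : V →L[ℝ] W →L[ℝ] V'}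
    {b₃ : V →L[ℝ] W' →L[ℝ] Z} {b₄ : W →L[ℝ] U →L[ℝ] W'}
    (hb : ∀ u v w, b₁ (b₂ u v) w = b₃ u (b₄ v w))
    (α : E [⋀^Fin k]→L[ℝ] V) (β : E [⋀^Fin l]→L[ℝ] W) (γ : E [⋀^Fin m]→L[ℝ] U) :
    castDegree (Nat.add_assoc k l m) (wedge b₁ (wedge b₂ α β) γ) =
      wedge b₃ α (wedge b₄ β γ) := by
  have hk : (k.factorial : ℝ) ≠ 0 := by positivity
  have hl : (l.factorial : ℝ) ≠ 0 := by positivity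
  have hm : (m.factorial : ℝ) ≠ 0 := by positivity
  have hkl : ((k + l).factorial : ℝ) ≠ 0 := by positivity
  have hlm : ((l + m).factorial : ℝ) ≠ 0 := by positivity
  ext X
  rw [castDegree_apply, wedge_apply, wedge_apply]
  have h1 : (⇑(wedge b₂ α β) : (Fin (k + l) → E) → V') = fun Y =>
      (k.factorial * l.factorial : ℝ)⁻¹ • altSum (altPair b₂ α β) Y :=
    funext fun Y => wedge_apply b₂ α β Y
  have h2 : (⇑(wedge b₄ β γ) : (Fin (l + m) → E) → W') = fun Y =>
      (l.factorial * m.factorial : ℝ)⁻¹ • altSum (altPair b₄ β γ) Y :=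
    funext fun Y => wedge_apply b₄ β γ Y
  rw [h1, h2, altPair_smul_left, altPair_smul_right, altSum_smul, altSum_smul,
    altSum_altPair_left, altSum_altPair_right, ← altSum_cast (Nat.add_assoc k l m)]
  -- Before antisymmetrisation both triple products feed the same three blocks of arguments to α, β
  -- and γ; only the bracketing of k + l + m differs.
  have h3 : (fun Y : Fin (k + (l + m)) → E =>
      altPair b₁ (altPair b₂ α β) γ (Y ∘ Fin.cast (Nat.add_assoc k l m))) =
      altPair b₃ α (altPair b₄ β γ) := by
    funext Y
    simp only [altPair, hb]
    congr 3
    funext i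
    simp only [Function.comp_apply]
    congr 1
    ext
    simp [add_assoc]
  -- The factorial of the inner degree produced by absorption cancels the one in the outer
  -- normalisation; on both sides 1 / (k! l! m!) remains.
  rw [h3, smul_smul, smul_smul, smul_smul, smul_smul]
  congr 1
  field_simp

theorem wedge_compContinuousLinearMap {k l : ℕ} (b : V →L[ℝ] W →L[ℝ] Z) (α : E [⋀^Fin k]→L[ℝ] V)
    (β : E [⋀^Fin l]→L[ℝ] W) (A : E' →L[ℝ] E) :
    (wedge b α β).compContinuousLinearMap A =
      wedge b (α.compContinuousLinearMap A) (β.compContinuousLinearMap A) := by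
  ext X
  rw [ContinuousAlternatingMap.compContinuousLinearMap_apply, wedge_apply, wedge_apply]
  rfl

theorem castDegree_compContinuousLinearMap {k l : ℕ} (h : k = l) (α : E [⋀^Fin k]→L[ℝ] V)
    (A : E' →L[ℝ] E) : (castDegree h α).compContinuousLinearMap A =
      castDegree h (α.compContinuousLinearMap A) := by
  subst h
  rfl

theorem compContinuousAlternatingMap_wedge {k l : ℕ} {b : V →L[ℝ] W →L[ℝ] Z}
    {b' : V' →L[ℝ] W' →L[ℝ] Z'} {L : Z →L[ℝ] Z'} {L₁ : V →L[ℝ] V'} {L₂ : W →L[ℝ] W'}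
    (h : ∀ v w, L (b v w) = b' (L₁ v) (L₂ w)) (α : E [⋀^Fin k]→L[ℝ] V)
    (β : E [⋀^Fin l]→L[ℝ] W) :
    L.compContinuousAlternatingMap (wedge b α β) =
      wedge b' (L₁.compContinuousAlternatingMap α) (L₂.compContinuousAlternatingMap β) := by
  ext X
  change L (wedge b α β X) = _
  rw [wedge_apply, wedge_apply, map_smul, altSum, altSum, map_sum]
  congr 1
  refine Finset.sum_congr rfl fun s _ => ?_
  have h' : ∀ Y, altPair b' (L₁.compContinuousAlternatingMap α)
      (L₂.compContinuousAlternatingMap β) Y = L (altPair b α β Y) := fun Y => by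
    simp only [altPair, h]; rfl
  rw [h']
  rcases Int.units_eq_one_or (Equiv.Perm.sign s) with h | h <;> simp [h]

/-- Two-forms commute with all forms. -/
theorem wedge_comm_two {k : ℕ} {b : V →L[ℝ] W →L[ℝ] Z} {b' : W →L[ℝ] V →L[ℝ] Z}
    (hb : ∀ v w, b v w = b' w v) (α : E [⋀^Fin k]→L[ℝ] V) (β : E [⋀^Fin 2]→L[ℝ] W) :
    wedge b α β = castDegree (Nat.add_comm 2 k) (wedge b' β α) := by
  ext X
  rw [castDegree_apply, wedge_apply, wedge_apply, ← altSum_cast (Nat.add_comm 2 k), mul_comm]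
  congr 1
  have h : (altPair b' β α : (Fin (2 + k) → E) → Z) ∘ (fun Y => Y ∘ Fin.cast (Nat.add_comm 2 k)) =
      fun Y : Fin (k + 2) → E => b' (β (Y ∘ Fin.cast (Nat.add_comm 2 k) ∘ Fin.castAdd k))
        (α (Y ∘ Fin.cast (Nat.add_comm 2 k) ∘ Fin.natAdd 2)) := rfl
  -- Two rotations of the k + 2 positions carry the block of α past the two slots of β.
  have h2 : (fun Y : Fin (k + 2) → E =>
      altPair b' β α (Y ∘ Fin.cast (Nat.add_comm 2 k))) =
      fun Y => altPair b α β (Y ∘ (finRotate (k + 2) ^ 2 : Equiv.Perm (Fin (k + 2)))) := by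
    funext Y
    simp only [altPair, hb]
    congr 2
    · congr 1
      funext i
      simp only [Function.comp_apply, pow_two, Equiv.Perm.mul_apply, finRotate_apply]
      congr 1
      ext
      have := i.2
      simp only [Fin.val_cast, Fin.val_castAdd, Fin.val_add, Fin.val_natAdd, Fin.val_one']
      interval_cases h : (i : ℕ)
      · simp
      · have : (k + 1 + 1 % (k + 1 + 1)) = k + 2 := by
          rw [Nat.mod_eq_of_lt (by omega)]
        simp [Nat.mod_eq_of_lt]
    · funext i
      simp only [Function.comp_apply, pow_two, Equiv.Perm.mul_apply, finRotate_apply]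
      congr 1
      ext
      have := i.2
      simp only [Fin.val_cast, Fin.val_castAdd, Fin.val_add, Fin.val_natAdd, Fin.val_one']
      rw [Nat.mod_eq_of_lt (show 1 < k + 1 + 1 by omega), Nat.mod_eq_of_lt (a := ↑i + 1) (by omega),
        Nat.mod_eq_of_lt (by omega)]
      omega
  -- The permutation is a square, hence even whatever the parity of k.
  rw [h2, altSum_comp_perm, map_pow, sign_finRotate]
  rcases Nat.even_or_odd k with hk | hk <;> simp [pow_succ, hk.neg_one_pow]

theorem norm_tensorPair_le {k l : ℕ} (b : V →L[ℝ] W →L[ℝ] Z) (α : E [⋀^Fin k]→L[ℝ] V)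
    (β : E [⋀^Fin l]→L[ℝ] W) : ‖tensorPair b α β‖ ≤ ‖b‖ * ‖α‖ * ‖β‖ := by
  refine ContinuousMultilinearMap.opNorm_le_bound (by positivity) fun X => ?_
  change ‖b (α fun i => X (Fin.castAdd l i)) (β fun j => X (Fin.natAdd k j))‖ ≤ _
  rw [Fin.prod_univ_add]
  refine (b.le_opNorm₂ _ _).trans ?_
  have h1 := α.le_opNorm fun i => X (Fin.castAdd l i)
  have h2 := β.le_opNorm fun j => X (Fin.natAdd k j)
  calc ‖b‖ * ‖α fun i => X (Fin.castAdd l i)‖ * ‖β fun j => X (Fin.natAdd k j)‖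
      ≤ ‖b‖ * (‖α‖ * ∏ i, ‖X (Fin.castAdd l i)‖) * (‖β‖ * ∏ j, ‖X (Fin.natAdd k j)‖) := by
        gcongr
    _ = _ := by ring

/-- The wedge product as a continuous bilinear map. -/
def wedgeCLM (E : Type*) [NormedAddCommGroup E] [NormedSpace ℝ E] (k l : ℕ)
    (b : V →L[ℝ] W →L[ℝ] Z) :
    (E [⋀^Fin k]→L[ℝ] V) →L[ℝ] (E [⋀^Fin l]→L[ℝ] W) →L[ℝ] E [⋀^Fin (k + l)]→L[ℝ] Z :=
  LinearMap.mkContinuous₂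
    (LinearMap.mk₂ ℝ (wedge b)
      (fun α α' β => by
        ext X
        simp only [ContinuousAlternatingMap.add_apply, wedge_apply, ← smul_add]
        simp [altSum, altPair, Finset.sum_add_distrib])
      (fun c α β => by
        ext X
        simp only [ContinuousAlternatingMap.smul_apply, wedge_apply]
        rw [smul_comm c]
        congr 1
        rw [← altSum_smul]
        exact altSum_congr (fun Y => by simp [altPair]) X)
      (fun α β β' => by
        ext X
        simp only [ContinuousAlternatingMap.add_apply, wedge_apply, ← smul_add]
        simp [altSum, altPair, Finset.sum_add_distrib])
      (fun c α β => by
        ext X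
        simp only [ContinuousAlternatingMap.smul_apply, wedge_apply]
        rw [smul_comm c]
        congr 1
        rw [← altSum_smul]
        exact altSum_congr (fun Y => by simp [altPair]) X))
    (‖((k.factorial * l.factorial : ℝ)⁻¹)‖ * ‖alternatizationCLM (E := E) (V := Z) (k + l)‖ * ‖b‖)
    (fun α β => by
      change ‖((k.factorial * l.factorial : ℝ)⁻¹) • alternatizationCLM (k + l)
        (tensorPair b α β)‖ ≤ _
      rw [norm_smul]
      calc _ ≤ ‖((k.factorial * l.factorial : ℝ)⁻¹)‖ *
            (‖alternatizationCLM (E := E) (V := Z) (k + l)‖ * (‖b‖ * ‖α‖ * ‖β‖)) := by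
            gcongr
            exact (ContinuousLinearMap.le_opNorm _ _).trans
              (mul_le_mul_of_nonneg_left (norm_tensorPair_le b α β) (norm_nonneg _))
        _ = _ := by ring)

@[simp] theorem wedgeCLM_apply {k l : ℕ} (b : V →L[ℝ] W →L[ℝ] Z) (α : E [⋀^Fin k]→L[ℝ] V)
    (β : E [⋀^Fin l]→L[ℝ] W) : wedgeCLM E k l b α β = wedge b α β := rfl

/-- Change of degree as a continuous linear map. -/
def castDegreeCLM {k l : ℕ} (h : k = l) : (E [⋀^Fin k]→L[ℝ] V) →L[ℝ] E [⋀^Fin l]→L[ℝ] V :=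
  h ▸ ContinuousLinearMap.id ℝ _

theorem castDegreeCLM_apply {k l : ℕ} (h : k = l) (α : E [⋀^Fin k]→L[ℝ] V) :
    castDegreeCLM h α = castDegree h α := by
  subst h
  rfl

/-- Only the identity and the transposition contribute. There is no factor ½, in accordance with the
shuffle convention. -/
theorem wedge_one_one_apply (b : V →L[ℝ] W →L[ℝ] Z) (α : E [⋀^Fin 1]→L[ℝ] V)
    (β : E [⋀^Fin 1]→L[ℝ] W) (X : Fin 2 → E) :
    wedge b α β X = b (α fun _ => X 0) (β fun _ => X 1) - b (α fun _ => X 1) (β fun _ => X 0) := by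
  have h : (Finset.univ : Finset (Equiv.Perm (Fin 2))) = {1, Equiv.swap 0 1} := by decide
  have h1 : ∀ Y : Fin (1 + 1) → E, altPair b α β Y = b (α fun _ => Y 0) (β fun _ => Y 1) := by
    intro Y
    simp only [altPair]
    congr 3
    · congr 1
      funext i
      have : i = 0 := Subsingleton.elim _ _
      subst this; rfl
    · funext i
      have : i = 0 := Subsingleton.elim _ _
      subst this; rfl
  rw [wedge_apply, altSum]
  change _ • (∑ s ∈ (Finset.univ : Finset (Equiv.Perm (Fin 2))), _) = _
  rw [h, Finset.sum_pair (by decide), h1, h1]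
  simp [sub_eq_add_neg]

end Wedge

/-! ### The Leibniz rule for the exterior derivative of a wedge product. -/

section Leibniz

variable {E : Type*} [NormedAddCommGroup E] [NormedSpace ℝ E]
  {V : Type*} [NormedAddCommGroup V] [NormedSpace ℝ V]
  {W : Type*} [NormedAddCommGroup W] [NormedSpace ℝ W]
  {Z : Type*} [NormedAddCommGroup Z] [NormedSpace ℝ Z]

open ContinuousAlternatingMap

/-- The left-hand form is already alternating, so antisymmetrising it multiplies by (k + 1)!. On the
other hand its k + 1 terms all antisymmetrise to the same sum; dividing by k + 1 leaves k!. -/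
theorem factorial_smul_alternatizeUncurryFin {k : ℕ} (f : E →L[ℝ] E [⋀^Fin k]→L[ℝ] V)
    (X : Fin (k + 1) → E) :
    (k.factorial : ℝ) • alternatizeUncurryFin f X =
      altSum (fun Y : Fin (k + 1) → E => f (Y 0) (Fin.tail Y)) X := by
  have h1 := altSum_alternating (alternatizeUncurryFin f) X
  -- The i-th term brings the i-th argument to the front by a cycle of sign (-1)^i, which is the
  -- sign it carries.
  have h2 : altSum (alternatizeUncurryFin f) X =
      ∑ i : Fin (k + 1), altSum (fun Y => (-1 : ℝ) ^ (i : ℕ) •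
        (fun Y : Fin (k + 1) → E => f (Y 0) (Fin.tail Y)) (Y ∘ i.cycleRange.symm)) X := by
    rw [← altSum_sum]
    refine altSum_congr (fun Y => ?_) X
    rw [alternatizeUncurryFin_apply]
    refine Finset.sum_congr rfl fun i _ => ?_
    have h3 : i.removeNth Y = Fin.tail (Y ∘ i.cycleRange.symm) := by
      funext j
      simp [Fin.removeNth, Fin.tail, Fin.cycleRange_symm_succ]
    have h4 : (Y ∘ i.cycleRange.symm) 0 = Y i := by simp [Fin.cycleRange_symm_zero]
    simp only [h3, h4]
    rcases Nat.even_or_odd (i : ℕ) with hk | hk <;> simp [hk.neg_one_pow]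
  have h3 : ∀ i : Fin (k + 1), altSum (fun Y => (-1 : ℝ) ^ (i : ℕ) •
        (fun Y : Fin (k + 1) → E => f (Y 0) (Fin.tail Y)) (Y ∘ i.cycleRange.symm)) X =
      altSum (fun Y : Fin (k + 1) → E => f (Y 0) (Fin.tail Y)) X := by
    intro i
    rw [altSum_smul, altSum_comp_perm (fun Y : Fin (k + 1) → E => f (Y 0) (Fin.tail Y)), Equiv.Perm.sign_symm, Fin.sign_cycleRange]
    rcases Nat.even_or_odd (i : ℕ) with hk | hk <;> simp [hk.neg_one_pow]
  simp only [h3, Finset.sum_const, Finset.card_univ, Fintype.card_fin] at h2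
  rw [h1, Nat.factorial_succ, mul_smul, ← Nat.cast_smul_eq_nsmul ℝ,
    ← Nat.cast_smul_eq_nsmul ℝ (k + 1)] at h2
  have h5 := smul_right_injective V (show ((k + 1 : ℕ) : ℝ) ≠ 0 by positivity) h2
  rwa [← Nat.cast_smul_eq_nsmul ℝ] at h5

/-- The permutations inside the wedge product move the last k + l arguments and are absorbed by the
outer sum. A and B enter merely as functions of the first argument, so that either may be constant;
these two cases are the two halves of the Leibniz rule. -/
theorem alternatizeUncurryFin_wedge_aux {k l : ℕ} (b : V →L[ℝ] W →L[ℝ] Z)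
    (A : E → E [⋀^Fin k]→L[ℝ] V) (B : E → E [⋀^Fin l]→L[ℝ] W)
    (f : E →L[ℝ] E [⋀^Fin (k + l)]→L[ℝ] Z) (hf : ∀ v, f v = wedge b (A v) (B v))
    (X : Fin (k + l + 1) → E) :
    (k.factorial * l.factorial : ℝ) • alternatizeUncurryFin f X =
      altSum (fun Y : Fin (k + l + 1) → E => altPair b (A (Y 0)) (B (Y 0)) (Fin.tail Y)) X := by
  have h1 := factorial_smul_alternatizeUncurryFin f X
  have h2 : altSum (fun Y : Fin (k + l + 1) → E => (k.factorial * l.factorial : ℝ) •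
      f (Y 0) (Fin.tail Y)) X = ((k + l).factorial : ℝ) •
      altSum (fun Y : Fin (k + l + 1) → E => altPair b (A (Y 0)) (B (Y 0)) (Fin.tail Y)) X := by
    rw [Nat.cast_smul_eq_nsmul]
    refine altSum_block (Fin.succEmb (k + l)) (fun Y => ?_) X
    rw [hf, factorial_smul_wedge, altSum]
    refine Finset.sum_congr rfl fun r _ => ?_
    have h3 : (Y ∘ r.viaFintypeEmbedding (Fin.succEmb (k + l))) 0 = Y 0 := by
      simp only [Function.comp_apply]
      rw [Equiv.Perm.viaFintypeEmbedding_apply_notMem_range]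
      rintro ⟨j, hj⟩
      exact Fin.succ_ne_zero j hj
    have h4 : Fin.tail (Y ∘ r.viaFintypeEmbedding (Fin.succEmb (k + l))) = Fin.tail Y ∘ r :=
      comp_viaFintypeEmbedding (Fin.succEmb (k + l)) r Y
    rw [h3, h4]
  rw [altSum_smul, ← h1, smul_comm] at h2
  exact smul_right_injective Z (show ((k + l).factorial : ℝ) ≠ 0 by positivity) h2

/-- The differentiated slot stands directly in front of the arguments of A, so no sign appears. -/
theorem alternatizeUncurryFin_wedge_left {k l : ℕ} (b : V →L[ℝ] W →L[ℝ] Z)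
    (A : E →L[ℝ] E [⋀^Fin k]→L[ℝ] V) (β : E [⋀^Fin l]→L[ℝ] W)
    (f : E →L[ℝ] E [⋀^Fin (k + l)]→L[ℝ] Z) (hf : ∀ v, f v = wedge b (A v) β) :
    alternatizeUncurryFin f =
      castDegree (Nat.add_right_comm k 1 l) (wedge b (alternatizeUncurryFin A) β) := by
  ext X
  have h1 := alternatizeUncurryFin_wedge_aux b A (fun _ => β) f hf X
  have h2 := factorial_smul_wedge b (alternatizeUncurryFin A) β
    (X ∘ Fin.cast (Nat.add_right_comm k 1 l))
  have h3 : (fun Y => (k.factorial : ℝ) • alternatizeUncurryFin A Y) =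
      altSum (fun Y : Fin (k + 1) → E => A (Y 0) (Fin.tail Y)) :=
    funext fun Y => factorial_smul_alternatizeUncurryFin A Y
  have h4 := altSum_altPair_left b (fun Y : Fin (k + 1) → E => A (Y 0) (Fin.tail Y)) β
    (X ∘ Fin.cast (Nat.add_right_comm k 1 l))
  rw [← h3, altPair_smul_left, altSum_smul, ← h2, ← altSum_cast] at h4
  have h5 : (fun Y : Fin (k + l + 1) → E => altPair b (A (Y 0)) β (Fin.tail Y)) =
      fun Y => altPair b (fun Y : Fin (k + 1) → E => A (Y 0) (Fin.tail Y)) β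
        (Y ∘ Fin.cast (Nat.add_right_comm k 1 l)) := by
    funext Y
    simp only [altPair]
    congr 2
    funext i
    simp only [Fin.tail, Function.comp_apply]
    congr 1
    ext
    simp only [Fin.val_cast, Fin.val_natAdd, Fin.val_succ]
    omega
  rw [h5] at h1
  rw [← h1, ← castDegree_apply (Nat.add_right_comm k 1 l), smul_smul, smul_smul] at h4
  have h6 : (k.factorial : ℝ) * (((k + 1).factorial : ℝ) * (l.factorial : ℝ)) =
      ((k + 1).factorial : ℝ) * ((k.factorial : ℝ) * (l.factorial : ℝ)) := by ring
  rw [h6] at h4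
  exact (smul_right_injective Z (by positivity) h4).symm

/-- The differentiated slot must pass the k arguments of α, which costs the sign (-1)^k. -/
theorem alternatizeUncurryFin_wedge_right {k l : ℕ} (b : V →L[ℝ] W →L[ℝ] Z)
    (α : E [⋀^Fin k]→L[ℝ] V) (B : E →L[ℝ] E [⋀^Fin l]→L[ℝ] W)
    (f : E →L[ℝ] E [⋀^Fin (k + l)]→L[ℝ] Z) (hf : ∀ v, f v = wedge b α (B v)) :
    alternatizeUncurryFin f =
      (-1 : ℝ) ^ k • castDegree (Nat.add_assoc k l 1).symm
        (wedge b α (alternatizeUncurryFin B)) := by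
  ext X
  have h1 := alternatizeUncurryFin_wedge_aux b (fun _ => α) B f hf X
  have h2 := factorial_smul_wedge b α (alternatizeUncurryFin B) X
  have h3 : (fun Y => (l.factorial : ℝ) • alternatizeUncurryFin B Y) =
      altSum (fun Y : Fin (l + 1) → E => B (Y 0) (Fin.tail Y)) :=
    funext fun Y => factorial_smul_alternatizeUncurryFin B Y
  have h4 := altSum_altPair_right b α (fun Y : Fin (l + 1) → E => B (Y 0) (Fin.tail Y)) X
  rw [← h3, altPair_smul_right, altSum_smul, ← h2] at h4
  -- The cycle of the first k + 1 positions puts the differentiated slot right before the arguments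
  -- of B.
  have h5 : (fun Y : Fin (k + l + 1) → E => altPair b α (B (Y 0)) (Fin.tail Y)) =
      fun Y => altPair b α (fun Y : Fin (l + 1) → E => B (Y 0) (Fin.tail Y))
        (Y ∘ (Fin.cycleRange (⟨k, by omega⟩ : Fin (k + l + 1)))) := by
    funext Y
    simp only [altPair]
    have e1 : ∀ i : Fin k, Fin.cycleRange (⟨k, by omega⟩ : Fin (k + l + 1))
        (Fin.castAdd (l + 1) i) = (Fin.castAdd l i).succ := fun i => by
      ext
      rw [Fin.coe_cycleRange_of_lt (by exact i.2)]
      rfl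
    have e2 : Fin.cycleRange (⟨k, by omega⟩ : Fin (k + l + 1)) (Fin.natAdd k (0 : Fin (l + 1))) = 0 := by
      exact Fin.cycleRange_self _
    have e3 : ∀ i : Fin l, Fin.cycleRange (⟨k, by omega⟩ : Fin (k + l + 1))
        (Fin.natAdd k i.succ) = (Fin.natAdd k i).succ := fun i => by
      rw [Fin.cycleRange_of_gt (by rw [Fin.lt_def]; simp)]
      ext
      simp [add_assoc]
    have e4 : (Fin.tail Y ∘ Fin.castAdd l) =
        (Y ∘ Fin.cycleRange (⟨k, by omega⟩ : Fin (k + l + 1))) ∘ Fin.castAdd (l + 1) := by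
      funext i
      exact congrArg Y (e1 i).symm
    have e5 : Fin.tail Y ∘ Fin.natAdd k =
        Fin.tail ((Y ∘ Fin.cycleRange (⟨k, by omega⟩ : Fin (k + l + 1))) ∘ Fin.natAdd k) := by
      funext i
      exact congrArg Y (e3 i).symm
    have e6 : Y 0 = ((Y ∘ Fin.cycleRange (⟨k, by omega⟩ : Fin (k + l + 1))) ∘
        (Fin.natAdd k : Fin (l + 1) → Fin (k + (l + 1)))) 0 :=
      congrArg Y e2.symm
    rw [e4, e5, e6]
  rw [h5] at h1
  have h7 := altSum_comp_perm (altPair b α (fun Y : Fin (l + 1) → E => B (Y 0) (Fin.tail Y)))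
    (Fin.cycleRange (⟨k, by omega⟩ : Fin (k + l + 1))) X
  rw [Fin.sign_cycleRange] at h7
  have h8 : ((k.factorial : ℝ) * (l.factorial : ℝ)) • alternatizeUncurryFin f X = (-1 : ℝ) ^ k •
      altSum (altPair b α (fun Y : Fin (l + 1) → E => B (Y 0) (Fin.tail Y))) X := by
    rw [h1]
    refine h7.trans ?_
    rcases Nat.even_or_odd k with hk | hk <;> simp [hk.neg_one_pow]
  have hl : ((l + 1).factorial : ℝ) ≠ 0 := by positivity
  have h9 : altSum (altPair b α (fun Y : Fin (l + 1) → E => B (Y 0) (Fin.tail Y))) X =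
      ((k.factorial : ℝ) * (l.factorial : ℝ)) • wedge b α (alternatizeUncurryFin B) X := by
    refine smul_right_injective Z hl ?_
    change ((l + 1).factorial : ℝ) • _ = ((l + 1).factorial : ℝ) • _
    refine h4.symm.trans ?_
    rw [smul_smul, smul_smul]
    congr 1
    ring
  rw [h9, smul_comm] at h8
  rw [ContinuousAlternatingMap.smul_apply, castDegree_apply]
  exact smul_right_injective Z (by positivity) h8

/-- The Leibniz rule for the exterior derivative, when the second factor is closed. -/
theorem extDeriv_wedge_of_closed {k l : ℕ} (b : V →L[ℝ] W →L[ℝ] Z) {f : E → E [⋀^Fin k]→L[ℝ] V}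
    {g : E → E [⋀^Fin l]→L[ℝ] W} {x : E} (hf : DifferentiableAt ℝ f x)
    (hg : DifferentiableAt ℝ g x) (hc : extDeriv g x = 0) :
    extDeriv (fun y => wedge b (f y) (g y)) x =
      castDegree (Nat.add_right_comm k 1 l) (wedge b (extDeriv f x) (g x)) := by
  have h : HasFDerivAt (fun y => wedge b (f y) (g y)) _ x :=
    (wedgeCLM E k l b).hasFDerivAt_of_bilinear hf.hasFDerivAt hg.hasFDerivAt
  rw [extDeriv, h.fderiv, alternatizeUncurryFin_add,
    alternatizeUncurryFin_wedge_right b (f x) (fderiv ℝ g x) _ (fun v => by simp),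
    alternatizeUncurryFin_wedge_left b (fderiv ℝ f x) (g x) _ (fun v => by simp)]
  rw [extDeriv] at hc
  have h0 : wedge b (f x) (0 : E [⋀^Fin (l + 1)]→L[ℝ] W) = 0 := (wedgeCLM E k (l + 1) b (f x)).map_zero
  rw [hc, h0, ← castDegreeCLM_apply, _root_.map_zero, smul_zero, zero_add]
  rfl

end Leibniz

/-! ### Linear algebra of symplectic forms -/

section DegreeCasts

variable {E : Type*} [NormedAddCommGroup E] [NormedSpace ℝ E]
  {V : Type*} [NormedAddCommGroup V] [NormedSpace ℝ V]
  {W : Type*} [NormedAddCommGroup W] [NormedSpace ℝ W]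
  {Z : Type*} [NormedAddCommGroup Z] [NormedSpace ℝ Z]

theorem castDegree_trans {k l m : ℕ} (h : k = l) (h' : l = m) (α : E [⋀^Fin k]→L[ℝ] V) :
    castDegree h' (castDegree h α) = castDegree (h.trans h') α := by
  subst h h'
  rfl

theorem wedge_castDegree_left {k k' l : ℕ} (h : k = k') (b : V →L[ℝ] W →L[ℝ] Z)
    (α : E [⋀^Fin k]→L[ℝ] V) (β : E [⋀^Fin l]→L[ℝ] W) :
    wedge b (castDegree h α) β = castDegree (congrArg (· + l) h) (wedge b α β) := by
  subst h
  rfl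

theorem wedge_smul_left {k l : ℕ} (b : V →L[ℝ] W →L[ℝ] Z) (c : ℝ)
    (α : E [⋀^Fin k]→L[ℝ] V) (β : E [⋀^Fin l]→L[ℝ] W) :
    wedge b (c • α) β = c • wedge b α β := by
  rw [← wedgeCLM_apply, map_smul]
  rfl

theorem castDegree_smul {k l : ℕ} (h : k = l) (c : ℝ) (α : E [⋀^Fin k]→L[ℝ] V) :
    castDegree h (c • α) = c • castDegree h α := by
  subst h
  rfl

theorem castDegree_add {k l : ℕ} (h : k = l) (α β : E [⋀^Fin k]→L[ℝ] V) :
    castDegree h (α + β) = castDegree h α + castDegree h β := by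
  subst h
  rfl

end DegreeCasts

/-! ### Powers of a two-form, their behaviour under shears, and non-degeneracy. -/

section Symplectic

variable {E : Type*} [NormedAddCommGroup E] [NormedSpace ℝ E]
  {E' : Type*} [NormedAddCommGroup E'] [NormedSpace ℝ E']

theorem wedgePow_compContinuousLinearMap (s : E [⋀^Fin 2]→L[ℝ] ℝ) (A : E' →L[ℝ] E) (j : ℕ) :
    (wedgePow s j).compContinuousLinearMap A = wedgePow (s.compContinuousLinearMap A) j := by
  induction j with
  | zero => rfl
  | succ j ih => rw [wedgePow, wedgePow, wedge_compContinuousLinearMap, ih]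

/-- Two-forms commute with all forms, so the j + 1 terms of the product rule are equal. -/
theorem hasDerivAt_wedgePow (s ω₀ : E [⋀^Fin 2]→L[ℝ] ℝ) (j : ℕ) :
    HasDerivAt (fun t : ℝ => wedgePow (s + t • ω₀) (j + 1))
      ((j + 1 : ℝ) • castDegree (show 2 + 2 * j = 2 * (j + 1) by omega)
        (wedge (ContinuousLinearMap.mul ℝ ℝ) ω₀ (wedgePow s j))) 0 := by
  have hlin : HasDerivAt (fun t : ℝ => s + t • ω₀) ω₀ 0 := by
    simpa using ((hasDerivAt_id (0 : ℝ)).smul_const ω₀).const_add s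
  have hcomm : ∀ i, wedge (ContinuousLinearMap.mul ℝ ℝ) (wedgePow s i) ω₀ =
      castDegree (Nat.add_comm 2 (2 * i))
        (wedge (ContinuousLinearMap.mul ℝ ℝ) ω₀ (wedgePow s i)) := fun i =>
    wedge_comm_two (fun v w => by simp [mul_comm]) _ _
  have hstep : ∀ i (D : E [⋀^Fin (2 * i)]→L[ℝ] ℝ),
      HasDerivAt (fun t : ℝ => wedgePow (s + t • ω₀) i) D 0 →
      HasDerivAt (fun t : ℝ => wedgePow (s + t • ω₀) (i + 1))
        (wedge (ContinuousLinearMap.mul ℝ ℝ) D s +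
          wedge (ContinuousLinearMap.mul ℝ ℝ) (wedgePow s i) ω₀) 0 := by
    intro i D hD
    have h := (wedgeCLM E (2 * i) 2 (ContinuousLinearMap.mul ℝ ℝ)).hasFDerivAt_of_bilinear
      hD.hasFDerivAt hlin.hasFDerivAt
    have h' := h.hasDerivAt
    refine h'.congr_deriv ?_
    simp [add_comm]
  induction j with
  | zero =>
    have h0 : HasDerivAt (fun t : ℝ => wedgePow (s + t • ω₀) 0) 0 0 := hasDerivAt_const _ _
    refine (hstep 0 0 h0).congr_deriv ?_
    have hz : wedge (ContinuousLinearMap.mul ℝ ℝ) (0 : E [⋀^Fin (2 * 0)]→L[ℝ] ℝ) s = 0 := by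
      rw [← wedgeCLM_apply, map_zero]; rfl
    rw [hz, hcomm]
    simp
  | succ j ih =>
    refine (hstep (j + 1) _ ih).congr_deriv ?_
    have hassoc := wedge_assoc (b₁ := ContinuousLinearMap.mul ℝ ℝ)
      (b₂ := ContinuousLinearMap.mul ℝ ℝ) (b₃ := ContinuousLinearMap.mul ℝ ℝ)
      (b₄ := ContinuousLinearMap.mul ℝ ℝ) (fun u v w => by simp [mul_assoc]) ω₀ (wedgePow s j) s
    rw [wedge_smul_left, wedge_castDegree_left, hcomm]
    have hs : wedge (ContinuousLinearMap.mul ℝ ℝ) ω₀ (wedgePow s (j + 1)) =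
      castDegree (Nat.add_assoc 2 (2 * j) 2) (wedge (ContinuousLinearMap.mul ℝ ℝ)
        (wedge (ContinuousLinearMap.mul ℝ ℝ) ω₀ (wedgePow s j)) s) := hassoc.symm
    rw [hs, castDegree_trans, Nat.cast_succ, add_smul (j + 1 : ℝ), one_smul]

/-- The one-form given by a covector. -/
def covectorForm (a : E →L[ℝ] ℝ) : E [⋀^Fin 1]→L[ℝ] ℝ :=
  ContinuousAlternatingMap.ofSubsingleton ℝ E ℝ (0 : Fin 1) a

theorem covectorForm_apply (a : E →L[ℝ] ℝ) (X : Fin 1 → E) : covectorForm a X = a (X 0) := rfl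

/-- The contraction of a two-form with a vector. -/
def contractTwo (s : E [⋀^Fin 2]→L[ℝ] ℝ) (X : E) : E →L[ℝ] ℝ :=
  s.toContinuousLinearMap ![X, 0] 1

theorem contractTwo_apply (s : E [⋀^Fin 2]→L[ℝ] ℝ) (X Y : E) :
    contractTwo s X Y = s ![X, Y] := by
  change s (Function.update ![X, 0] 1 Y) = _
  congr 1
  funext i
  fin_cases i <;> simp

/-- The map `v ↦ v + t a(v) X`. -/
def shear (a : E →L[ℝ] ℝ) (X : E) (t : ℝ) : E →L[ℝ] E :=
  ContinuousLinearMap.id ℝ E + t • a.smulRight X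

theorem shear_apply (a : E →L[ℝ] ℝ) (X : E) (t : ℝ) (v : E) :
    shear a X t v = v + (t * a v) • X := by
  simp [shear, mul_smul]

theorem twoForm_swap (s : E [⋀^Fin 2]→L[ℝ] ℝ) (X Y : E) : s ![X, Y] = -s ![Y, X] := by
  have h := s.toAlternatingMap.map_swap ![Y, X] (i := 0) (j := 1) (by decide)
  have h1 : (![Y, X] ∘ Equiv.swap (0 : Fin 2) 1) = ![X, Y] := by
    funext i
    fin_cases i <;> simp
  rw [h1] at h
  exact h

/-- The term of order t² carries the factor s(X, X) = 0, so the pull-back is affine in t. The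
deformation s + t a ∧ i_X s is thereby realised by linear maps, under which powers are natural. -/
theorem compContinuousLinearMap_shear (s : E [⋀^Fin 2]→L[ℝ] ℝ) (a : E →L[ℝ] ℝ) (X : E) (t : ℝ) :
    s.compContinuousLinearMap (shear a X t) =
      s + t • wedge (ContinuousLinearMap.mul ℝ ℝ) (covectorForm a)
        (covectorForm (contractTwo s X)) := by
  ext Y
  have h2 : ∀ u v : E, s ![u, v] = contractTwo s u v := fun u v => (contractTwo_apply s u v).symm
  have hadd : ∀ u u' v : E, contractTwo s (u + u') v = contractTwo s u v + contractTwo s u' v := by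
    intro u u' v
    simp only [contractTwo_apply]
    rw [twoForm_swap s (u + u'), twoForm_swap s u, twoForm_swap s u']
    simp only [h2, map_add]
    ring
  have hsmul : ∀ (c : ℝ) (u v : E), contractTwo s (c • u) v = c * contractTwo s u v := by
    intro c u v
    simp only [contractTwo_apply]
    rw [twoForm_swap s (c • u), twoForm_swap s u]
    simp only [h2, map_smul, smul_eq_mul]
    ring
  have hself : contractTwo s X X = 0 := by
    have := twoForm_swap s X X
    rw [contractTwo_apply]
    linarith
  have hY : ∀ Y : Fin 2 → E, s Y = contractTwo s (Y 0) (Y 1) := fun Y => by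
    rw [contractTwo_apply]
    congr 1
    funext i
    fin_cases i <;> rfl
  rw [ContinuousAlternatingMap.compContinuousLinearMap_apply, ContinuousAlternatingMap.add_apply,
    ContinuousAlternatingMap.smul_apply, wedge_one_one_apply, hY, hY]
  have hswap : contractTwo s (Y 0) X = -contractTwo s X (Y 0) := by
    rw [contractTwo_apply, contractTwo_apply, twoForm_swap]
  simp only [Function.comp_apply, shear_apply, covectorForm_apply, hadd, hsmul, map_add, map_smul,
    smul_eq_mul, hself, ContinuousLinearMap.mul_apply', hswap]
  ring

variable [FiniteDimensional ℝ E]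

theorem topForm_comp {N : ℕ} (hN : Module.finrank ℝ E = N) (μ : E [⋀^Fin N]→L[ℝ] ℝ)
    (A : E →L[ℝ] E) : μ.compContinuousLinearMap A = LinearMap.det (A : E →ₗ[ℝ] E) • μ := by
  let e : Module.Basis (Fin N) ℝ E := (Module.finBasis ℝ E).reindex (finCongr hN)
  have h := AlternatingMap.eq_smul_basis_det e μ.toAlternatingMap
  have h' : ∀ Y, μ Y = μ e * e.det Y := fun Y => by
    have := DFunLike.congr_fun h Y
    simpa using this
  ext Y
  rw [ContinuousAlternatingMap.compContinuousLinearMap_apply, h',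
    ContinuousAlternatingMap.smul_apply, h' Y]
  have := e.det_comp (A : E →ₗ[ℝ] E) Y
  have h3 : e.det (⇑A ∘ Y) = LinearMap.det (A : E →ₗ[ℝ] E) * e.det Y := this
  rw [h3, smul_eq_mul]
  ring

theorem det_shear (a : E →L[ℝ] ℝ) (X : E) (t : ℝ) :
    LinearMap.det (shear a X t : E →ₗ[ℝ] E) = 1 + t * a X := by
  have h : (shear a X t : E →ₗ[ℝ] E) = LinearMap.transvection (a : E →ₗ[ℝ] ℝ) (t • X) := by
    ext v
    simp [shear_apply, LinearMap.transvection.apply, mul_smul, smul_comm t]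
  rw [h, LinearMap.transvection.det]
  simp

/-- `n a ∧ (i_X σ) ∧ σ^(n-1) = a(X) σ^n` in dimension `2n`. -/
theorem wedge_contractTwo_wedgePow {j : ℕ} (hN : Module.finrank ℝ E = 2 * (j + 1))
    (s : E [⋀^Fin 2]→L[ℝ] ℝ) (a : E →L[ℝ] ℝ) (X : E) :
    (j + 1 : ℝ) • castDegree (show 2 + 2 * j = 2 * (j + 1) by omega)
      (wedge (ContinuousLinearMap.mul ℝ ℝ) (wedge (ContinuousLinearMap.mul ℝ ℝ) (covectorForm a)
        (covectorForm (contractTwo s X))) (wedgePow s j)) = a X • wedgePow s (j + 1) := by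
  -- The derivative at t = 0 of the pull-back of s^(j+1) under the shear is computed twice: by the
  -- product rule, and from the determinant 1 + t a(X).
  have h1 := hasDerivAt_wedgePow s (wedge (ContinuousLinearMap.mul ℝ ℝ) (covectorForm a)
        (covectorForm (contractTwo s X))) j
  have h2 : (fun t : ℝ => wedgePow (s + t • wedge (ContinuousLinearMap.mul ℝ ℝ) (covectorForm a)
        (covectorForm (contractTwo s X))) (j + 1)) = fun t => (1 + t * a X) • wedgePow s (j + 1) := by
    funext t
    rw [← compContinuousLinearMap_shear, ← wedgePow_compContinuousLinearMap, topForm_comp hN,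
      det_shear]
  rw [h2] at h1
  have h3 : HasDerivAt (fun t : ℝ => (1 + t * a X) • wedgePow s (j + 1))
      (a X • wedgePow s (j + 1)) 0 := by
    have : HasDerivAt (fun t : ℝ => 1 + t * a X) (a X) 0 := by
      simpa using ((hasDerivAt_id (0 : ℝ)).mul_const (a X)).const_add 1
    exact HasDerivAt.smul_const (F := E [⋀^Fin (2 * (j + 1))]→L[ℝ] ℝ) this _
  exact h1.unique h3

theorem exists_contractTwo_eq {s : E [⋀^Fin 2]→L[ℝ] ℝ} (hs : ∀ X, (∀ Y, s ![X, Y] = 0) → X = 0)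
    (b : E →L[ℝ] ℝ) : ∃ X, contractTwo s X = b := by
  -- The sign makes T X equal to Y ↦ s(Y, X), so that linearity in X is linearity in the last
  -- argument. Non-degeneracy gives injectivity, and equality of dimensions surjectivity.
  let T : E →ₗ[ℝ] Module.Dual ℝ E :=
    { toFun := fun X => (-contractTwo s X : E →L[ℝ] ℝ).toLinearMap
      map_add' := fun X X' => by
        ext Y
        simp only [ContinuousLinearMap.coe_coe, neg_apply, contractTwo_apply, ← twoForm_swap s Y,
          LinearMap.add_apply]
        simp only [← contractTwo_apply, map_add]
      map_smul' := fun c X => by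
        ext Y
        simp only [ContinuousLinearMap.coe_coe, neg_apply, contractTwo_apply, ← twoForm_swap s Y,
          LinearMap.smul_apply, RingHom.id_apply]
        simp only [← contractTwo_apply, map_smul] }
  have hT : Function.Injective T := by
    rw [← LinearMap.ker_eq_bot, LinearMap.ker_eq_bot']
    intro X hX
    refine hs X fun Y => ?_
    have : (-contractTwo s X) Y = 0 := DFunLike.congr_fun hX Y
    rw [neg_apply, neg_eq_zero, contractTwo_apply] at this
    exact this
  have hsurj : Function.Surjective T :=
    (LinearMap.injective_iff_surjective_of_finrank_eq_finrank
      (Subspace.dual_finrank_eq (K := ℝ) (V := E)).symm).1 hT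
  obtain ⟨X, hX⟩ := hsurj (-b : E →L[ℝ] ℝ).toLinearMap
  refine ⟨X, ?_⟩
  ext Y
  have : (-contractTwo s X) Y = (-b) Y := DFunLike.congr_fun hX Y
  simpa using this

/-- The product of covectors, as a function of vectors. -/
def covectorProd {m : ℕ} (c : Fin m → E →L[ℝ] ℝ) (Z : Fin m → E) : ℝ := ∏ i, c i (Z i)

/-- The step that trades a power of s for two covectors a, b. Non-degeneracy gives b = i_x s, so a ∧
b is the direction in which shears deform s. The assumed vanishing concerns arbitrary covectors and
thus survives pull-back under invertible shears; its derivative in t is the vanishing with a ∧ b ∧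
s^j in place of s^(j+1). -/
theorem altSum_covectorProd_wedgePow_of_succ {N j : ℕ}
    {s : E [⋀^Fin 2]→L[ℝ] ℝ} (hs : ∀ X, (∀ Y, s ![X, Y] = 0) → X = 0)
    (ih : ∀ m, m + 2 * (j + 1) = N → ∀ (c : Fin m → E →L[ℝ] ℝ) (X : Fin (m + 2 * (j + 1)) → E),
      altSum (altPair (ContinuousLinearMap.mul ℝ ℝ) (covectorProd c) (wedgePow s (j + 1))) X = 0)
    (m : ℕ) (hm : m + 2 + 2 * j = N) (c : Fin (m + 2) → E →L[ℝ] ℝ)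
    (X : Fin (m + 2 + 2 * j) → E) :
    altSum (altPair (ContinuousLinearMap.mul ℝ ℝ) (covectorProd c) (wedgePow s j)) X = 0 := by
  set c' : Fin m → E →L[ℝ] ℝ := fun i => c (Fin.castAdd 2 i) with hc'
  set a := c (Fin.natAdd m 0) with ha
  set b := c (Fin.natAdd m 1) with hb
  obtain ⟨x, hx⟩ := exists_contractTwo_eq hs b
  set ω₀ := wedge (ContinuousLinearMap.mul ℝ ℝ) (covectorForm a) (covectorForm b) with hω₀
  have hm' : m + 2 * (j + 1) = N := by omega
  have hcast : m + (2 + 2 * j) = m + 2 + 2 * j := by omega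
  have hcast' : 2 + 2 * j = 2 * (j + 1) := by omega
  -- vanishing along the deformation of `s`
  have h1 : ∀ Y, ∀ᶠ t in 𝓝 (0 : ℝ), altSum (altPair (ContinuousLinearMap.mul ℝ ℝ)
      (covectorProd c') (wedgePow (s + t • ω₀) (j + 1))) Y = 0 := by
    intro Y
    have hcont : ContinuousAt (fun t : ℝ => 1 + t * a x) 0 := by fun_prop
    have hne : ∀ᶠ t in 𝓝 (0 : ℝ), 1 + t * a x ≠ 0 :=
      hcont.eventually_ne (by simp)
    filter_upwards [hne] with t ht
    -- The shear with parameter -t / (1 + t a(x)) is the inverse of the one with parameter t;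
    -- composing the covectors with it compensates for moving the arguments.
    have h2 := ih m hm' (fun i => (c' i).comp (shear a x (-(t / (1 + t * a x)))))
      (fun i => shear a x t (Y i))
    rw [← h2]
    simp only [altSum]
    refine Finset.sum_congr rfl fun r _ => ?_
    congr 1
    simp only [altPair, hω₀, ← hx, ← compContinuousLinearMap_shear]
    rw [← wedgePow_compContinuousLinearMap]
    congr 2
    simp only [covectorProd]
    refine Finset.prod_congr rfl fun i _ => ?_
    simp only [Function.comp_apply, ContinuousLinearMap.comp_apply]
    congr 1
    simp only [shear_apply, map_add, map_smul]
    match_scalars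
    · ring
    · field_simp
      ring
  -- differentiate
  have h2 : ∀ Y, altSum (altPair (ContinuousLinearMap.mul ℝ ℝ) (covectorProd c')
      (castDegree hcast' (wedge (ContinuousLinearMap.mul ℝ ℝ) ω₀ (wedgePow s j)))) Y = 0 := by
    intro Y
    set D := castDegree hcast' (wedge (ContinuousLinearMap.mul ℝ ℝ) ω₀ (wedgePow s j)) with hD
    have hd : HasDerivAt (fun t : ℝ => altSum (altPair (ContinuousLinearMap.mul ℝ ℝ)
        (covectorProd c') (wedgePow (s + t • ω₀) (j + 1))) Y)
        (altSum (altPair (ContinuousLinearMap.mul ℝ ℝ) (covectorProd c')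
          ((j + 1 : ℝ) • D)) Y) 0 := by
      simp only [altSum]
      refine HasDerivAt.fun_sum fun r _ => ?_
      refine HasDerivAt.const_smul (Equiv.Perm.sign r) ?_
      simp only [altPair, ContinuousLinearMap.mul_apply']
      refine HasDerivAt.const_mul _ ?_
      have := hasDerivAt_wedgePow s ω₀ j
      have hev := (ContinuousAlternatingMap.apply ℝ E ℝ
        ((Y ∘ r) ∘ Fin.natAdd m)).hasFDerivAt.comp_hasDerivAt 0 this
      exact hev
    have h0 := hd.unique ((hasDerivAt_const (0 : ℝ) (0 : ℝ)).congr_of_eventuallyEq (h1 Y))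
    have h3 : altSum (altPair (ContinuousLinearMap.mul ℝ ℝ) (covectorProd c')
          ((j + 1 : ℝ) • D)) Y = (j + 1 : ℝ) • altSum (altPair (ContinuousLinearMap.mul ℝ ℝ)
          (covectorProd c') D) Y := by
      rw [← altSum_smul]
      exact altSum_congr (fun Z => by simp [altPair]; ring) Y
    rw [h3, smul_eq_zero] at h0
    exact h0.resolve_left (by positivity)
  -- expand the wedge products
  have h3 : ∀ Y, altSum (altPair (ContinuousLinearMap.mul ℝ ℝ) (covectorProd c')
      (wedge (ContinuousLinearMap.mul ℝ ℝ) ω₀ (wedgePow s j))) Y = 0 := by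
    intro Y
    have h4 := h2 (Y ∘ Fin.cast (show m + 2 * (j + 1) = m + (2 + 2 * j) by omega))
    rw [← altSum_cast] at h4
    rw [← h4]
    refine altSum_congr (fun Z => ?_) Y
    simp only [altPair, castDegree_apply]
    rfl
  have h4 : (⇑(wedge (ContinuousLinearMap.mul ℝ ℝ) ω₀ (wedgePow s j)) :
      (Fin (2 + 2 * j) → E) → ℝ) = fun Y =>
      ((Nat.factorial 2 * (2 * j).factorial : ℝ)⁻¹) •
        altSum (altPair (ContinuousLinearMap.mul ℝ ℝ) ω₀ (wedgePow s j)) Y :=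
    funext fun Y => wedge_apply _ _ _ Y
  have h5 : (⇑ω₀ : (Fin (1 + 1) → E) → ℝ) =
      altSum (altPair (ContinuousLinearMap.mul ℝ ℝ) (covectorForm a) (covectorForm b)) := by
    funext Y
    rw [hω₀, wedge_apply]
    simp
  have h6 : ∀ Y, altSum (altPair (ContinuousLinearMap.mul ℝ ℝ) (covectorProd c')
      (altPair (ContinuousLinearMap.mul ℝ ℝ) (altPair (ContinuousLinearMap.mul ℝ ℝ)
        (covectorForm a) (covectorForm b)) (wedgePow s j))) Y = 0 := by
    intro Y
    have h7 := h3 Y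
    rw [h4, altPair_smul_right, altSum_smul, altSum_altPair_right, h5] at h7
    have h8 : (altPair (ContinuousLinearMap.mul ℝ ℝ)
        (altSum (altPair (ContinuousLinearMap.mul ℝ ℝ) (covectorForm a) (covectorForm b)))
        (wedgePow s j) : (Fin (2 + 2 * j) → E) → ℝ) =
        altPair (ContinuousLinearMap.mul ℝ ℝ)
        (altSum (altPair (ContinuousLinearMap.mul ℝ ℝ) (covectorForm a) (covectorForm b)))
        (wedgePow s j) := rfl
    have h9 := altSum_altPair_right (ContinuousLinearMap.mul ℝ ℝ) (covectorProd c')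
      (altPair (ContinuousLinearMap.mul ℝ ℝ)
        (altSum (altPair (ContinuousLinearMap.mul ℝ ℝ) (covectorForm a) (covectorForm b)))
        (wedgePow s j)) Y
    have h10 : altSum (altPair (ContinuousLinearMap.mul ℝ ℝ)
        (altSum (altPair (ContinuousLinearMap.mul ℝ ℝ) (covectorForm a) (covectorForm b)))
        (wedgePow s j)) = fun Z => ((1 + 1).factorial : ℝ) • altSum (altPair
          (ContinuousLinearMap.mul ℝ ℝ) (altPair (ContinuousLinearMap.mul ℝ ℝ) (covectorForm a)
          (covectorForm b)) (wedgePow s j)) Z :=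
      funext fun Z => altSum_altPair_left _ _ _ Z
    rw [h10, altPair_smul_right, altSum_smul, altSum_altPair_right] at h9
    rw [← h9] at h7
    simp only [smul_eq_mul, mul_eq_zero, inv_eq_zero, Nat.cast_eq_zero,
      Nat.factorial_ne_zero, or_self, false_or] at h7
    exact h7
  rw [← h6 (X ∘ Fin.cast hcast), ← altSum_cast]
  refine altSum_congr (fun Z => ?_) X
  simp only [altPair, covectorProd, Fin.prod_univ_add, Fin.prod_univ_two,
    ContinuousLinearMap.mul_apply', mul_assoc, covectorForm_apply]
  congr 3
  congr 1
  funext i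
  simp only [Function.comp_apply]
  congr 1
  ext
  simp [add_assoc]

/-- The top power of a non-degenerate two-form does not vanish. -/
theorem wedgePow_ne_zero {n : ℕ} (hN : Module.finrank ℝ E = 2 * n)
    {s : E [⋀^Fin 2]→L[ℝ] ℝ} (hs : ∀ X, (∀ Y, s ![X, Y] = 0) → X = 0) : wedgePow s n ≠ 0 := by
  intro h0
  -- If s^n = 0, lowering the power i times shows that products of 2i covectors with s^(n-i)
  -- antisymmetrise to zero.
  have key : ∀ i ≤ n, ∀ m, m + 2 * (n - i) = 2 * n → ∀ (c : Fin m → E →L[ℝ] ℝ)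
      (X : Fin (m + 2 * (n - i)) → E), altSum (altPair (ContinuousLinearMap.mul ℝ ℝ)
        (covectorProd c) (wedgePow s (n - i))) X = 0 := by
    intro i
    induction i with
    | zero =>
      intro _ m _ c X
      have : ∀ Y, altPair (ContinuousLinearMap.mul ℝ ℝ) (covectorProd c) (wedgePow s (n - 0)) Y =
          0 := fun Y => by
        have h1 : ⇑(wedgePow s (n - 0)) = 0 := congrArg DFunLike.coe h0
        simp only [altPair, h1, Pi.zero_apply, map_zero]
      rw [altSum_congr (Ψ := fun _ => 0) this]
      simp [altSum]
    | succ i ih =>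
      intro hi m hm c X
      obtain ⟨j, hj⟩ : ∃ j, n - i = j + 1 := ⟨n - i - 1, by omega⟩
      have hj' : n - (i + 1) = j := by omega
      have ih' := ih (by omega)
      rw [hj] at ih'
      revert c X
      rw [hj'] at hm ⊢
      obtain ⟨m', rfl⟩ : ∃ m', m = m' + 2 := ⟨m - 2, by omega⟩
      exact altSum_covectorProd_wedgePow_of_succ hs ih' m' hm
  have h1 := key n le_rfl
  rw [Nat.sub_self] at h1
  let e : Module.Basis (Fin (2 * n)) ℝ E := (Module.finBasis ℝ E).reindex (finCongr hN)
  -- At i = n no power of s is left. The dual basis evaluated on its basis gives the determinant of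
  -- the identity matrix, which is not zero.
  have h2 := h1 (2 * n) rfl (fun i => LinearMap.toContinuousLinearMap (e.coord i)) e
  have h3 : ∀ Y : Fin (2 * n + 2 * 0) → E, altPair (ContinuousLinearMap.mul ℝ ℝ)
      (covectorProd fun i => LinearMap.toContinuousLinearMap (e.coord i)) (wedgePow s 0) Y =
      ∏ i, e.repr (Y i) i := fun Y => by
    simp only [altPair, covectorProd, ContinuousLinearMap.mul_apply']
    change (∏ i, e.repr (Y i) i) * 1 = _
    rw [mul_one]
  rw [altSum_congr h3] at h2
  have h4 : altSum (fun Y : Fin (2 * n) → E => ∏ i, e.repr (Y i) i) e =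
      (1 : Matrix (Fin (2 * n)) (Fin (2 * n)) ℝ).det := by
    rw [Matrix.det_apply, altSum]
    refine Finset.sum_congr rfl fun r _ => ?_
    congr 1
    refine Finset.prod_congr rfl fun i _ => ?_
    simp only [Function.comp_apply, Module.Basis.repr_self, Finsupp.single_apply, Matrix.one_apply]
  rw [Matrix.det_one] at h4
  exact one_ne_zero (h4.symm.trans h2)

/-- Wedging with covectors and `σ^(n-1)` separates covectors. -/
theorem eq_zero_of_wedge_wedgePow_eq_zero {j : ℕ} (hN : Module.finrank ℝ E = 2 * (j + 1))
    {s : E [⋀^Fin 2]→L[ℝ] ℝ} (hs : ∀ X, (∀ Y, s ![X, Y] = 0) → X = 0) (a : E →L[ℝ] ℝ)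
    (ha : ∀ b : E →L[ℝ] ℝ, wedge (ContinuousLinearMap.mul ℝ ℝ)
      (wedge (ContinuousLinearMap.mul ℝ ℝ) (covectorForm a) (covectorForm b)) (wedgePow s j) = 0) :
    a = 0 := by
  ext X
  -- The choice b = i_X s turns the hypothesis into a(X) s^(j+1) = 0.
  have h := wedge_contractTwo_wedgePow hN s a X
  rw [ha, ← castDegreeCLM_apply, map_zero, smul_zero] at h
  exact (smul_eq_zero.1 h.symm).resolve_right (wedgePow_ne_zero hN hs)

end Symplectic

/-! ### The adjoint representation and the Lie bracket -/

section ChartCalculus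

variable {E : Type*} [NormedAddCommGroup E] [NormedSpace ℝ E]
  {N : Type*} [TopologicalSpace N] [ChartedSpace E N]
  {E' : Type*} [NormedAddCommGroup E'] [NormedSpace ℝ E']
  {N' : Type*} [TopologicalSpace N'] [ChartedSpace E' N']

theorem tangent_eq_fderiv_chart {f : N → N'} {x : N} {q : N'}
    (hf : MDifferentiableAt 𝓘(ℝ, E) 𝓘(ℝ, E') f x) (hq : f x = q) :
    tangent (E := E) (E' := E') f x = fderiv ℝ (fun y => extChartAt 𝓘(ℝ, E') q
      (f ((extChartAt 𝓘(ℝ, E) x).symm y))) (extChartAt 𝓘(ℝ, E) x x) := by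
  subst hq
  rw [tangent, hf.mfderiv, modelWithCornersSelf_coe, Set.range_id, fderivWithin_univ]
  rfl

/-- The tangent space at x is identified with the model space by this very chart. -/
theorem tangent_chart_self [IsManifold 𝓘(ℝ, E) ∞ N] (x : N) :
    tangent (E := E) (E' := E) (extChartAt 𝓘(ℝ, E) x) x = ContinuousLinearMap.id ℝ E := by
  have hid := tangent_eq_fderiv_chart (E := E) (E' := E) (f := extChartAt 𝓘(ℝ, E) x) (x := x)
    (mdifferentiableAt_chart (mem_extChartAt_source x)) rfl
  have h2 : (fun y => extChartAt 𝓘(ℝ, E) (extChartAt 𝓘(ℝ, E) x x) (extChartAt 𝓘(ℝ, E) x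
      ((extChartAt 𝓘(ℝ, E) x).symm y))) =ᶠ[𝓝 (extChartAt 𝓘(ℝ, E) x x)] id := by
    filter_upwards [(isOpen_extChartAt_target x).mem_nhds (mem_extChartAt_target x)] with y hy
    exact (extChartAt 𝓘(ℝ, E) x).right_inv hy
  rw [hid, h2.fderiv_eq, fderiv_id]

theorem tangent_chart_symm_self [IsManifold 𝓘(ℝ, E) ∞ N] (x : N) :
    tangent (E := E) (E' := E) (extChartAt 𝓘(ℝ, E) x).symm (extChartAt 𝓘(ℝ, E) x x) =
      ContinuousLinearMap.id ℝ E := by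
  have h := tangent_chart_symm_comp (E := E) (mem_extChartAt_source (I := 𝓘(ℝ, E)) x)
  rwa [tangent_chart_self, ContinuousLinearMap.comp_id] at h

theorem contDiffAt_chart_comp [IsManifold 𝓘(ℝ, E') ∞ N'] {φ : E → N'} {x : E} {q : N'}
    (hφ : ContMDiffAt 𝓘(ℝ, E) 𝓘(ℝ, E') ∞ φ x) (hq : φ x ∈ (extChartAt 𝓘(ℝ, E') q).source) :
    ContDiffAt ℝ ∞ (fun y => extChartAt 𝓘(ℝ, E') q (φ y)) x :=
  contMDiffAt_iff_contDiffAt.1 (((contMDiffOn_chart q).contMDiffAt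
    ((isOpen_extChartAt_source q).mem_nhds hq)).comp x hφ)

theorem contMDiffAt_chart_symm_comp [IsManifold 𝓘(ℝ, E') ∞ N'] {f : E → E'} {x : E} {q : N'}
    (hf : ContDiffAt ℝ ∞ f x) (hq : f x ∈ (extChartAt 𝓘(ℝ, E') q).target) :
    ContMDiffAt 𝓘(ℝ, E) 𝓘(ℝ, E') ∞ (fun y => (extChartAt 𝓘(ℝ, E') q).symm (f y)) x :=
  ((contMDiffOn_chart_symm q).contMDiffAt ((isOpen_extChartAt_target q).mem_nhds hq)).comp x
    hf.contMDiffAt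

end ChartCalculus

/-! ### Ad, its smoothness and its derivative, computed in the chart at the identity. -/

section Adjoint

variable {EG : Type*} [NormedAddCommGroup EG] [NormedSpace ℝ EG] [FiniteDimensional ℝ EG]
  {G : Type*} [TopologicalSpace G] [ChartedSpace EG G] [Group G] [LieGroup 𝓘(ℝ, EG) ∞ G]

theorem contMDiff_conj (g : G) :
    ContMDiff 𝓘(ℝ, EG) 𝓘(ℝ, EG) ∞ fun h : G => g * h * g⁻¹ :=
  (contMDiff_const.mul contMDiff_id).mul contMDiff_const

theorem Ad_mul (g h : G) : Ad EG (g * h) = (Ad EG g).comp (Ad EG h) := by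
  have h1 : (fun k : G => g * h * k * (g * h)⁻¹) =
      (fun k => g * k * g⁻¹) ∘ fun k => h * k * h⁻¹ := by
    funext k
    simp [mul_assoc]
  have h2 : tangent (E := EG) (E' := EG) (fun k : G => g * k * g⁻¹) (h * 1 * h⁻¹) = Ad EG g := by
    rw [mul_one, mul_inv_cancel]; rfl
  rw [Ad, h1, tangent_comp ((contMDiff_conj g).mdifferentiable (by simp) _)
    ((contMDiff_conj h).mdifferentiable (by simp) _), h2]
  rfl

theorem Ad_one : Ad EG (1 : G) = ContinuousLinearMap.id ℝ EG := by
  have h1 : (fun k : G => 1 * k * 1⁻¹) = id := by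
    funext k
    simp
  rw [Ad, h1, tangent_id]

theorem Ad_inv_comp (g : G) : (Ad EG g⁻¹).comp (Ad EG g) = ContinuousLinearMap.id ℝ EG := by
  rw [← Ad_mul, inv_mul_cancel, Ad_one]

theorem Ad_inv_apply_Ad (g : G) (A : EG) : Ad EG g⁻¹ (Ad EG g A) = A :=
  DFunLike.congr_fun (Ad_inv_comp g) A

variable (EG G) in
/-- The chart at the identity. -/
def oneChart : PartialEquiv G EG := extChartAt 𝓘(ℝ, EG) (1 : G)

theorem one_mem_oneChart_source : (1 : G) ∈ (oneChart EG G).source :=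
  mem_extChartAt_source (I := 𝓘(ℝ, EG)) (1 : G)

theorem oneChart_one_mem : oneChart EG G 1 ∈ (oneChart EG G).target :=
  mem_extChartAt_target (I := 𝓘(ℝ, EG)) (1 : G)

@[simp] theorem oneChart_symm_one : (oneChart EG G).symm (oneChart EG G 1) = 1 :=
  (oneChart EG G).left_inv one_mem_oneChart_source

variable {F : Type*} [NormedAddCommGroup F] [NormedSpace ℝ F]

theorem contMDiffAt_oneChart_symm {f : F → EG} {x : F} (hf : ContDiffAt ℝ ∞ f x)
    (hq : f x ∈ (oneChart EG G).target) :
    ContMDiffAt 𝓘(ℝ, F) 𝓘(ℝ, EG) ∞ (fun y => (oneChart EG G).symm (f y)) x :=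
  contMDiffAt_chart_symm_comp hf hq

theorem contDiffAt_oneChart {φ : F → G} {x : F} (hφ : ContMDiffAt 𝓘(ℝ, F) 𝓘(ℝ, EG) ∞ φ x)
    (hx : φ x = 1) : ContDiffAt ℝ ∞ (fun y => oneChart EG G (φ y)) x :=
  contDiffAt_chart_comp hφ (by rw [hx]; exact one_mem_oneChart_source)

theorem Ad_eq_fderiv (g : G) : Ad EG g = fderiv ℝ (fun y => oneChart EG G
    (g * (oneChart EG G).symm y * g⁻¹)) (oneChart EG G 1) :=
  tangent_eq_fderiv_chart ((contMDiff_conj g).mdifferentiable (by simp) 1) (by simp)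

variable (EG G) in
/-- Multiplication in the chart at the identity. -/
def chartMul (u : EG × EG) : EG :=
  oneChart EG G ((oneChart EG G).symm u.1 * (oneChart EG G).symm u.2)

variable (EG G) in
/-- Conjugation in the chart at the identity. -/
def chartConj (u : EG × EG) : EG :=
  oneChart EG G ((oneChart EG G).symm u.1 * (oneChart EG G).symm u.2 * ((oneChart EG G).symm u.1)⁻¹)

theorem contDiffAt_chartMul :
    ContDiffAt ℝ ∞ (chartMul EG G) (oneChart EG G 1, oneChart EG G 1) := by
  have h1 : ContMDiffAt 𝓘(ℝ, EG × EG) 𝓘(ℝ, EG) ∞ (fun u : EG × EG => (oneChart EG G).symm u.1)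
      (oneChart EG G 1, oneChart EG G 1) := contMDiffAt_oneChart_symm contDiffAt_fst oneChart_one_mem
  have h2 : ContMDiffAt 𝓘(ℝ, EG × EG) 𝓘(ℝ, EG) ∞ (fun u : EG × EG => (oneChart EG G).symm u.2)
      (oneChart EG G 1, oneChart EG G 1) := contMDiffAt_oneChart_symm contDiffAt_snd oneChart_one_mem
  exact contDiffAt_oneChart (h1.mul h2) (by simp)

theorem contDiffAt_chartConj :
    ContDiffAt ℝ ∞ (chartConj EG G) (oneChart EG G 1, oneChart EG G 1) := by
  have h1 : ContMDiffAt 𝓘(ℝ, EG × EG) 𝓘(ℝ, EG) ∞ (fun u : EG × EG => (oneChart EG G).symm u.1)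
      (oneChart EG G 1, oneChart EG G 1) := contMDiffAt_oneChart_symm contDiffAt_fst oneChart_one_mem
  have h2 : ContMDiffAt 𝓘(ℝ, EG × EG) 𝓘(ℝ, EG) ∞ (fun u : EG × EG => (oneChart EG G).symm u.2)
      (oneChart EG G 1, oneChart EG G 1) := contMDiffAt_oneChart_symm contDiffAt_snd oneChart_one_mem
  exact contDiffAt_oneChart ((h1.mul h2).mul h1.inv) (by simp)

theorem _root_.ContDiffAt.eventually_differentiableAt {f : F → EG} {x : F}
    (hf : ContDiffAt ℝ ∞ f x) : ∀ᶠ y in 𝓝 x, DifferentiableAt ℝ f y := by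
  have h := (hf.of_le (show (1 : WithTop ℕ∞) ≤ ∞ by simp)).eventually (by simp)
  filter_upwards [h] with y hy using hy.differentiableAt (by simp)

/-- In the chart Ad is a partial derivative of the smooth map (u, y) ↦ u y u⁻¹, taken at y = 1; this
makes it smooth near the identity. -/
theorem eventually_Ad_eq : ∀ᶠ u in 𝓝 (oneChart EG G 1), Ad EG ((oneChart EG G).symm u) =
    (fderiv ℝ (chartConj EG G) (u, oneChart EG G 1)).comp (ContinuousLinearMap.inr ℝ EG EG) := by
  have hc : ContinuousAt (fun u : EG => (u, oneChart EG G 1)) (oneChart EG G 1) := by fun_prop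
  filter_upwards [hc.eventually (contDiffAt_chartConj (EG := EG) (G := G)).eventually_differentiableAt]
    with u hu
  rw [Ad_eq_fderiv]
  have h1 : HasFDerivAt (fun y : EG => (u, y)) (ContinuousLinearMap.inr ℝ EG EG) (oneChart EG G 1) :=
    hasFDerivAt_prodMk_right u _
  exact (hu.hasFDerivAt.comp (oneChart EG G 1) h1).fderiv

theorem contDiffAt_Ad_chart :
    ContDiffAt ℝ ∞ (fun u => Ad EG ((oneChart EG G).symm u)) (oneChart EG G 1) := by
  have h1 : ContDiffAt ℝ ∞ (fderiv ℝ (chartConj EG G)) (oneChart EG G 1, oneChart EG G 1) :=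
    contDiffAt_chartConj.fderiv_right (by simp)
  have h2 : ContDiffAt ℝ ∞ (fun u => (fderiv ℝ (chartConj EG G) (u, oneChart EG G 1)).comp
      (ContinuousLinearMap.inr ℝ EG EG)) (oneChart EG G 1) :=
    (h1.comp (f := fun u => (u, oneChart EG G 1)) (oneChart EG G 1)
      (contDiffAt_id.prodMk contDiffAt_const)).clm_comp contDiffAt_const
  exact h2.congr_of_eventuallyEq eventually_Ad_eq

/-- Smoothness at 1 spreads to every g₀ because Ad g = Ad g₀ ∘ Ad(g₀⁻¹ g). -/
theorem contMDiff_Ad : ContMDiff 𝓘(ℝ, EG) 𝓘(ℝ, EG →L[ℝ] EG) ∞ (Ad EG : G → EG →L[ℝ] EG) := by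
  have h1 : ContMDiffAt 𝓘(ℝ, EG) 𝓘(ℝ, EG →L[ℝ] EG) ∞ (Ad EG : G → EG →L[ℝ] EG) 1 := by
    have h2 := contDiffAt_Ad_chart.contMDiffAt.comp (1 : G) ((contMDiffOn_chart (1 : G)).contMDiffAt
      ((isOpen_extChartAt_source (I := 𝓘(ℝ, EG)) (1 : G)).mem_nhds one_mem_oneChart_source))
    refine h2.congr_of_eventuallyEq ?_
    filter_upwards [(isOpen_extChartAt_source (I := 𝓘(ℝ, EG)) (1 : G)).mem_nhds
      one_mem_oneChart_source] with g hg
    simp only [Function.comp_apply]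
    rw [(oneChart EG G).left_inv hg]
  intro g₀
  have h3 : (Ad EG : G → EG →L[ℝ] EG) = fun g => (Ad EG g₀).comp (Ad EG (g₀⁻¹ * g)) := by
    funext g
    rw [← Ad_mul, mul_inv_cancel_left]
  have h4 : ContMDiffAt 𝓘(ℝ, EG) 𝓘(ℝ, EG) ∞ (fun g : G => g₀⁻¹ * g) g₀ :=
    (contMDiff_const.mul contMDiff_id).contMDiffAt
  have h5 : ContMDiffAt 𝓘(ℝ, EG) 𝓘(ℝ, EG →L[ℝ] EG) ∞ (fun g : G => Ad EG (g₀⁻¹ * g)) g₀ := by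
    refine ContMDiffAt.comp g₀ (g := (Ad EG : G → EG →L[ℝ] EG)) ?_ h4
    rw [inv_mul_cancel]
    exact h1
  rw [h3]
  exact (((ContinuousLinearMap.compL ℝ EG EG EG) (Ad EG g₀)).contDiff.contMDiff.contMDiffAt).comp
    g₀ h5

theorem fderiv_chartMul_inl (B : EG) :
    fderiv ℝ (chartMul EG G) (oneChart EG G 1, oneChart EG G 1) (B, 0) = B := by
  have hd := (contDiffAt_chartMul (EG := EG) (G := G)).differentiableAt (by simp)
  have h1 : HasFDerivAt (fun y : EG => (y, oneChart EG G 1)) (ContinuousLinearMap.inl ℝ EG EG)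
    (oneChart EG G 1) := hasFDerivAt_prodMk_left _ _
  have h2 := (hd.hasFDerivAt.comp (f := fun y => (y, oneChart EG G 1)) (oneChart EG G 1) h1).fderiv
  have h3 : chartMul EG G ∘ (fun y : EG => (y, oneChart EG G 1)) =ᶠ[𝓝 (oneChart EG G 1)] id := by
    filter_upwards [(isOpen_extChartAt_target (I := 𝓘(ℝ, EG)) (1 : G)).mem_nhds
      oneChart_one_mem] with y hy
    simp only [chartMul, Function.comp_apply, oneChart_symm_one, mul_one]
    exact (oneChart EG G).right_inv hy
  rw [h3.fderiv_eq, fderiv_id] at h2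
  exact (DFunLike.congr_fun h2 B).symm

/-- The second derivative of the multiplication in the chart at the identity. -/
def chartMulHess (u v : EG × EG) : EG :=
  fderiv ℝ (fderiv ℝ (chartMul EG G)) (oneChart EG G 1, oneChart EG G 1) u v

theorem hasFDerivAt_fderiv_chartMul : HasFDerivAt (fderiv ℝ (chartMul EG G))
    (fderiv ℝ (fderiv ℝ (chartMul EG G)) (oneChart EG G 1, oneChart EG G 1))
    (oneChart EG G 1, oneChart EG G 1) :=
  ((contDiffAt_chartMul.fderiv_right (m := ∞) (by simp)).differentiableAt (by simp)).hasFDerivAt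

theorem chartMulHess_symm (u v : EG × EG) :
    chartMulHess (G := G) u v = chartMulHess (G := G) v u :=
  ((contDiffAt_chartMul (EG := EG) (G := G)).isSymmSndFDerivAt
    (by simpa using ENat.LEInfty.out)).eq u v

/-- Let m be the multiplication in the chart. Differentiating u y = (u y u⁻¹) u in y at 1 gives
D₂m(u, 1) B = D₁m(1, u) (Ad_u B). A derivative in u at 1 in the direction A then expresses D Ad(A) B
by the mixed second derivatives of m, up to the symmetry of the Hessian. -/
theorem hasFDerivAt_Ad_chart_aux (A B : EG) :
    fderiv ℝ (fun u => Ad EG ((oneChart EG G).symm u)) (oneChart EG G 1) A B =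
      chartMulHess (G := G) (A, 0) (0, B) - chartMulHess (G := G) (B, 0) (0, A) := by
  set y₀ := oneChart EG G 1 with hy₀
  -- left and right translations of `B`
  have hev : (fun u => fderiv ℝ (chartMul EG G) (u, y₀) (0, B)) =ᶠ[𝓝 y₀]
      fun u => fderiv ℝ (chartMul EG G) (y₀, u) (Ad EG ((oneChart EG G).symm u) B, 0) := by
    have hc1 : ContinuousAt (fun u : EG => (u, y₀)) y₀ := by fun_prop
    have hc2 : ContinuousAt (fun u : EG => (y₀, u)) y₀ := by fun_prop
    have hK := hc1.eventually (contDiffAt_chartConj (EG := EG) (G := G)).eventually_differentiableAt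
    have hKc := hc1.eventually ((contDiffAt_chartConj (EG := EG) (G := G)).of_le
      (show (1 : WithTop ℕ∞) ≤ ∞ by simp) |>.eventually (by simp))
    have hm1 := hc1.eventually (contDiffAt_chartMul (EG := EG) (G := G)).eventually_differentiableAt
    have hm2 := hc2.eventually (contDiffAt_chartMul (EG := EG) (G := G)).eventually_differentiableAt
    filter_upwards [hK, hm1, hm2, eventually_Ad_eq (EG := EG) (G := G),
      (isOpen_extChartAt_target (I := 𝓘(ℝ, EG)) (1 : G)).mem_nhds oneChart_one_mem] with
      u hKu hmu hmu' hAd hu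
    have hKy : chartConj EG G (u, y₀) = y₀ := by simp [chartConj, hy₀]
    have e1 : HasFDerivAt (fun y : EG => (u, y)) (ContinuousLinearMap.inr ℝ EG EG) y₀ :=
      hasFDerivAt_prodMk_right u _
    have e2 := hmu.hasFDerivAt.comp y₀ e1
    have e3 := hKu.hasFDerivAt.comp y₀ e1
    have e4 := e3.prodMk (hasFDerivAt_const u y₀)
    have e5 : HasFDerivAt (chartMul EG G) (fderiv ℝ (chartMul EG G) (y₀, u))
        ((chartConj EG G ∘ fun y => (u, y)) y₀, u) := by
      simp only [Function.comp_apply, hKy]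
      exact hmu'.hasFDerivAt
    have e6 := e5.comp y₀ e4
    -- This is u y = (u y u⁻¹) u, valid as long as the conjugate stays in the chart.
    have e7 : (chartMul EG G ∘ fun y : EG => (u, y)) =ᶠ[𝓝 y₀]
        chartMul EG G ∘ fun y => ((chartConj EG G ∘ fun y => (u, y)) y, u) := by
      have hcont : ContinuousAt (fun y : EG => (oneChart EG G).symm u * (oneChart EG G).symm y *
          ((oneChart EG G).symm u)⁻¹) y₀ := by
        have := contMDiffAt_oneChart_symm (G := G) (contDiffAt_id (x := y₀) (𝕜 := ℝ) (n := ∞))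
          oneChart_one_mem
        exact (((contMDiff_conj ((oneChart EG G).symm u)).contMDiffAt).comp y₀ this).continuousAt
      have hs : ∀ᶠ y in 𝓝 y₀, (oneChart EG G).symm u * (oneChart EG G).symm y *
          ((oneChart EG G).symm u)⁻¹ ∈ (oneChart EG G).source := by
        refine hcont.eventually ((isOpen_extChartAt_source (I := 𝓘(ℝ, EG)) (1 : G)).mem_nhds ?_)
        simp only [hy₀, oneChart_symm_one, mul_one, mul_inv_cancel]
        exact one_mem_oneChart_source
      filter_upwards [hs] with y hy
      simp only [Function.comp_apply, chartMul, chartConj]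
      rw [(oneChart EG G).left_inv hy]
      simp
    have e8 := (e2.congr_of_eventuallyEq e7.symm).unique e6
    have e9 := DFunLike.congr_fun e8 B
    rw [hAd]
    simpa using e9
  -- differentiate both sides in direction `A`
  have hL : HasFDerivAt (fun u : EG => fderiv ℝ (chartMul EG G) (u, y₀) (0, B))
      (((fderiv ℝ (fderiv ℝ (chartMul EG G)) (y₀, y₀)).comp
        (ContinuousLinearMap.inl ℝ EG EG)).flip (0, B)) y₀ := by
    have := (hasFDerivAt_fderiv_chartMul (EG := EG) (G := G)).comp
      (f := fun u => (u, y₀)) y₀ (hasFDerivAt_prodMk_left (𝕜 := ℝ) y₀ y₀)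
    have h2 := this.clm_apply (hasFDerivAt_const ((0 : EG), B) y₀)
    refine h2.congr_fderiv ?_
    ext v
    simp [hy₀]
  have hAd' : HasFDerivAt (fun u => Ad EG ((oneChart EG G).symm u))
      (fderiv ℝ (fun u => Ad EG ((oneChart EG G).symm u)) y₀) y₀ :=
    (contDiffAt_Ad_chart.differentiableAt (by simp)).hasFDerivAt
  have hR := ((hasFDerivAt_fderiv_chartMul (EG := EG) (G := G)).comp y₀
      (hasFDerivAt_prodMk_right (𝕜 := ℝ) y₀ y₀)).clm_apply
      ((hAd'.clm_apply (hasFDerivAt_const B y₀)).prodMk (hasFDerivAt_const (0 : EG) y₀))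
  have h := (hR.congr_of_eventuallyEq hev).unique hL
  have h' := DFunLike.congr_fun h A
  have h1 : Ad EG ((oneChart EG G).symm y₀) B = B := by
    rw [hy₀, oneChart_symm_one, Ad_one]; rfl
  have h2 := fderiv_chartMul_inl (G := G)
    (fderiv ℝ (fun u => Ad EG ((oneChart EG G).symm u)) y₀ A B)
  simp only [Function.comp_apply, add_apply, ContinuousLinearMap.comp_apply,
    ContinuousLinearMap.flip_apply, ContinuousLinearMap.prod_apply, zero_apply,
    ContinuousLinearMap.inl_apply, ContinuousLinearMap.inr_apply, map_zero, zero_add, h1] at h'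
  rw [← hy₀] at h2
  have h3 := chartMulHess_symm (G := G) (0, A) (B, 0)
  have h4 : fderiv ℝ (fun u => Ad EG ((oneChart EG G).symm u)) y₀ A B +
      chartMulHess (G := G) (0, A) (B, 0) = chartMulHess (G := G) (A, 0) (0, B) := by
    rw [← h2]
    exact h'
  rw [← h4, h3, add_sub_cancel_right]

theorem lieBracket_eq_mlieBracket (A B : EG) : lieBracket EG G A B =
    VectorField.mlieBracket 𝓘(ℝ, EG) (mulInvariantVectorField (I := 𝓘(ℝ, EG)) (G := G) A)
      (mulInvariantVectorField (I := 𝓘(ℝ, EG)) (G := G) B) (1 : G) := rfl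

/-- In the chart the left-invariant field of A at u is the derivative of y ↦ u y at 1. Brackets of
such fields thus become second derivatives of the multiplication. -/
theorem eventually_mpullback_eq (A : EG) : VectorField.mpullbackWithin 𝓘(ℝ, EG) 𝓘(ℝ, EG)
    (extChartAt 𝓘(ℝ, EG) (1 : G)).symm (mulInvariantVectorField (I := 𝓘(ℝ, EG)) (G := G) A)
    (range 𝓘(ℝ, EG)) =ᶠ[𝓝 (oneChart EG G 1)]
    fun u => fderiv ℝ (chartMul EG G) (u, oneChart EG G 1) (0, A) := by
  have hc1 : ContinuousAt (fun u : EG => (u, oneChart EG G 1)) (oneChart EG G 1) := by fun_prop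
  filter_upwards [(isOpen_extChartAt_target (I := 𝓘(ℝ, EG)) (1 : G)).mem_nhds oneChart_one_mem,
    hc1.eventually (contDiffAt_chartMul (EG := EG) (G := G)).eventually_differentiableAt] with u hu hm
  rw [VectorField.mpullbackWithin_apply, modelWithCornersSelf_coe, Set.range_id, mfderivWithin_univ]
  set g := (extChartAt 𝓘(ℝ, EG) (1 : G)).symm u with hg
  have hgs : g ∈ (extChartAt 𝓘(ℝ, EG) (1 : G)).source :=
    (extChartAt 𝓘(ℝ, EG) (1 : G)).map_target hu
  have h1 : (mfderiv 𝓘(ℝ, EG) 𝓘(ℝ, EG) (extChartAt 𝓘(ℝ, EG) (1 : G)).symm u).inverse =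
      mfderiv 𝓘(ℝ, EG) 𝓘(ℝ, EG) (extChartAt 𝓘(ℝ, EG) (1 : G)) g := by
    refine ContinuousLinearMap.inverse_eq (M := EG) (M₂ := EG) ?_ ?_
    · have := tangent_chart_symm_comp (E := EG) hgs
      rw [(extChartAt 𝓘(ℝ, EG) (1 : G)).right_inv hu] at this
      exact this
    · exact tangent_chart_comp_symm (E := EG) hu
  rw [h1]
  have hmul : MDifferentiableAt 𝓘(ℝ, EG) 𝓘(ℝ, EG) (fun h : G => g * h) 1 :=
    (contMDiff_const.mul contMDiff_id).mdifferentiable (by simp : (∞ : WithTop ℕ∞) ≠ 0) 1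
  have hgs' : g * 1 ∈ (extChartAt 𝓘(ℝ, EG) (1 : G)).source := by rw [mul_one]; exact hgs
  have h2 := tangent_comp (E := EG) (E' := EG) (E'' := EG) (mdifferentiableAt_chart hgs') hmul
  have h3 : tangent (E := EG) (E' := EG) (extChartAt 𝓘(ℝ, EG) (1 : G)) (g * 1) =
      tangent (E := EG) (E' := EG) (extChartAt 𝓘(ℝ, EG) (1 : G)) g := by rw [mul_one]
  have h4 : tangent (E := EG) (E' := EG) ((extChartAt 𝓘(ℝ, EG) (1 : G)) ∘ fun h : G => g * h) 1 =
      (fderiv ℝ (chartMul EG G) (u, oneChart EG G 1)).comp (ContinuousLinearMap.inr ℝ EG EG) := by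
    have e1 : HasFDerivAt (fun y : EG => (u, y)) (ContinuousLinearMap.inr ℝ EG EG)
      (oneChart EG G 1) := hasFDerivAt_prodMk_right u _
    rw [← (hm.hasFDerivAt.comp _ e1).fderiv,
      tangent_eq_fderiv_chart ((mdifferentiableAt_chart hgs').comp _ hmul) rfl]
    rfl
  rw [h3, h4] at h2
  exact (DFunLike.congr_fun h2 A).symm

/-- The derivative of the adjoint representation is the Lie bracket. -/
theorem hasFDerivAt_Ad_chart : HasFDerivAt (fun u => Ad EG ((oneChart EG G).symm u))
    (lieBracket EG G) (oneChart EG G 1) := by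
  have hd : HasFDerivAt (fun u => Ad EG ((oneChart EG G).symm u))
      (fderiv ℝ (fun u => Ad EG ((oneChart EG G).symm u)) (oneChart EG G 1)) (oneChart EG G 1) :=
    (contDiffAt_Ad_chart.differentiableAt (by simp)).hasFDerivAt
  refine hd.congr_fderiv ?_
  ext A B
  rw [hasFDerivAt_Ad_chart_aux, lieBracket_eq_mlieBracket]
  have hL : ∀ B : EG, HasFDerivAt (fun u : EG => fderiv ℝ (chartMul EG G) (u, oneChart EG G 1) (0, B))
      (((fderiv ℝ (fderiv ℝ (chartMul EG G)) (oneChart EG G 1, oneChart EG G 1)).comp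
        (ContinuousLinearMap.inl ℝ EG EG)).flip (0, B)) (oneChart EG G 1) := by
    intro B
    have := (hasFDerivAt_fderiv_chartMul (EG := EG) (G := G)).comp
      (f := fun u => (u, oneChart EG G 1)) (oneChart EG G 1)
      (hasFDerivAt_prodMk_left (𝕜 := ℝ) (oneChart EG G 1) (oneChart EG G 1))
    have h2 := this.clm_apply (hasFDerivAt_const ((0 : EG), B) (oneChart EG G 1))
    refine h2.congr_fderiv ?_
    ext v
    simp
  have h0 : ∀ B : EG, fderiv ℝ (chartMul EG G) (oneChart EG G 1, oneChart EG G 1) (0, B) = B := by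
    intro B
    have h := (eventually_Ad_eq (EG := EG) (G := G)).self_of_nhds
    have hd := (contDiffAt_chartMul (EG := EG) (G := G)).differentiableAt (by simp)
    have h1 : HasFDerivAt (fun y : EG => (oneChart EG G 1, y)) (ContinuousLinearMap.inr ℝ EG EG)
      (oneChart EG G 1) := hasFDerivAt_prodMk_right _ _
    have h2 := (hd.hasFDerivAt.comp (oneChart EG G 1) h1).fderiv
    have h3 : chartMul EG G ∘ (fun y : EG => (oneChart EG G 1, y)) =ᶠ[𝓝 (oneChart EG G 1)] id := by
      filter_upwards [(isOpen_extChartAt_target (I := 𝓘(ℝ, EG)) (1 : G)).mem_nhds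
        oneChart_one_mem] with y hy
      simp only [chartMul, Function.comp_apply, oneChart_symm_one, one_mul]
      exact (oneChart EG G).right_inv hy
    rw [h3.fderiv_eq, fderiv_id] at h2
    exact (DFunLike.congr_fun h2 B).symm
  have hid := tangent_chart_self (E := EG) (1 : G)
  -- By definition the bracket on the manifold is that of the chart representations, carried back by
  -- the differential of the chart; at 1 this differential is the identity.
  have e1 : VectorField.mlieBracket 𝓘(ℝ, EG) (mulInvariantVectorField (I := 𝓘(ℝ, EG)) (G := G) A)
      (mulInvariantVectorField (I := 𝓘(ℝ, EG)) (G := G) B) (1 : G) =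
      (tangent (E := EG) (E' := EG) (extChartAt 𝓘(ℝ, EG) (1 : G)) (1 : G)).inverse
        (VectorField.lieBracketWithin ℝ (E := EG)
          (VectorField.mpullbackWithin 𝓘(ℝ, EG) 𝓘(ℝ, EG) (extChartAt 𝓘(ℝ, EG) (1 : G)).symm
            (mulInvariantVectorField (I := 𝓘(ℝ, EG)) (G := G) A) (range 𝓘(ℝ, EG)))
          (VectorField.mpullbackWithin 𝓘(ℝ, EG) 𝓘(ℝ, EG) (extChartAt 𝓘(ℝ, EG) (1 : G)).symm
            (mulInvariantVectorField (I := 𝓘(ℝ, EG)) (G := G) B) (range 𝓘(ℝ, EG)))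
          ((extChartAt 𝓘(ℝ, EG) (1 : G)).symm ⁻¹' univ ∩ range 𝓘(ℝ, EG)) (oneChart EG G 1)) := rfl
  have hs : (extChartAt 𝓘(ℝ, EG) (1 : G)).symm ⁻¹' univ ∩ range 𝓘(ℝ, EG) = univ := by simp
  have hV : ∀ V W : EG → EG, (tangent (E := EG) (E' := EG) (extChartAt 𝓘(ℝ, EG) (1 : G))
      (1 : G)).inverse (VectorField.lieBracketWithin ℝ (E := EG) V W
        ((extChartAt 𝓘(ℝ, EG) (1 : G)).symm ⁻¹' univ ∩ range 𝓘(ℝ, EG)) (oneChart EG G 1)) =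
      VectorField.lieBracket ℝ V W (oneChart EG G 1) := by
    intro V W
    rw [hs, VectorField.lieBracketWithin_univ, hid, ContinuousLinearMap.inverse_id]
    rfl
  have hbr := Filter.EventuallyEq.lieBracket_vectorField_eq (𝕜 := ℝ)
    (eventually_mpullback_eq (G := G) A) (eventually_mpullback_eq (G := G) B)
  refine Eq.trans ?_ ((e1.trans (hV _ _)).trans hbr).symm
  -- The bracket D V_B · V_A - D V_A · V_B is the antisymmetrised mixed Hessian of the
  -- multiplication found for D Ad.
  rw [VectorField.lieBracket, (hL A).fderiv, (hL B).fderiv, h0, h0]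
  rfl

/-- Obtained by differentiating Ad(g⁻¹) Ad(g) = id at g = 1. -/
theorem hasFDerivAt_Ad_inv_chart : HasFDerivAt (fun u => Ad EG ((oneChart EG G).symm u)⁻¹)
    (-lieBracket EG G) (oneChart EG G 1) := by
  have hinv : ContMDiffAt 𝓘(ℝ, EG) 𝓘(ℝ, EG →L[ℝ] EG) ∞
      (fun u => Ad EG ((oneChart EG G).symm u)⁻¹) (oneChart EG G 1) :=
    (contMDiff_Ad (G := G)).contMDiffAt.comp (oneChart EG G 1)
      (contMDiffAt_oneChart_symm contDiffAt_id oneChart_one_mem).inv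
  have hd := ((contMDiffAt_iff_contDiffAt.1 hinv).differentiableAt (by simp)).hasFDerivAt
  refine hd.congr_fderiv ?_
  have h1 := hd.clm_comp (hasFDerivAt_Ad_chart (EG := EG) (G := G))
  have h2 : (fun u => (Ad EG ((oneChart EG G).symm u)⁻¹).comp (Ad EG ((oneChart EG G).symm u))) =
      fun _ => ContinuousLinearMap.id ℝ EG := funext fun u => Ad_inv_comp _
  rw [h2] at h1
  have h3 := h1.unique (hasFDerivAt_const _ _)
  ext A B
  have h4 := DFunLike.congr_fun (DFunLike.congr_fun h3 A) B
  simp only [oneChart_symm_one, inv_one, Ad_one] at h4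
  simp at h4
  rw [neg_apply, neg_apply]
  exact eq_neg_of_add_eq_zero_right h4

theorem Ad_lieBracket (g : G) (A B : EG) :
    Ad EG g (lieBracket EG G A B) = lieBracket EG G (Ad EG g A) (Ad EG g B) := by
  -- differentiate `Ad (g h g⁻¹) = Ad g ∘ Ad h ∘ Ad g⁻¹` in `h`
  have hconj : ContDiffAt ℝ ∞ (fun y => oneChart EG G (g * (oneChart EG G).symm y * g⁻¹))
      (oneChart EG G 1) :=
    contDiffAt_oneChart ((contMDiff_conj g).contMDiffAt.comp _
      (contMDiffAt_oneChart_symm contDiffAt_id oneChart_one_mem)) (by simp)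
  have h1 : HasFDerivAt (fun y => oneChart EG G (g * (oneChart EG G).symm y * g⁻¹)) (Ad EG g)
      (oneChart EG G 1) := by
    rw [Ad_eq_fderiv]
    exact (hconj.differentiableAt (by simp)).hasFDerivAt
  have h2 : HasFDerivAt (fun u => Ad EG ((oneChart EG G).symm u)) (lieBracket EG G)
      (oneChart EG G (g * (oneChart EG G).symm (oneChart EG G 1) * g⁻¹)) := by
    simpa using hasFDerivAt_Ad_chart (EG := EG) (G := G)
  have h3 := h2.comp (oneChart EG G 1) h1
  have h4 := ((hasFDerivAt_const (Ad EG g) (oneChart EG G 1)).clm_comp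
    (hasFDerivAt_Ad_chart (EG := EG) (G := G))).clm_comp
    (hasFDerivAt_const (Ad EG g⁻¹) (oneChart EG G 1))
  have h5 : ((fun u => Ad EG ((oneChart EG G).symm u)) ∘
      fun y => oneChart EG G (g * (oneChart EG G).symm y * g⁻¹)) =ᶠ[𝓝 (oneChart EG G 1)]
      fun u => ((Ad EG g).comp (Ad EG ((oneChart EG G).symm u))).comp (Ad EG g⁻¹) := by
    have hcont : ContinuousAt (fun y : EG => g * (oneChart EG G).symm y * g⁻¹) (oneChart EG G 1) :=
      ((contMDiff_conj g).contMDiffAt.comp _ (contMDiffAt_oneChart_symm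
        (contDiffAt_id (𝕜 := ℝ) (n := ∞)) oneChart_one_mem)).continuousAt
    have hs : ∀ᶠ y in 𝓝 (oneChart EG G 1), g * (oneChart EG G).symm y * g⁻¹ ∈
        (oneChart EG G).source := by
      refine hcont.eventually ((isOpen_extChartAt_source (I := 𝓘(ℝ, EG)) (1 : G)).mem_nhds ?_)
      simp only [oneChart_symm_one, mul_one, mul_inv_cancel]
      exact one_mem_oneChart_source
    filter_upwards [hs] with y hy
    simp only [Function.comp_apply]
    rw [(oneChart EG G).left_inv hy, Ad_mul, Ad_mul]
  have h6 := (h4.congr_of_eventuallyEq h5).unique h3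
  have h7 := DFunLike.congr_fun (DFunLike.congr_fun h6 A) (Ad EG g B)
  simpa [Ad_inv_apply_Ad] using h7

theorem lieBracket_swap (A B : EG) : lieBracket EG G A B = -lieBracket EG G B A := by
  rw [lieBracket_eq_mlieBracket, lieBracket_eq_mlieBracket]
  exact VectorField.mlieBracket_swap_apply

/-- The infinitesimal form of invariance: the derivative at h = 1, in the direction A, of the
constant function tr(Ad_h B, Ad_h C). -/
theorem AdInvariantScalarProduct.lieBracket_invariant (tr : AdInvariantScalarProduct EG G)
    (A B C : EG) :
    tr.toBilin (lieBracket EG G A B) C + tr.toBilin B (lieBracket EG G A C) = 0 := by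
  have hB := (hasFDerivAt_Ad_chart (EG := EG) (G := G)).clm_apply
    (hasFDerivAt_const B (oneChart EG G 1))
  have hC := (hasFDerivAt_Ad_chart (EG := EG) (G := G)).clm_apply
    (hasFDerivAt_const C (oneChart EG G 1))
  have h1 := tr.toBilin.hasFDerivAt_of_bilinear hB hC
  simp only [tr.invariant] at h1
  have h2 := DFunLike.congr_fun (h1.unique (hasFDerivAt_const _ _)) A
  simp [Ad_one] at h2
  linarith

end Adjoint

/-! ### Geometry of principal bundles -/

/-- The arguments are exchanged one at a time; each exchange changes the value by a term with an
argument in K. -/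
theorem map_eq_of_congr_mod {k : ℕ} {E V : Type*} [NormedAddCommGroup E] [NormedSpace ℝ E]
    [NormedAddCommGroup V] [NormedSpace ℝ V] (η : E [⋀^Fin k]→L[ℝ] V) (K : Set E)
    (hK : ∀ X : Fin k → E, (∃ i, X i ∈ K) → η X = 0) {X Y : Fin k → E}
    (h : ∀ i, X i - Y i ∈ K) : η X = η Y := by
  classical
  have key : ∀ s : Finset (Fin k), η (s.piecewise X Y) = η Y := by
    intro s
    induction s using Finset.induction_on with
    | empty => simp
    | insert a s ha ih =>
      rw [Finset.piecewise_insert]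
      have h1 : η (Function.update (s.piecewise X Y) a (X a - Y a)) = 0 :=
        hK _ ⟨a, by simpa using h a⟩
      have h2 : Function.update (s.piecewise X Y) a (Y a) = s.piecewise X Y := by
        conv_rhs => rw [← Function.update_eq_self a (s.piecewise X Y)]
        simp [ha]
      rw [ContinuousAlternatingMap.map_update_sub, h2, sub_eq_zero] at h1
      rw [h1, ih]
  simpa using key Finset.univ

section BundleGeometry

variable {EM EG EP : Type*} [NormedAddCommGroup EM] [NormedSpace ℝ EM]
  [NormedAddCommGroup EG] [NormedSpace ℝ EG] [NormedAddCommGroup EP] [NormedSpace ℝ EP]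
  {M G P : Type*} [TopologicalSpace M] [ChartedSpace EM M]
  [TopologicalSpace G] [ChartedSpace EG G] [Group G]
  [TopologicalSpace P] [ChartedSpace EP P]

namespace PrincipalBundle

/-- A local section `sec` of a principal bundle over an open set `base`, together with the group
coordinate `coord` with respect to it. -/
structure LocalTriv (B : PrincipalBundle EM EG EP M G P) where
  base : Set M
  sec : M → P
  coord : P → G
  isOpen_base : IsOpen base
  contMDiffOn_sec : ContMDiffOn 𝓘(ℝ, EM) 𝓘(ℝ, EP) ∞ sec base
  contMDiffOn_coord : ContMDiffOn 𝓘(ℝ, EP) 𝓘(ℝ, EG) ∞ coord (B.proj ⁻¹' base)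
  proj_sec : ∀ m ∈ base, B.proj (sec m) = m
  act_sec : ∀ p, B.proj p ∈ base → B.act (sec (B.proj p)) (coord p) = p
  coord_act : ∀ p, B.proj p ∈ base → ∀ g, coord (B.act p g) = coord p * g

/-- The section is m ↦ e⁻¹(m, 1) and the coordinate is the second component of e; sec(π p) · coord p
= p follows since e is injective. -/
theorem exists_localTriv (B : PrincipalBundle EM EG EP M G P) (m₀ : M) :
    ∃ T : LocalTriv B, m₀ ∈ T.base := by
  obtain ⟨U, e, hU, hm, hs, ht, he, hes, hp⟩ := B.locally_trivial m₀
  have hmem : ∀ m ∈ U, ∀ g : G, (m, g) ∈ e.target := fun m hm g => by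
    rw [ht]; exact ⟨hm, mem_univ _⟩
  have hsrc : ∀ m ∈ U, ∀ g : G, e.symm (m, g) ∈ e.source := fun m hm g =>
    e.map_target (hmem m hm g)
  have hproj : ∀ m ∈ U, ∀ g : G, B.proj (e.symm (m, g)) = m := fun m hm g => by
    rw [← (hp _ (hsrc m hm g)).1, e.right_inv (hmem m hm g)]
  refine ⟨⟨U, fun m => e.symm (m, 1), fun p => (e p).2, hU, ?_, ?_, fun m hm => hproj m hm 1, ?_, ?_⟩,
    hm⟩
  · exact hes.comp (contMDiffOn_id.prodMk contMDiffOn_const) fun m hm => hmem m hm 1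
  · rw [← hs]
    exact contMDiff_snd.comp_contMDiffOn he
  · intro p hpU
    have hps : p ∈ e.source := by rw [hs]; exact hpU
    have h1 := hsrc _ hpU 1
    have h2 := hp _ h1
    have h3 : B.act (e.symm (B.proj p, 1)) (e p).2 ∈ e.source := by
      rw [hs, mem_preimage, B.proj_act, hproj _ hpU]; exact hpU
    refine e.injOn h3 hps (Prod.ext ?_ ?_)
    · rw [(hp _ h3).1, B.proj_act, hproj _ hpU, (hp _ hps).1]
    · rw [h2.2, e.right_inv (hmem _ hpU 1), one_mul]
  · intro p hpU g
    exact (hp p (by rw [hs]; exact hpU)).2 g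

variable (B : PrincipalBundle EM EG EP M G P)

theorem LocalTriv.coord_sec {B : PrincipalBundle EM EG EP M G P} (T : LocalTriv B) {m : M}
    (hm : m ∈ T.base) : T.coord (T.sec m) = 1 := by
  have h1 := T.proj_sec m hm
  have h2 := T.act_sec (T.sec m) (by rw [h1]; exact hm)
  rw [h1] at h2
  have h3 := T.coord_act (T.sec m) (by rw [h1]; exact hm) (T.coord (T.sec m))
  rw [h2] at h3
  exact (mul_eq_left.1 h3.symm)

theorem LocalTriv.coord_act_sec {B : PrincipalBundle EM EG EP M G P} (T : LocalTriv B) {m : M}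
    (hm : m ∈ T.base) (g : G) : T.coord (B.act (T.sec m) g) = g := by
  rw [T.coord_act _ (by rw [T.proj_sec m hm]; exact hm), T.coord_sec hm, one_mul]

theorem surjective_proj : Function.Surjective B.proj := fun m => by
  obtain ⟨T, hT⟩ := B.exists_localTriv m
  exact ⟨T.sec m, T.proj_sec m hT⟩

theorem exists_act_eq {p q : P} (h : B.proj p = B.proj q) : ∃ g, B.act p g = q := by
  obtain ⟨T, hT⟩ := B.exists_localTriv (B.proj p)
  refine ⟨(T.coord p)⁻¹ * T.coord q, ?_⟩
  have h1 := T.act_sec p hT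
  have h2 := T.act_sec q (by rw [← h]; exact hT)
  calc B.act p ((T.coord p)⁻¹ * T.coord q)
      = B.act (B.act (T.sec (B.proj p)) (T.coord p)) ((T.coord p)⁻¹ * T.coord q) := by rw [h1]
    _ = B.act (T.sec (B.proj p)) (T.coord q) := by rw [← B.act_mul, mul_inv_cancel_left]
    _ = q := by rw [h, h2]

theorem mdifferentiable_proj : MDifferentiable 𝓘(ℝ, EP) 𝓘(ℝ, EM) B.proj :=
  B.contMDiff_proj.mdifferentiable (by simp)

theorem contMDiff_act_left (g : G) : ContMDiff 𝓘(ℝ, EP) 𝓘(ℝ, EP) ∞ fun p => B.act p g :=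
  B.contMDiff_act.comp (contMDiff_id.prodMk contMDiff_const)

theorem contMDiff_act_right (p : P) : ContMDiff 𝓘(ℝ, EG) 𝓘(ℝ, EP) ∞ fun g => B.act p g :=
  B.contMDiff_act.comp (contMDiff_const.prodMk contMDiff_id)

theorem mdifferentiable_act_left (g : G) :
    MDifferentiable 𝓘(ℝ, EP) 𝓘(ℝ, EP) fun p => B.act p g :=
  (B.contMDiff_act_left g).mdifferentiable (by simp)

theorem mdifferentiable_act_right (p : P) :
    MDifferentiable 𝓘(ℝ, EG) 𝓘(ℝ, EP) fun g => B.act p g :=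
  (B.contMDiff_act_right p).mdifferentiable (by simp)

theorem tangent_proj_fund (p : P) (A : EG) :
    tangent (E := EP) (E' := EM) B.proj p (B.fund p A) = 0 := by
  have h1 : B.proj ∘ (fun g : G => B.act p g) = fun _ => B.proj p := funext fun g => B.proj_act p g
  have h2 := tangent_comp (E := EG) (E' := EP) (E'' := EM) (f := fun g : G => B.act p g) (x := 1)
    (B.mdifferentiable_proj _) (B.mdifferentiable_act_right p 1)
  have h3 : tangent (E := EP) (E' := EM) B.proj (B.act p 1) = tangent (E := EP) (E' := EM) B.proj p := by
    rw [B.act_one]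
  rw [h1, h3] at h2
  have h4 : tangent (E := EG) (E' := EM) (fun _ : G => B.proj p) 1 = 0 := mfderiv_const
  rw [h4] at h2
  exact (DFunLike.congr_fun h2 A).symm

theorem tangent_proj_tangentAct (g : G) (p : P) (X : EP) :
    tangent (E := EP) (E' := EM) B.proj (B.act p g) (B.tangentAct g p X) =
      tangent (E := EP) (E' := EM) B.proj p X := by
  have h1 : B.proj ∘ (fun q : P => B.act q g) = B.proj := funext fun q => B.proj_act q g
  have h2 := tangent_comp (E := EP) (E' := EP) (E'' := EM) (f := fun q : P => B.act q g) (x := p)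
    (B.mdifferentiable_proj _) (B.mdifferentiable_act_left g p)
  rw [h1] at h2
  exact (DFunLike.congr_fun h2 X).symm

theorem exists_section (p : P) : ∃ (U : Set M) (s : M → P), IsOpen U ∧ B.proj p ∈ U ∧
    ContMDiffOn 𝓘(ℝ, EM) 𝓘(ℝ, EP) ∞ s U ∧ s (B.proj p) = p ∧ ∀ m ∈ U, B.proj (s m) = m := by
  obtain ⟨T, hT⟩ := B.exists_localTriv (B.proj p)
  exact ⟨T.base, fun m => B.act (T.sec m) (T.coord p), T.isOpen_base, hT,
    (B.contMDiff_act_left (T.coord p)).comp_contMDiffOn T.contMDiffOn_sec, T.act_sec p hT,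
    fun m hm => by rw [B.proj_act, T.proj_sec m hm]⟩

theorem tangent_proj_section {U : Set M} {s : M → P} (hU : IsOpen U)
    (hs : ContMDiffOn 𝓘(ℝ, EM) 𝓘(ℝ, EP) ∞ s U) (hps : ∀ m ∈ U, B.proj (s m) = m) {m : M}
    (hm : m ∈ U) : (tangent (E := EP) (E' := EM) B.proj (s m)).comp
      (tangent (E := EM) (E' := EP) s m) = ContinuousLinearMap.id ℝ EM := by
  have hsm : MDifferentiableAt 𝓘(ℝ, EM) 𝓘(ℝ, EP) s m :=
    (hs.contMDiffAt (hU.mem_nhds hm)).mdifferentiableAt (by simp)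
  have h1 : B.proj ∘ s =ᶠ[𝓝 m] id := by
    filter_upwards [hU.mem_nhds hm] with q hq using hps q hq
  rw [← tangent_comp (B.mdifferentiable_proj _) hsm, tangent_congr h1, tangent_id]

theorem surjective_tangent_proj (p : P) :
    Function.Surjective (tangent (E := EP) (E' := EM) B.proj p) := by
  obtain ⟨U, s, hU, hm, hs, hsp, hps⟩ := B.exists_section p
  have h := B.tangent_proj_section hU hs hps hm
  rw [hsp] at h
  exact fun v => ⟨_, DFunLike.congr_fun h v⟩

end PrincipalBundle

variable [FiniteDimensional ℝ EG] [LieGroup 𝓘(ℝ, EG) ∞ G]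

variable (EG) in
/-- The (left) Maurer-Cartan form. -/
def maurerCartan (g : G) : EG →L[ℝ] EG := tangent (E := EG) (E' := EG) (fun h : G => g⁻¹ * h) g

theorem maurerCartan_one : maurerCartan EG (1 : G) = ContinuousLinearMap.id ℝ EG := by
  have : (fun h : G => 1⁻¹ * h) = id := by funext h; simp
  rw [maurerCartan, this, tangent_id]

namespace PrincipalBundle

variable (B : PrincipalBundle EM EG EP M G P)

/-- Writing p h = (p g)(g⁻¹ h) moves the derivative at g to one at the identity. -/
theorem tangent_act_right (p : P) (g : G) (a : EG) :
    tangent (E := EG) (E' := EP) (fun h : G => B.act p h) g a =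
      B.fund (B.act p g) (maurerCartan EG g a) := by
  have h1 : (fun h : G => B.act p h) = (fun h : G => B.act (B.act p g) h) ∘ fun h : G => g⁻¹ * h := by
    funext h
    simp only [Function.comp_apply]
    rw [← B.act_mul, mul_inv_cancel_left]
  have h2 := tangent_comp (E := EG) (E' := EG) (E'' := EP) (g := fun h : G => B.act (B.act p g) h)
    (f := fun h : G => g⁻¹ * h) (x := g) (B.mdifferentiable_act_right _ _)
    ((contMDiff_const.mul contMDiff_id).mdifferentiable (by simp : (∞ : WithTop ℕ∞) ≠ 0) g)
  have h3 : tangent (E := EG) (E' := EP) (fun h : G => B.act (B.act p g) h) (g⁻¹ * g) =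
      tangent (E := EG) (E' := EP) (fun h : G => B.act (B.act p g) h) 1 := by rw [inv_mul_cancel]
  rw [h3] at h2
  rw [h1, h2]
  rfl

variable {E₁ : Type*} [NormedAddCommGroup E₁] [NormedSpace ℝ E₁] {N : Type*} [TopologicalSpace N]
  [ChartedSpace E₁ N]

/-- The Leibniz rule for the right action. -/
theorem tangent_act {a : N → P} {γ : N → G} {x : N} (ha : MDifferentiableAt 𝓘(ℝ, E₁) 𝓘(ℝ, EP) a x)
    (hγ : MDifferentiableAt 𝓘(ℝ, E₁) 𝓘(ℝ, EG) γ x) (v : E₁) :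
    tangent (E := E₁) (E' := EP) (fun y => B.act (a y) (γ y)) x v =
      B.tangentAct (γ x) (a x) (tangent (E := E₁) (E' := EP) a x v) +
        B.fund (B.act (a x) (γ x)) (maurerCartan EG (γ x) (tangent (E := E₁) (E' := EG) γ x v)) := by
  have hact : MDifferentiableAt (𝓘(ℝ, EP).prod 𝓘(ℝ, EG)) 𝓘(ℝ, EP) (fun x : P × G => B.act x.1 x.2)
      (a x, γ x) := B.contMDiff_act.mdifferentiable (by simp) _
  have h1 := mfderiv_comp x (g := fun x : P × G => B.act x.1 x.2) (f := fun y => (a y, γ y)) hact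
    (ha.prodMk hγ)
  have h2 := congrArg (fun L => L v) h1
  have h3 := mfderiv_prod_eq_add_apply (v := mfderiv 𝓘(ℝ, E₁) (𝓘(ℝ, EP).prod 𝓘(ℝ, EG))
    (fun y => (a y, γ y)) x v) hact
  have h4 := mfderiv_prodMk ha hγ
  rw [← B.tangent_act_right]
  refine h2.trans (h3.trans ?_)
  rw [h4]
  rfl

/-- Every tangent vector in the kernel of the projection is a fundamental vector. -/
theorem exists_fund_eq {p : P} {X : EP} (hX : tangent (E := EP) (E' := EM) B.proj p X = 0) :
    ∃ A, X = B.fund p A := by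
  obtain ⟨T, hT⟩ := B.exists_localTriv (B.proj p)
  have hU : IsOpen (B.proj ⁻¹' T.base) := T.isOpen_base.preimage B.contMDiff_proj.continuous
  have hs : MDifferentiableAt 𝓘(ℝ, EM) 𝓘(ℝ, EP) T.sec (B.proj p) :=
    (T.contMDiffOn_sec.contMDiffAt (T.isOpen_base.mem_nhds hT)).mdifferentiableAt (by simp)
  have hc : MDifferentiableAt 𝓘(ℝ, EP) 𝓘(ℝ, EG) T.coord p :=
    (T.contMDiffOn_coord.contMDiffAt (hU.mem_nhds hT)).mdifferentiableAt (by simp)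
  -- The identity q = sec(π q) · coord q is differentiated; the part coming from the base dies on X,
  -- leaving a fundamental vector.
  have h1 := B.tangent_act (a := T.sec ∘ B.proj) (hs.comp p (B.mdifferentiable_proj p)) hc X
  have h2 : (fun q => B.act ((T.sec ∘ B.proj) q) (T.coord q)) =ᶠ[𝓝 p] id := by
    filter_upwards [hU.mem_nhds hT] with q hq using T.act_sec q hq
  rw [tangent_congr h2, tangent_id, tangent_comp hs (B.mdifferentiable_proj p),
    ContinuousLinearMap.comp_apply, hX, map_zero, map_zero, zero_add] at h1
  have h3 : B.act ((T.sec ∘ B.proj) p) (T.coord p) = p := T.act_sec p hT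
  rw [h3] at h1
  exact ⟨_, h1⟩

/-- The kernel of dπ consists of fundamental vectors, so a horizontal form sees its arguments only
through dπ. -/
theorem horizontal_congr {V : Type*} [NormedAddCommGroup V] [NormedSpace ℝ V] {k : ℕ} {p : P}
    {η : EP [⋀^Fin k]→L[ℝ] V}
    (hη : ∀ X : Fin k → EP, (∃ i A, X i = B.fund p A) → η X = 0) {X Y : Fin k → EP}
    (h : ∀ i, tangent (E := EP) (E' := EM) B.proj p (X i) =
      tangent (E := EP) (E' := EM) B.proj p (Y i)) : η X = η Y :=
  map_eq_of_congr_mod η {Z | ∃ A, Z = B.fund p A} hη fun i =>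
    B.exists_fund_eq (by rw [map_sub, h i, sub_self])

end PrincipalBundle

/-- A basic form: smooth, horizontal and invariant. -/
structure IsBasic (B : PrincipalBundle EM EG EP M G P) {V : Type*} [NormedAddCommGroup V]
    [NormedSpace ℝ V] {k : ℕ} (η : P → EP [⋀^Fin k]→L[ℝ] V) : Prop where
  smooth : IsSmoothForm η
  horizontal : ∀ p X, (∃ i A, X i = B.fund p A) → η p X = 0
  invariant : ∀ g p X, η (B.act p g) (fun i => B.tangentAct g p (X i)) = η p X

variable {B : PrincipalBundle EM EG EP M G P} {V : Type*} [NormedAddCommGroup V] [NormedSpace ℝ V]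
  {k : ℕ}

theorem pullback_proj_injective : Function.Injective fun τ : M → EM [⋀^Fin k]→L[ℝ] V =>
    pullback (E := EP) (E' := EM) B.proj τ := by
  intro τ τ' h
  funext m
  obtain ⟨p, rfl⟩ := B.surjective_proj m
  ext X
  choose Y hY using fun i => B.surjective_tangent_proj p (X i)
  have := DFunLike.congr_fun (congrFun h p) Y
  simpa [pullback_apply, hY] using this

/-- The choice made in `descend` is harmless: π is a surjective submersion, so pull-back along it is
injective. -/
theorem descend_pullback_proj (τ : M → EM [⋀^Fin k]→L[ℝ] ℝ) :
    descend B (pullback (E := EP) (E' := EM) B.proj τ) = τ :=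
  pullback_proj_injective (B := B) (Classical.epsilon_spec
    (p := fun τ' => pullback (E := EP) (E' := EM) B.proj τ' =
      pullback (E := EP) (E' := EM) B.proj τ) ⟨τ, rfl⟩)

/-- At each point of M the form is pulled back along some local section. Invariance and
horizontality make the value the same at every point of the fibre, so the sections need not fit
together. -/
theorem IsBasic.exists_pullback_eq {η : P → EP [⋀^Fin k]→L[ℝ] V} (hη : IsBasic B η) :
    ∃ τ, pullback (E := EP) (E' := EM) B.proj τ = η := by
  choose T hT using B.exists_localTriv
  refine ⟨fun m => (η ((T m).sec m)).compContinuousLinearMap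
    (tangent (E := EM) (E' := EP) (T m).sec m), ?_⟩
  funext p
  ext X
  set m := B.proj p with hm
  have hq : B.proj ((T m).sec m) = m := (T m).proj_sec m (hT m)
  obtain ⟨g, hg⟩ := B.exists_act_eq (hm.symm.trans hq.symm)
  have h1 := B.tangent_proj_section (T m).isOpen_base (T m).contMDiffOn_sec (T m).proj_sec (hT m)
  change η ((T m).sec m) (fun i => tangent (E := EM) (E' := EP) (T m).sec m
    (tangent (E := EP) (E' := EM) B.proj p (X i))) = η p X
  -- A right translation carries p to the chosen point of its fibre; there the two lists of
  -- arguments have equal projections.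
  rw [← hη.invariant g p X]
  have h2 : ∀ i, tangent (E := EP) (E' := EM) B.proj ((T m).sec m)
      (tangent (E := EM) (E' := EP) (T m).sec m (tangent (E := EP) (E' := EM) B.proj p (X i))) =
      tangent (E := EP) (E' := EM) B.proj ((T m).sec m) (B.tangentAct g p (X i)) := by
    intro i
    rw [← hg, B.tangent_proj_tangentAct, hg]
    exact DFunLike.congr_fun h1 _
  rw [B.horizontal_congr (hη.horizontal _) h2, hg]

theorem pullback_proj_descend {η : P → EP [⋀^Fin k]→L[ℝ] ℝ} (hη : IsBasic B η) :
    pullback (E := EP) (E' := EM) B.proj (descend B η) = η :=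
  Classical.epsilon_spec (p := fun τ => pullback (E := EP) (E' := EM) B.proj τ = η)
    hη.exists_pullback_eq

theorem pullback_section {U : Set M} {s : M → P} (hU : IsOpen U)
    (hs : ContMDiffOn 𝓘(ℝ, EM) 𝓘(ℝ, EP) ∞ s U) (hps : ∀ m ∈ U, B.proj (s m) = m)
    (τ : M → EM [⋀^Fin k]→L[ℝ] V) {m : M} (hm : m ∈ U) :
    pullback (E := EM) (E' := EP) s (pullback (E := EP) (E' := EM) B.proj τ) m = τ m := by
  have hsm : MDifferentiableAt 𝓘(ℝ, EM) 𝓘(ℝ, EP) s m :=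
    (hs.contMDiffAt (hU.mem_nhds hm)).mdifferentiableAt (by simp)
  rw [← pullback_comp_apply (B.mdifferentiable_proj _) hsm]
  have h1 : B.proj ∘ s =ᶠ[𝓝 m] id := by
    filter_upwards [hU.mem_nhds hm] with q hq using hps q hq
  rw [pullback_congr h1, pullback_id]

variable [IsManifold 𝓘(ℝ, EM) ∞ M]

/-- In the domain of a local section `s`, the chart representation of `τ` is the pull-back of
`π^* τ` along `s ∘ chart⁻¹`. -/
theorem chartRep_eq_pullback_section {U : Set M} {s : M → P} (hU : IsOpen U)
    (hs : ContMDiffOn 𝓘(ℝ, EM) 𝓘(ℝ, EP) ∞ s U) (hps : ∀ m ∈ U, B.proj (s m) = m)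
    (τ : M → EM [⋀^Fin k]→L[ℝ] V) (x : M) {y : EM} (hy : y ∈ (extChartAt 𝓘(ℝ, EM) x).target)
    (hyU : (extChartAt 𝓘(ℝ, EM) x).symm y ∈ U) :
    chartRep x τ y = pullback (E := EM) (E' := EP) (s ∘ (extChartAt 𝓘(ℝ, EM) x).symm)
      (pullback (E := EP) (E' := EM) B.proj τ) y := by
  have hsm : MDifferentiableAt 𝓘(ℝ, EM) 𝓘(ℝ, EP) s ((extChartAt 𝓘(ℝ, EM) x).symm y) :=
    (hs.contMDiffAt (hU.mem_nhds hyU)).mdifferentiableAt (by simp)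
  rw [pullback_comp_apply hsm (mdifferentiableAt_chart_symm hy)]
  ext X
  rw [pullback_apply, pullback_section hU hs hps τ hyU]
  rfl

theorem isOpen_chart_target_inter {U : Set M} (hU : IsOpen U) (x : M) :
    IsOpen ((extChartAt 𝓘(ℝ, EM) x).target ∩ (extChartAt 𝓘(ℝ, EM) x).symm ⁻¹' U) :=
  (contMDiffOn_chart_symm x).continuousOn.isOpen_inter_preimage (isOpen_extChartAt_target x) hU

theorem contMDiffOn_section_chart {U : Set M} {s : M → P}
    (hs : ContMDiffOn 𝓘(ℝ, EM) 𝓘(ℝ, EP) ∞ s U) (x : M) :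
    ContMDiffOn 𝓘(ℝ, EM) 𝓘(ℝ, EP) ∞ (s ∘ (extChartAt 𝓘(ℝ, EM) x).symm)
      ((extChartAt 𝓘(ℝ, EM) x).target ∩ (extChartAt 𝓘(ℝ, EM) x).symm ⁻¹' U) :=
  hs.comp ((contMDiffOn_chart_symm x).mono inter_subset_left) fun _ hz => hz.2

variable [IsManifold 𝓘(ℝ, EP) ∞ P]

/-- Smoothness is local, and over the domain of a section s one has τ = s^* π^* τ. -/
theorem isSmoothForm_of_pullback_proj {τ : M → EM [⋀^Fin k]→L[ℝ] V}
    (h : IsSmoothForm (pullback (E := EP) (E' := EM) B.proj τ)) : IsSmoothForm τ := by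
  intro x y hy
  obtain ⟨T, hT⟩ := B.exists_localTriv ((extChartAt 𝓘(ℝ, EM) x).symm y)
  have hW := isOpen_chart_target_inter (EM := EM) T.isOpen_base x
  have h1 := h.contDiffOn_pullback hW (contMDiffOn_section_chart T.contMDiffOn_sec x)
  have h2 := h1.congr fun z hz =>
    chartRep_eq_pullback_section T.isOpen_base T.contMDiffOn_sec T.proj_sec τ x hz.1 hz.2
  exact ((h2 y ⟨hy, hT⟩).contDiffAt (hW.mem_nhds ⟨hy, hT⟩)).contDiffWithinAt

theorem IsBasic.isSmoothForm_descend {η : P → EP [⋀^Fin k]→L[ℝ] ℝ} (hη : IsBasic B η) :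
    IsSmoothForm (descend B η) :=
  isSmoothForm_of_pullback_proj (B := B) (by rw [pullback_proj_descend hη]; exact hη.smooth)

theorem isBasic_pullback_proj {τ : M → EM [⋀^Fin k]→L[ℝ] V} (hτ : IsSmoothForm τ) :
    IsBasic B (pullback (E := EP) (E' := EM) B.proj τ) where
  smooth := hτ.pullback B.contMDiff_proj
  horizontal p X h := by
    obtain ⟨i, A, hi⟩ := h
    rw [pullback_apply]
    exact (τ (B.proj p)).map_coord_zero i (by rw [hi, B.tangent_proj_fund])
  invariant g p X := by
    rw [pullback_apply, pullback_apply]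
    simp only [B.tangent_proj_tangentAct, B.proj_act]

end BundleGeometry

/-! ### Operations on smooth forms -/

section SmoothForms

variable {E : Type*} [NormedAddCommGroup E] [NormedSpace ℝ E]
  {N : Type*} [TopologicalSpace N] [ChartedSpace E N]
  {E' : Type*} [NormedAddCommGroup E'] [NormedSpace ℝ E']
  {N' : Type*} [TopologicalSpace N'] [ChartedSpace E' N']
  {V : Type*} [NormedAddCommGroup V] [NormedSpace ℝ V]
  {W : Type*} [NormedAddCommGroup W] [NormedSpace ℝ W]
  {Z : Type*} [NormedAddCommGroup Z] [NormedSpace ℝ Z]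
  {k l : ℕ}

theorem IsSmoothForm.add {η θ : N → E [⋀^Fin k]→L[ℝ] V} (hη : IsSmoothForm η)
    (hθ : IsSmoothForm θ) : IsSmoothForm (η + θ) := fun x => (hη x).add (hθ x)

theorem IsSmoothForm.const_smul {η : N → E [⋀^Fin k]→L[ℝ] V} (c : ℝ) (hη : IsSmoothForm η) :
    IsSmoothForm (c • η) := fun x => (hη x).const_smul c

theorem isSmoothForm_zero : IsSmoothForm (0 : N → E [⋀^Fin k]→L[ℝ] V) :=
  fun _ => contDiffOn_const (c := (0 : E [⋀^Fin k]→L[ℝ] V))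

theorem IsSmoothForm.sum {ι : Type*} (t : Finset ι) {η : ι → N → E [⋀^Fin k]→L[ℝ] V}
    (hη : ∀ i ∈ t, IsSmoothForm (η i)) : IsSmoothForm (∑ i ∈ t, η i) := by
  classical
  induction t using Finset.induction_on with
  | empty => exact isSmoothForm_zero
  | insert a t ha ih =>
    rw [Finset.sum_insert ha]
    exact (hη a (by simp)).add (ih fun i hi => hη i (by simp [hi]))

/-- Composition with a linear map of the value spaces, as a continuous bilinear map. -/
def postcompCLM (E : Type*) [NormedAddCommGroup E] [NormedSpace ℝ E] (k : ℕ) (V W : Type*)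
    [NormedAddCommGroup V] [NormedSpace ℝ V] [NormedAddCommGroup W] [NormedSpace ℝ W] :
    (V →L[ℝ] W) →L[ℝ] (E [⋀^Fin k]→L[ℝ] V) →L[ℝ] E [⋀^Fin k]→L[ℝ] W :=
  LinearMap.mkContinuous₂
    (LinearMap.mk₂ ℝ (fun (L : V →L[ℝ] W) (η : E [⋀^Fin k]→L[ℝ] V) =>
        L.compContinuousAlternatingMap η)
      (fun _ _ _ => rfl) (fun _ _ _ => rfl)
      (fun L η θ => by ext X; simp) (fun c L η => by ext X; simp)) 1
    (fun L η => by
      refine ContinuousAlternatingMap.opNorm_le_bound _ (by positivity) fun X => ?_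
      rw [one_mul, mul_assoc]
      exact (L.le_opNorm _).trans (mul_le_mul_of_nonneg_left (η.le_opNorm X) (norm_nonneg L)))

@[simp] theorem postcompCLM_apply (L : V →L[ℝ] W) (η : E [⋀^Fin k]→L[ℝ] V) :
    postcompCLM E k V W L η = L.compContinuousAlternatingMap η := rfl

theorem chartRep_wedge (b : V →L[ℝ] W →L[ℝ] Z) (η : N → E [⋀^Fin k]→L[ℝ] V)
    (θ : N → E [⋀^Fin l]→L[ℝ] W) (x : N) :
    chartRep x (fun p => wedge b (η p) (θ p)) =
      fun y => wedge b (chartRep x η y) (chartRep x θ y) := by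
  funext y
  exact wedge_compContinuousLinearMap _ _ _ _

theorem pullback_wedge (b : V →L[ℝ] W →L[ℝ] Z) (f : N → N') (η : N' → E' [⋀^Fin k]→L[ℝ] V)
    (θ : N' → E' [⋀^Fin l]→L[ℝ] W) :
    pullback (E := E) (E' := E') f (fun p => wedge b (η p) (θ p)) =
      fun y => wedge b (pullback (E := E) (E' := E') f η y) (pullback (E := E) (E' := E') f θ y) := by
  funext y
  exact wedge_compContinuousLinearMap _ _ _ _

theorem pullback_castDegree (h : k = l) (f : N → N') (η : N' → E' [⋀^Fin k]→L[ℝ] V) :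
    pullback (E := E) (E' := E') f (fun p => castDegree h (η p)) =
      fun y => castDegree h (pullback (E := E) (E' := E') f η y) := by
  funext y
  exact castDegree_compContinuousLinearMap _ _ _

theorem IsSmoothForm.wedge (b : V →L[ℝ] W →L[ℝ] Z) {η : N → E [⋀^Fin k]→L[ℝ] V}
    {θ : N → E [⋀^Fin l]→L[ℝ] W} (hη : IsSmoothForm η) (hθ : IsSmoothForm θ) :
    IsSmoothForm fun p => wedge b (η p) (θ p) := fun x => by
  rw [chartRep_wedge]
  exact (((wedgeCLM E k l b).contDiff.comp_contDiffOn (hη x)).clm_apply (hθ x))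

theorem IsSmoothForm.castDegree (h : k = l) {η : N → E [⋀^Fin k]→L[ℝ] V} (hη : IsSmoothForm η) :
    IsSmoothForm fun p => castDegree h (η p) := by
  subst h
  exact hη

theorem IsSmoothForm.wedgePow {s : N → E [⋀^Fin 2]→L[ℝ] ℝ} (hs : IsSmoothForm s) (j : ℕ) :
    IsSmoothForm fun p => wedgePow (s p) j := by
  induction j with
  | zero =>
    intro x
    refine (contDiffOn_const (c := ContinuousAlternatingMap.constOfIsEmpty ℝ E (Fin 0) (1 : ℝ))).congr
      fun y _ => ?_
    ext X
    rfl
  | succ j ih => exact ih.wedge _ hs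

variable [IsManifold 𝓘(ℝ, E) ∞ N]

theorem IsSmoothForm.bilin (b : V →L[ℝ] W →L[ℝ] Z) {ξ : N → V}
    (hξ : ContMDiff 𝓘(ℝ, E) 𝓘(ℝ, V) ∞ ξ) {η : N → E [⋀^Fin k]→L[ℝ] W} (hη : IsSmoothForm η) :
    IsSmoothForm fun p => (b (ξ p)).compContinuousAlternatingMap (η p) := fun x => by
  have h1 : ContDiffOn ℝ ∞ (ξ ∘ (extChartAt 𝓘(ℝ, E) x).symm) (extChartAt 𝓘(ℝ, E) x).target :=
    contMDiffOn_iff_contDiffOn.1 (hξ.comp_contMDiffOn (contMDiffOn_chart_symm x))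
  exact (((postcompCLM E k W Z).comp b).contDiff.comp_contDiffOn h1).clm_apply (hη x)

/-- A function, considered as a form of degree zero. -/
def zeroForm (E : Type*) [NormedAddCommGroup E] [NormedSpace ℝ E] {N : Type*} (f : N → V) :
    N → E [⋀^Fin 0]→L[ℝ] V :=
  fun x => ContinuousAlternatingMap.constOfIsEmpty ℝ E (Fin 0) (f x)

theorem chartRep_zeroForm (f : N → V) (x : N) :
    chartRep x (zeroForm E f) = zeroForm E (f ∘ (extChartAt 𝓘(ℝ, E) x).symm) := rfl

theorem IsSmoothForm.differentiableAt_chartRep {η : N → E [⋀^Fin k]→L[ℝ] V} (hη : IsSmoothForm η)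
    (x : N) {y : E} (hy : y ∈ (extChartAt 𝓘(ℝ, E) x).target) :
    DifferentiableAt ℝ (chartRep x η) y :=
  ((hη x).contDiffAt ((isOpen_extChartAt_target x).mem_nhds hy)).differentiableAt (by simp)

theorem extD_add {η θ : N → E [⋀^Fin k]→L[ℝ] V} (hη : IsSmoothForm η) (hθ : IsSmoothForm θ) :
    extD (η + θ) = extD η + extD θ := by
  funext x
  have hx := mem_extChartAt_target (I := 𝓘(ℝ, E)) x
  have h := extDeriv_add (hη.differentiableAt_chartRep x hx) (hθ.differentiableAt_chartRep x hx)
  change (extDeriv (chartRep x η + chartRep x θ) _).compContinuousLinearMap _ = _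
  rw [h]
  rfl

theorem extD_smul (c : ℝ) (η : N → E [⋀^Fin k]→L[ℝ] V) : extD (c • η) = c • extD η := by
  funext x
  change (extDeriv (c • chartRep x η) _).compContinuousLinearMap _ = _
  rw [extDeriv_smul]
  rfl

theorem extD_clm_comp (L : V →L[ℝ] W) {η : N → E [⋀^Fin k]→L[ℝ] V} (hη : IsSmoothForm η) :
    extD (fun x => L.compContinuousAlternatingMap (η x)) =
      fun x => L.compContinuousAlternatingMap (extD η x) := by
  funext x
  have hx := mem_extChartAt_target (I := 𝓘(ℝ, E)) x
  have hd := (hη.differentiableAt_chartRep x hx).hasFDerivAt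
  have h1 : HasFDerivAt (chartRep x fun x => L.compContinuousAlternatingMap (η x))
      ((postcompCLM E k V W L).comp (fderiv ℝ (chartRep x η) (extChartAt 𝓘(ℝ, E) x x)))
      (extChartAt 𝓘(ℝ, E) x x) := (postcompCLM E k V W L).hasFDerivAt.comp _ hd
  ext X
  simp only [extD, extDeriv, h1.fderiv, ContinuousAlternatingMap.compContinuousLinearMap_apply,
    ContinuousLinearMap.compContinuousAlternatingMap_coe, Function.comp_apply,
    ContinuousAlternatingMap.alternatizeUncurryFin_apply, map_sum, map_zsmul]
  simp

theorem extD_zeroForm_apply {f : N → V} (hf : ContMDiff 𝓘(ℝ, E) 𝓘(ℝ, V) ∞ f) (x : N)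
    (X : Fin 1 → E) : extD (zeroForm E f) x X = tangent (E := E) (E' := V) f x (X 0) := by
  rw [extD, chartRep_zeroForm]
  have h := extDeriv_constOfIsEmpty (𝕜 := ℝ) (f ∘ (extChartAt 𝓘(ℝ, E) x).symm)
    (extChartAt 𝓘(ℝ, E) x x)
  have h1 := tangent_eq_fderiv_chart (E := E) (E' := V) (f := f) (x := x)
    (hf.mdifferentiable (by simp) x) rfl
  rw [tangent_chart_self, h1]
  exact DFunLike.congr_fun h X

theorem extD_wedge_of_closed (b : V →L[ℝ] W →L[ℝ] Z) {η : N → E [⋀^Fin k]→L[ℝ] V}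
    {θ : N → E [⋀^Fin l]→L[ℝ] W} (hη : IsSmoothForm η) (hθ : IsSmoothForm θ)
    (hc : ∀ x, extD θ x = 0) :
    extD (fun p => wedge b (η p) (θ p)) =
      fun p => castDegree (Nat.add_right_comm k 1 l) (wedge b (extD η p) (θ p)) := by
  funext x
  have hx := mem_extChartAt_target (I := 𝓘(ℝ, E)) x
  have hc' : extDeriv (chartRep x θ) (extChartAt 𝓘(ℝ, E) x x) = 0 := by
    rw [← chartRep_extD hθ x hx, show extD θ = 0 from funext hc]
    rfl
  rw [extD, chartRep_wedge, extDeriv_wedge_of_closed b (hη.differentiableAt_chartRep x hx)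
    (hθ.differentiableAt_chartRep x hx) hc', castDegree_compContinuousLinearMap,
    wedge_compContinuousLinearMap, chartRep_comp_tangent θ (mem_extChartAt_source x)]
  rfl

/-- Induction by the Leibniz rule with closed second factor, starting from the constant function 1.
-/
theorem extD_wedgePow {s : N → E [⋀^Fin 2]→L[ℝ] ℝ} (hs : IsSmoothForm s) (hc : ∀ x, extD s x = 0)
    (j : ℕ) (x : N) : extD (fun p => wedgePow (s p) j) x = 0 := by
  induction j generalizing x with
  | zero =>
    have h := extD_zeroForm_apply (E := E) (V := ℝ) (N := N) (f := fun _ => (1 : ℝ)) contMDiff_const x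
    ext X
    refine (h X).trans ?_
    have : tangent (E := E) (E' := ℝ) (fun _ : N => (1 : ℝ)) x = 0 := mfderiv_const
    rw [this]
    rfl
  | succ j ih =>
    have h := extD_wedge_of_closed (ContinuousLinearMap.mul ℝ ℝ) (hs.wedgePow j) hs hc
    refine (congrFun h x).trans ?_
    simp only [ih x]
    rw [← wedgeCLM_apply, _root_.map_zero, zero_apply, ← castDegreeCLM_apply, _root_.map_zero]

/-- The exterior derivative of a one-form on a pair of vectors. -/
theorem extDeriv_one_apply {ω₀ : E → E [⋀^Fin 1]→L[ℝ] V} {x : E} (h : DifferentiableAt ℝ ω₀ x)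
    (v w : E) : extDeriv ω₀ x ![v, w] =
      fderiv ℝ (fun y => ω₀ y fun _ => w) x v - fderiv ℝ (fun y => ω₀ y fun _ => v) x w := by
  rw [extDeriv_apply h, Fin.sum_univ_two]
  have h1 : (Fin.removeNth 0 ![v, w] : Fin 1 → E) = fun _ => w := by
    funext i; fin_cases i; rfl
  have h2 : (Fin.removeNth 1 ![v, w] : Fin 1 → E) = fun _ => v := by
    funext i; fin_cases i; rfl
  rw [h1, h2]
  simp [sub_eq_add_neg]

/-- If both factors vanish on arguments from `K`, so does the wedge product. -/
theorem wedge_horizontal (b : V →L[ℝ] W →L[ℝ] Z) {K : Set E} {η : E [⋀^Fin k]→L[ℝ] V}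
    {θ : E [⋀^Fin l]→L[ℝ] W} (hη : ∀ X : Fin k → E, (∃ i, X i ∈ K) → η X = 0)
    (hθ : ∀ X : Fin l → E, (∃ i, X i ∈ K) → θ X = 0) (X : Fin (k + l) → E) (hX : ∃ i, X i ∈ K) :
    wedge b η θ X = 0 := by
  obtain ⟨i, hi⟩ := hX
  rw [wedge_apply, altSum, Finset.sum_eq_zero, smul_zero]
  intro s _
  have key : altPair b η θ (X ∘ s) = 0 := by
    have hj : (X ∘ s) (s.symm i) ∈ K := by simpa using hi
    revert hj
    generalize X ∘ s = Y
    generalize s.symm i = j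
    intro hj
    rw [altPair]
    induction j using Fin.addCases with
    | left j =>
      have : η (fun i => Y (Fin.castAdd l i)) = 0 := hη _ ⟨j, hj⟩
      exact (congrArg (fun z => b z _) this).trans (by simp)
    | right j =>
      have : θ (fun i => Y (Fin.natAdd k i)) = 0 := hθ _ ⟨j, hj⟩
      exact (congrArg (b _) this).trans (by simp)
  rw [key, smul_zero]

end SmoothForms

/-! ### Curvature -/

section Curvature

variable {EM EG EP : Type*} [NormedAddCommGroup EM] [NormedSpace ℝ EM]
  [NormedAddCommGroup EG] [NormedSpace ℝ EG] [NormedAddCommGroup EP] [NormedSpace ℝ EP]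
  {M G P : Type*} [TopologicalSpace M] [ChartedSpace EM M]
  [TopologicalSpace G] [ChartedSpace EG G] [Group G]
  [TopologicalSpace P] [ChartedSpace EP P]
  {B : PrincipalBundle EM EG EP M G P} {k l : ℕ}

namespace AdForm

@[ext] theorem ext {η θ : AdForm B k} (h : ∀ p, η.form p = θ.form p) : η = θ :=
  Subtype.ext (funext h)

@[simp] theorem form_add (η θ : AdForm B k) : (η + θ).form = η.form + θ.form := rfl

@[simp] theorem form_smul (c : ℝ) (η : AdForm B k) : (c • η).form = c • η.form := rfl

theorem smooth (η : AdForm B k) : IsSmoothForm η.form := η.isTensorial.smooth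

end AdForm

theorem IsTensorial.castDegree (h : k = l) {η : P → EP [⋀^Fin k]→L[ℝ] EG} (hη : IsTensorial B η) :
    IsTensorial B fun p => castDegree h (η p) := by
  subst h
  exact hη

theorem IsTensorial.pullback_act {η : P → EP [⋀^Fin k]→L[ℝ] EG} (hη : IsTensorial B η) (g : G) :
    pullback (E := EP) (E' := EP) (fun p => B.act p g) η =
      fun p => (Ad EG g⁻¹).compContinuousAlternatingMap (η p) := by
  funext p
  ext X
  exact hη.equivariant g p X

variable [FiniteDimensional ℝ EG] [LieGroup 𝓘(ℝ, EG) ∞ G]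

theorem IsBasic.pullback_act {V : Type*} [NormedAddCommGroup V] [NormedSpace ℝ V]
    {η : P → EP [⋀^Fin k]→L[ℝ] V} (hη : IsBasic B η) (g : G) :
    pullback (E := EP) (E' := EP) (fun p => B.act p g) η = η := by
  funext p
  ext X
  exact hη.invariant g p X

namespace Connection

theorem pullback_act (Γ : Connection B) (g : G) :
    pullback (E := EP) (E' := EP) (fun p => B.act p g) Γ.form =
      fun p => (Ad EG g⁻¹).compContinuousAlternatingMap (Γ.form p) := by
  funext p
  ext X
  exact Γ.equivariant g p X

/-- The transformation rule Γ((a γ)') = Ad(γ⁻¹) Γ(a') + γ⁻¹ γ': the Leibniz rule for the right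
action combined with the two axioms of a connection. -/
theorem apply_tangent_act (Γ : Connection B) {E₁ : Type*} [NormedAddCommGroup E₁]
    [NormedSpace ℝ E₁] {N : Type*} [TopologicalSpace N] [ChartedSpace E₁ N] {a : N → P} {γ : N → G}
    {x : N} (ha : MDifferentiableAt 𝓘(ℝ, E₁) 𝓘(ℝ, EP) a x)
    (hγ : MDifferentiableAt 𝓘(ℝ, E₁) 𝓘(ℝ, EG) γ x) (v : E₁) :
    Γ.form (B.act (a x) (γ x)) (fun _ => tangent (E := E₁) (E' := EP)
      (fun y => B.act (a y) (γ y)) x v) =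
      Ad EG (γ x)⁻¹ (Γ.form (a x) fun _ => tangent (E := E₁) (E' := EP) a x v) +
        maurerCartan EG (γ x) (tangent (E := E₁) (E' := EG) γ x v) := by
  have hadd : ∀ (θ : EP [⋀^Fin 1]→L[ℝ] EG) (X Y : EP), θ (fun _ => X + Y) =
      θ (fun _ => X) + θ fun _ => Y := by
    intro θ X Y
    have := θ.map_update_add (fun _ => X) 0 X Y
    have e : ∀ Z, Function.update (fun _ : Fin 1 => X) 0 Z = fun _ => Z := by
      intro Z; funext i; fin_cases i; simp
    rwa [e, e, e] at this
  rw [B.tangent_act ha hγ, hadd, Γ.fund]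
  congr 1
  exact Γ.equivariant (γ x) (a x) fun _ => tangent (E := E₁) (E' := EP) a x v

end Connection

variable [IsManifold 𝓘(ℝ, EP) ∞ P]

/-- The curvature expression for an arbitrary `𝔤`-valued one-form. -/
def curvForm (G : Type*) [TopologicalSpace G] [ChartedSpace EG G] [Group G] [LieGroup 𝓘(ℝ, EG) ∞ G]
    (θ : P → EP [⋀^Fin 1]→L[ℝ] EG) : P → EP [⋀^Fin 2]→L[ℝ] EG :=
  extD θ + (1 / 2 : ℝ) • fun p => wedge (lieBracket EG G) (θ p) (θ p)

theorem isSmoothForm_curvForm {θ : P → EP [⋀^Fin 1]→L[ℝ] EG} (hθ : IsSmoothForm θ) :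
    IsSmoothForm (curvForm G θ) :=
  hθ.extD.add ((hθ.wedge _ hθ).const_smul _)

/-- Naturality of d and of ∧. Right translations give the equivariance of the curvature, gauge
transformations its behaviour under the action. -/
theorem pullback_curvForm {f : P → P} (hf : ContMDiff 𝓘(ℝ, EP) 𝓘(ℝ, EP) ∞ f)
    {θ : P → EP [⋀^Fin 1]→L[ℝ] EG} (hθ : IsSmoothForm θ) :
    pullback (E := EP) (E' := EP) f (curvForm G θ) =
      curvForm G (pullback (E := EP) (E' := EP) f θ) := by
  rw [curvForm, curvForm, extD_pullback hf hθ]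
  have h := pullback_wedge (E := EP) (E' := EP) (lieBracket EG G) f θ θ
  rw [← h]
  rfl

theorem curvForm_Ad (g : G) {θ : P → EP [⋀^Fin 1]→L[ℝ] EG} (hθ : IsSmoothForm θ) :
    curvForm G (fun p => (Ad EG g).compContinuousAlternatingMap (θ p)) =
      fun p => (Ad EG g).compContinuousAlternatingMap (curvForm G θ p) := by
  rw [curvForm, extD_clm_comp _ hθ]
  funext p
  have h := compContinuousAlternatingMap_wedge (L := Ad EG g) (L₁ := Ad EG g) (L₂ := Ad EG g)
    (b := lieBracket EG G) (b' := lieBracket EG G) (fun v w => Ad_lieBracket g v w) (θ p) (θ p)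
  simp only [Pi.add_apply, Pi.smul_apply]
  rw [← h, curvForm]
  ext X
  simp

theorem curvForm_add {θ α : P → EP [⋀^Fin 1]→L[ℝ] EG} (hθ : IsSmoothForm θ)
    (hα : IsSmoothForm α) : curvForm G (θ + α) = curvForm G θ +
      (extD α + fun p => wedge (lieBracket EG G) (θ p) (α p)) +
      (1 / 2 : ℝ) • fun p => wedge (lieBracket EG G) (α p) (α p) := by
  rw [curvForm, curvForm, extD_add hθ hα]
  funext p
  -- For one-forms the two antisymmetries cancel, so the cross terms coincide and absorb the factor
  -- ½.
  have hs : wedge (lieBracket EG G) (α p) (θ p) = wedge (lieBracket EG G) (θ p) (α p) := by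
    ext X
    rw [wedge_one_one_apply, wedge_one_one_apply, lieBracket_swap,
      lieBracket_swap (α p fun _ => X 1)]
    abel
  have h : wedge (lieBracket EG G) ((θ + α) p) ((θ + α) p) =
      wedge (lieBracket EG G) (θ p) (θ p) + (2 : ℝ) • wedge (lieBracket EG G) (θ p) (α p) +
        wedge (lieBracket EG G) (α p) (α p) := by
    rw [← wedgeCLM_apply, Pi.add_apply, map_add, map_add, add_apply, add_apply]
    simp only [wedgeCLM_apply]
    rw [hs, two_smul]
    abel
  simp only [Pi.add_apply, Pi.smul_apply] at h ⊢
  rw [h, smul_add, smul_add, smul_smul]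
  norm_num
  abel

namespace Connection

/-- The curvature vanishes on pairs of vectors the first of which is vertical. -/
theorem curvature_fund (Γ : Connection B) (p : P) (A : EG) (Y : EP) :
    Γ.curvature p ![B.fund p A, Y] = 0 := by
  set c := extChartAt 𝓘(ℝ, EP) p with hc
  set y₀ := c p with hy₀
  set u₀ := oneChart EG G 1 with hu₀
  -- In the coordinates (u, y) ↦ y · u on G × P the vertical direction A becomes the constant
  -- direction (A, 0), and dΓ can be computed with constant vectors.
  set F : EG × EP → P := fun z => B.act (c.symm z.2) ((oneChart EG G).symm z.1) with hF
  set W : Set (EG × EP) := (oneChart EG G).target ×ˢ c.target with hW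
  have hcp : c.symm y₀ = p := extChartAt_to_inv p
  have hu1 : (oneChart EG G).symm u₀ = 1 := oneChart_symm_one
  have hWo : IsOpen W := (isOpen_extChartAt_target (1 : G)).prod (isOpen_extChartAt_target p)
  have hz : (u₀, y₀) ∈ W := ⟨oneChart_one_mem, mem_extChartAt_target p⟩
  have ha : ContMDiffOn 𝓘(ℝ, EG × EP) 𝓘(ℝ, EP) ∞ (fun z : EG × EP => c.symm z.2) W :=
    (contMDiffOn_chart_symm p).comp contDiff_snd.contMDiff.contMDiffOn fun z hz => hz.2
  have hγ : ContMDiffOn 𝓘(ℝ, EG × EP) 𝓘(ℝ, EG) ∞ (fun z : EG × EP => (oneChart EG G).symm z.1) W :=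
    (contMDiffOn_chart_symm (1 : G)).comp contDiff_fst.contMDiff.contMDiffOn fun z hz => hz.1
  have hFs : ContMDiffOn 𝓘(ℝ, EG × EP) 𝓘(ℝ, EP) ∞ F W :=
    B.contMDiff_act.comp_contMDiffOn (ha.prodMk hγ)
  set ω₀ : EG × EP → (EG × EP) [⋀^Fin 1]→L[ℝ] EG :=
    pullback (E := EG × EP) (E' := EP) F Γ.form with hω
  have hωs : ContDiffOn ℝ ∞ ω₀ W := Γ.smooth.contDiffOn_pullback hWo hFs
  have hωd : DifferentiableAt ℝ ω₀ (u₀, y₀) :=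
    (hωs.contDiffAt (hWo.mem_nhds hz)).differentiableAt (by simp)
  -- The transformation rule in these coordinates.
  have hval : ∀ z ∈ W, ∀ v : EG × EP, ω₀ z (fun _ => v) =
      Ad EG ((oneChart EG G).symm z.1)⁻¹ (Γ.form (c.symm z.2) fun _ =>
        tangent (E := EP) (E' := EP) c.symm z.2 v.2) +
      maurerCartan EG ((oneChart EG G).symm z.1)
        (tangent (E := EG) (E' := EG) (oneChart EG G).symm z.1 v.1) := by
    intro z hz v
    have h1 := Γ.apply_tangent_act ((ha.contMDiffAt (hWo.mem_nhds hz)).mdifferentiableAt (by simp))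
      ((hγ.contMDiffAt (hWo.mem_nhds hz)).mdifferentiableAt (by simp)) v
    have h2 := tangent_comp (E := EG × EP) (E' := EP) (E'' := EP) (g := c.symm)
      (f := (Prod.snd : EG × EP → EP)) (x := z) (mdifferentiableAt_chart_symm hz.2)
      (contDiff_snd.contMDiff.mdifferentiable (by simp : (∞ : WithTop ℕ∞) ≠ 0) z)
    have h3 := tangent_comp (E := EG × EP) (E' := EG) (E'' := EG) (g := (oneChart EG G).symm)
      (f := (Prod.fst : EG × EP → EG)) (x := z) (mdifferentiableAt_chart_symm hz.1)
      (contDiff_fst.contMDiff.mdifferentiable (by simp : (∞ : WithTop ℕ∞) ≠ 0) z)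
    rw [tangent_eq_fderiv, fderiv_snd] at h2
    rw [tangent_eq_fderiv, fderiv_fst] at h3
    refine h1.trans ?_
    have h2' := DFunLike.congr_fun h2 v
    have h3' := DFunLike.congr_fun h3 v
    exact congrArg₂ (fun s t => Ad EG ((oneChart EG G).symm z.1)⁻¹ (Γ.form (c.symm z.2) fun _ => s) +
      maurerCartan EG ((oneChart EG G).symm z.1) t) h2' h3'
  have hT1 : tangent (E := EG) (E' := EG) (oneChart EG G).symm u₀ = ContinuousLinearMap.id ℝ EG :=
    tangent_chart_symm_self (1 : G)
  have hT2 : tangent (E := EP) (E' := EP) c.symm y₀ = ContinuousLinearMap.id ℝ EP :=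
    tangent_chart_symm_self p
  have hvA : ω₀ (u₀, y₀) (fun _ => ((A, 0) : EG × EP)) = A := by
    rw [hval _ hz]
    simp only [hu1, hT1, maurerCartan_one, map_zero]
    rw [(Γ.form (c.symm y₀)).map_coord_zero 0 rfl, map_zero, zero_add]
    rfl
  have hvY : ω₀ (u₀, y₀) (fun _ => ((0, Y) : EG × EP)) = Γ.form p fun _ => Y := by
    rw [hval _ hz]
    simp only [hu1, hT2, inv_one, Ad_one, map_zero, add_zero, hcp]
    rfl
  have hX : pullback (E := EG × EP) (E' := EP) F Γ.curvature (u₀, y₀) ![(A, 0), (0, Y)] =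
      Γ.curvature p ![B.fund p A, Y] := by
    have hFp : F (u₀, y₀) = p := by simp only [hF, hu1, B.act_one, hcp]
    have ht : ∀ v : EG × EP, tangent (E := EG × EP) (E' := EP) F (u₀, y₀) v =
        v.2 + B.fund p v.1 := by
      intro v
      have h1 := B.tangent_act ((ha.contMDiffAt (hWo.mem_nhds hz)).mdifferentiableAt (by simp))
        ((hγ.contMDiffAt (hWo.mem_nhds hz)).mdifferentiableAt (by simp)) v
      have h2 := tangent_comp (E := EG × EP) (E' := EP) (E'' := EP) (g := c.symm)
        (f := (Prod.snd : EG × EP → EP)) (x := (u₀, y₀)) (mdifferentiableAt_chart_symm hz.2)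
        (contDiff_snd.contMDiff.mdifferentiable (by simp : (∞ : WithTop ℕ∞) ≠ 0) _)
      have h3 := tangent_comp (E := EG × EP) (E' := EG) (E'' := EG) (g := (oneChart EG G).symm)
        (f := (Prod.fst : EG × EP → EG)) (x := (u₀, y₀)) (mdifferentiableAt_chart_symm hz.1)
        (contDiff_fst.contMDiff.mdifferentiable (by simp : (∞ : WithTop ℕ∞) ≠ 0) _)
      rw [tangent_eq_fderiv, fderiv_snd, hT2] at h2
      rw [tangent_eq_fderiv, fderiv_fst, hT1] at h3
      refine h1.trans ?_
      have h2' := DFunLike.congr_fun h2 v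
      have h3' := DFunLike.congr_fun h3 v
      have h4 : B.tangentAct (1 : G) p = ContinuousLinearMap.id ℝ EP := by
        have : (fun q : P => B.act q 1) = id := funext B.act_one
        rw [PrincipalBundle.tangentAct, this, tangent_id]
      have h5 : B.tangentAct ((oneChart EG G).symm u₀) (c.symm y₀) v.2 +
          B.fund (B.act (c.symm y₀) ((oneChart EG G).symm u₀))
            (maurerCartan EG ((oneChart EG G).symm u₀) v.1) = v.2 + B.fund p v.1 := by
        rw [hu1, hcp, h4, maurerCartan_one, B.act_one]
        rfl
      refine Eq.trans ?_ h5
      exact congrArg₂ (fun s t => B.tangentAct ((oneChart EG G).symm u₀) (c.symm y₀) s +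
        B.fund (B.act (c.symm y₀) ((oneChart EG G).symm u₀))
          (maurerCartan EG ((oneChart EG G).symm u₀) t)) h2' h3'
    rw [pullback_apply, hFp]
    congr 1
    funext i
    rw [ht]
    fin_cases i
    · simp
    · simp [PrincipalBundle.fund]
  have hpb : pullback (E := EG × EP) (E' := EP) F Γ.curvature (u₀, y₀) =
      extDeriv ω₀ (u₀, y₀) + (1 / 2 : ℝ) • wedge (lieBracket EG G) (ω₀ (u₀, y₀)) (ω₀ (u₀, y₀)) := by
    rw [hω, extDeriv_pullback_plot Γ.smooth hWo hFs hz]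
    have h := congrFun (pullback_wedge (E := EG × EP) (E' := EP) (lieBracket EG G) F Γ.form Γ.form)
      (u₀, y₀)
    rw [← h]
    rfl
  -- At y₀ the value on (0, Y) depends on u only through Ad(u⁻¹), whose derivative at 1 is minus the
  -- bracket.
  have hd1 : fderiv ℝ (fun z => ω₀ z fun _ => ((0, Y) : EG × EP)) (u₀, y₀) (A, 0) =
      -lieBracket EG G A (Γ.form p fun _ => Y) := by
    have hdiff : DifferentiableAt ℝ (fun z => ω₀ z fun _ => ((0, Y) : EG × EP)) (u₀, y₀) :=
      ((ContinuousAlternatingMap.apply ℝ (EG × EP) EG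
        (fun _ : Fin 1 => ((0, Y) : EG × EP))).differentiableAt).comp _ hωd
    have h1 : HasFDerivAt (fun u : EG => (u, y₀)) (ContinuousLinearMap.inl ℝ EG EP) u₀ :=
      hasFDerivAt_prodMk_left _ _
    have h2 := hdiff.hasFDerivAt.comp u₀ h1
    have h3 := (hasFDerivAt_Ad_inv_chart (EG := EG) (G := G)).clm_apply
      (hasFDerivAt_const (Γ.form p fun _ => Y) (oneChart EG G 1))
    have h4 : ((fun z => ω₀ z fun _ => ((0, Y) : EG × EP)) ∘ fun u : EG => (u, y₀)) =ᶠ[𝓝 u₀]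
        fun u => Ad EG ((oneChart EG G).symm u)⁻¹ (Γ.form p fun _ => Y) := by
      filter_upwards [(isOpen_extChartAt_target (I := 𝓘(ℝ, EG)) (1 : G)).mem_nhds
        oneChart_one_mem] with u hu
      simp only [Function.comp_apply]
      rw [hval (u, y₀) ⟨hu, hz.2⟩]
      simp only [hT2, map_zero, add_zero, hcp]
      rfl
    have h5 := DFunLike.congr_fun ((h3.congr_of_eventuallyEq h4).unique h2) A
    simp at h5
    exact h5.symm
  -- The value on (A, 0) at u = 1 is the constant A, by the fundamental vector axiom.
  have hd2 : fderiv ℝ (fun z => ω₀ z fun _ => ((A, 0) : EG × EP)) (u₀, y₀) (0, Y) = 0 := by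
    have hdiff : DifferentiableAt ℝ (fun z => ω₀ z fun _ => ((A, 0) : EG × EP)) (u₀, y₀) :=
      ((ContinuousAlternatingMap.apply ℝ (EG × EP) EG
        (fun _ : Fin 1 => ((A, 0) : EG × EP))).differentiableAt).comp _ hωd
    have h1 : HasFDerivAt (fun y : EP => (u₀, y)) (ContinuousLinearMap.inr ℝ EG EP) y₀ :=
      hasFDerivAt_prodMk_right _ _
    have h2 := hdiff.hasFDerivAt.comp y₀ h1
    have h4 : ((fun z => ω₀ z fun _ => ((A, 0) : EG × EP)) ∘ fun y : EP => (u₀, y)) =ᶠ[𝓝 y₀]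
        fun _ => A := by
      filter_upwards [(isOpen_extChartAt_target (I := 𝓘(ℝ, EP)) p).mem_nhds
        (mem_extChartAt_target p)] with y hy
      simp only [Function.comp_apply]
      rw [hval (u₀, y) ⟨hz.1, hy⟩]
      simp only [hT1, hu1, maurerCartan_one, map_zero]
      rw [(Γ.form (c.symm y)).map_coord_zero 0 rfl, map_zero, zero_add]
      rfl
    have h5 := DFunLike.congr_fun
      (((hasFDerivAt_const A y₀).congr_of_eventuallyEq h4).unique h2) Y
    simpa using h5.symm
  -- Now dΓ contributes -[A, Γ(Y)] and ½ [Γ ∧ Γ] contributes [A, Γ(Y)].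
  rw [← hX, hpb, ContinuousAlternatingMap.add_apply, ContinuousAlternatingMap.smul_apply,
    extDeriv_one_apply hωd, hd1, hd2, wedge_one_one_apply]
  simp only [Matrix.cons_val_zero, Matrix.cons_val_one, hvA, hvY]
  rw [lieBracket_swap (Γ.form p fun _ => Y) A, sub_zero, sub_neg_eq_add, ← two_smul ℝ, smul_smul]
  norm_num

theorem isTensorial_curvature (Γ : Connection B) : IsTensorial B Γ.curvature where
  smooth := isSmoothForm_curvForm Γ.smooth
  horizontal p X h := by
    obtain ⟨i, A, hi⟩ := h
    have hX : X = ![X 0, X 1] := by funext j; fin_cases j <;> rfl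
    fin_cases i
    · rw [hX, show X 0 = B.fund p A from hi, Γ.curvature_fund]
    · have h0 := (Γ.curvature p).toAlternatingMap.map_swap ![X 1, X 0] (i := 0) (j := 1) (by decide)
      have h1 : (![X 1, X 0] ∘ Equiv.swap (0 : Fin 2) 1) = X := by
        funext j
        fin_cases j <;> simp
      rw [h1] at h0
      refine h0.trans ?_
      rw [neg_eq_zero, show X 1 = B.fund p A from hi]
      exact Γ.curvature_fund p A _
  equivariant g p X := by
    have h1 := pullback_curvForm (G := G) (B.contMDiff_act_left g) Γ.smooth
    rw [Γ.pullback_act, curvForm_Ad _ Γ.smooth] at h1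
    exact DFunLike.congr_fun (congrFun h1 p) X

theorem curvature_smul (φ : GaugeTransformation B) (Γ : Connection B) :
    (φ • Γ).curvature = GaugeTransformation.push φ Γ.curvature :=
  (pullback_curvForm (G := G) φ⁻¹.toDiffeo.contMDiff Γ.smooth).symm

/-- The curvature as an element of `Ω²(M, Ad P)`. -/
def curvatureAd (Γ : Connection B) : AdForm B 2 := ⟨Γ.curvature, Γ.isTensorial_curvature⟩

/-- The expression `dα + [Γ ∧ α]`. -/
def covForm (Γ : Connection B) (α : AdForm B 1) : P → EP [⋀^Fin 2]→L[ℝ] EG :=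
  extD α.form + fun p => wedge (lieBracket EG G) (Γ.form p) (α.form p)

theorem curvature_translate (Γ : Connection B) (α : AdForm B 1) :
    (Γ.translate α).curvature = Γ.curvature + Γ.covForm α +
      (1 / 2 : ℝ) • fun p => wedge (lieBracket EG G) (α.form p) (α.form p) :=
  curvForm_add Γ.smooth α.smooth

theorem covForm_smul (Γ : Connection B) (c : ℝ) (α : AdForm B 1) :
    Γ.covForm (c • α) = c • Γ.covForm α := by
  rw [covForm, covForm, AdForm.form_smul, extD_smul, smul_add]
  congr 1
  funext p
  exact (wedgeCLM EP 1 1 (lieBracket EG G) (Γ.form p)).map_smul c (α.form p)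

/-- The covariant exterior derivative `d_Γ α = dα + [Γ ∧ α]` on `Ω¹(M, Ad P)`. -/
def covD (Γ : Connection B) (α : AdForm B 1) : AdForm B 2 :=
  ⟨Γ.covForm α, by
    -- Tensoriality without computation: d_Γ α is half the difference of the curvatures of Γ + α and
    -- Γ - α, in which the quadratic terms cancel.
    have h : Γ.covForm α = (1 / 2 : ℝ) • ((Γ.translate α).curvature +
        (-1 : ℝ) • (Γ.translate ((-1 : ℝ) • α)).curvature) := by
      rw [curvature_translate, curvature_translate, covForm_smul]
      have h2 : (fun p => wedge (lieBracket EG G) (((-1 : ℝ) • α).form p) (((-1 : ℝ) • α).form p)) =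
          fun p => wedge (lieBracket EG G) (α.form p) (α.form p) := by
        funext p
        simp only [AdForm.form_smul, Pi.smul_apply]
        rw [← wedgeCLM_apply, map_smul, map_smul, smul_apply, smul_smul]
        simp only [mul_neg, mul_one, neg_neg, one_smul, wedgeCLM_apply]
      rw [h2]
      module
    rw [h]
    exact (tensorialSubmodule B 2).smul_mem _ ((tensorialSubmodule B 2).add_mem
      (isTensorial_curvature _) ((tensorialSubmodule B 2).smul_mem _ (isTensorial_curvature _)))⟩

/-- The bracket `[α ∧ β]` of one-forms. -/
def bracketForm (α β : AdForm B 1) : AdForm B 2 :=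
  ⟨fun p => wedge (lieBracket EG G) (α.form p) (β.form p),
    { smooth := α.smooth.wedge _ β.smooth
      horizontal := fun p => wedge_horizontal (K := {Z | ∃ A, Z = B.fund p A}) _
        (α.isTensorial.horizontal p) (β.isTensorial.horizontal p)
      equivariant := fun g p X => by
        have h1 := pullback_wedge (E := EP) (E' := EP) (lieBracket EG G) (fun p => B.act p g)
          α.form β.form
        rw [α.isTensorial.pullback_act, β.isTensorial.pullback_act] at h1
        refine (DFunLike.congr_fun (congrFun h1 p) X).trans ?_
        simp only
        rw [← compContinuousAlternatingMap_wedge (L := Ad EG g⁻¹) (b := lieBracket EG G)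
          (fun v w => Ad_lieBracket g⁻¹ v w)]
        rfl }⟩

theorem curvatureAd_translate (Γ : Connection B) (α : AdForm B 1) :
    (Γ.translate α).curvatureAd = Γ.curvatureAd + Γ.covD α + (1 / 2 : ℝ) • bracketForm α α :=
  Subtype.ext (Γ.curvature_translate α)

end Connection

/-- The wedge product of a tensorial form with a real form that is pulled back from the base. -/
theorem IsTensorial.wedge_pullback {η : P → EP [⋀^Fin k]→L[ℝ] EG} (hη : IsTensorial B η)
    [IsManifold 𝓘(ℝ, EM) ∞ M] {τ : M → EM [⋀^Fin l]→L[ℝ] ℝ} (hτ : IsSmoothForm τ) :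
    IsTensorial B fun p => wedge (ContinuousLinearMap.lsmul ℝ ℝ).flip (η p)
      (pullback (E := EP) (E' := EM) B.proj τ p) where
  smooth := hη.smooth.wedge _ (hτ.pullback B.contMDiff_proj)
  horizontal p := wedge_horizontal (K := {Z | ∃ A, Z = B.fund p A}) _ (hη.horizontal p)
    ((isBasic_pullback_proj (B := B) hτ).horizontal p)
  equivariant g p X := by
    have h1 := pullback_wedge (E := EP) (E' := EP)
      (ContinuousLinearMap.lsmul ℝ ℝ : ℝ →L[ℝ] EG →L[ℝ] EG).flip (fun p => B.act p g) η
      (pullback (E := EP) (E' := EM) B.proj τ)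
    rw [hη.pullback_act, (isBasic_pullback_proj (B := B) hτ).pullback_act] at h1
    refine (DFunLike.congr_fun (congrFun h1 p) X).trans ?_
    have h2 := compContinuousAlternatingMap_wedge (L := Ad EG g⁻¹) (L₁ := Ad EG g⁻¹)
      (L₂ := ContinuousLinearMap.id ℝ ℝ)
      (b := (ContinuousLinearMap.lsmul ℝ ℝ : ℝ →L[ℝ] EG →L[ℝ] EG).flip)
      (b' := (ContinuousLinearMap.lsmul ℝ ℝ : ℝ →L[ℝ] EG →L[ℝ] EG).flip)
      (fun v w => by simp) (η p) (pullback (E := EP) (E' := EM) B.proj τ p)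
    exact (DFunLike.congr_fun h2 X).symm

end Curvature

/-! ### Integration of top-degree forms -/

section IntegralAux

open MeasureTheory

variable {E : Type*} [NormedAddCommGroup E] [NormedSpace ℝ E] [FiniteDimensional ℝ E]
  [MeasurableSpace E] [BorelSpace E] {μ : Measure E} [μ.IsAddHaarMeasure]

theorem integrableOn_of_eq_zero_off_compact {f : E → ℝ} {U K : Set E} (hK : IsCompact K)
    (hU : MeasurableSet U) (hKU : K ⊆ U) (hf : ContinuousOn f U) (h0 : ∀ y ∈ U, y ∉ K → f y = 0) : IntegrableOn f U μ := by
  have h1 : IntegrableOn f K μ := (hf.mono hKU).integrableOn_compact hK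
  refine h1.of_forall_sdiff_eq_zero hU fun y hy => h0 y hy.1 hy.2

/-- The integral of a derivative of a compactly supported function, multiplied by a locally constant
function, vanishes. -/
theorem setIntegral_mul_fderiv_eq_zero {f s : E → ℝ} {U K : Set E} (hU : IsOpen U)
    (hK : IsCompact K) (hKU : K ⊆ U) (hf : ContDiffOn ℝ ∞ f U) (h0 : ∀ y ∈ U, y ∉ K → f y = 0)
    (hs : ∀ y ∈ U, ∀ᶠ z in 𝓝 y, s z = s y) (v : E) : ∫ y in U, s y * fderiv ℝ f y v ∂μ = 0 := by
  -- Extended by zero, s f is smooth on all of E, although s itself need not extend: s is locally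
  -- constant on U and f vanishes off a compact subset of U.
  set F : E → ℝ := U.indicator fun y => s y * f y with hF
  have hFU : ∀ y ∈ U, F =ᶠ[𝓝 y] fun z => s y * f z := by
    intro y hy
    filter_upwards [hU.mem_nhds hy, hs y hy] with z hz hz'
    rw [hF, indicator_of_mem hz, hz']
  have hFK : ∀ y ∉ K, F =ᶠ[𝓝 y] fun _ => 0 := by
    intro y hy
    filter_upwards [hK.isClosed.isOpen_compl.mem_nhds hy] with z hz
    by_cases hzU : z ∈ U
    · rw [hF, indicator_of_mem hzU, h0 z hzU hz, mul_zero]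
    · rw [hF, indicator_of_notMem hzU]
  have hFs : ContDiff ℝ ∞ F := by
    rw [contDiff_iff_contDiffAt]
    intro y
    by_cases hy : y ∈ U
    · exact ((hf.contDiffAt (hU.mem_nhds hy)).const_smul (s y)).congr_of_eventuallyEq (hFU y hy)
    · exact contDiffAt_const.congr_of_eventuallyEq (hFK y fun h => hy (hKU h))
  have hsupp : HasCompactSupport F := HasCompactSupport.intro hK fun y hy => (hFK y hy).self_of_nhds
  have hd : Continuous fun y => fderiv ℝ F y v :=
    (hFs.continuous_fderiv (by simp)).clm_apply continuous_const
  have hdsupp : HasCompactSupport fun y => fderiv ℝ F y v :=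
    HasCompactSupport.intro hK fun y hy => by
      rw [(hFK y hy).fderiv_eq]; simp
  have h1 : ∫ y in U, s y * fderiv ℝ f y v ∂μ = ∫ y in U, fderiv ℝ F y v ∂μ := by
    refine setIntegral_congr_fun hU.measurableSet fun y hy => ?_
    have hfd : DifferentiableAt ℝ f y :=
      (hf.contDiffAt (hU.mem_nhds hy)).differentiableAt (by simp)
    rw [(hFU y hy).fderiv_eq, fderiv_const_mul hfd]
    simp
  have h2 : ∫ y in U, fderiv ℝ F y v ∂μ = ∫ y, fderiv ℝ F y v ∂μ := by
    refine setIntegral_eq_integral_of_forall_compl_eq_zero fun y hy => ?_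
    rw [(hFK y fun h => hy (hKU h)).fderiv_eq]
    simp
  -- Integration by parts against the constant function 1.
  have h3 := integral_mul_fderiv_eq_neg_fderiv_mul_of_integrable (μ := μ) (f := fun _ => (1 : ℝ))
    (g := F) (v := v) (by simp)
    (by simpa using hd.integrable_of_hasCompactSupport hdsupp)
    (by simpa using hFs.continuous.integrable_of_hasCompactSupport hsupp)
    (fun x _ => differentiableAt_const _) (fun x _ => hFs.differentiable (by simp) x)
  rw [h1, h2]
  simpa using h3

end IntegralAux

/-! ### Chart integrals, independence of the chart, Stokes' theorem, positivity and continuity. -/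

section Integral

open MeasureTheory

variable {n : ℕ} {M : Type*} [TopologicalSpace M]
  [ChartedSpace (EuclideanSpace ℝ (Fin (2 * n))) M]

local notation "𝓔(" n ")" => EuclideanSpace ℝ (Fin (2 * n))

theorem topCoeff_comp (η : 𝓔(n) [⋀^Fin (2 * n)]→L[ℝ] ℝ) (A : 𝓔(n) →L[ℝ] 𝓔(n)) :
    topCoeff (η.compContinuousLinearMap A) = LinearMap.det (A : 𝓔(n) →ₗ[ℝ] 𝓔(n)) * topCoeff η := by
  rw [topForm_comp (by simp) η A]
  rfl

theorem eq_zero_of_topCoeff_eq_zero {η : 𝓔(n) [⋀^Fin (2 * n)]→L[ℝ] ℝ} (h : topCoeff η = 0) :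
    η = 0 := by
  have h1 := η.toAlternatingMap.eq_smul_basis_det (EuclideanSpace.basisFun (Fin (2 * n)) ℝ).toBasis
  have h2 : η.toAlternatingMap (EuclideanSpace.basisFun (Fin (2 * n)) ℝ).toBasis = 0 := by
    rw [← h]
    change η _ = η _
    congr 1
    funext j
    simp
  rw [h2, zero_smul] at h1
  ext X
  exact DFunLike.congr_fun h1 X

variable (n) in
/-- The coefficient as a continuous linear map. -/
def topCoeffCLM : (𝓔(n) [⋀^Fin (2 * n)]→L[ℝ] ℝ) →L[ℝ] ℝ :=
  ContinuousAlternatingMap.apply ℝ _ ℝ fun j => EuclideanSpace.single j 1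

variable [IsManifold 𝓘(ℝ, 𝓔(n)) ∞ M]

theorem det_tangent_chart_symm_ne_zero (i : M) {y : 𝓔(n)} (hy : y ∈ (extChartAt 𝓘(ℝ, 𝓔(n)) i).target) :
    LinearMap.det (tangent (E := 𝓔(n)) (E' := 𝓔(n)) (extChartAt 𝓘(ℝ, 𝓔(n)) i).symm y : 𝓔(n) →ₗ[ℝ] 𝓔(n)) ≠ 0 := by
  have h := congrArg (fun A : 𝓔(n) →L[ℝ] 𝓔(n) => LinearMap.det (A : 𝓔(n) →ₗ[ℝ] 𝓔(n)))
    (tangent_chart_comp_symm (E := 𝓔(n)) hy)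
  simp only [ContinuousLinearMap.toLinearMap_comp, LinearMap.det_comp] at h
  exact right_ne_zero_of_mul_eq_one (h.trans LinearMap.det_id)

variable (σ : SymplecticForm 𝓔(n) M)

/-- The volume form `σ^n`. -/
def volForm (m : M) : 𝓔(n) [⋀^Fin (2 * n)]→L[ℝ] ℝ := wedgePow (σ.form m) n

theorem volForm_ne_zero (m : M) : volForm σ m ≠ 0 :=
  wedgePow_ne_zero (by simp) (σ.nondegenerate m)

theorem isSmoothForm_volForm : IsSmoothForm (volForm σ) := σ.smooth.wedgePow n

/-- The differential of an inverse chart is invertible and σ^n vanishes nowhere. Hence the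
orientation sign in the integral is ±1 on the whole chart target. -/
theorem topCoeff_volForm_ne_zero (i : M) {y : 𝓔(n)} (hy : y ∈ (extChartAt 𝓘(ℝ, 𝓔(n)) i).target) :
    topCoeff (chartRep i (volForm σ) y) ≠ 0 := by
  rw [chartRep, pullback, topCoeff_comp]
  exact mul_ne_zero (det_tangent_chart_symm_ne_zero i hy)
    fun h => volForm_ne_zero σ _ (eq_zero_of_topCoeff_eq_zero h)

/-- The sign that compares the orientation of a chart with that of the symplectic form. -/
def orientSign (i : M) (y : 𝓔(n)) : ℝ := (SignType.sign (topCoeff (chartRep i (volForm σ) y)) : ℝ)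

theorem continuousOn_topCoeff_chartRep {τ : M → 𝓔(n) [⋀^Fin (2 * n)]→L[ℝ] ℝ} (hτ : IsSmoothForm τ)
    (i : M) : ContinuousOn (fun y => topCoeff (chartRep i τ y)) (extChartAt 𝓘(ℝ, 𝓔(n)) i).target :=
  (topCoeffCLM n).continuous.comp_continuousOn (hτ i).continuousOn

/-- The sign of a continuous function is locally constant where the function does not vanish.
Orientability thus needs no oriented atlas: the sign passes through derivatives as a constant. -/
theorem eventually_orientSign_eq (i : M) {y : 𝓔(n)} (hy : y ∈ (extChartAt 𝓘(ℝ, 𝓔(n)) i).target) :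
    ∀ᶠ z in 𝓝 y, orientSign σ i z = orientSign σ i y := by
  have h1 : ContinuousAt (fun y => topCoeff (chartRep i (volForm σ) y)) y :=
    (continuousOn_topCoeff_chartRep (isSmoothForm_volForm σ) i).continuousAt
      ((isOpen_extChartAt_target i).mem_nhds hy)
  have h2 := (continuousAt_sign_of_ne_zero (topCoeff_volForm_ne_zero σ i hy)).comp
    (f := fun y => topCoeff (chartRep i (volForm σ) y)) h1
  have h3 := h2.eventually (isOpen_discrete {SignType.sign (topCoeff (chartRep i (volForm σ) y))}
    |>.mem_nhds rfl)
  filter_upwards [h3] with z hz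
  rw [orientSign, orientSign]
  exact congrArg _ hz

theorem continuousOn_orientSign (i : M) :
    ContinuousOn (orientSign σ i) (extChartAt 𝓘(ℝ, 𝓔(n)) i).target := fun y hy =>
  (continuousAt_const.congr ((eventually_orientSign_eq σ i hy).mono fun _ h => h.symm)
    : ContinuousAt (orientSign σ i) y).continuousWithinAt

theorem abs_orientSign_le (i : M) (y : 𝓔(n)) : |orientSign σ i y| ≤ 1 := by
  rw [orientSign]
  rcases SignType.sign (topCoeff (chartRep i (volForm σ) y)) with _ | _ | _ <;> simp

/-- The integral of a form over a chart domain. -/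
def chartIntegral (i : M) (τ : M → 𝓔(n) [⋀^Fin (2 * n)]→L[ℝ] ℝ) : ℝ :=
  ∫ y in (extChartAt 𝓘(ℝ, 𝓔(n)) i).target, orientSign σ i y * topCoeff (chartRep i τ y)

/-- The form `η` vanishes outside a compact subset of the domain of the chart at `i`. -/
def SupportedInChart {k : ℕ} (i : M) (η : M → 𝓔(n) [⋀^Fin k]→L[ℝ] ℝ) : Prop :=
  ∃ K ⊆ (extChartAt 𝓘(ℝ, 𝓔(n)) i).source, IsCompact K ∧ ∀ m ∉ K, η m = 0

theorem SupportedInChart.exists_compact {k : ℕ} {i : M} {η : M → 𝓔(n) [⋀^Fin k]→L[ℝ] ℝ}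
    (h : SupportedInChart i η) : ∃ K ⊆ (extChartAt 𝓘(ℝ, 𝓔(n)) i).target, IsCompact K ∧
      ∀ y ∈ (extChartAt 𝓘(ℝ, 𝓔(n)) i).target, y ∉ K → chartRep i η y = 0 := by
  obtain ⟨K, hK, hKc, h0⟩ := h
  refine ⟨extChartAt 𝓘(ℝ, 𝓔(n)) i '' K, ?_, hKc.image_of_continuousOn
    ((continuousOn_extChartAt i).mono hK), ?_⟩
  · rintro _ ⟨m, hm, rfl⟩
    exact (extChartAt 𝓘(ℝ, 𝓔(n)) i).map_source (hK hm)
  · intro y hy hyK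
    have h1 : (extChartAt 𝓘(ℝ, 𝓔(n)) i).symm y ∉ K := fun h =>
      hyK ⟨_, h, (extChartAt 𝓘(ℝ, 𝓔(n)) i).right_inv hy⟩
    rw [chartRep, pullback, h0 _ h1]
    rfl

theorem integrableOn_chart {i : M} {τ : M → 𝓔(n) [⋀^Fin (2 * n)]→L[ℝ] ℝ} (hτ : IsSmoothForm τ)
    (h : SupportedInChart i τ) : IntegrableOn
      (fun y => orientSign σ i y * topCoeff (chartRep i τ y)) (extChartAt 𝓘(ℝ, 𝓔(n)) i).target := by
  obtain ⟨K, hKU, hK, h0⟩ := h.exists_compact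
  refine integrableOn_of_eq_zero_off_compact hK (isOpen_extChartAt_target i).measurableSet hKU
    ((continuousOn_orientSign σ i).mul (continuousOn_topCoeff_chartRep hτ i)) fun y hy hyK => ?_
  rw [h0 y hy hyK]
  exact mul_zero _

theorem chartIntegral_add {i : M} {τ τ' : M → 𝓔(n) [⋀^Fin (2 * n)]→L[ℝ] ℝ} (hτ : IsSmoothForm τ)
    (hτ' : IsSmoothForm τ') (h : SupportedInChart i τ) (h' : SupportedInChart i τ') :
    chartIntegral σ i (τ + τ') = chartIntegral σ i τ + chartIntegral σ i τ' := by
  rw [chartIntegral, chartIntegral, chartIntegral, ← integral_add (integrableOn_chart σ hτ h)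
    (integrableOn_chart σ hτ' h')]
  refine integral_congr_ae (Eventually.of_forall fun y => ?_)
  exact mul_add _ _ _

theorem chartIntegral_smul (i : M) (c : ℝ) (τ : M → 𝓔(n) [⋀^Fin (2 * n)]→L[ℝ] ℝ) :
    chartIntegral σ i (c • τ) = c * chartIntegral σ i τ := by
  rw [chartIntegral, chartIntegral, ← integral_const_mul]
  refine integral_congr_ae (Eventually.of_forall fun y => ?_)
  change orientSign σ i y * (c * topCoeff (chartRep i τ y)) = _
  ring

/-- The integral over a chart domain does not depend on the chart. -/
theorem chartIntegral_eq (i j : M) {τ : M → 𝓔(n) [⋀^Fin (2 * n)]→L[ℝ] ℝ}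
    (hi : ∀ m ∉ (extChartAt 𝓘(ℝ, 𝓔(n)) i).source, τ m = 0)
    (hj : ∀ m ∉ (extChartAt 𝓘(ℝ, 𝓔(n)) j).source, τ m = 0) :
    chartIntegral σ i τ = chartIntegral σ j τ := by
  set c := extChartAt 𝓘(ℝ, 𝓔(n)) i with hc
  set d := extChartAt 𝓘(ℝ, 𝓔(n)) j with hd
  set O := c.source ∩ d.source with hO
  have hOo : IsOpen O := (isOpen_extChartAt_source i).inter (isOpen_extChartAt_source j)
  set Vi := c.target ∩ c.symm ⁻¹' O with hVi
  have hVo : IsOpen Vi := isOpen_chart_target_inter (EM := 𝓔(n)) hOo i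
  set Φ : 𝓔(n) → 𝓔(n) := d ∘ c.symm with hΦ
  have hcd : ∀ y ∈ Vi, c.symm y ∈ d.source := fun y hy => hy.2.2
  have hΦV : Φ '' Vi = d.target ∩ d.symm ⁻¹' O := by
    ext z
    constructor
    · rintro ⟨y, hy, rfl⟩
      refine ⟨d.map_source (hcd y hy), ?_⟩
      simp only [hΦ, mem_preimage, Function.comp_apply, d.left_inv (hcd y hy)]
      exact hy.2
    · rintro ⟨hz, hz'⟩
      refine ⟨c (d.symm z), ⟨c.map_source hz'.1, ?_⟩, ?_⟩
      · rw [mem_preimage, c.left_inv hz'.1]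
        exact hz'
      · simp only [hΦ, Function.comp_apply, c.left_inv hz'.1, d.right_inv hz]
  have hm : ∀ y ∈ Vi, MDifferentiableAt 𝓘(ℝ, 𝓔(n)) 𝓘(ℝ, 𝓔(n)) Φ y := fun y hy =>
    (mdifferentiableAt_chart (hcd y hy)).comp y (mdifferentiableAt_chart_symm hy.1)
  have hder : ∀ y ∈ Vi, HasFDerivWithinAt Φ (fderiv ℝ Φ y) Vi y := fun y hy =>
    ((mdifferentiableAt_iff_differentiableAt.1 (hm y hy)).hasFDerivAt).hasFDerivWithinAt
  have hinj : InjOn Φ Vi := by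
    intro y hy z hz h
    have h1 : c.symm y = c.symm z := d.injOn (hcd y hy) (hcd z hz) h
    exact c.symm.injOn hy.1 hz.1 h1
  -- Every top-degree form, σ^n included, changes by the determinant of the transition map.
  have hrep : ∀ (ρ : M → 𝓔(n) [⋀^Fin (2 * n)]→L[ℝ] ℝ), ∀ y ∈ Vi, topCoeff (chartRep i ρ y) =
      (fderiv ℝ Φ y).det * topCoeff (chartRep j ρ (Φ y)) := by
    intro ρ y hy
    have h1 : c.symm =ᶠ[𝓝 y] d.symm ∘ Φ := by
      filter_upwards [hVo.mem_nhds hy] with z hz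
      exact (d.left_inv (hcd z hz)).symm
    have h2 : chartRep i ρ y = (chartRep j ρ (Φ y)).compContinuousLinearMap (fderiv ℝ Φ y) := by
      rw [chartRep, pullback_congr h1, pullback_comp_apply (g := d.symm) (f := Φ)
        (mdifferentiableAt_chart_symm (d.map_source (hcd y hy))) (hm y hy)]
      rw [pullback, tangent_eq_fderiv]
      rfl
    rw [h2, topCoeff_comp]
  -- Outside the overlap O the form vanishes, so only the part of the chart target lying over O
  -- matters.
  have hset : ∀ (i' : M), (∀ m ∉ (extChartAt 𝓘(ℝ, 𝓔(n)) i').source, τ m = 0) → O ⊆ (extChartAt 𝓘(ℝ, 𝓔(n)) i').source →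
      chartIntegral σ i' τ = ∫ y in (extChartAt 𝓘(ℝ, 𝓔(n)) i').target ∩
        (extChartAt 𝓘(ℝ, 𝓔(n)) i').symm ⁻¹' O, orientSign σ i' y * topCoeff (chartRep i' τ y) := by
    intro i' hi' hOi
    refine setIntegral_eq_of_subset_of_forall_sdiff_eq_zero
      (isOpen_extChartAt_target (I := 𝓘(ℝ, 𝓔(n))) i').measurableSet inter_subset_left ?_
    rintro y ⟨hy, hy'⟩
    have h0 : τ ((extChartAt 𝓘(ℝ, 𝓔(n)) i').symm y) = 0 := by
      by_cases h1 : (extChartAt 𝓘(ℝ, 𝓔(n)) i').symm y ∈ c.source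
      · by_cases h2 : (extChartAt 𝓘(ℝ, 𝓔(n)) i').symm y ∈ d.source
        · exact absurd ⟨hy, h1, h2⟩ hy'
        · exact hj _ h2
      · exact hi _ h1
    rw [chartRep, pullback, h0]
    exact mul_zero _
  rw [hset i hi inter_subset_left, hset j hj inter_subset_right, ← hd, ← hΦV,
    integral_image_eq_integral_abs_det_fderiv_smul volume hVo.measurableSet hder hinj]
  refine setIntegral_congr_fun hVo.measurableSet fun y hy => ?_
  -- Otherwise the coefficient of σ^n would vanish in the chart at i.
  have hdet : (fderiv ℝ Φ y).det ≠ 0 := by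
    intro h
    have h1 := hrep (volForm σ) y hy
    rw [h, zero_mul] at h1
    exact topCoeff_volForm_ne_zero σ i hy.1 h1
  -- The determinant from τ and its sign from σ^n multiply to the absolute value required by the
  -- change of variables.
  simp only [orientSign, hrep _ y hy, sign_mul, smul_eq_mul, SignType.coe_mul]
  rcases lt_or_gt_of_ne hdet with h | h
  · rw [sign_neg h, abs_of_neg h]
    simp only [SignType.coe_neg_one]
    ring
  · rw [sign_pos h, abs_of_pos h]
    simp only [SignType.coe_one]
    ring

variable [T2Space M] [CompactSpace M]

theorem SupportedInChart.of_tsupport {k : ℕ} {i : M} {f : M → ℝ}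
    (hf : tsupport f ⊆ (extChartAt 𝓘(ℝ, 𝓔(n)) i).source) (η : M → 𝓔(n) [⋀^Fin k]→L[ℝ] ℝ) :
    SupportedInChart i (fun m => f m • η m) :=
  ⟨tsupport f, hf, (isClosed_tsupport f).isCompact, fun m hm => by
    beta_reduce
    rw [image_eq_zero_of_notMem_tsupport hm, zero_smul]⟩

theorem chartPartition_tsupport (i : M) :
    tsupport (chartPartition 𝓔(n) M i) ⊆ (extChartAt 𝓘(ℝ, 𝓔(n)) i).source := by
  rw [extChartAt_source]
  exact Classical.choose_spec
    (SmoothPartitionOfUnity.exists_isSubordinate_chartAt_source 𝓘(ℝ, 𝓔(n)) M) i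

variable (n M) in
/-- The indices of the members of the partition of unity that do not vanish. -/
def partitionIndex : Finset M :=
  ((chartPartition 𝓔(n) M).locallyFinite.finite_nonempty_of_compact).toFinset

theorem chartPartition_eq_zero {i : M} (hi : i ∉ partitionIndex n M) (m : M) :
    chartPartition 𝓔(n) M i m = 0 := by
  by_contra h
  exact hi ((Set.Finite.mem_toFinset _).2 ⟨m, h⟩)

theorem sum_chartPartition (m : M) : ∑ i ∈ partitionIndex n M, chartPartition 𝓔(n) M i m = 1 := by
  rw [← (chartPartition 𝓔(n) M).sum_eq_one (mem_univ m)]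
  refine (finsum_eq_sum_of_support_subset _ fun i hi => ?_).symm
  by_contra h
  exact hi (chartPartition_eq_zero h m)

theorem integral_eq_sum (τ : M → 𝓔(n) [⋀^Fin (2 * n)]→L[ℝ] ℝ) : integral σ τ =
    ∑ i ∈ partitionIndex n M, chartIntegral σ i fun m => chartPartition 𝓔(n) M i m • τ m := by
  have h1 : ∀ i : M, chartIntegral σ i (fun m => chartPartition 𝓔(n) M i m • τ m) =
      ∫ y in (extChartAt 𝓘(ℝ, 𝓔(n)) i).target, chartPartition 𝓔(n) M i ((extChartAt 𝓘(ℝ, 𝓔(n)) i).symm y) *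
        (SignType.sign (topCoeff (chartRep i (fun m => wedgePow (σ.form m) n) y)) : ℝ) *
        topCoeff (chartRep i τ y) := by
    intro i
    refine integral_congr_ae (Eventually.of_forall fun y => ?_)
    change orientSign σ i y * (chartPartition 𝓔(n) M i ((extChartAt 𝓘(ℝ, 𝓔(n)) i).symm y) *
      topCoeff (chartRep i τ y)) = _ * orientSign σ i y * _
    ring
  rw [integral]
  simp only [← h1]
  refine finsum_eq_sum_of_support_subset _ fun i hi => ?_
  by_contra h
  refine hi ?_
  have h2 : (fun m => chartPartition 𝓔(n) M i m • τ m) = (0 : ℝ) • τ := by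
    funext m
    rw [chartPartition_eq_zero h m]
    rfl
  beta_reduce
  rw [h2, chartIntegral_smul, zero_mul]

theorem IsSmoothForm.partition_smul {k : ℕ} {η : M → 𝓔(n) [⋀^Fin k]→L[ℝ] ℝ} (hη : IsSmoothForm η)
    (i : M) : IsSmoothForm fun m => chartPartition 𝓔(n) M i m • η m :=
  IsSmoothForm.bilin (ContinuousLinearMap.lsmul ℝ ℝ) (chartPartition 𝓔(n) M i).contMDiff hη

theorem sum_partition_smul {k : ℕ} (η : M → 𝓔(n) [⋀^Fin k]→L[ℝ] ℝ) :
    ∑ i ∈ partitionIndex n M, (fun m => chartPartition 𝓔(n) M i m • η m) = η := by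
  funext m
  rw [Finset.sum_apply, ← Finset.sum_smul, sum_chartPartition, one_smul]

theorem integral_add {τ τ' : M → 𝓔(n) [⋀^Fin (2 * n)]→L[ℝ] ℝ} (hτ : IsSmoothForm τ)
    (hτ' : IsSmoothForm τ') : integral σ (τ + τ') = integral σ τ + integral σ τ' := by
  rw [integral_eq_sum, integral_eq_sum, integral_eq_sum, ← Finset.sum_add_distrib]
  refine Finset.sum_congr rfl fun i _ => ?_
  rw [← chartIntegral_add σ (hτ.partition_smul i) (hτ'.partition_smul i)
    (.of_tsupport (chartPartition_tsupport i) _) (.of_tsupport (chartPartition_tsupport i) _)]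
  congr 1
  funext m
  simp

theorem integral_smul (c : ℝ) (τ : M → 𝓔(n) [⋀^Fin (2 * n)]→L[ℝ] ℝ) :
    integral σ (c • τ) = c * integral σ τ := by
  rw [integral_eq_sum, integral_eq_sum, Finset.mul_sum]
  refine Finset.sum_congr rfl fun i _ => ?_
  rw [← chartIntegral_smul]
  congr 1
  funext m
  simp [smul_comm c]

theorem integral_zero : integral σ (0 : M → 𝓔(n) [⋀^Fin (2 * n)]→L[ℝ] ℝ) = 0 := by
  have h := integral_smul σ 0 (0 : M → 𝓔(n) [⋀^Fin (2 * n)]→L[ℝ] ℝ)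
  rwa [zero_smul, zero_mul] at h

theorem integral_sum {ι : Type*} (t : Finset ι) {τ : ι → M → 𝓔(n) [⋀^Fin (2 * n)]→L[ℝ] ℝ}
    (hτ : ∀ i ∈ t, IsSmoothForm (τ i)) :
    integral σ (∑ i ∈ t, τ i) = ∑ i ∈ t, integral σ (τ i) := by
  classical
  induction t using Finset.induction_on with
  | empty => exact integral_zero σ
  | insert a t ha ih =>
    rw [Finset.sum_insert ha, Finset.sum_insert ha, integral_add σ (hτ a (by simp))
      (IsSmoothForm.sum t fun i hi => hτ i (by simp [hi])), ih fun i hi => hτ i (by simp [hi])]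

/-- Each piece of the partition can be integrated in the chart j instead of its own, where the
pieces add up to τ again. This frees the integral from the chosen partition of unity. -/
theorem integral_eq_chartIntegral {j : M} {τ : M → 𝓔(n) [⋀^Fin (2 * n)]→L[ℝ] ℝ}
    (hτ : IsSmoothForm τ) (hj : SupportedInChart j τ) : integral σ τ = chartIntegral σ j τ := by
  classical
  obtain ⟨K, hK, hKc, h0⟩ := hj
  have hsj : ∀ i, SupportedInChart j fun m => chartPartition 𝓔(n) M i m • τ m := fun i =>
    ⟨K, hK, hKc, fun m hm => by beta_reduce; rw [h0 m hm, smul_zero]⟩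
  have h1 : ∀ i, chartIntegral σ i (fun m => chartPartition 𝓔(n) M i m • τ m) =
      chartIntegral σ j (fun m => chartPartition 𝓔(n) M i m • τ m) := by
    intro i
    refine chartIntegral_eq σ i j (fun m hm => ?_) fun m hm => ?_
    · rw [image_eq_zero_of_notMem_tsupport fun h => hm (chartPartition_tsupport i h), zero_smul]
    · rw [h0 m fun h => hm (hK h), smul_zero]
  have h2 : ∀ t : Finset M, ∑ i ∈ t, chartIntegral σ j (fun m => chartPartition 𝓔(n) M i m • τ m) =
      chartIntegral σ j (∑ i ∈ t, fun m => chartPartition 𝓔(n) M i m • τ m) := by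
    intro t
    induction t using Finset.induction_on with
    | empty =>
      have h := chartIntegral_smul σ j 0 (0 : M → 𝓔(n) [⋀^Fin (2 * n)]→L[ℝ] ℝ)
      rw [zero_smul, zero_mul] at h
      simpa using h.symm
    | insert a t ha ih =>
      rw [Finset.sum_insert ha, Finset.sum_insert ha, ih, chartIntegral_add σ (hτ.partition_smul a)
        (IsSmoothForm.sum t fun i _ => hτ.partition_smul i) (hsj a) ⟨K, hK, hKc, fun m hm => by
          rw [Finset.sum_apply]
          exact Finset.sum_eq_zero fun i _ => by rw [h0 m hm, smul_zero]⟩]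
  rw [integral_eq_sum, Finset.sum_congr rfl fun i _ => h1 i, h2, sum_partition_smul]

omit [T2Space M] [CompactSpace M] in
-- The coefficient of dθ is a signed sum of partial derivatives of functions with compact support,
-- and the orientation sign is locally constant.
theorem chartIntegral_extD {k : ℕ} (h : k + 1 = 2 * n) {i : M} {θ : M → 𝓔(n) [⋀^Fin k]→L[ℝ] ℝ}
    (hθ : IsSmoothForm θ) (hs : SupportedInChart i θ) :
    chartIntegral σ i (fun m => castDegree h (extD θ m)) = 0 := by
  obtain ⟨K, hKU, hK, h0⟩ := hs.exists_compact
  have hT := isOpen_extChartAt_target (I := 𝓘(ℝ, 𝓔(n))) i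
  set e : Fin (k + 1) → 𝓔(n) := (fun j : Fin (2 * n) => EuclideanSpace.single j 1) ∘ Fin.cast h with he
  set f : Fin (k + 1) → 𝓔(n) → ℝ := fun j y => chartRep i θ y (j.removeNth e) with hf
  have hfs : ∀ j, ContDiffOn ℝ ∞ (f j) (extChartAt 𝓘(ℝ, 𝓔(n)) i).target := fun j =>
    (ContinuousAlternatingMap.apply ℝ 𝓔(n) ℝ (j.removeNth e)).contDiff.comp_contDiffOn (hθ i)
  have hf0 : ∀ j, ∀ y ∈ (extChartAt 𝓘(ℝ, 𝓔(n)) i).target, y ∉ K → f j y = 0 := fun j y hy hyK => by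
    simp only [hf, h0 y hy hyK]
    rfl
  have h1 : chartIntegral σ i (fun m => castDegree h (extD θ m)) =
      ∫ y in (extChartAt 𝓘(ℝ, 𝓔(n)) i).target, ∑ j : Fin (k + 1),
        (-1 : ℝ) ^ (j : ℕ) * (orientSign σ i y * fderiv ℝ (f j) y (e j)) := by
    refine setIntegral_congr_fun hT.measurableSet fun y hy => ?_
    have h2 : chartRep i (fun m => castDegree h (extD θ m)) y =
        castDegree h (extDeriv (chartRep i θ) y) := by
      rw [← chartRep_extD hθ i hy]
      exact castDegree_compContinuousLinearMap _ _ _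
    have h3 : topCoeff (castDegree h (extDeriv (chartRep i θ) y)) =
        ∑ j : Fin (k + 1), (-1 : ℝ) ^ (j : ℕ) * fderiv ℝ (f j) y (e j) := by
      rw [topCoeff, castDegree_apply, extDeriv_apply (hθ.differentiableAt_chartRep i hy)]
      simp [hf, he]
    simp only [h2, h3, Finset.mul_sum]
    exact Finset.sum_congr rfl fun j _ => by ring
  have hint : ∀ j : Fin (k + 1), IntegrableOn (fun y => (-1 : ℝ) ^ (j : ℕ) *
      (orientSign σ i y * fderiv ℝ (f j) y (e j))) (extChartAt 𝓘(ℝ, 𝓔(n)) i).target := by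
    intro j
    refine (integrableOn_of_eq_zero_off_compact hK hT.measurableSet hKU ((continuousOn_orientSign σ i).mul
      ((((hfs j).continuousOn_fderiv_of_isOpen hT (by simp))).clm_apply continuousOn_const))
      fun y hy hyK => ?_).const_mul _
    have : f j =ᶠ[𝓝 y] fun _ => 0 := by
      filter_upwards [hT.mem_nhds hy, hK.isClosed.isOpen_compl.mem_nhds hyK] with z hz hz'
      exact hf0 j z hz hz'
    rw [Pi.mul_apply, this.fderiv_eq]
    simp
  rw [h1, integral_finsetSum _ fun j _ => hint j]
  refine Finset.sum_eq_zero fun j _ => ?_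
  rw [integral_const_mul, setIntegral_mul_fderiv_eq_zero hT hK hKU (hfs j) (hf0 j)
    (fun y hy => eventually_orientSign_eq σ i hy), mul_zero]

omit [T2Space M] [CompactSpace M] in
theorem extD_eq_zero_of_eventuallyEq {k : ℕ} {θ : M → 𝓔(n) [⋀^Fin k]→L[ℝ] ℝ} {m : M}
    (h : ∀ᶠ q in 𝓝 m, θ q = 0) : extD θ m = 0 := by
  have h1 : chartRep m θ =ᶠ[𝓝 (extChartAt 𝓘(ℝ, 𝓔(n)) m m)] fun _ => 0 := by
    have h2 := (continuousAt_extChartAt_symm (I := 𝓘(ℝ, 𝓔(n))) m).eventually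
      (by rw [extChartAt_to_inv]; exact h)
    filter_upwards [h2] with y hy
    rw [chartRep, pullback, hy]
    rfl
  rw [extD, h1.extDeriv_eq]
  have : extDeriv (fun _ : 𝓔(n) => (0 : 𝓔(n) [⋀^Fin k]→L[ℝ] ℝ)) (extChartAt 𝓘(ℝ, 𝓔(n)) m m) = 0 := by
    have := extDeriv_smul (𝕜 := ℝ) (x := extChartAt 𝓘(ℝ, 𝓔(n)) m m) (0 : ℝ)
      (fun _ : 𝓔(n) => (0 : 𝓔(n) [⋀^Fin k]→L[ℝ] ℝ))
    rw [zero_smul, zero_smul] at this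
    exact this
  rw [this]
  rfl

omit [T2Space M] [CompactSpace M] in
theorem extD_sum {k : ℕ} {ι : Type*} (t : Finset ι) {θ : ι → M → 𝓔(n) [⋀^Fin k]→L[ℝ] ℝ}
    (hθ : ∀ i, IsSmoothForm (θ i)) : extD (∑ i ∈ t, θ i) = ∑ i ∈ t, extD (θ i) := by
  classical
  induction t using Finset.induction_on with
  | empty =>
    funext m
    exact extD_eq_zero_of_eventuallyEq (Eventually.of_forall fun _ => rfl)
  | insert a t ha ih =>
    rw [Finset.sum_insert ha, Finset.sum_insert ha, extD_add (hθ a)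
      (IsSmoothForm.sum t fun i _ => hθ i), ih]

/-- Stokes' theorem. -/
theorem integral_extD {k : ℕ} (h : k + 1 = 2 * n) {θ : M → 𝓔(n) [⋀^Fin k]→L[ℝ] ℝ}
    (hθ : IsSmoothForm θ) : integral σ (fun m => castDegree h (extD θ m)) = 0 := by
  -- The partition is applied to θ before taking d, so that each summand is exact with support in
  -- one chart.
  have h1 : (fun m => castDegree h (extD θ m)) = ∑ i ∈ partitionIndex n M,
      fun m => castDegree h (extD (fun m => chartPartition 𝓔(n) M i m • θ m) m) := by
    conv_lhs => rw [← sum_partition_smul θ, extD_sum _ fun i => hθ.partition_smul i]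
    funext m
    rw [Finset.sum_apply, Finset.sum_apply, ← castDegreeCLM_apply, map_sum]
    simp only [castDegreeCLM_apply]
  rw [h1, integral_sum σ _ fun i _ => (hθ.partition_smul i).extD.castDegree h]
  refine Finset.sum_eq_zero fun i _ => ?_
  rw [integral_eq_chartIntegral σ (j := i) ((hθ.partition_smul i).extD.castDegree h),
    chartIntegral_extD σ h (hθ.partition_smul i) (.of_tsupport (chartPartition_tsupport i) _)]
  refine ⟨tsupport (chartPartition 𝓔(n) M i), chartPartition_tsupport i,
    (isClosed_tsupport _).isCompact, fun m hm => ?_⟩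
  have h2 : extD (fun m => chartPartition 𝓔(n) M i m • θ m) m = 0 := by
    refine extD_eq_zero_of_eventuallyEq ?_
    filter_upwards [(isClosed_tsupport (chartPartition 𝓔(n) M i)).isOpen_compl.mem_nhds hm] with q hq
    rw [image_eq_zero_of_notMem_tsupport hq, zero_smul]
  beta_reduce
  rw [h2, ← castDegreeCLM_apply, map_zero]

/-- A non-negative multiple of the volume form with vanishing integral is zero. -/
theorem eq_zero_of_integral_smul_volForm {u : M → ℝ} (hu : ContMDiff 𝓘(ℝ, 𝓔(n)) 𝓘(ℝ, ℝ) ∞ u)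
    (h0 : ∀ m, 0 ≤ u m) (h : integral σ (fun m => u m • volForm σ m) = 0) (m : M) : u m = 0 := by
  have hs : IsSmoothForm fun m => u m • volForm σ m :=
    IsSmoothForm.bilin (ContinuousLinearMap.lsmul ℝ ℝ) hu (isSmoothForm_volForm σ)
  -- The orientation sign turns the coefficient of σ^n into its absolute value.
  have hnn : ∀ i : M, ∀ y, 0 ≤ orientSign σ i y * topCoeff (chartRep i
      (fun m => chartPartition 𝓔(n) M i m • u m • volForm σ m) y) := by
    intro i y
    have h1 : topCoeff (chartRep i (fun m => chartPartition 𝓔(n) M i m • u m • volForm σ m) y) =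
        chartPartition 𝓔(n) M i ((extChartAt 𝓘(ℝ, 𝓔(n)) i).symm y) *
          (u ((extChartAt 𝓘(ℝ, 𝓔(n)) i).symm y) * topCoeff (chartRep i (volForm σ) y)) := rfl
    have h2 : 0 ≤ orientSign σ i y * topCoeff (chartRep i (volForm σ) y) := by
      rw [orientSign, sign_mul_self]
      exact abs_nonneg _
    rw [h1]
    have h3 := mul_nonneg (mul_nonneg ((chartPartition 𝓔(n) M).nonneg i
      ((extChartAt 𝓘(ℝ, 𝓔(n)) i).symm y)) (h0 ((extChartAt 𝓘(ℝ, 𝓔(n)) i).symm y))) h2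
    linarith
  have hsum := h
  rw [integral_eq_sum, Finset.sum_eq_zero_iff_of_nonneg
    fun i _ => integral_nonneg fun y => hnn i y] at hsum
  obtain ⟨i, hi⟩ := (chartPartition 𝓔(n) M).exists_pos_of_mem (mem_univ m)
  have hiI : i ∈ partitionIndex n M := by
    by_contra hc
    rw [chartPartition_eq_zero hc m] at hi
    exact lt_irrefl _ hi
  have hms : m ∈ (extChartAt 𝓘(ℝ, 𝓔(n)) i).source :=
    chartPartition_tsupport i (subset_tsupport _ (ne_of_gt hi))
  have h1 := hsum i hiI
  have hsi := hs.partition_smul i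
  rw [chartIntegral, setIntegral_eq_zero_iff_of_nonneg_ae (Eventually.of_forall fun y => hnn i y)
    (integrableOn_chart σ hsi (.of_tsupport (chartPartition_tsupport i) _))] at h1
  -- The integrand vanishes almost everywhere; being continuous on an open set, it vanishes there
  -- identically.
  have h2 := Measure.eqOn_open_of_ae_eq h1 (isOpen_extChartAt_target (I := 𝓘(ℝ, 𝓔(n))) i)
    ((continuousOn_orientSign σ i).mul (continuousOn_topCoeff_chartRep hsi i)) continuousOn_const
  have hy := (extChartAt 𝓘(ℝ, 𝓔(n)) i).map_source hms
  have h3 := h2 hy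
  have h4 : orientSign σ i (extChartAt 𝓘(ℝ, 𝓔(n)) i m) * (chartPartition 𝓔(n) M i
      ((extChartAt 𝓘(ℝ, 𝓔(n)) i).symm (extChartAt 𝓘(ℝ, 𝓔(n)) i m)) *
        (u ((extChartAt 𝓘(ℝ, 𝓔(n)) i).symm (extChartAt 𝓘(ℝ, 𝓔(n)) i m)) *
          topCoeff (chartRep i (volForm σ) (extChartAt 𝓘(ℝ, 𝓔(n)) i m)))) = 0 := h3
  rw [(extChartAt 𝓘(ℝ, 𝓔(n)) i).left_inv hms] at h4
  have h5 := topCoeff_volForm_ne_zero σ i hy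
  have h6 : orientSign σ i (extChartAt 𝓘(ℝ, 𝓔(n)) i m) ≠ 0 := by
    rw [orientSign]
    rcases lt_or_gt_of_ne h5 with h | h
    · rw [sign_neg h]; simp
    · rw [sign_pos h]; simp
  rcases mul_eq_zero.1 h4 with h4 | h4
  · exact absurd h4 h6
  · rcases mul_eq_zero.1 h4 with h4 | h4
    · exact absurd h4 hi.ne'
    · exact (mul_eq_zero.1 h4).resolve_right h5

/-- Continuity of the integral under locally uniform convergence of the coefficients. -/
theorem tendsto_integral {ι : Type*} {L : Filter ι} {τ : ι → M → 𝓔(n) [⋀^Fin (2 * n)]→L[ℝ] ℝ}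
    {τ₀ : M → 𝓔(n) [⋀^Fin (2 * n)]→L[ℝ] ℝ} (hτ : ∀ t, IsSmoothForm (τ t)) (hτ₀ : IsSmoothForm τ₀)
    (h : ∀ x : M, TendstoLocallyUniformlyOn (fun t => chartRep x (τ t)) (chartRep x τ₀) L
      (extChartAt 𝓘(ℝ, 𝓔(n)) x).target) :
    Tendsto (fun t => integral σ (τ t)) L (𝓝 (integral σ τ₀)) := by
  simp only [integral_eq_sum]
  refine tendsto_finsetSum _ fun i _ => ?_
  set c := extChartAt 𝓘(ℝ, 𝓔(n)) i with hc
  set K := c '' tsupport (chartPartition 𝓔(n) M i) with hK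
  have hKU : K ⊆ c.target := by
    rintro _ ⟨m, hm, rfl⟩
    exact c.map_source (chartPartition_tsupport i hm)
  have hKc : IsCompact K := (isClosed_tsupport _).isCompact.image_of_continuousOn
    ((continuousOn_extChartAt i).mono (chartPartition_tsupport i))
  have hK0 : ∀ y ∈ c.target, y ∉ K → chartPartition 𝓔(n) M i (c.symm y) = 0 := fun y hy hyK =>
    image_eq_zero_of_notMem_tsupport fun h => hyK ⟨_, h, c.right_inv hy⟩
  have hint : ∀ ρ : M → 𝓔(n) [⋀^Fin (2 * n)]→L[ℝ] ℝ,
      chartIntegral σ i (fun m => chartPartition 𝓔(n) M i m • ρ m) = ∫ y in K,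
        orientSign σ i y * (chartPartition 𝓔(n) M i (c.symm y) * topCoeffCLM n (chartRep i ρ y)) := by
    intro ρ
    refine setIntegral_eq_of_subset_of_forall_sdiff_eq_zero
      (isOpen_extChartAt_target (I := 𝓘(ℝ, 𝓔(n))) i).measurableSet hKU ?_
    rintro y ⟨hy, hyK⟩
    change orientSign σ i y * (chartPartition 𝓔(n) M i (c.symm y) * topCoeff (chartRep i ρ y)) = 0
    rw [hK0 y hy hyK, zero_mul, mul_zero]
  have hcont : ∀ ρ : M → 𝓔(n) [⋀^Fin (2 * n)]→L[ℝ] ℝ, IsSmoothForm ρ → IntegrableOn (fun y =>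
      orientSign σ i y * (chartPartition 𝓔(n) M i (c.symm y) * topCoeffCLM n (chartRep i ρ y))) K :=
    fun ρ hρ => (integrableOn_chart σ (hρ.partition_smul i)
      (.of_tsupport (chartPartition_tsupport i) _)).mono_set hKU
  have hu := (tendstoLocallyUniformlyOn_iff_tendstoUniformlyOn_of_compact hKc).1 ((h i).mono hKU)
  rw [Metric.tendstoUniformlyOn_iff] at hu
  simp only [hint]
  rw [Metric.tendsto_nhds]
  intro ε hε
  -- The added 1 keeps C positive and makes the final bound strict, even if the norm or the volume
  -- is zero.
  set C := ‖topCoeffCLM n‖ * volume.real K + 1 with hC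
  have hCpos : 0 < C := by positivity
  filter_upwards [hu (ε / C) (by positivity)] with t ht
  rw [dist_eq_norm, ← integral_sub (hcont _ (hτ t)) (hcont _ hτ₀)]
  have hb := norm_setIntegral_le_of_norm_le_const (μ := volume) (s := K) (f := fun y =>
      orientSign σ i y * (chartPartition 𝓔(n) M i (c.symm y) * topCoeffCLM n (chartRep i (τ t) y)) -
      orientSign σ i y * (chartPartition 𝓔(n) M i (c.symm y) * topCoeffCLM n (chartRep i τ₀ y)))
    (C := ‖topCoeffCLM n‖ * (ε / C)) hKc.measure_lt_top fun y hy => by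
      rw [← mul_sub, ← mul_sub, ← map_sub, norm_mul, norm_mul]
      have h1 : ‖orientSign σ i y‖ ≤ 1 := abs_orientSign_le σ i y
      have h2 : ‖chartPartition 𝓔(n) M i (c.symm y)‖ ≤ 1 := by
        rw [Real.norm_eq_abs, abs_of_nonneg ((chartPartition 𝓔(n) M).nonneg i _)]
        exact (chartPartition 𝓔(n) M).le_one i _
      have h3 := (topCoeffCLM n).le_opNorm (chartRep i (τ t) y - chartRep i τ₀ y)
      have h4 : ‖chartRep i (τ t) y - chartRep i τ₀ y‖ ≤ ε / C := by
        rw [← dist_eq_norm, dist_comm]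
        exact (ht y hy).le
      calc _ ≤ 1 * (1 * (‖topCoeffCLM n‖ * (ε / C))) := by
            gcongr
            exact h3.trans (by gcongr)
        _ = _ := by ring
  refine hb.trans_lt ?_
  have h5 : ‖topCoeffCLM n‖ * (ε / C) * volume.real K =
      (‖topCoeffCLM n‖ * volume.real K) / C * ε := by ring
  rw [h5]
  have h6 : ‖topCoeffCLM n‖ * volume.real K / C < 1 := by
    rw [div_lt_one hCpos]
    exact lt_add_one _
  nlinarith

end Integral

/-! ### The `C^∞`-topology -/

section CInf

variable {E : Type*} [NormedAddCommGroup E] [NormedSpace ℝ E]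
  {V : Type*} [NormedAddCommGroup V] [NormedSpace ℝ V]
  {W : Type*} [NormedAddCommGroup W] [NormedSpace ℝ W]
  {Z : Type*} [NormedAddCommGroup Z] [NormedSpace ℝ Z]
  {ι : Type*} {L : Filter ι} {U : Set E}

/-- Locally uniform convergence of all derivatives on `U` to a limit with continuous
derivatives. -/
def CInfTendsto (L : Filter ι) (F : ι → E → V) (F₀ : E → V) (U : Set E) : Prop :=
  ∀ i : ℕ, ∀ y ∈ U, Tendsto (fun z : ι × E => iteratedFDeriv ℝ i (F z.1) z.2) (L ×ˢ 𝓝 y)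
    (𝓝 (iteratedFDeriv ℝ i F₀ y))

theorem eventually_mem_prod_nhds (hU : IsOpen U) {y : E} (hy : y ∈ U) :
    ∀ᶠ z : ι × E in L ×ˢ 𝓝 y, z.2 ∈ U :=
  tendsto_snd.eventually (hU.mem_nhds hy)

namespace CInfTendsto

theorem const {F₀ : E → V} (hU : IsOpen U) (h : ContDiffOn ℝ ∞ F₀ U) :
    CInfTendsto L (fun _ => F₀) F₀ U := fun i _ hy =>
  ((((h.contDiffAt (hU.mem_nhds hy)).continuousAt_iteratedFDeriv
    (by exact_mod_cast le_top)).tendsto).comp tendsto_snd)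

theorem congr {F F' : ι → E → V} {F₀ F₀' : E → V} (hU : IsOpen U) (h : CInfTendsto L F F₀ U)
    (hF : ∀ t, EqOn (F t) (F' t) U) (hF₀ : EqOn F₀ F₀' U) : CInfTendsto L F' F₀' U := fun i y hy => by
  have h1 : ∀ {f g : E → V}, EqOn f g U → ∀ z ∈ U, iteratedFDeriv ℝ i f z = iteratedFDeriv ℝ i g z :=
    fun hfg z hz => ((hfg.eventuallyEq_of_mem (hU.mem_nhds hz)).iteratedFDeriv ℝ i).self_of_nhds
  rw [← h1 hF₀ y hy]
  refine (h i y hy).congr' ?_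
  filter_upwards [eventually_mem_prod_nhds hU hy] with z hz using h1 (hF z.1) z.2 hz

theorem add {F G : ι → E → V} {F₀ G₀ : E → V} (hU : IsOpen U) (hF : ∀ t, ContDiffOn ℝ ∞ (F t) U)
    (hG : ∀ t, ContDiffOn ℝ ∞ (G t) U) (hF₀ : ContDiffOn ℝ ∞ F₀ U) (hG₀ : ContDiffOn ℝ ∞ G₀ U)
    (h : CInfTendsto L F F₀ U) (h' : CInfTendsto L G G₀ U) :
    CInfTendsto L (fun t => F t + G t) (F₀ + G₀) U := fun i y hy => by
  have hc : ∀ {f : E → V}, ContDiffOn ℝ ∞ f U → ∀ z ∈ U, ContDiffAt ℝ i f z := fun hf z hz =>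
    (hf.contDiffAt (hU.mem_nhds hz)).of_le (by exact_mod_cast le_top)
  rw [iteratedFDeriv_add_apply (hc hF₀ y hy) (hc hG₀ y hy)]
  refine ((h i y hy).add (h' i y hy)).congr' ?_
  filter_upwards [eventually_mem_prod_nhds hU hy] with z hz
  rw [iteratedFDeriv_add_apply (hc (hF z.1) z.2 hz) (hc (hG z.1) z.2 hz)]

theorem sub {F G : ι → E → V} {F₀ G₀ : E → V} (hU : IsOpen U) (hF : ∀ t, ContDiffOn ℝ ∞ (F t) U)
    (hG : ∀ t, ContDiffOn ℝ ∞ (G t) U) (hF₀ : ContDiffOn ℝ ∞ F₀ U) (hG₀ : ContDiffOn ℝ ∞ G₀ U)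
    (h : CInfTendsto L F F₀ U) (h' : CInfTendsto L G G₀ U) :
    CInfTendsto L (fun t => F t - G t) (F₀ - G₀) U := fun i y hy => by
  have hc : ∀ {f : E → V}, ContDiffOn ℝ ∞ f U → ∀ z ∈ U, ContDiffAt ℝ i f z := fun hf z hz =>
    (hf.contDiffAt (hU.mem_nhds hz)).of_le (by exact_mod_cast le_top)
  rw [iteratedFDeriv_sub_apply (hc hF₀ y hy) (hc hG₀ y hy)]
  refine ((h i y hy).sub (h' i y hy)).congr' ?_
  filter_upwards [eventually_mem_prod_nhds hU hy] with z hz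
  rw [iteratedFDeriv_sub_apply (hc (hF z.1) z.2 hz) (hc (hG z.1) z.2 hz)]

theorem clm_comp {F : ι → E → V} {F₀ : E → V} (hU : IsOpen U) (hF : ∀ t, ContDiffOn ℝ ∞ (F t) U)
    (hF₀ : ContDiffOn ℝ ∞ F₀ U) (h : CInfTendsto L F F₀ U) (A : V →L[ℝ] W) :
    CInfTendsto L (fun t y => A (F t y)) (fun y => A (F₀ y)) U := fun i y hy => by
  have hc : ∀ {f : E → V}, ContDiffOn ℝ ∞ f U → ∀ z ∈ U, iteratedFDeriv ℝ i (fun y => A (f y)) z =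
      A.compContinuousMultilinearMap (iteratedFDeriv ℝ i f z) := fun hf z hz =>
    A.iteratedFDeriv_comp_left (hf.contDiffAt (hU.mem_nhds hz)) (by exact_mod_cast le_top)
  rw [hc hF₀ y hy]
  refine (((ContinuousLinearMap.compContinuousMultilinearMapL ℝ (fun _ : Fin i => E) V W
    A).continuous.tendsto _).comp (h i y hy)).congr' ?_
  filter_upwards [eventually_mem_prod_nhds hU hy] with z hz
  exact (hc (hF z.1) z.2 hz).symm

theorem fderiv {F : ι → E → V} {F₀ : E → V} (h : CInfTendsto L F F₀ U) :
    CInfTendsto L (fun t => fderiv ℝ (F t)) (fderiv ℝ F₀) U := fun i y hy => by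
  have hc : ∀ (f : E → V) (z : E), iteratedFDeriv ℝ i (_root_.fderiv ℝ f) z =
      continuousMultilinearCurryRightEquiv' ℝ i E V (iteratedFDeriv ℝ (i + 1) f z) := fun f z => by
    rw [iteratedFDeriv_succ_eq_comp_right]
    simp
  simp only [hc]
  exact ((continuousMultilinearCurryRightEquiv' ℝ i E V).continuous.tendsto _).comp (h (i + 1) y hy)

/-- When one of the limits is zero, the Leibniz bound on the norms of iterated derivatives suffices;
no formula for the derivatives of a product is needed. -/
theorem bilin_aux {F : ι → E → V} {G : ι → E → W} {F₀ : E → V} {G₀ : E → W} (hU : IsOpen U)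
    (hF : ∀ t, ContDiffOn ℝ ∞ (F t) U) (hG : ∀ t, ContDiffOn ℝ ∞ (G t) U)
    (h : CInfTendsto L F F₀ U) (h' : CInfTendsto L G G₀ U) (b : V →L[ℝ] W →L[ℝ] Z)
    (h0 : F₀ = 0 ∨ G₀ = 0) : CInfTendsto L (fun t y => b (F t y) (G t y)) 0 U := fun i y hy => by
  have hz0 : iteratedFDeriv ℝ i (0 : E → Z) y = 0 := by
    rw [iteratedFDeriv_zero]; rfl
  rw [hz0]
  refine squeeze_zero_norm' (a := fun z : ι × E => ‖b‖ * ∑ j ∈ Finset.range (i + 1),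
      (i.choose j) * ‖iteratedFDeriv ℝ j (F z.1) z.2‖ * ‖iteratedFDeriv ℝ (i - j) (G z.1) z.2‖) ?_ ?_
  · filter_upwards [eventually_mem_prod_nhds hU hy] with z hz
    have h1 := b.norm_iteratedFDerivWithin_le_of_bilinear (hF z.1) (hG z.1) hU.uniqueDiffOn hz
      (n := i) (by exact_mod_cast le_top)
    rw [iteratedFDerivWithin_of_isOpen i hU hz] at h1
    simpa only [iteratedFDerivWithin_of_isOpen _ hU hz] using h1
  · have h2 : Tendsto (fun z : ι × E => ‖b‖ * ∑ j ∈ Finset.range (i + 1),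
      (i.choose j) * ‖iteratedFDeriv ℝ j (F z.1) z.2‖ * ‖iteratedFDeriv ℝ (i - j) (G z.1) z.2‖)
        (L ×ˢ 𝓝 y) (𝓝 (‖b‖ * ∑ j ∈ Finset.range (i + 1), (i.choose j) * ‖iteratedFDeriv ℝ j F₀ y‖ *
          ‖iteratedFDeriv ℝ (i - j) G₀ y‖)) :=
      (tendsto_finsetSum _ fun j _ => (((h j y hy).norm.const_mul _).mul
        (h' (i - j) y hy).norm)).const_mul _
    convert h2 using 2
    symm
    refine mul_eq_zero_of_right _ (Finset.sum_eq_zero fun j _ => ?_)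
    rcases h0 with rfl | rfl <;> simp

/-- Reduction to limits zero by FG - F₀G₀ = (F - F₀)(G - G₀) + (F - F₀)G₀ + F₀(G - G₀). -/
theorem bilin {F : ι → E → V} {G : ι → E → W} {F₀ : E → V} {G₀ : E → W} (hU : IsOpen U)
    (hF : ∀ t, ContDiffOn ℝ ∞ (F t) U) (hG : ∀ t, ContDiffOn ℝ ∞ (G t) U)
    (hF₀ : ContDiffOn ℝ ∞ F₀ U) (hG₀ : ContDiffOn ℝ ∞ G₀ U)
    (h : CInfTendsto L F F₀ U) (h' : CInfTendsto L G G₀ U) (b : V →L[ℝ] W →L[ℝ] Z) :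
    CInfTendsto L (fun t y => b (F t y) (G t y)) (fun y => b (F₀ y) (G₀ y)) U := by
  have hb : ∀ {f : E → V} {g : E → W}, ContDiffOn ℝ ∞ f U → ContDiffOn ℝ ∞ g U →
      ContDiffOn ℝ ∞ (fun y => b (f y) (g y)) U := fun hf hg =>
    (b.contDiff.comp_contDiffOn hf).clm_apply hg
  have e1 := h.sub hU hF (fun _ => hF₀) hF₀ hF₀ (const hU hF₀)
  have e2 := h'.sub hU hG (fun _ => hG₀) hG₀ hG₀ (const hU hG₀)
  rw [sub_self] at e1 e2
  have d1 : ∀ t, ContDiffOn ℝ ∞ (F t - F₀) U := fun t => (hF t).sub hF₀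
  have d2 : ∀ t, ContDiffOn ℝ ∞ (G t - G₀) U := fun t => (hG t).sub hG₀
  have z0 : ContDiffOn ℝ ∞ (0 : E → Z) U := contDiffOn_const (c := (0 : Z))
  have a1 := bilin_aux hU d1 d2 e1 e2 b (Or.inl rfl)
  have a2 := bilin_aux hU d1 (fun _ => hG₀) e1 (const hU hG₀) b (Or.inl rfl)
  have a3 := bilin_aux hU (fun _ => hF₀) d2 (const hU hF₀) e2 b (Or.inr rfl)
  have s1 := a1.add hU (fun t => hb (d1 t) (d2 t)) (fun t => hb (d1 t) hG₀) z0 z0 a2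
  have s2 := s1.add hU (fun t => (hb (d1 t) (d2 t)).add (hb (d1 t) hG₀)) (fun t => hb hF₀ (d2 t))
    (z0.add z0) z0 a3
  have s3 := s2.add hU (fun t => ((hb (d1 t) (d2 t)).add (hb (d1 t) hG₀)).add (hb hF₀ (d2 t)))
    (fun _ => hb hF₀ hG₀) ((z0.add z0).add z0) (hb hF₀ hG₀) (const hU (hb hF₀ hG₀))
  refine s3.congr hU (fun t y _ => ?_) (fun y _ => by simp)
  simp only [Pi.add_apply, Pi.sub_apply, map_sub, sub_apply]
  abel

theorem tendsto_apply {F : ι → E → V} {F₀ : E → V} (h : CInfTendsto L F F₀ U) {y : E} (hy : y ∈ U) :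
    Tendsto (fun z : ι × E => F z.1 z.2) (L ×ˢ 𝓝 y) (𝓝 (F₀ y)) := by
  have h1 := ((continuousMultilinearCurryFin0 ℝ E V).continuous.tendsto _).comp (h 0 y hy)
  simpa [iteratedFDeriv_zero_eq_comp, Function.comp_def] using h1

end CInfTendsto

/-- For a continuous limit, locally uniform convergence is joint convergence in parameter and point.
In this form it composes with continuous maps without estimates. -/
theorem tendstoLocallyUniformlyOn_iff_tendsto_prod {F : ι → E → V} {F₀ : E → V} (hU : IsOpen U)
    (hF₀ : ContinuousOn F₀ U) : TendstoLocallyUniformlyOn F F₀ L U ↔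
      ∀ y ∈ U, Tendsto (fun z : ι × E => F z.1 z.2) (L ×ˢ 𝓝 y) (𝓝 (F₀ y)) := by
  rw [tendstoLocallyUniformlyOn_iff_forall_tendsto]
  refine forall₂_congr fun y hy => ?_
  rw [hU.nhdsWithin_eq hy]
  have h1 : Tendsto (fun z : ι × E => F₀ z.2) (L ×ˢ 𝓝 y) (𝓝 (F₀ y)) :=
    (hF₀.continuousAt (hU.mem_nhds hy)).tendsto.comp tendsto_snd
  refine ⟨fun h => ?_, fun h => ?_⟩
  · have h2 : Tendsto (fun z : ι × E => F₀ z.2 - F z.1 z.2) (L ×ˢ 𝓝 y) (𝓝 0) := by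
      rw [tendsto_zero_iff_norm_tendsto_zero]
      simpa only [dist_eq_norm] using tendsto_uniformity_iff_dist_tendsto_zero.1 h
    simpa using h1.sub h2
  · rw [tendsto_uniformity_iff_dist_tendsto_zero]
    simpa using h1.dist h

end CInf

/-! ### Convergence in the spaces of forms with values in Ad P. -/

section AdFormTopology

variable {EM EG EP : Type*} [NormedAddCommGroup EM] [NormedSpace ℝ EM]
  [NormedAddCommGroup EG] [NormedSpace ℝ EG] [NormedAddCommGroup EP] [NormedSpace ℝ EP]
  [FiniteDimensional ℝ EP]
  {M G P : Type*} [TopologicalSpace M] [ChartedSpace EM M]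
  [TopologicalSpace G] [ChartedSpace EG G] [Group G]
  [TopologicalSpace P] [ChartedSpace EP P]
  {B : PrincipalBundle EM EG EP M G P} {k l : ℕ} {ι : Type*} {L : Filter ι}

/-- The target of the preferred chart at `x`. -/
abbrev chartTarget (EP : Type*) [NormedAddCommGroup EP] [NormedSpace ℝ EP]
    {P : Type*} [TopologicalSpace P] [ChartedSpace EP P] (x : P) : Set EP :=
  (extChartAt 𝓘(ℝ, EP) x).target

namespace AdForm

/-- The model space is finite-dimensional, hence locally compact, so uniform convergence on the
compact subsets of a chart target is locally uniform convergence. -/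
theorem tendsto_iff {η : ι → AdForm B k} {η₀ : AdForm B k} : Tendsto η L (𝓝 η₀) ↔
    ∀ x : P, CInfTendsto L (fun t => chartRep x (η t).form) (chartRep x η₀.form)
      (chartTarget EP x) := by
  have : ProperSpace EP := FiniteDimensional.proper_real EP
  simp only [nhds_iInf, tendsto_iInf]
  refine forall₂_congr fun x i => ?_
  rw [nhds_induced, tendsto_comap_iff]
  have hU : IsOpen (chartTarget EP x) := isOpen_extChartAt_target x
  have hc : ContinuousOn (iteratedFDeriv ℝ i (chartRep x η₀.form)) (chartTarget EP x) := fun y hy =>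
    ((((η₀.smooth x).contDiffAt (hU.mem_nhds hy)).continuousAt_iteratedFDeriv
      (by exact_mod_cast le_top))).continuousWithinAt
  refine Iff.trans ?_ (tendstoLocallyUniformlyOn_iff_tendsto_prod (L := L)
    (F := fun t => iteratedFDeriv ℝ i (chartRep x (η t).form)) hU hc)
  rw [UniformOnFun.tendsto_iff_tendstoUniformlyOn,
    tendstoLocallyUniformlyOn_iff_forall_isCompact hU]
  exact ⟨fun h K hK hK' => h K ⟨hK', hK⟩, fun h K hK => h K hK.2 hK.1⟩

theorem tendsto_chartRep {η : ι → AdForm B k} {η₀ : AdForm B k} (h : Tendsto η L (𝓝 η₀)) (x : P) :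
    CInfTendsto L (fun t => chartRep x (η t).form) (chartRep x η₀.form) (chartTarget EP x) :=
  tendsto_iff.1 h x

theorem isOpen_chartTarget (x : P) : IsOpen (chartTarget EP x) := isOpen_extChartAt_target x

instance : IsTopologicalAddGroup (AdForm B k) where
  continuous_add := continuous_iff_continuousAt.2 fun z => tendsto_iff.2 fun x =>
    (tendsto_chartRep tendsto_fst x (L := 𝓝 z.1 ×ˢ 𝓝 z.2)).add (isOpen_chartTarget x)
      (fun t => t.1.smooth x) (fun t => t.2.smooth x) (z.1.smooth x) (z.2.smooth x)
      (tendsto_chartRep tendsto_snd x) |> fun h => by rw [nhds_prod_eq]; exact h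
  continuous_neg := continuous_iff_continuousAt.2 fun z => tendsto_iff.2 fun x =>
    (CInfTendsto.clm_comp (isOpen_chartTarget x) (fun t : AdForm B k => t.smooth x) (z.smooth x)
      (tendsto_chartRep tendsto_id x) (-ContinuousLinearMap.id ℝ (EP [⋀^Fin k]→L[ℝ] EG)))

instance : ContinuousSMul ℝ (AdForm B k) where
  continuous_smul := continuous_iff_continuousAt.2 fun z => tendsto_iff.2 fun x => by
    -- The scalar is regarded as a constant function on the chart, so scalar multiplication falls
    -- under the rule for bilinear maps.
    have hconst : CInfTendsto (𝓝 z) (fun (t : ℝ × AdForm B k) (_ : EP) => t.1) (fun _ => z.1)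
        (chartTarget EP x) := fun i y hy => by
      rcases i with _ | i
      · simp only [iteratedFDeriv_zero_eq_comp]
        exact ((continuousMultilinearCurryFin0 ℝ EP ℝ).symm.continuous.tendsto _).comp
          ((continuous_fst.tendsto z).comp tendsto_fst)
      · simp only [iteratedFDeriv_succ_const]
        exact tendsto_const_nhds
    exact CInfTendsto.bilin (isOpen_chartTarget x) (fun t => contDiffOn_const)
      (fun t : ℝ × AdForm B k => t.2.smooth x) contDiffOn_const (z.2.smooth x) hconst
      (tendsto_chartRep (continuous_snd.tendsto z) x)
      (ContinuousLinearMap.lsmul ℝ ℝ : ℝ →L[ℝ] (EP [⋀^Fin k]→L[ℝ] EG) →L[ℝ] _)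

end AdForm

/-! ### Continuity of the operators from which the momentum map is built. -/

section Operators

variable [FiniteDimensional ℝ EG] [LieGroup 𝓘(ℝ, EG) ∞ G] [IsManifold 𝓘(ℝ, EP) ∞ P]

/-- The wedge product with a real form on the base, as a linear map. -/
def wedgeBase [IsManifold 𝓘(ℝ, EM) ∞ M] {τ : M → EM [⋀^Fin l]→L[ℝ] ℝ} (hτ : IsSmoothForm τ) :
    AdForm B k →ₗ[ℝ] AdForm B (k + l) where
  toFun η := ⟨_, η.isTensorial.wedge_pullback hτ⟩
  map_add' η θ := AdForm.ext fun p => by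
    let b : EG →L[ℝ] ℝ →L[ℝ] EG := (ContinuousLinearMap.lsmul ℝ ℝ).flip
    change wedge b (η.form p + θ.form p) _ = wedge b (η.form p) _ + wedge b (θ.form p) _
    simp only [← wedgeCLM_apply, map_add, add_apply]
  map_smul' c η := AdForm.ext fun p => by
    let b : EG →L[ℝ] ℝ →L[ℝ] EG := (ContinuousLinearMap.lsmul ℝ ℝ).flip
    change wedge b (c • η.form p) _ = c • wedge b (η.form p) _
    simp only [← wedgeCLM_apply, map_smul, smul_apply]

theorem wedgeBase_form [IsManifold 𝓘(ℝ, EM) ∞ M] {τ : M → EM [⋀^Fin l]→L[ℝ] ℝ}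
    (hτ : IsSmoothForm τ) (η : AdForm B k) : (wedgeBase hτ η).form =
      fun p => wedge (ContinuousLinearMap.lsmul ℝ ℝ).flip (η.form p)
        (pullback (E := EP) (E' := EM) B.proj τ p) := rfl

theorem continuous_wedgeBase [IsManifold 𝓘(ℝ, EM) ∞ M] {τ : M → EM [⋀^Fin l]→L[ℝ] ℝ}
    (hτ : IsSmoothForm τ) : Continuous (wedgeBase (B := B) (k := k) hτ) :=
  continuous_iff_continuousAt.2 fun z => AdForm.tendsto_iff.2 fun x => by
    have hτ' : IsSmoothForm (pullback (E := EP) (E' := EM) B.proj τ) := hτ.pullback B.contMDiff_proj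
    have h := CInfTendsto.bilin (AdForm.isOpen_chartTarget x) (fun t : AdForm B k => t.smooth x)
      (fun _ => hτ' x) (z.smooth x) (hτ' x) (AdForm.tendsto_chartRep tendsto_id x)
      (CInfTendsto.const (AdForm.isOpen_chartTarget x) (hτ' x))
      (wedgeCLM EP k l (ContinuousLinearMap.lsmul ℝ ℝ : ℝ →L[ℝ] EG →L[ℝ] EG).flip)
    simp only [wedgeBase_form, chartRep_wedge]
    exact h

/-- Change of degree, as a linear map. -/
def AdForm.cast (h : k = l) : AdForm B k →ₗ[ℝ] AdForm B l where
  toFun η := ⟨_, η.isTensorial.castDegree h⟩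
  map_add' η θ := by subst h; rfl
  map_smul' c η := by subst h; rfl

theorem AdForm.continuous_cast (h : k = l) : Continuous (AdForm.cast (B := B) h) := by
  subst h
  exact continuous_id

namespace Connection

theorem covForm_add (Γ : Connection B) (α β : AdForm B 1) :
    Γ.covForm (α + β) = Γ.covForm α + Γ.covForm β := by
  rw [covForm, covForm, covForm, AdForm.form_add, extD_add α.smooth β.smooth]
  funext p
  simp only [Pi.add_apply, ← wedgeCLM_apply, map_add]
  abel

/-- The covariant exterior derivative as a linear map. -/
def covDLinear (Γ : Connection B) : AdForm B 1 →ₗ[ℝ] AdForm B 2 where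
  toFun := Γ.covD
  map_add' α β := Subtype.ext (Γ.covForm_add α β)
  map_smul' c α := Subtype.ext (Γ.covForm_smul c α)

/-- In charts this is an antisymmetrised derivative plus a product with the fixed form Γ. The loss
of a derivative is harmless in the C^∞-topology. -/
theorem continuous_covD (Γ : Connection B) : Continuous Γ.covD :=
  continuous_iff_continuousAt.2 fun z => AdForm.tendsto_iff.2 fun x => by
    have hU := AdForm.isOpen_chartTarget (EP := EP) x
    have hT := AdForm.tendsto_chartRep (tendsto_id (α := AdForm B 1) (x := 𝓝 z)) x
    have h1 := CInfTendsto.bilin hU (fun _ => Γ.smooth x) (fun t : AdForm B 1 => t.smooth x)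
      (Γ.smooth x) (z.smooth x) (CInfTendsto.const hU (Γ.smooth x)) hT
      (wedgeCLM EP 1 1 (lieBracket EG G))
    have hd : ∀ {f : EP → EP [⋀^Fin 1]→L[ℝ] EG}, ContDiffOn ℝ ∞ f (chartTarget EP x) →
        ContDiffOn ℝ ∞ (fderiv ℝ f) (chartTarget EP x) := fun hf =>
      ((contDiffOn_infty_iff_fderiv_of_isOpen hU).1 hf).2
    have h2 := hT.fderiv.clm_comp hU (fun t : AdForm B 1 => hd (t.smooth x)) (hd (z.smooth x))
      (ContinuousAlternatingMap.alternatizeUncurryFinCLM ℝ EP EG)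
    have hC : ContDiff ℝ ∞ (wedgeCLM EP 1 1 (lieBracket EG G)) := ContinuousLinearMap.contDiff _
    have hw : ∀ {f : EP → EP [⋀^Fin 1]→L[ℝ] EG}, ContDiffOn ℝ ∞ f (chartTarget EP x) →
        ContDiffOn ℝ ∞ (fun y => wedgeCLM EP 1 1 (lieBracket EG G) (chartRep x Γ.form y) (f y))
          (chartTarget EP x) := fun hf =>
      ContDiffOn.clm_apply (f := fun y => wedgeCLM EP 1 1 (lieBracket EG G) (chartRep x Γ.form y))
        (hC.comp_contDiffOn (Γ.smooth x)) hf
    have h3 := h2.add hU (fun t : AdForm B 1 => contDiffOn_extDeriv hU (t.smooth x))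
      (fun t => hw (t.smooth x)) (contDiffOn_extDeriv hU (z.smooth x)) (hw (z.smooth x)) h1
    have he : ∀ t : AdForm B 1, EqOn ((fun y => extDeriv (chartRep x t.form) y) +
        fun y => wedgeCLM EP 1 1 (lieBracket EG G) (chartRep x Γ.form y) (chartRep x t.form y))
        (chartRep x (Γ.covD t).form) (chartTarget EP x) := fun t y hy => by
      have h4 : (Γ.covD t).form = extD t.form + fun p => wedge (lieBracket EG G) (Γ.form p) (t.form p) :=
        rfl
      rw [h4, chartRep_add, Pi.add_apply, Pi.add_apply, chartRep_extD t.smooth x hy, chartRep_wedge]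
      rfl
    exact h3.congr hU he (he z)

theorem bracketForm_add_left (α α' β : AdForm B 1) :
    bracketForm (α + α') β = bracketForm α β + bracketForm α' β := AdForm.ext fun p => by
  let b := lieBracket EG G
  change wedge b (α.form p + α'.form p) _ = wedge b (α.form p) _ + wedge b (α'.form p) _
  simp only [← wedgeCLM_apply, map_add, add_apply]

theorem bracketForm_smul_left (c : ℝ) (α β : AdForm B 1) :
    bracketForm (c • α) β = c • bracketForm α β := AdForm.ext fun p => by
  let b := lieBracket EG G
  change wedge b (c • α.form p) _ = c • wedge b (α.form p) _
  simp only [← wedgeCLM_apply, map_smul, smul_apply]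

theorem bracketForm_add_right (α β β' : AdForm B 1) :
    bracketForm α (β + β') = bracketForm α β + bracketForm α β' := AdForm.ext fun p => by
  let b := lieBracket EG G
  change wedge b _ (β.form p + β'.form p) = wedge b _ (β.form p) + wedge b _ (β'.form p)
  simp only [← wedgeCLM_apply, map_add]

theorem bracketForm_smul_right (c : ℝ) (α β : AdForm B 1) :
    bracketForm α (c • β) = c • bracketForm α β := AdForm.ext fun p => by
  let b := lieBracket EG G
  change wedge b _ (c • β.form p) = c • wedge b _ (β.form p)
  simp only [← wedgeCLM_apply, map_smul]

theorem continuous_bracketForm : Continuous fun z : AdForm B 1 × AdForm B 1 => bracketForm z.1 z.2 :=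
  continuous_iff_continuousAt.2 fun z => AdForm.tendsto_iff.2 fun x => by
    have h := CInfTendsto.bilin (AdForm.isOpen_chartTarget x)
      (fun t : AdForm B 1 × AdForm B 1 => t.1.smooth x) (fun t => t.2.smooth x) (z.1.smooth x)
      (z.2.smooth x) (AdForm.tendsto_chartRep (continuous_fst.tendsto z) x)
      (AdForm.tendsto_chartRep (continuous_snd.tendsto z) x)
      (wedgeCLM EP 1 1 (lieBracket EG G))
    have he : ∀ α β : AdForm B 1, chartRep x (bracketForm α β).form =
        fun y => wedgeCLM EP 1 1 (lieBracket EG G) (chartRep x α.form y) (chartRep x β.form y) :=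
      fun α β => chartRep_wedge (lieBracket EG G) α.form β.form x
    simp only [he]
    exact h

end Connection

end Operators

end AdFormTopology

/-! ### Polynomial maps of degree two -/

section Bastiani

/-- A map of the form `x ↦ c + L x + Q (x, x)` with `L` linear and `Q` bilinear, both
continuous. -/
structure IsQuadraticMap {X : Type*} {Y : Type*} [AddCommGroup X] [Module ℝ X] [TopologicalSpace X]
    [AddCommGroup Y] [Module ℝ Y] [TopologicalSpace Y] (f : X → Y) : Prop where
  exists_eq : ∃ (c : Y) (L : X →ₗ[ℝ] Y) (Q : X →ₗ[ℝ] X →ₗ[ℝ] Y), Continuous L ∧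
    (Continuous fun z : X × X => Q z.1 z.2) ∧ ∀ x, f x = c + L x + Q x x

variable {X : Type u} {Y : Type v} [AddCommGroup X] [Module ℝ X] [TopologicalSpace X]
  [AddCommGroup Y] [Module ℝ Y] [TopologicalSpace Y] [IsTopologicalAddGroup Y] [ContinuousSMul ℝ Y]

/-- The directional derivative of such a map is again such a map, on X × X; hence the induction on k
has to let the space vary. -/
theorem IsQuadraticMap.isBastianiC (k : ℕ) : ∀ {X : Type u} [AddCommGroup X] [Module ℝ X]
    [TopologicalSpace X] {f : X → Y}, IsQuadraticMap f → IsBastianiC k f := by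
  have hcont : ∀ {X : Type u} [AddCommGroup X] [Module ℝ X]
    [TopologicalSpace X] {f : X → Y}, IsQuadraticMap f → Continuous f := by
    intro X _ _ _ f hf
    obtain ⟨c, L, Q, hL, hQ, h⟩ := hf.exists_eq
    rw [show f = fun x => c + L x + Q x x from funext h]
    exact (continuous_const.add hL).add (hQ.comp (continuous_id.prodMk continuous_id))
  induction k with
  | zero => exact fun hf => hcont hf
  | succ k ih =>
    intro X _ _ _ f hf
    refine ⟨hcont hf, ?_⟩
    obtain ⟨c, L, Q, hL, hQ, h⟩ := hf.exists_eq
    -- The derivative (x, v) ↦ L v + Q(x, v) + Q(v, x) is the linear map L ∘ snd plus the diagonal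
    -- of (z, w) ↦ Q(z₁, w₂) + Q(z₂, w₁).
    refine ⟨fun z => L z.2 + (Q z.1 z.2 + Q z.2 z.1), fun x v => ?_, ih ⟨0, L ∘ₗ LinearMap.snd ℝ X X,
      (Q.compl₁₂ (LinearMap.fst ℝ X X) (LinearMap.snd ℝ X X)) +
        (Q.compl₁₂ (LinearMap.snd ℝ X X) (LinearMap.fst ℝ X X)), hL.comp continuous_snd, ?_, ?_⟩⟩
    -- For t ≠ 0 the difference quotient equals this expression exactly, with t Q(v, v) as only
    -- error.
    · have h1 : Tendsto (fun t : ℝ => L v + (Q x v + Q v x) + t • Q v v) (𝓝[≠] 0)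
          (𝓝 (L v + (Q x v + Q v x) + (0 : ℝ) • Q v v)) :=
        (tendsto_const_nhds.add ((tendsto_id.mono_left nhdsWithin_le_nhds).smul_const _))
      rw [zero_smul, add_zero] at h1
      refine h1.congr' ?_
      filter_upwards [self_mem_nhdsWithin] with t ht
      have ht' : t ≠ 0 := ht
      rw [h, h]
      simp only [map_add, map_smul, LinearMap.add_apply, LinearMap.smul_apply]
      have h2 : c + (L x + t • L v) + (Q x x + t • Q v x + t • (Q x v + t • Q v v)) -
          (c + L x + Q x x) = t • (L v + (Q x v + Q v x) + t • Q v v) := by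
        simp only [smul_add]
        abel
      rw [h2, inv_smul_smul₀ ht']
    · have e1 : Continuous fun z : (X × X) × (X × X) => Q z.1.1 z.2.2 :=
        hQ.comp (by fun_prop : Continuous fun z : (X × X) × (X × X) => (z.1.1, z.2.2))
      have e2 : Continuous fun z : (X × X) × (X × X) => Q z.1.2 z.2.1 :=
        hQ.comp (by fun_prop : Continuous fun z : (X × X) × (X × X) => (z.1.2, z.2.1))
      exact e1.add e2
    · intro z
      simp

theorem IsQuadraticMap.isBastianiSmooth {f : X → Y} (hf : IsQuadraticMap f) : IsBastianiSmooth f :=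
  fun k => hf.isBastianiC k

end Bastiani

/-! ### Difference quotients of smooth families -/

section Slope

variable {E : Type*} [NormedAddCommGroup E] [NormedSpace ℝ E]
  {V : Type*} [NormedAddCommGroup V] [NormedSpace ℝ V] {U : Set E}

theorem fderiv_partial_right {Ψ : ℝ × E → V} {z : ℝ × E} (h : DifferentiableAt ℝ Ψ z) :
    fderiv ℝ (fun y => Ψ (z.1, y)) z.2 = (fderiv ℝ Ψ z).comp (ContinuousLinearMap.inr ℝ ℝ E) :=
  (h.hasFDerivAt.comp z.2 (hasFDerivAt_prodMk_right z.1 z.2)).fderiv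

theorem differentiableAt_of_contDiffOn_strip (hU : IsOpen U) {Ψ : ℝ × E → V}
    (h : ContDiffOn ℝ ∞ Ψ (univ ×ˢ U)) {t : ℝ} {y : E} (hy : y ∈ U) : ContDiffAt ℝ ∞ Ψ (t, y) :=
  h.contDiffAt ((isOpen_univ.prod hU).mem_nhds ⟨mem_univ t, hy⟩)

theorem contDiffOn_fderiv_strip (hU : IsOpen U) {Ψ : ℝ × E → V}
    (h : ContDiffOn ℝ ∞ Ψ (univ ×ˢ U)) : ContDiffOn ℝ ∞ (fderiv ℝ Ψ) (univ ×ˢ U) :=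
  ((contDiffOn_infty_iff_fderiv_of_isOpen (isOpen_univ.prod hU)).1 h).2

theorem contDiffOn_partial_right (hU : IsOpen U) {Ψ : ℝ × E → V}
    (h : ContDiffOn ℝ ∞ Ψ (univ ×ˢ U)) :
    ContDiffOn ℝ ∞ (fun z : ℝ × E => fderiv ℝ (fun y => Ψ (z.1, y)) z.2) (univ ×ˢ U) := by
  have h1 : ContDiffOn ℝ ∞ (fun z : ℝ × E => (fderiv ℝ Ψ z).comp (ContinuousLinearMap.inr ℝ ℝ E))
      (univ ×ˢ U) := (contDiffOn_fderiv_strip hU h).clm_comp contDiffOn_const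
  exact h1.congr fun z hz => fderiv_partial_right
    ((differentiableAt_of_contDiffOn_strip hU h hz.2).differentiableAt (by simp))

theorem contDiffOn_iteratedFDeriv_right (hU : IsOpen U) {F : ℝ × E → V}
    (h : ContDiffOn ℝ ∞ F (univ ×ˢ U)) (i : ℕ) :
    ContDiffOn ℝ ∞ (fun z : ℝ × E => iteratedFDeriv ℝ i (fun y => F (z.1, y)) z.2) (univ ×ˢ U) := by
  induction i with
  | zero =>
    simp only [iteratedFDeriv_zero_eq_comp]
    exact (continuousMultilinearCurryFin0 ℝ E V).symm.contDiff.comp_contDiffOn h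
  | succ i ih =>
    simp only [iteratedFDeriv_succ_eq_comp_left]
    exact (continuousMultilinearCurryLeftEquiv ℝ (fun _ : Fin (i + 1) => E) V).symm.contDiff.comp_contDiffOn
      (contDiffOn_partial_right hU ih)

/-- Partial derivatives commute. -/
theorem fderiv_partial_swap (hU : IsOpen U) {Ψ : ℝ × E → V} (h : ContDiffOn ℝ ∞ Ψ (univ ×ˢ U))
    {t : ℝ} {y : E} (hy : y ∈ U) :
    fderiv ℝ (fun z : ℝ × E => fderiv ℝ (fun y => Ψ (z.1, y)) z.2) (t, y) (1, 0) =
      fderiv ℝ (fun y => fderiv ℝ Ψ (t, y) (1, 0)) y := by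
  have hat := differentiableAt_of_contDiffOn_strip hU h (t := t) hy
  have hd : DifferentiableAt ℝ (fderiv ℝ Ψ) (t, y) :=
    (differentiableAt_of_contDiffOn_strip hU (contDiffOn_fderiv_strip hU h) hy).differentiableAt
      (by simp)
  have hev : (fun z : ℝ × E => fderiv ℝ (fun y => Ψ (z.1, y)) z.2) =ᶠ[𝓝 (t, y)]
      fun z => (fderiv ℝ Ψ z).comp (ContinuousLinearMap.inr ℝ ℝ E) := by
    filter_upwards [(isOpen_univ.prod hU).mem_nhds ⟨mem_univ t, hy⟩] with z hz
    exact fderiv_partial_right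
      ((differentiableAt_of_contDiffOn_strip hU h hz.2).differentiableAt (by simp))
  have h1 := hd.hasFDerivAt.clm_comp (hasFDerivAt_const (ContinuousLinearMap.inr ℝ ℝ E) (t, y))
  have h2 := (hd.hasFDerivAt.comp y (hasFDerivAt_prodMk_right t y)).clm_apply
    (hasFDerivAt_const ((1, 0) : ℝ × E) y)
  rw [hev.fderiv_eq, h1.fderiv]
  have h3 : fderiv ℝ (fun y => fderiv ℝ Ψ (t, y) (1, 0)) y = _ := h2.fderiv
  rw [h3]
  ext v
  simpa using hat.isSymmSndFDerivAt
    (by rw [minSmoothness_of_isRCLikeNormedField]; exact ENat.LEInfty.out) (1, 0) (0, v)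

/-- The time derivative passes through the spatial derivatives one at a time, by symmetry of second
derivatives. -/
theorem fderiv_iteratedFDeriv_right (hU : IsOpen U) {F : ℝ × E → V}
    (h : ContDiffOn ℝ ∞ F (univ ×ˢ U)) (i : ℕ) (t : ℝ) : ∀ y ∈ U,
    fderiv ℝ (fun z : ℝ × E => iteratedFDeriv ℝ i (fun y => F (z.1, y)) z.2) (t, y) (1, 0) =
      iteratedFDeriv ℝ i (fun y => fderiv ℝ F (t, y) (1, 0)) y := by
  induction i with
  | zero =>
    intro y hy
    simp only [iteratedFDeriv_zero_eq_comp]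
    have hd := (differentiableAt_of_contDiffOn_strip hU h (t := t) hy).differentiableAt (by simp)
    have := ((continuousMultilinearCurryFin0 ℝ E V).symm.toContinuousLinearEquiv.hasFDerivAt.comp
      (t, y) hd.hasFDerivAt).fderiv
    exact DFunLike.congr_fun this (1, 0)
  | succ i ih =>
    intro y hy
    simp only [iteratedFDeriv_succ_eq_comp_left]
    have hs := contDiffOn_iteratedFDeriv_right hU h i
    have hd := (differentiableAt_of_contDiffOn_strip hU (contDiffOn_partial_right hU hs)
      (t := t) hy).differentiableAt (by simp)
    have h1 := ((continuousMultilinearCurryLeftEquiv ℝ (fun _ : Fin (i + 1) => E)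
      V).symm.toContinuousLinearEquiv.hasFDerivAt.comp (t, y) hd.hasFDerivAt).fderiv
    refine (DFunLike.congr_fun h1 (1, 0)).trans ?_
    have h2 := fderiv_partial_swap hU hs (t := t) hy
    have h3 : (fun y => fderiv ℝ (fun z : ℝ × E => iteratedFDeriv ℝ i (fun y => F (z.1, y)) z.2)
        (t, y) (1, 0)) =ᶠ[𝓝 y] iteratedFDeriv ℝ i fun y => fderiv ℝ F (t, y) (1, 0) := by
      filter_upwards [hU.mem_nhds hy] with z hz using ih z hz
    rw [h3.fderiv_eq] at h2
    exact congrArg (continuousMultilinearCurryLeftEquiv ℝ (fun _ : Fin (i + 1) => E) V).symm h2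

/-- The difference quotients of a smooth family converge together with all derivatives. -/
theorem cinfTendsto_slope (hU : IsOpen U) {F : ℝ × E → V} (h : ContDiffOn ℝ ∞ F (univ ×ˢ U)) :
    CInfTendsto (𝓝[≠] (0 : ℝ)) (fun t y => t⁻¹ • (F (t, y) - F (0, y)))
      (fun y => fderiv ℝ F (0, y) (1, 0)) U := fun i y hy => by
  set Φ : ℝ × E → E [×i]→L[ℝ] V := fun z => iteratedFDeriv ℝ i (fun y => F (z.1, y)) z.2 with hΦ
  have hΦs := differentiableAt_of_contDiffOn_strip hU (contDiffOn_iteratedFDeriv_right hU h i)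
    (t := 0) hy
  -- Strict differentiability at (0, y) controls Φ(t, z) - Φ(0, z) uniformly for z near y, as joint
  -- convergence of the quotients demands.
  have hstrict := (hΦs.hasStrictFDerivAt (by simp)).isLittleO
  rw [← fderiv_iteratedFDeriv_right hU h i 0 y hy]
  have hFt : ∀ t : ℝ, ContDiffOn ℝ ∞ (fun y => F (t, y)) U := fun t =>
    h.comp (contDiff_const.prodMk contDiff_id).contDiffOn fun z hz => ⟨mem_univ t, hz⟩
  have hmap : Tendsto (fun z : ℝ × E => (((z.1, z.2), (0, z.2)) : (ℝ × E) × (ℝ × E)))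
      (𝓝[≠] (0 : ℝ) ×ˢ 𝓝 y) (𝓝 ((0, y), (0, y))) := by
    have : Tendsto (fun z : ℝ × E => (((z.1, z.2), (0, z.2)) : (ℝ × E) × (ℝ × E))) (𝓝 (0, y))
        (𝓝 ((0, y), (0, y))) :=
      Continuous.tendsto' (by fun_prop) _ _ rfl
    refine this.mono_left ?_
    rw [nhds_prod_eq]
    exact Filter.prod_mono nhdsWithin_le_nhds le_rfl
  have h1 := hstrict.comp_tendsto hmap
  have h2 : Tendsto (fun z : ℝ × E => z.1⁻¹ • (Φ z - Φ (0, z.2)) - fderiv ℝ Φ (0, y) (1, 0))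
      (𝓝[≠] (0 : ℝ) ×ˢ 𝓝 y) (𝓝 0) := by
    rw [Metric.tendsto_nhds]
    intro ε hε
    filter_upwards [Asymptotics.isLittleO_iff.1 h1 (half_pos hε),
      tendsto_fst.eventually (self_mem_nhdsWithin : {0}ᶜ ∈ 𝓝[≠] (0 : ℝ))] with z hz hz0
    have ht : z.1 ≠ 0 := hz0
    have hn : 0 < ‖z.1‖ := norm_pos_iff.2 ht
    have e1 : ((z.1, z.2) : ℝ × E) - (0, z.2) = z.1 • ((1, 0) : ℝ × E) :=
      Prod.ext (by simp) (by simp)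
    have hz1 : ‖Φ z - Φ (0, z.2) - fderiv ℝ Φ (0, y) (z.1 • (1, 0))‖ ≤
        ε / 2 * ‖z.1 • ((1, 0) : ℝ × E)‖ := by
      rw [← e1]
      exact hz
    have e2 : z.1⁻¹ • (Φ z - Φ (0, z.2)) - fderiv ℝ Φ (0, y) (1, 0) =
        z.1⁻¹ • (Φ z - Φ (0, z.2) - fderiv ℝ Φ (0, y) (z.1 • (1, 0))) := by
      rw [map_smul, smul_sub _ _ (z.1 • _), inv_smul_smul₀ ht]
    have e3 : ‖z.1 • ((1, 0) : ℝ × E)‖ = ‖z.1‖ := by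
      rw [norm_smul, Prod.norm_mk]
      simp
    rw [dist_zero_right, e2, norm_smul, norm_inv, inv_mul_lt_iff₀ hn]
    rw [e3] at hz1
    nlinarith
  have h3 := h2.add_const (fderiv ℝ Φ (0, y) (1, 0))
  simp only [sub_add_cancel, zero_add] at h3
  refine h3.congr' ?_
  filter_upwards [eventually_mem_prod_nhds hU hy] with z hz
  have e1 : ∀ t : ℝ, ContDiffAt ℝ i (fun y => F (t, y)) z.2 := fun t =>
    ((hFt t).contDiffAt (hU.mem_nhds hz)).of_le (by exact_mod_cast le_top)
  have e2 := iteratedFDeriv_sub_apply (e1 z.1) (e1 0)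
  have e3 := iteratedFDeriv_const_smul_apply (a := z.1⁻¹) ((e1 z.1).sub (e1 0))
  exact (e3.trans (congrArg _ e2)).symm

end Slope

/-! ### The infinitesimal action of the gauge group -/

section Differential

variable {E : Type*} [NormedAddCommGroup E] [NormedSpace ℝ E]
  {N : Type*} [TopologicalSpace N] [ChartedSpace E N]
  {V : Type*} [NormedAddCommGroup V] [NormedSpace ℝ V]
  {W : Type*} [NormedAddCommGroup W] [NormedSpace ℝ W]
  {Z : Type*} [NormedAddCommGroup Z] [NormedSpace ℝ Z]

/-- The differential of a vector-valued function. -/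
def dForm (E : Type*) [NormedAddCommGroup E] [NormedSpace ℝ E] {N : Type*} [TopologicalSpace N]
    [ChartedSpace E N] (f : N → V) : N → E [⋀^Fin 1]→L[ℝ] V := fun x =>
  ContinuousAlternatingMap.ofSubsingleton ℝ E V (0 : Fin 1) (tangent (E := E) (E' := V) f x)

theorem dForm_apply (f : N → V) (x : N) (X : Fin 1 → E) :
    dForm E f x X = tangent (E := E) (E' := V) f x (X 0) := rfl

theorem pullback_dForm {E' : Type*} [NormedAddCommGroup E'] [NormedSpace ℝ E'] {N' : Type*}
    [TopologicalSpace N'] [ChartedSpace E' N'] {f : N → V} {φ : N' → N} {x : N'}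
    (hf : MDifferentiableAt 𝓘(ℝ, E) 𝓘(ℝ, V) f (φ x)) (hφ : MDifferentiableAt 𝓘(ℝ, E') 𝓘(ℝ, E) φ x) :
    pullback (E := E') (E' := E) φ (dForm E f) x = dForm E' (f ∘ φ) x := by
  ext X
  rw [pullback_apply, dForm_apply, dForm_apply, tangent_comp hf hφ]
  rfl

variable [IsManifold 𝓘(ℝ, E) ∞ N]

theorem chartRep_dForm {f : N → V} (hf : ContMDiff 𝓘(ℝ, E) 𝓘(ℝ, V) ∞ f) (x : N) {y : E}
    (hy : y ∈ (extChartAt 𝓘(ℝ, E) x).target) : chartRep x (dForm E f) y =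
      ContinuousAlternatingMap.ofSubsingleton ℝ E V (0 : Fin 1)
        (fderiv ℝ (f ∘ (extChartAt 𝓘(ℝ, E) x).symm) y) := by
  rw [chartRep, pullback_dForm (hf.mdifferentiable (by simp) _) (mdifferentiableAt_chart_symm hy),
    dForm, tangent_eq_fderiv]

theorem contDiffOn_comp_chart_symm {f : N → V} (hf : ContMDiff 𝓘(ℝ, E) 𝓘(ℝ, V) ∞ f) (x : N) :
    ContDiffOn ℝ ∞ (f ∘ (extChartAt 𝓘(ℝ, E) x).symm) (extChartAt 𝓘(ℝ, E) x).target :=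
  contMDiffOn_iff_contDiffOn.1 (hf.comp_contMDiffOn (contMDiffOn_chart_symm x))

theorem isSmoothForm_dForm {f : N → V} (hf : ContMDiff 𝓘(ℝ, E) 𝓘(ℝ, V) ∞ f) :
    IsSmoothForm (dForm E f) := fun x => by
  have h1 := ((contDiffOn_infty_iff_fderiv_of_isOpen (isOpen_extChartAt_target x)).1
    (contDiffOn_comp_chart_symm hf x)).2
  exact ((ContinuousAlternatingMap.ofSubsingletonLIE (𝕜 := ℝ) (E := E) (F := V)
    (0 : Fin 1)).contDiff.comp_contDiffOn h1).congr fun y hy => chartRep_dForm hf x hy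

theorem form_eq_of_chartRep_eq {k : ℕ} {η θ : N → E [⋀^Fin k]→L[ℝ] V} {x : N}
    (h : chartRep x η (extChartAt 𝓘(ℝ, E) x x) = chartRep x θ (extChartAt 𝓘(ℝ, E) x x)) :
    η x = θ x := by
  rw [← chartRep_comp_tangent η (mem_extChartAt_source (I := 𝓘(ℝ, E)) x), h,
    chartRep_comp_tangent θ (mem_extChartAt_source (I := 𝓘(ℝ, E)) x)]

/-- The Leibniz rule for the product of a function and a one-form. -/
theorem extD_bilin (b : V →L[ℝ] W →L[ℝ] Z) {f : N → V} (hf : ContMDiff 𝓘(ℝ, E) 𝓘(ℝ, V) ∞ f)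
    {η : N → E [⋀^Fin 1]→L[ℝ] W} (hη : IsSmoothForm η) :
    extD (fun p => (b (f p)).compContinuousAlternatingMap (η p)) =
      fun p => wedge b (dForm E f p) (η p) + (b (f p)).compContinuousAlternatingMap (extD η p) := by
  funext x
  apply form_eq_of_chartRep_eq (η := extD fun p => (b (f p)).compContinuousAlternatingMap (η p))
    (θ := (fun p => wedge b (dForm E f p) (η p)) +
      fun p => (b (f p)).compContinuousAlternatingMap (extD η p))
  set c := extChartAt 𝓘(ℝ, E) x with hc
  have hy : c x ∈ c.target := mem_extChartAt_target x
  have hr : ∀ {j : ℕ} (θ : N → E [⋀^Fin j]→L[ℝ] W), chartRep x (fun p => (b (f p)).compContinuousAlternatingMap (θ p)) =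
      fun y => (b (f (c.symm y))).compContinuousAlternatingMap (chartRep x θ y) := fun θ => rfl
  have hadd : ∀ η θ : N → E [⋀^Fin 2]→L[ℝ] Z, chartRep x (η + θ) = chartRep x η + chartRep x θ :=
    fun _ _ => rfl
  rw [chartRep_extD (hη.bilin b hf) x hy, hadd, Pi.add_apply, chartRep_wedge, hr, hr]
  beta_reduce
  rw [chartRep_extD hη x hy, chartRep_dForm hf x hy]
  have hF : DifferentiableAt ℝ (f ∘ c.symm) (c x) :=
    ((contDiffOn_comp_chart_symm hf x).contDiffAt
      ((isOpen_extChartAt_target x).mem_nhds hy)).differentiableAt (by simp)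
  have hτ := hη.differentiableAt_chartRep x hy
  have hL := (hη.bilin b hf).differentiableAt_chartRep x hy
  rw [hr] at hL
  have hap : ∀ v u : E, fderiv ℝ (fun y => b (f (c.symm y)) (chartRep x η y fun _ => v)) (c x) u =
      b (fderiv ℝ (f ∘ c.symm) (c x) u) (chartRep x η (c x) fun _ => v) +
        b (f (c.symm (c x))) (fderiv ℝ (fun y => chartRep x η y fun _ => v) (c x) u) := by
    intro v u
    have h1 : DifferentiableAt ℝ (fun y => chartRep x η y fun _ => v) (c x) :=
      (ContinuousAlternatingMap.apply ℝ E W (fun _ : Fin 1 => v)).differentiableAt.comp _ hτ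
    have h2 := (b.hasFDerivAt_of_bilinear hF.hasFDerivAt h1.hasFDerivAt).fderiv
    refine (DFunLike.congr_fun h2 u).trans ?_
    simp [add_comm]
  ext X
  have hX : X = ![X 0, X 1] := by funext j; fin_cases j <;> rfl
  rw [hX, ContinuousAlternatingMap.add_apply, extDeriv_one_apply hL, wedge_one_one_apply]
  simp only [ContinuousLinearMap.compContinuousAlternatingMap_coe, Function.comp_apply]
  rw [hap, hap, extDeriv_one_apply hτ]
  simp only [ContinuousAlternatingMap.ofSubsingleton_apply_apply, map_sub, Matrix.cons_val_zero,
    Matrix.cons_val_one]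
  abel

end Differential

/-! ### The covariant derivative of sections of Ad P. -/

section InfinitesimalAction

variable {EM EG EP : Type*} [NormedAddCommGroup EM] [NormedSpace ℝ EM]
  [NormedAddCommGroup EG] [NormedSpace ℝ EG] [NormedAddCommGroup EP] [NormedSpace ℝ EP]
  {M G P : Type*} [TopologicalSpace M] [ChartedSpace EM M]
  [TopologicalSpace G] [ChartedSpace EG G] [Group G]
  [TopologicalSpace P] [ChartedSpace EP P]
  {B : PrincipalBundle EM EG EP M G P}
  [FiniteDimensional ℝ EG] [LieGroup 𝓘(ℝ, EG) ∞ G] [IsManifold 𝓘(ℝ, EP) ∞ P]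

theorem mdifferentiable_adSection (ξ : AdSection B) : MDifferentiable 𝓘(ℝ, EP) 𝓘(ℝ, EG) ξ.1 :=
  ξ.2.1.mdifferentiable (by simp)

/-- The derivative of ξ(p g) = Ad(g⁻¹) ξ(p) at g = 1. -/
theorem tangent_adSection_fund (ξ : AdSection B) (p : P) (A : EG) :
    tangent (E := EP) (E' := EG) ξ.1 p (B.fund p A) = -lieBracket EG G A (ξ.1 p) := by
  have h1 := tangent_comp (E := EG) (E' := EP) (E'' := EG) (g := ξ.1)
    (f := fun g : G => B.act p g) (x := 1) (mdifferentiable_adSection ξ _) (B.mdifferentiable_act_right p 1)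
  have h2 : ξ.1 ∘ (fun g : G => B.act p g) = fun g => Ad EG g⁻¹ (ξ.1 p) :=
    funext fun g => ξ.2.2 g p
  have h3 : MDifferentiableAt 𝓘(ℝ, EG) 𝓘(ℝ, EG) (fun g : G => Ad EG g⁻¹ (ξ.1 p)) 1 := by
    rw [← h2]
    exact (mdifferentiable_adSection ξ _).comp _ (B.mdifferentiable_act_right p 1)
  have h4 := (hasFDerivAt_Ad_inv_chart (EG := EG) (G := G)).clm_apply
    (hasFDerivAt_const (ξ.1 p) (oneChart EG G 1))
  rw [h2, tangent_eq_fderiv_chart h3 rfl] at h1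
  have h5 : fderiv ℝ (fun u => Ad EG ((oneChart EG G).symm u)⁻¹ (ξ.1 p)) (oneChart EG G 1) A =
      tangent (E := EP) (E' := EG) ξ.1 (B.act p 1) (B.fund p A) := DFunLike.congr_fun h1 A
  rw [B.act_one, h4.fderiv] at h5
  rw [← h5]
  simp

theorem tangent_adSection_tangentAct (ξ : AdSection B) (g : G) (p : P) (X : EP) :
    tangent (E := EP) (E' := EG) ξ.1 (B.act p g) (B.tangentAct g p X) =
      Ad EG g⁻¹ (tangent (E := EP) (E' := EG) ξ.1 p X) := by
  have h1 := tangent_comp (E := EP) (E' := EP) (E'' := EG) (g := ξ.1)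
    (f := fun q : P => B.act q g) (x := p) (mdifferentiable_adSection ξ _) (B.mdifferentiable_act_left g p)
  have h2 : ξ.1 ∘ (fun q : P => B.act q g) = Ad EG g⁻¹ ∘ ξ.1 := funext fun q => ξ.2.2 g q
  have h3 := tangent_comp (E := EP) (E' := EG) (E'' := EG) (g := Ad EG g⁻¹)
    (f := ξ.1) (x := p) (Ad EG g⁻¹).mdifferentiableAt (mdifferentiable_adSection ξ p)
  rw [h2, h3, tangent_eq_fderiv, ContinuousLinearMap.fderiv] at h1
  exact (DFunLike.congr_fun h1 X).symm

namespace Connection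

/-- The covariant derivative `dξ + [Γ, ξ]` of a section of the adjoint bundle. -/
def covSection (Γ : Connection B) (ξ : AdSection B) : AdForm B 1 :=
  ⟨dForm EP ξ.1 + fun p => ((lieBracket EG G).flip (ξ.1 p)).compContinuousAlternatingMap (Γ.form p),
    { smooth := (isSmoothForm_dForm ξ.2.1).add (Γ.smooth.bilin _ ξ.2.1)
      horizontal := fun p X h => by
        obtain ⟨i, A, hi⟩ := h
        have hX : X = fun _ => B.fund p A := by
          funext j; rw [← hi]; congr 1; exact Subsingleton.elim _ _
        -- On a fundamental vector dξ gives -[A, ξ], which the bracket term [Γ(A), ξ] = [A, ξ]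
        -- cancels.
        rw [hX, Pi.add_apply, ContinuousAlternatingMap.add_apply, dForm_apply, tangent_adSection_fund]
        simp [Γ.fund p A]
      equivariant := fun g p X => by
        rw [Pi.add_apply, Pi.add_apply, ContinuousAlternatingMap.add_apply,
          ContinuousAlternatingMap.add_apply, map_add, dForm_apply, dForm_apply,
          tangent_adSection_tangentAct]
        simp [Γ.equivariant g p X, ξ.2.2 g p, Ad_lieBracket] }⟩

theorem covSection_apply (Γ : Connection B) (ξ : AdSection B) (p : P) (X : Fin 1 → EP) :
    (Γ.covSection ξ).form p X = tangent (E := EP) (E' := EG) ξ.1 p (X 0) +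
      lieBracket EG G (Γ.form p X) (ξ.1 p) := rfl

end Connection

end InfinitesimalAction

/-! ### The velocity of a connection moved by a curve of gauge transformations. -/

section Velocity

variable {EM EG EP : Type*} [NormedAddCommGroup EM] [NormedSpace ℝ EM]
  [NormedAddCommGroup EG] [NormedSpace ℝ EG] [NormedAddCommGroup EP] [NormedSpace ℝ EP]
  {M G P : Type*} [TopologicalSpace M] [ChartedSpace EM M]
  [TopologicalSpace G] [ChartedSpace EG G] [Group G]
  [TopologicalSpace P] [ChartedSpace EP P]
  {B : PrincipalBundle EM EG EP M G P}
  [FiniteDimensional ℝ EG] [LieGroup 𝓘(ℝ, EG) ∞ G] [IsManifold 𝓘(ℝ, EP) ∞ P]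

namespace PrincipalBundle.LocalTriv

/-- The group element by which a gauge transformation moves a point of the bundle. -/
def shift (T : LocalTriv B) (φ : GaugeTransformation B) (p : P) : G :=
  (T.coord p)⁻¹ * T.coord (φ.toDiffeo p)

theorem act_shift (T : LocalTriv B) (φ : GaugeTransformation B) {p : P} (hp : B.proj p ∈ T.base) :
    B.act p (T.shift φ p) = φ.toDiffeo p := by
  have hp' : B.proj (φ.toDiffeo p) ∈ T.base := by rwa [φ.proj_eq]
  have h1 := T.act_sec (φ.toDiffeo p) hp'
  rw [φ.proj_eq] at h1
  have h2 := T.act_sec p hp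
  conv_lhs => rw [← h2]
  rw [← B.act_mul, h2, shift, mul_inv_cancel_left, h1]

/-- By equivariance φ(p · s⁻¹) = φ(p) · s⁻¹ = p, where φ(p) = p · s. The inverse of φ is thus given
by inversion in G. -/
theorem act_shift_inv (T : LocalTriv B) (φ : GaugeTransformation B) {p : P}
    (hp : B.proj p ∈ T.base) : φ⁻¹.toDiffeo p = B.act p (T.shift φ p)⁻¹ := by
  have h : φ.toDiffeo (B.act p (T.shift φ p)⁻¹) = p := by
    rw [φ.equivariant, ← T.act_shift φ hp, ← B.act_mul, mul_inv_cancel, B.act_one]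
  have h2 : φ⁻¹.toDiffeo (φ.toDiffeo (B.act p (T.shift φ p)⁻¹)) = B.act p (T.shift φ p)⁻¹ :=
    φ.toDiffeo.symm_apply_apply _
  rwa [h] at h2

end PrincipalBundle.LocalTriv

namespace IsGaugeCurve

variable {c : ℝ → GaugeTransformation B} {ξ : AdSection B}

theorem contMDiffOn_shift (hc : IsGaugeCurve c ξ) (T : PrincipalBundle.LocalTriv B) :
    ContMDiffOn (𝓘(ℝ, ℝ).prod 𝓘(ℝ, EP)) 𝓘(ℝ, EG) ∞ (fun z : ℝ × P => T.shift (c z.1) z.2)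
      {z | B.proj z.2 ∈ T.base} := by
  have h1 : ContMDiffOn (𝓘(ℝ, ℝ).prod 𝓘(ℝ, EP)) 𝓘(ℝ, EG) ∞ (fun z : ℝ × P => T.coord z.2)
      {z | B.proj z.2 ∈ T.base} :=
    T.contMDiffOn_coord.comp contMDiff_snd.contMDiffOn fun z hz => hz
  have h2 : ContMDiffOn (𝓘(ℝ, ℝ).prod 𝓘(ℝ, EP)) 𝓘(ℝ, EG) ∞
      (fun z : ℝ × P => T.coord ((c z.1).toDiffeo z.2)) {z | B.proj z.2 ∈ T.base} :=
    T.contMDiffOn_coord.comp hc.smooth.contMDiffOn fun z hz => by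
      change B.proj ((c z.1).toDiffeo z.2) ∈ T.base
      rw [(c z.1).proj_eq]
      exact hz
  exact h1.inv.mul h2

/-- Joint smoothness of the inverses is not assumed for a gauge curve; locally it follows from
smoothness of the group element that moves p. -/
theorem contMDiff_inv (hc : IsGaugeCurve c ξ) :
    ContMDiff (𝓘(ℝ, ℝ).prod 𝓘(ℝ, EP)) 𝓘(ℝ, EP) ∞ fun z : ℝ × P => (c z.1)⁻¹.toDiffeo z.2 := by
  intro z
  obtain ⟨T, hT⟩ := B.exists_localTriv (B.proj z.2)
  have hO : IsOpen {z : ℝ × P | B.proj z.2 ∈ T.base} :=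
    T.isOpen_base.preimage (B.contMDiff_proj.continuous.comp continuous_snd)
  have h1 := B.contMDiff_act.comp_contMDiffOn
    (contMDiff_snd.contMDiffOn.prodMk (hc.contMDiffOn_shift T).inv)
  refine (h1.contMDiffAt (hO.mem_nhds hT)).congr_of_eventuallyEq ?_
  filter_upwards [hO.mem_nhds hT] with w hw using T.act_shift_inv (c w.1) hw

/-- The inverses of a gauge curve have the opposite velocity. -/
theorem velocity_inv (hc : IsGaugeCurve c ξ) (p : P) :
    tangent (E := ℝ) (E' := EP) (fun t : ℝ => (c t)⁻¹.toDiffeo p) 0 1 = -B.fund p (ξ.1 p) := by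
  obtain ⟨T, hT⟩ := B.exists_localTriv (B.proj p)
  have hu : ContMDiff 𝓘(ℝ, ℝ) 𝓘(ℝ, EG) ∞ fun t : ℝ => (T.shift (c t) p)⁻¹ := by
    have := (hc.contMDiffOn_shift T).comp
      (contMDiff_id.prodMk (contMDiff_const (c := p) (I := 𝓘(ℝ, ℝ)) (M := ℝ))).contMDiffOn
      (s := univ) fun t _ => hT
    exact (contMDiffOn_univ.1 this).inv
  have hc1 : ContMDiff 𝓘(ℝ, ℝ) 𝓘(ℝ, EP) ∞ fun t : ℝ => (c t).toDiffeo p :=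
    hc.smooth.comp (contMDiff_id.prodMk contMDiff_const)
  have hu0 : (T.shift (c 0) p)⁻¹ = 1 := by
    rw [hc.start]
    exact inv_eq_one.2 (inv_mul_cancel _)
  have hp0 : (c 0).toDiffeo p = p := by rw [hc.start]; rfl
  have hud := hu.mdifferentiable (by simp) (0 : ℝ)
  have hcd := hc1.mdifferentiable (by simp) (0 : ℝ)
  have h1 := B.tangent_act (E₁ := ℝ) (N := ℝ) (a := fun _ : ℝ => p) (x := 0)
    mdifferentiableAt_const hud 1
  have h2 := B.tangent_act (E₁ := ℝ) (N := ℝ) (x := 0) hcd hud 1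
  -- With c_t(p) = p · s_t, the curve c_t(p) · s_t⁻¹ is constant; by the Leibniz rule its vanishing
  -- velocity is that of c_t(p) plus that of p · s_t⁻¹ = c_t⁻¹(p).
  have h3 : (fun t : ℝ => B.act ((c t).toDiffeo p) (T.shift (c t) p)⁻¹) = fun _ => p := by
    funext t
    rw [← T.act_shift (c t) hT, ← B.act_mul, mul_inv_cancel, B.act_one]
  have h4 : (fun t : ℝ => (c t)⁻¹.toDiffeo p) = fun t => B.act p (T.shift (c t) p)⁻¹ :=
    funext fun t => T.act_shift_inv (c t) hT
  have h5 : tangent (E := ℝ) (E' := EP) (fun _ : ℝ => p) 0 = 0 := mfderiv_const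
  have h6 : B.tangentAct (1 : G) p = ContinuousLinearMap.id ℝ EP := by
    have : (fun q : P => B.act q 1) = id := funext B.act_one
    rw [PrincipalBundle.tangentAct, this, tangent_id]
  rw [h3, h5] at h2
  rw [hc.velocity] at h2
  simp only [hu0, hp0, h6, B.act_one] at h2
  rw [h4, h1, h5]
  simp only [hu0, B.act_one, zero_apply, map_zero, zero_add]
  rw [zero_apply] at h2
  exact (neg_eq_of_add_eq_zero_right h2.symm).symm

/-- A gauge curve acting on a chart of the bundle. -/
def plot (_hc : IsGaugeCurve c ξ) (x : P) (z : ℝ × EP) : P :=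
  (c z.1)⁻¹.toDiffeo ((extChartAt 𝓘(ℝ, EP) x).symm z.2)

theorem contMDiffOn_plot (hc : IsGaugeCurve c ξ) (x : P) :
    ContMDiffOn 𝓘(ℝ, ℝ × EP) 𝓘(ℝ, EP) ∞ (hc.plot x) (univ ×ˢ chartTarget EP x) := by
  have h1 : ContMDiffOn 𝓘(ℝ, ℝ × EP) 𝓘(ℝ, EP) ∞
      (fun z : ℝ × EP => (extChartAt 𝓘(ℝ, EP) x).symm z.2) (univ ×ˢ chartTarget EP x) :=
    (contMDiffOn_chart_symm x).comp contDiff_snd.contMDiff.contMDiffOn fun z hz => hz.2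
  exact hc.contMDiff_inv.comp_contMDiffOn (contDiff_fst.contMDiff.contMDiffOn.prodMk h1)

theorem isOpen_strip (x : P) : IsOpen ((univ : Set ℝ) ×ˢ chartTarget EP x) :=
  isOpen_univ.prod (isOpen_extChartAt_target x)

theorem mdifferentiableAt_plot (hc : IsGaugeCurve c ξ) (x : P) (t : ℝ) {y : EP}
    (hy : y ∈ chartTarget EP x) :
    MDifferentiableAt 𝓘(ℝ, ℝ × EP) 𝓘(ℝ, EP) (hc.plot x) (t, y) :=
  ((hc.contMDiffOn_plot x).contMDiffAt ((isOpen_strip x).mem_nhds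
    ⟨mem_univ t, hy⟩)).mdifferentiableAt (by simp)

theorem tangent_plot_right (hc : IsGaugeCurve c ξ) (x : P) {y : EP} (hy : y ∈ chartTarget EP x)
    (Y : EP) : tangent (E := ℝ × EP) (E' := EP) (hc.plot x) (0, y) (0, Y) =
      tangent (E := EP) (E' := EP) (extChartAt 𝓘(ℝ, EP) x).symm y Y := by
  have h1 := tangent_comp (E := EP) (E' := ℝ × EP) (E'' := EP) (f := fun y : EP => ((0 : ℝ), y))
    (hc.mdifferentiableAt_plot x 0 hy)
    (differentiableAt_const (0 : ℝ) |>.prodMk differentiableAt_id).mdifferentiableAt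
  have h2 : hc.plot x ∘ (fun y : EP => ((0 : ℝ), y)) = (extChartAt 𝓘(ℝ, EP) x).symm := by
    funext y
    simp only [plot, Function.comp_apply, hc.start, inv_one]
    rfl
  rw [h2, tangent_eq_fderiv, (hasFDerivAt_prodMk_right (0 : ℝ) y).fderiv] at h1
  exact (DFunLike.congr_fun h1 Y).symm

theorem tangent_plot_left (hc : IsGaugeCurve c ξ) (x : P) {y : EP} (hy : y ∈ chartTarget EP x) :
    tangent (E := ℝ × EP) (E' := EP) (hc.plot x) (0, y) (1, 0) =
      -B.fund ((extChartAt 𝓘(ℝ, EP) x).symm y) (ξ.1 ((extChartAt 𝓘(ℝ, EP) x).symm y)) := by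
  have h1 := tangent_comp (E := ℝ) (E' := ℝ × EP) (E'' := EP) (f := fun t : ℝ => (t, y)) (x := 0)
    (hc.mdifferentiableAt_plot x 0 hy)
    (differentiableAt_id.prodMk (differentiableAt_const y)).mdifferentiableAt
  rw [tangent_eq_fderiv, (hasFDerivAt_prodMk_left (0 : ℝ) y).fderiv] at h1
  exact (DFunLike.congr_fun h1 1).symm.trans (hc.velocity_inv ((extChartAt 𝓘(ℝ, EP) x).symm y))

theorem plot_zero (hc : IsGaugeCurve c ξ) (x : P) (y : EP) :
    hc.plot x (0, y) = (extChartAt 𝓘(ℝ, EP) x).symm y := by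
  simp only [plot, hc.start, inv_one]
  rfl

variable (Γ : Connection B)

theorem contDiffOn_pullback_plot (hc : IsGaugeCurve c ξ) (x : P) :
    ContDiffOn ℝ ∞ (pullback (E := ℝ × EP) (E' := EP) (hc.plot x) Γ.form)
      (univ ×ˢ chartTarget EP x) :=
  Γ.smooth.contDiffOn_pullback (isOpen_strip x) (hc.contMDiffOn_plot x)

/-- The chart representations of the connections `c t • Γ`. -/
theorem chartRep_smul_eq (hc : IsGaugeCurve c ξ) (x : P) (t : ℝ) {y : EP} (hy : y ∈ chartTarget EP x) :
    chartRep x (c t • Γ).form y =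
      (pullback (E := ℝ × EP) (E' := EP) (hc.plot x) Γ.form (t, y)).compContinuousLinearMap
        (ContinuousLinearMap.inr ℝ ℝ EP) := by
  have h0 : (c t • Γ).form = pullback (E := EP) (E' := EP) (c t)⁻¹.toDiffeo Γ.form := rfl
  rw [h0, chartRep_pullback (GaugeTransformation.mdiff _) Γ.form x hy]
  have h2 : (⇑(c t)⁻¹.toDiffeo : P → P) ∘ (extChartAt 𝓘(ℝ, EP) x).symm =
      hc.plot x ∘ fun y : EP => (t, y) := rfl
  rw [h2, pullback_comp_apply (E := EP) (E' := ℝ × EP) (E'' := EP)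
    (hc.mdifferentiableAt_plot x t hy)
    (differentiableAt_const t |>.prodMk differentiableAt_id).mdifferentiableAt, pullback,
    tangent_eq_fderiv, (hasFDerivAt_prodMk_right t y).fderiv]

/-- Cartan's formula in disguise. For τ, the pull-back of Γ along (t, y) ↦ c_t⁻¹(y), one has ∂_t
τ(Y) = dτ(∂_t, Y) + Y(τ(∂_t)). At t = 0 the direction ∂_t maps to the fundamental vector of -ξ, so
the two terms are [ξ, Γ(Y)] and -dξ(Y). -/
theorem fderiv_pullback_plot (hc : IsGaugeCurve c ξ) (x : P) {y : EP} (hy : y ∈ chartTarget EP x)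
    (Y : EP) : fderiv ℝ (fun z => pullback (E := ℝ × EP) (E' := EP) (hc.plot x) Γ.form z
        fun _ => (0, Y)) (0, y) (1, 0) =
      chartRep x (-Γ.covSection ξ).form y fun _ => Y := by
  set s := (extChartAt 𝓘(ℝ, EP) x).symm with hs
  set τ := pullback (E := ℝ × EP) (E' := EP) (hc.plot x) Γ.form with hτ
  have hz : ((0 : ℝ), y) ∈ (univ : Set ℝ) ×ˢ chartTarget EP x := ⟨mem_univ _, hy⟩
  have hτd : DifferentiableAt ℝ τ (0, y) := ((contDiffOn_pullback_plot Γ hc x).contDiffAt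
    ((isOpen_strip x).mem_nhds hz)).differentiableAt (by simp)
  have h1 := extDeriv_one_apply hτd ((1, 0) : ℝ × EP) (0, Y)
  set X := tangent (E := EP) (E' := EP) s y Y with hX
  -- Here dΓ = curv Γ - ½ [Γ ∧ Γ], and the curvature vanishes on the vertical vector.
  have h2 : extDeriv τ (0, y) ![((1, 0) : ℝ × EP), (0, Y)] =
      lieBracket EG G (ξ.1 (s y)) (Γ.form (s y) fun _ => X) := by
    have e1 : extD Γ.form (s y) = Γ.curvature (s y) -
        (1 / 2 : ℝ) • wedge (lieBracket EG G) (Γ.form (s y)) (Γ.form (s y)) := by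
      rw [Connection.curvature, add_sub_cancel_right]
    have e2 : (fun i => tangent (E := ℝ × EP) (E' := EP) (hc.plot x) (0, y)
        ((![((1, 0) : ℝ × EP), (0, Y)] : Fin 2 → ℝ × EP) i)) =
        ![B.fund (s y) (-ξ.1 (s y)), X] := by
      funext i
      fin_cases i
      · exact (hc.tangent_plot_left x hy).trans
          (map_neg (tangent (E := EG) (E' := EP) (fun g : G => B.act (s y) g) 1) _).symm
      · exact hc.tangent_plot_right x hy Y
    rw [hτ, extDeriv_pullback_plot Γ.smooth (isOpen_strip x) (hc.contMDiffOn_plot x) hz,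
      pullback_apply, e2, hc.plot_zero, ← hs, e1, ContinuousAlternatingMap.sub_apply,
      Γ.curvature_fund, ContinuousAlternatingMap.smul_apply, wedge_one_one_apply]
    simp only [Matrix.cons_val_zero, Matrix.cons_val_one, Γ.fund]
    rw [lieBracket_swap (Γ.form (s y) fun _ => X), sub_neg_eq_add, ← two_smul ℝ, smul_smul]
    simp
  -- At t = 0 the value τ(∂_t) is -ξ, as Γ reproduces the generators of fundamental vectors.
  have h3 : fderiv ℝ (fun z => τ z fun _ => ((1, 0) : ℝ × EP)) (0, y) (0, Y) =
      -tangent (E := EP) (E' := EG) ξ.1 (s y) X := by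
    have hd : DifferentiableAt ℝ (fun z => τ z fun _ => ((1, 0) : ℝ × EP)) (0, y) :=
      ((ContinuousAlternatingMap.apply ℝ (ℝ × EP) EG
        (fun _ : Fin 1 => ((1, 0) : ℝ × EP))).differentiableAt).comp _ hτd
    have e1 := (hd.hasFDerivAt.comp y (hasFDerivAt_prodMk_right (0 : ℝ) y)).fderiv
    have e2 : (fun z => τ z fun _ => ((1, 0) : ℝ × EP)) ∘ (fun y => ((0 : ℝ), y)) =ᶠ[𝓝 y]
        fun y => -(ξ.1 ∘ s) y := by
      filter_upwards [(isOpen_extChartAt_target x).mem_nhds hy] with w hw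
      simp only [Function.comp_apply]
      rw [hτ, pullback_apply, hc.plot_zero]
      simp only [hc.tangent_plot_left x hw]
      rw [← Γ.fund (s w) (-ξ.1 (s w))]
      simp [PrincipalBundle.fund, hs]
    have e3 := DFunLike.congr_fun (e2.fderiv_eq.symm.trans e1) Y
    have e4 := tangent_comp (E := EP) (E' := EP) (E'' := EG) (g := ξ.1) (f := s) (x := y)
      (mdifferentiable_adSection ξ _) (mdifferentiableAt_chart_symm hy)
    rw [tangent_eq_fderiv] at e4
    rw [fderiv_fun_neg, e4] at e3
    exact e3.symm
  rw [h2, h3] at h1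
  have h4 : fderiv ℝ (fun z => τ z fun _ => ((0, Y) : ℝ × EP)) (0, y) (1, 0) =
      lieBracket EG G (ξ.1 (s y)) (Γ.form (s y) fun _ => X) -
        tangent (E := EP) (E' := EG) ξ.1 (s y) X := by
    rw [h1]; abel
  rw [h4, lieBracket_swap]
  change _ = -((Γ.covSection ξ).form (s y) fun _ => X)
  rw [Connection.covSection_apply]
  abel

variable [FiniteDimensional ℝ EP]

/-- In each chart the quotients are difference quotients of a jointly smooth family; these converge
with all derivatives. Only the pointwise time derivative remains to be identified. -/
theorem hasVelocity (hc : IsGaugeCurve c ξ) :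
    Connection.HasVelocity (fun t => c t • Γ) (-Γ.covSection ξ) := by
  refine AdForm.tendsto_iff.2 fun x => ?_
  have hU : IsOpen (chartTarget EP x) := isOpen_extChartAt_target x
  have hs := contDiffOn_pullback_plot Γ hc x
  set F : ℝ × EP → EP [⋀^Fin 1]→L[ℝ] EG := fun z =>
    (pullback (E := ℝ × EP) (E' := EP) (hc.plot x) Γ.form z).compContinuousLinearMap
        (ContinuousLinearMap.inr ℝ ℝ EP) with hF
  have hFs : ContDiffOn ℝ ∞ F (univ ×ˢ chartTarget EP x) :=
    contDiffOn_compContinuousLinearMap hs contDiffOn_const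
  refine (cinfTendsto_slope hU hFs).congr hU (fun t y hy => ?_) (fun y hy => ?_)
  · have h1 := chartRep_smul_eq Γ hc x t hy
    have h2 := chartRep_smul_eq Γ hc x 0 hy
    beta_reduce
    rw [hF]
    beta_reduce
    rw [← h1, ← h2, sub_eq_add_neg, ← neg_one_smul ℝ]
    rfl
  · have hd : DifferentiableAt ℝ F (0, y) := (hFs.contDiffAt ((isOpen_strip x).mem_nhds
      ⟨mem_univ _, hy⟩)).differentiableAt (by simp)
    ext X
    have h0 : X = fun _ => X 0 := by funext i; congr 1; exact Subsingleton.elim _ _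
    have h1 := (((ContinuousAlternatingMap.apply ℝ EP EG X).hasFDerivAt).comp (0, y)
      hd.hasFDerivAt).fderiv
    have h2 := (DFunLike.congr_fun h1 (1, 0)).symm
    refine Eq.trans h2 ?_
    conv_rhs => rw [h0]
    rw [← fderiv_pullback_plot Γ hc x hy (X 0)]
    conv_lhs => rw [h0]
    rfl

end IsGaugeCurve

end Velocity

/-! ### Existence of gauge curves with given velocity -/

section GaugeCurves

variable {EM EG EP : Type*} [NormedAddCommGroup EM] [NormedSpace ℝ EM]
  [NormedAddCommGroup EG] [NormedSpace ℝ EG] [NormedAddCommGroup EP] [NormedSpace ℝ EP]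
  {M G P : Type*} [TopologicalSpace M] [ChartedSpace EM M]
  [TopologicalSpace G] [ChartedSpace EG G] [Group G]
  [TopologicalSpace P] [ChartedSpace EP P]
  {B : PrincipalBundle EM EG EP M G P}
  [FiniteDimensional ℝ EG] [LieGroup 𝓘(ℝ, EG) ∞ G] [IsManifold 𝓘(ℝ, EP) ∞ P]

variable (EG G) in
/-- A global smooth substitute for the exponential map. -/
theorem exists_smooth_retraction : ∃ e : EG → G, ContMDiff 𝓘(ℝ, EG) 𝓘(ℝ, EG) ∞ e ∧ e 0 = 1 ∧
    tangent (E := EG) (E' := EG) e 0 = ContinuousLinearMap.id ℝ EG := by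
  set y₀ := oneChart EG G 1 with hy₀
  obtain ⟨δ, hδ, hb⟩ := Metric.isOpen_iff.1 (isOpen_extChartAt_target (I := 𝓘(ℝ, EG)) (1 : G)) y₀
    oneChart_one_mem
  -- The map A ↦ χ(A) A is the identity near 0 and stays in the ball of radius δ, since χ vanishes
  -- beyond δ / 2. Hence the inverse chart is defined on all its values.
  let χ : ContDiffBump (0 : EG) := ⟨δ / 3, δ / 2, by positivity, by linarith⟩
  have hsm : ContDiff ℝ ∞ fun A : EG => y₀ + χ A • A :=
    contDiff_const.add (χ.contDiff.smul contDiff_id)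
  have hmem : ∀ A : EG, y₀ + χ A • A ∈ (oneChart EG G).target := by
    intro A
    apply hb
    rw [Metric.mem_ball, dist_eq_norm, add_sub_cancel_left, norm_smul, Real.norm_eq_abs,
      abs_of_nonneg χ.nonneg]
    by_cases hA : χ.rOut ≤ dist A 0
    · rw [χ.zero_of_le_dist hA, zero_mul]
      exact hδ
    · have h1 : ‖A‖ < δ / 2 := by
        rw [← dist_zero_right]
        exact not_le.1 hA
      calc χ A * ‖A‖ ≤ 1 * ‖A‖ := mul_le_mul_of_nonneg_right χ.le_one (norm_nonneg _)
        _ < δ := by linarith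
  refine ⟨fun A => (oneChart EG G).symm (y₀ + χ A • A), fun A =>
    contMDiffAt_oneChart_symm hsm.contDiffAt (hmem A), ?_, ?_⟩
  · simp [hy₀]
  · have h1 := tangent_comp (E := EG) (E' := EG) (E'' := EG) (g := (oneChart EG G).symm)
      (f := fun A : EG => y₀ + χ A • A) (x := 0) (mdifferentiableAt_chart_symm (hmem 0))
      (hsm.contMDiff.mdifferentiable (by simp : (∞ : WithTop ℕ∞) ≠ 0) 0)
    have h2 : (fun A : EG => y₀ + χ A • A) =ᶠ[𝓝 0] fun A => y₀ + A := by
      filter_upwards [χ.eventuallyEq_one] with A hA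
      rw [hA, Pi.one_apply, one_smul]
    have h3 : fderiv ℝ (fun A : EG => y₀ + χ A • A) 0 = ContinuousLinearMap.id ℝ EG := by
      rw [h2.fderiv_eq, fderiv_const_add, fderiv_fun_id]
    have h4 : tangent (E := EG) (E' := EG) (oneChart EG G).symm y₀ = ContinuousLinearMap.id ℝ EG :=
      tangent_chart_symm_self (1 : G)
    rw [tangent_eq_fderiv, h3, ContinuousLinearMap.comp_id] at h1
    simp only [smul_zero, add_zero] at h1
    exact h1.trans h4

namespace PrincipalBundle.LocalTriv

variable (T : LocalTriv B)

open Classical in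
/-- Left translation by a `G`-valued function in a local trivialisation, extended by the
identity. -/
def move (h : M → G) (p : P) : P :=
  if B.proj p ∈ T.base then B.act (T.sec (B.proj p)) (h (B.proj p) * T.coord p) else p

theorem move_of_mem (h : M → G) {p : P} (hp : B.proj p ∈ T.base) :
    T.move h p = B.act (T.sec (B.proj p)) (h (B.proj p) * T.coord p) := if_pos hp

theorem move_of_eq_one {h : M → G} {p : P} (hp : h (B.proj p) = 1) : T.move h p = p := by
  by_cases hb : B.proj p ∈ T.base
  · rw [T.move_of_mem h hb, hp, one_mul, T.act_sec p hb]
  · exact if_neg hb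

theorem proj_move (h : M → G) (p : P) : B.proj (T.move h p) = B.proj p := by
  by_cases hp : B.proj p ∈ T.base
  · rw [T.move_of_mem h hp, B.proj_act, T.proj_sec _ hp]
  · rw [move, if_neg hp]

theorem move_act (h : M → G) (p : P) (g : G) : T.move h (B.act p g) = B.act (T.move h p) g := by
  by_cases hp : B.proj p ∈ T.base
  · have hp' : B.proj (B.act p g) ∈ T.base := by rwa [B.proj_act]
    rw [T.move_of_mem h hp, T.move_of_mem h hp', B.proj_act, T.coord_act p hp, ← B.act_mul, mul_assoc]
  · have hp' : B.proj (B.act p g) ∉ T.base := by rwa [B.proj_act]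
    rw [move, move, if_neg hp, if_neg hp']

theorem move_move_inv (h : M → G) (p : P) : T.move h (T.move (fun m => (h m)⁻¹) p) = p := by
  by_cases hp : B.proj p ∈ T.base
  · rw [T.move_of_mem h (by rwa [T.proj_move]), T.proj_move, T.move_of_mem _ hp,
      T.coord_act_sec hp, mul_inv_cancel_left, T.act_sec p hp]
  · rw [move, T.proj_move, if_neg hp, move, if_neg hp]

/-- Over the base of the trivialisation there is a smooth formula, over the complement of K the map
is the identity, and these two open sets cover M. -/
theorem contMDiff_move {h : ℝ × M → G} (hh : ContMDiff (𝓘(ℝ, ℝ).prod 𝓘(ℝ, EM)) 𝓘(ℝ, EG) ∞ h)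
    {K : Set M} (hK : IsClosed K) (hKb : K ⊆ T.base) (h1 : ∀ t, ∀ m ∉ K, h (t, m) = 1) :
    ContMDiff (𝓘(ℝ, ℝ).prod 𝓘(ℝ, EP)) 𝓘(ℝ, EP) ∞
      fun z : ℝ × P => T.move (fun m => h (z.1, m)) z.2 := by
  have hcont : Continuous fun z : ℝ × P => B.proj z.2 :=
    B.contMDiff_proj.continuous.comp continuous_snd
  have hproj : ContMDiff (𝓘(ℝ, ℝ).prod 𝓘(ℝ, EP)) 𝓘(ℝ, EM) ∞ fun z : ℝ × P => B.proj z.2 :=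
    B.contMDiff_proj.comp contMDiff_snd
  intro z
  by_cases hz : B.proj z.2 ∈ T.base
  · have hO : IsOpen {z : ℝ × P | B.proj z.2 ∈ T.base} := T.isOpen_base.preimage hcont
    have e1 : ContMDiffOn (𝓘(ℝ, ℝ).prod 𝓘(ℝ, EP)) 𝓘(ℝ, EP) ∞
        (fun z : ℝ × P => T.sec (B.proj z.2)) {z | B.proj z.2 ∈ T.base} :=
      T.contMDiffOn_sec.comp hproj.contMDiffOn fun z hz => hz
    have e2 : ContMDiffOn (𝓘(ℝ, ℝ).prod 𝓘(ℝ, EP)) 𝓘(ℝ, EG) ∞ (fun z : ℝ × P => T.coord z.2)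
        {z | B.proj z.2 ∈ T.base} :=
      T.contMDiffOn_coord.comp contMDiff_snd.contMDiffOn fun z hz => hz
    have e3 : ContMDiff (𝓘(ℝ, ℝ).prod 𝓘(ℝ, EP)) 𝓘(ℝ, EG) ∞
        (fun z : ℝ × P => h (z.1, B.proj z.2)) := hh.comp (contMDiff_fst.prodMk hproj)
    have e4 := B.contMDiff_act.comp_contMDiffOn (e1.prodMk (e3.contMDiffOn.mul e2))
    refine (e4.contMDiffAt (hO.mem_nhds hz)).congr_of_eventuallyEq ?_
    filter_upwards [hO.mem_nhds hz] with w hw using T.move_of_mem _ hw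
  · have hO : IsOpen {z : ℝ × P | B.proj z.2 ∈ Kᶜ} := hK.isOpen_compl.preimage hcont
    refine contMDiff_snd.contMDiffAt.congr_of_eventuallyEq ?_
    filter_upwards [hO.mem_nhds fun hm => hz (hKb hm)] with w hw
    exact T.move_of_eq_one (h1 _ _ hw)

/-- A gauge transformation that is supported over the base of a local trivialisation. -/
def moveGauge {h : ℝ × M → G} (hh : ContMDiff (𝓘(ℝ, ℝ).prod 𝓘(ℝ, EM)) 𝓘(ℝ, EG) ∞ h)
    {K : Set M} (hK : IsClosed K) (hKb : K ⊆ T.base) (h1 : ∀ t, ∀ m ∉ K, h (t, m) = 1) (t : ℝ) :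
    GaugeTransformation B where
  toDiffeo :=
    { toFun := T.move fun m => h (t, m)
      invFun := T.move fun m => (h (t, m))⁻¹
      left_inv := fun p => by
        have := T.move_move_inv (fun m => (h (t, m))⁻¹) p
        simpa only [inv_inv] using this
      right_inv := fun p => T.move_move_inv (fun m => h (t, m)) p
      contMDiff_toFun := (T.contMDiff_move hh hK hKb h1).comp (contMDiff_const.prodMk contMDiff_id)
      contMDiff_invFun := (T.contMDiff_move hh.inv hK hKb fun t m hm => by
        simp only [h1 t m hm, inv_one]).comp (contMDiff_const.prodMk contMDiff_id) }
  proj_eq := T.proj_move fun m => h (t, m)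
  equivariant := T.move_act fun m => h (t, m)

end PrincipalBundle.LocalTriv

/-- The product of a section of the adjoint bundle with a function on the base. -/
def smulSection {f : M → ℝ} (hf : ContMDiff 𝓘(ℝ, EM) 𝓘(ℝ, ℝ) ∞ f) (ξ : AdSection B) : AdSection B :=
  ⟨fun p => f (B.proj p) • ξ.1 p, (hf.comp B.contMDiff_proj).smul ξ.2.1, fun g p => by
    beta_reduce
    rw [B.proj_act, ξ.2.2, map_smul]⟩

/-- The curve multiplies the local section over m by e(t f(m) ξ(sec m)), where e replaces the
exponential map: only its value and its derivative at 0 matter. -/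
theorem exists_isGaugeCurve_of_tsupport (T : PrincipalBundle.LocalTriv B) {f : M → ℝ}
    (hf : ContMDiff 𝓘(ℝ, EM) 𝓘(ℝ, ℝ) ∞ f) (hT : tsupport f ⊆ T.base) (ξ : AdSection B) :
    ∃ c, IsGaugeCurve c (smulSection hf ξ) := by
  obtain ⟨e, he, he0, het⟩ := exists_smooth_retraction EG G
  set a : M → EG := fun m => f m • ξ.1 (T.sec m) with ha
  have has : ContMDiff 𝓘(ℝ, EM) 𝓘(ℝ, EG) ∞ a := by
    refine contMDiff_of_tsupport fun m hm => ?_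
    have hm' : m ∈ T.base := hT (tsupport_smul_subset_left _ _ hm)
    exact hf.contMDiffAt.smul (ξ.2.1.contMDiffAt.comp m
      (T.contMDiffOn_sec.contMDiffAt (T.isOpen_base.mem_nhds hm')))
  set h : ℝ × M → G := fun z => e (z.1 • a z.2) with hh
  have hhs : ContMDiff (𝓘(ℝ, ℝ).prod 𝓘(ℝ, EM)) 𝓘(ℝ, EG) ∞ h :=
    he.comp (contMDiff_fst.smul (has.comp contMDiff_snd))
  have h1 : ∀ t, ∀ m ∉ tsupport f, h (t, m) = 1 := fun t m hm => by
    rw [hh]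
    simp only [ha, image_eq_zero_of_notMem_tsupport hm, zero_smul, smul_zero, he0]
  refine ⟨fun t => T.moveGauge hhs (isClosed_tsupport f) hT h1 t,
    T.contMDiff_move hhs (isClosed_tsupport f) hT h1, ?_, fun p => ?_⟩
  · refine GaugeTransformation.ext (Diffeomorph.ext fun p => ?_)
    exact T.move_of_eq_one (h := fun m => h (0, m)) (by simp [hh, he0])
  · change tangent (E := ℝ) (E' := EP) (fun t : ℝ => T.move (fun m => h (t, m)) p) 0 1 = _
    by_cases hp : B.proj p ∈ T.base
    · set g := T.coord p with hg
      -- Since p = sec · g, multiplying the section by x amounts to moving p by g⁻¹ x g.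
      set k : ℝ → G := fun t => g⁻¹ * e (t • a (B.proj p)) * g⁻¹⁻¹ with hk
      have hcurve : ContMDiff 𝓘(ℝ, ℝ) 𝓘(ℝ, EG) ∞ fun t : ℝ => e (t • a (B.proj p)) :=
        he.comp (contDiff_id.smul contDiff_const).contMDiff
      have hks : ContMDiff 𝓘(ℝ, ℝ) 𝓘(ℝ, EG) ∞ k := (contMDiff_conj g⁻¹).comp hcurve
      have e1 : (fun t : ℝ => T.move (fun m => h (t, m)) p) = fun t => B.act p (k t) := by
        funext t
        rw [T.move_of_mem _ hp]
        conv_rhs => rw [← T.act_sec p hp]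
        rw [← B.act_mul, hk]
        simp only [inv_inv, mul_assoc, ← hg, mul_inv_cancel_left]
        rfl
      have e2 := tangent_comp (E := ℝ) (E' := EG) (E'' := EG) (g := fun x : G => g⁻¹ * x * g⁻¹⁻¹)
        (f := fun t : ℝ => e (t • a (B.proj p))) (x := 0)
        ((contMDiff_conj g⁻¹).mdifferentiable (by simp) _) (hcurve.mdifferentiable (by simp) 0)
      have e3 := tangent_comp (E := ℝ) (E' := EG) (E'' := EG) (g := e)
        (f := fun t : ℝ => t • a (B.proj p)) (x := 0) (he.mdifferentiable (by simp) _)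
        ((contDiff_id.smul contDiff_const).contMDiff.mdifferentiable
          (by simp : (∞ : WithTop ℕ∞) ≠ 0) (0 : ℝ))
      have e4 : tangent (E := ℝ) (E' := EG) (fun t : ℝ => t • a (B.proj p)) 0 1 = a (B.proj p) := by
        rw [tangent_eq_fderiv]
        have := ((hasFDerivAt_id (𝕜 := ℝ) (0 : ℝ)).smul_const (a (B.proj p))).fderiv
        refine (DFunLike.congr_fun this 1).trans ?_
        simp
      have e5 : tangent (E := ℝ) (E' := EG) (fun t : ℝ => e (t • a (B.proj p))) 0 1 =
          a (B.proj p) := by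
        refine (DFunLike.congr_fun e3 1).trans ?_
        rw [zero_smul, het]
        exact e4
      have hk0 : k 0 = 1 := by simp [hk, he0]
      -- Conjugation contributes Ad(g⁻¹), and Ad(g⁻¹) ξ(sec) = ξ(sec · g) = ξ(p).
      have e6 : tangent (E := ℝ) (E' := EG) k 0 1 = f (B.proj p) • ξ.1 p := by
        refine (DFunLike.congr_fun e2 1).trans ?_
        rw [ContinuousLinearMap.comp_apply, e5, zero_smul, he0]
        change Ad EG g⁻¹ (a (B.proj p)) = _
        rw [ha, map_smul, ← ξ.2.2, hg, T.act_sec p hp]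
      have e7 := tangent_comp (E := ℝ) (E' := EG) (E'' := EP) (g := fun x : G => B.act p x)
        (f := k) (x := 0) (B.mdifferentiable_act_right p _) (hks.mdifferentiable (by simp) 0)
      rw [e1]
      refine (DFunLike.congr_fun e7 1).trans ?_
      rw [ContinuousLinearMap.comp_apply, e6, hk0]
      rfl
    · have hf0 : f (B.proj p) = 0 := image_eq_zero_of_notMem_tsupport fun hm => hp (hT hm)
      have e1 : (fun t : ℝ => T.move (fun m => h (t, m)) p) = fun _ => p :=
        funext fun t => T.move_of_eq_one (h1 t _ fun hm => hp (hT hm))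
      have e2 : tangent (E := ℝ) (E' := EP) (fun _ : ℝ => p) 0 = 0 := mfderiv_const
      have e3 : (smulSection hf ξ).1 p = 0 := by
        change f (B.proj p) • ξ.1 p = 0
        rw [hf0, zero_smul]
      rw [e1, e2, e3, PrincipalBundle.fund, map_zero, zero_apply]

theorem isGaugeCurve_one : IsGaugeCurve (B := B) (fun _ => 1) 0 where
  smooth := contMDiff_snd
  start := rfl
  velocity p := by
    have e2 : tangent (E := ℝ) (E' := EP) (fun _ : ℝ => p) 0 = 0 := mfderiv_const
    have e3 : (0 : AdSection B).1 p = 0 := rfl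
    refine (DFunLike.congr_fun e2 1).trans ?_
    rw [e3, PrincipalBundle.fund, map_zero, zero_apply]

/-- With c'_t(p) = p · s_t, equivariance gives c_t(c'_t(p)) = c_t(p) · s_t, and the Leibniz rule
adds the velocities. -/
theorem IsGaugeCurve.mul {c c' : ℝ → GaugeTransformation B} {ξ ξ' : AdSection B}
    (hc : IsGaugeCurve c ξ) (hc' : IsGaugeCurve c' ξ') : IsGaugeCurve (fun t => c t * c' t) (ξ + ξ') where
  smooth := hc.smooth.comp (contMDiff_fst.prodMk hc'.smooth)
  start := by rw [hc.start, hc'.start, mul_one]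
  velocity p := by
    obtain ⟨T, hT⟩ := B.exists_localTriv (B.proj p)
    have hu : ContMDiff 𝓘(ℝ, ℝ) 𝓘(ℝ, EG) ∞ fun t : ℝ => T.shift (c' t) p := by
      have := (hc'.contMDiffOn_shift T).comp
        (contMDiff_id.prodMk (contMDiff_const (c := p) (I := 𝓘(ℝ, ℝ)) (M := ℝ))).contMDiffOn
        (s := univ) fun t _ => hT
      exact contMDiffOn_univ.1 this
    have hc1 : ContMDiff 𝓘(ℝ, ℝ) 𝓘(ℝ, EP) ∞ fun t : ℝ => (c t).toDiffeo p :=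
      hc.smooth.comp (contMDiff_id.prodMk contMDiff_const)
    have hu0 : T.shift (c' 0) p = 1 := by
      rw [hc'.start]
      exact inv_mul_cancel _
    have hp0 : (c 0).toDiffeo p = p := by rw [hc.start]; rfl
    have hud := hu.mdifferentiable (by simp) (0 : ℝ)
    have hcd := hc1.mdifferentiable (by simp) (0 : ℝ)
    have h1 := B.tangent_act (E₁ := ℝ) (N := ℝ) (a := fun _ : ℝ => p) (x := 0)
      mdifferentiableAt_const hud 1
    have h2 := B.tangent_act (E₁ := ℝ) (N := ℝ) (x := 0) hcd hud 1
    have h3 : (fun t : ℝ => B.act ((c t).toDiffeo p) (T.shift (c' t) p)) =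
        fun t => (c t * c' t).toDiffeo p := by
      funext t
      rw [← (c t).equivariant, T.act_shift (c' t) hT]
      rfl
    have h4 : (fun t : ℝ => (c' t).toDiffeo p) = fun t => B.act p (T.shift (c' t) p) :=
      funext fun t => (T.act_shift (c' t) hT).symm
    have h5 : tangent (E := ℝ) (E' := EP) (fun _ : ℝ => p) 0 = 0 := mfderiv_const
    have h6 : B.tangentAct (1 : G) p = ContinuousLinearMap.id ℝ EP := by
      have : (fun q : P => B.act q 1) = id := funext B.act_one
      rw [PrincipalBundle.tangentAct, this, tangent_id]
    rw [← h4, hc'.velocity, h5] at h1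
    rw [h3, hc.velocity] at h2
    simp only [hu0, hp0, h6, B.act_one] at h1 h2
    rw [zero_apply, map_zero, zero_add] at h1
    rw [h2, ← h1]
    exact (map_add (tangent (E := EG) (E' := EP) (fun g : G => B.act p g) 1) _ _).symm

/-- Every section of the adjoint bundle is the velocity of a curve of gauge transformations. -/
theorem exists_isGaugeCurve [FiniteDimensional ℝ EM] [IsManifold 𝓘(ℝ, EM) ∞ M] [T2Space M]
    [CompactSpace M] (ξ : AdSection B) : ∃ c, IsGaugeCurve c ξ := by
  choose T hT using B.exists_localTriv
  obtain ⟨ρ, hρ⟩ := SmoothPartitionOfUnity.exists_isSubordinate 𝓘(ℝ, EM) (s := (univ : Set M))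
    isClosed_univ (fun m => (T m).base) (fun m => (T m).isOpen_base)
    (fun m _ => mem_iUnion_of_mem m (hT m))
  -- Products of curves realise finite sums of sections cut off by the partition; compactness leaves
  -- only finitely many non-zero functions.
  have key : ∀ s : Finset M, ∃ c, IsGaugeCurve c (∑ i ∈ s, smulSection (ρ i).contMDiff ξ) := by
    classical
    intro s
    induction s using Finset.induction_on with
    | empty => exact ⟨_, by simpa using isGaugeCurve_one⟩
    | insert i s hi ih =>
      obtain ⟨c, hc⟩ := ih
      obtain ⟨c', hc'⟩ := exists_isGaugeCurve_of_tsupport (T i) (ρ i).contMDiff (hρ i) ξ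
      rw [Finset.sum_insert hi]
      exact ⟨_, hc'.mul hc⟩
  set s : Finset M := (ρ.locallyFinite.finite_nonempty_of_compact).toFinset with hs
  obtain ⟨c, hc⟩ := key s
  refine ⟨c, ?_⟩
  convert hc
  refine Subtype.ext (funext fun p => ?_)
  have h1 : ∑ i ∈ s, ρ i (B.proj p) = 1 := by
    rw [← ρ.sum_eq_one (mem_univ (B.proj p))]
    refine (finsum_eq_sum_of_support_subset _ fun i hi => ?_).symm
    exact (Set.Finite.mem_toFinset _).2 ⟨B.proj p, hi⟩
  have h2 : (∑ i ∈ s, smulSection (ρ i).contMDiff ξ).1 p = ∑ i ∈ s, ρ i (B.proj p) • ξ.1 p := by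
    rw [AddSubmonoidClass.coe_finsetSum, Finset.sum_apply]
    rfl
  rw [h2, ← Finset.sum_smul, h1, one_smul]

/-- The sign is due to the action by pull-back along the inverse. -/
theorem isFundamentalVector_neg_covSection [FiniteDimensional ℝ EM] [FiniteDimensional ℝ EP]
    [IsManifold 𝓘(ℝ, EM) ∞ M] [T2Space M] [CompactSpace M] (Γ : Connection B) (ξ : AdSection B) :
    IsFundamentalVector ξ Γ (-Γ.covSection ξ) :=
  ⟨exists_isGaugeCurve ξ, fun _ hc => hc.hasVelocity Γ⟩

end GaugeCurves

/-! ### Invariant pairings of forms with values in the adjoint bundle -/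

section TracePairings

variable {EM EG EP : Type*} [NormedAddCommGroup EM] [NormedSpace ℝ EM]
  [NormedAddCommGroup EG] [NormedSpace ℝ EG] [NormedAddCommGroup EP] [NormedSpace ℝ EP]
  {M G P : Type*} [TopologicalSpace M] [ChartedSpace EM M]
  [TopologicalSpace G] [ChartedSpace EG G] [Group G]
  [TopologicalSpace P] [ChartedSpace EP P]
  {B : PrincipalBundle EM EG EP M G P} {k l : ℕ}
  [FiniteDimensional ℝ EG] [LieGroup 𝓘(ℝ, EG) ∞ G] [IsManifold 𝓘(ℝ, EP) ∞ P]
  (tr : AdInvariantScalarProduct EG G)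

section Descent

variable [IsManifold 𝓘(ℝ, EM) ∞ M]

theorem descend_eq {η : P → EP [⋀^Fin k]→L[ℝ] ℝ} {τ : M → EM [⋀^Fin k]→L[ℝ] ℝ}
    (h : pullback (E := EP) (E' := EM) B.proj τ = η) : descend B η = τ := by
  rw [← h, descend_pullback_proj]

theorem descend_add {η θ : P → EP [⋀^Fin k]→L[ℝ] ℝ} (hη : IsBasic B η) (hθ : IsBasic B θ) :
    descend B (η + θ) = descend B η + descend B θ := by
  refine descend_eq (Eq.trans ?_ (congrArg₂ (· + ·) (pullback_proj_descend hη)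
    (pullback_proj_descend hθ)))
  rfl

theorem descend_smul (c : ℝ) {η : P → EP [⋀^Fin k]→L[ℝ] ℝ} (hη : IsBasic B η) :
    descend B (c • η) = c • descend B η := by
  refine descend_eq (Eq.trans ?_ (congrArg (c • ·) (pullback_proj_descend hη)))
  rfl

/-- A basic form is pulled back from M, and π ∘ φ = π. All invariance statements about integrals
rest on this. -/
theorem pullback_gauge_of_basic (φ : GaugeTransformation B) {η : P → EP [⋀^Fin k]→L[ℝ] ℝ}
    (hη : IsBasic B η) : pullback (E := EP) (E' := EP) φ.toDiffeo η = η := by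
  obtain ⟨τ, rfl⟩ := hη.exists_pullback_eq
  rw [← pullback_comp B.mdifferentiable_proj (GaugeTransformation.mdiff φ)]
  congr 1
  exact funext φ.proj_eq

theorem pullback_gauge_proj (φ : GaugeTransformation B) (τ : M → EM [⋀^Fin k]→L[ℝ] ℝ) :
    pullback (E := EP) (E' := EP) φ.toDiffeo (pullback (E := EP) (E' := EM) B.proj τ) =
      pullback (E := EP) (E' := EM) B.proj τ := by
  rw [← pullback_comp B.mdifferentiable_proj (GaugeTransformation.mdiff φ)]
  congr 1
  exact funext φ.proj_eq

end Descent

/-- The real two-form `tr (α ∧ β)`. -/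
def traceWedge (α β : AdForm B 1) (p : P) : EP [⋀^Fin (1 + 1)]→L[ℝ] ℝ :=
  wedge tr.toBilin (α.form p) (β.form p)

theorem traceWedge_apply (α β : AdForm B 1) (p : P) (X : Fin 2 → EP) : traceWedge tr α β p X =
    tr.toBilin (α.form p fun _ => X 0) (β.form p fun _ => X 1) -
      tr.toBilin (α.form p fun _ => X 1) (β.form p fun _ => X 0) :=
  wedge_one_one_apply _ _ _ X

theorem isBasic_traceWedge (α β : AdForm B 1) : IsBasic B (traceWedge tr α β) where
  smooth := α.smooth.wedge _ β.smooth
  horizontal := fun p => wedge_horizontal (K := {Z | ∃ A, Z = B.fund p A}) _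
    (α.isTensorial.horizontal p) (β.isTensorial.horizontal p)
  invariant := fun g p X => by
    have h1 := pullback_wedge (E := EP) (E' := EP) tr.toBilin (fun p => B.act p g) α.form β.form
    rw [α.isTensorial.pullback_act, β.isTensorial.pullback_act] at h1
    refine (DFunLike.congr_fun (congrFun h1 p) X).trans ?_
    simp only
    rw [← compContinuousAlternatingMap_wedge (L := ContinuousLinearMap.id ℝ ℝ) (b := tr.toBilin)
      (fun v w => (tr.invariant g⁻¹ v w).symm)]
    rfl

theorem traceWedge_add_left (α α' β : AdForm B 1) :
    traceWedge tr (α + α') β = traceWedge tr α β + traceWedge tr α' β := by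
  funext p
  change wedgeCLM EP 1 1 tr.toBilin (α.form p + α'.form p) (β.form p) = _
  rw [map_add]
  rfl

theorem traceWedge_smul_left (c : ℝ) (α β : AdForm B 1) :
    traceWedge tr (c • α) β = c • traceWedge tr α β := by
  funext p
  change wedgeCLM EP 1 1 tr.toBilin (c • α.form p) (β.form p) = _
  rw [map_smul]
  rfl

theorem traceWedge_swap (α β : AdForm B 1) : traceWedge tr α β = (-1 : ℝ) • traceWedge tr β α := by
  funext p
  ext X
  have h : ((-1 : ℝ) • traceWedge tr β α) p X = -traceWedge tr β α p X := neg_one_smul ℝ _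
  rw [h, traceWedge_apply, traceWedge_apply, tr.symm, tr.symm (α.form p fun _ => X 1)]
  ring

theorem traceWedge_smul_gauge (φ : GaugeTransformation B) (α β : AdForm B 1) :
    traceWedge tr (φ • α) (φ • β) =
      pullback (E := EP) (E' := EP) φ⁻¹.toDiffeo (traceWedge tr α β) :=
  (pullback_wedge (E := EP) (E' := EP) tr.toBilin φ⁻¹.toDiffeo α.form β.form).symm

/-- The real form `tr (ξ, η)`. -/
def tracePair (ξ : AdSection B) (η : AdForm B k) (p : P) : EP [⋀^Fin k]→L[ℝ] ℝ :=
  (tr.toBilin (ξ.1 p)).compContinuousAlternatingMap (η.form p)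

theorem tracePair_apply (ξ : AdSection B) (η : AdForm B k) (p : P) (X : Fin k → EP) :
    tracePair tr ξ η p X = tr.toBilin (ξ.1 p) (η.form p X) := rfl

theorem isBasic_tracePair (ξ : AdSection B) (η : AdForm B k) : IsBasic B (tracePair tr ξ η) where
  smooth := η.smooth.bilin tr.toBilin ξ.2.1
  horizontal p X h := by rw [tracePair_apply, η.isTensorial.horizontal p X h, map_zero]
  invariant g p X := by
    rw [tracePair_apply, tracePair_apply, ξ.2.2, η.isTensorial.equivariant, tr.invariant]

theorem tracePair_add_right (ξ : AdSection B) (η θ : AdForm B k) :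
    tracePair tr ξ (η + θ) = tracePair tr ξ η + tracePair tr ξ θ := by
  funext p; ext X
  exact map_add (tr.toBilin (ξ.1 p)) _ _

theorem tracePair_smul_right (ξ : AdSection B) (c : ℝ) (η : AdForm B k) :
    tracePair tr ξ (c • η) = c • tracePair tr ξ η := by
  funext p; ext X
  exact map_smul (tr.toBilin (ξ.1 p)) _ _

theorem tracePair_add_left (ξ ζ : AdSection B) (η : AdForm B k) :
    tracePair tr (ξ + ζ) η = tracePair tr ξ η + tracePair tr ζ η := by
  funext p; ext X
  change tr.toBilin (ξ.1 p + ζ.1 p) (η.form p X) = _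
  rw [map_add]
  rfl

theorem tracePair_smul_left (c : ℝ) (ξ : AdSection B) (η : AdForm B k) :
    tracePair tr (c • ξ) η = c • tracePair tr ξ η := by
  funext p; ext X
  change tr.toBilin (c • ξ.1 p) (η.form p X) = _
  rw [map_smul]
  rfl

theorem tracePair_cast (h : k = l) (ξ : AdSection B) (η : AdForm B k) :
    tracePair tr ξ (AdForm.cast h η) = fun p => castDegree h (tracePair tr ξ η p) := by
  subst h
  rfl

theorem tracePair_wedgeBase [IsManifold 𝓘(ℝ, EM) ∞ M] {τ : M → EM [⋀^Fin l]→L[ℝ] ℝ}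
    (hτ : IsSmoothForm τ) (ξ : AdSection B) (η : AdForm B k) :
    tracePair tr ξ (wedgeBase hτ η) = fun p => wedge (ContinuousLinearMap.mul ℝ ℝ)
      (tracePair tr ξ η p) (pullback (E := EP) (E' := EM) B.proj τ p) := by
  funext p
  exact compContinuousAlternatingMap_wedge (L := tr.toBilin (ξ.1 p)) (L₁ := tr.toBilin (ξ.1 p))
    (L₂ := ContinuousLinearMap.id ℝ ℝ)
    (b := (ContinuousLinearMap.lsmul ℝ ℝ : ℝ →L[ℝ] EG →L[ℝ] EG).flip)
    (b' := ContinuousLinearMap.mul ℝ ℝ) (fun v w => by simp [mul_comm]) (η.form p)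
    (pullback (E := EP) (E' := EM) B.proj τ p)

/-- The product of a section of the adjoint bundle with a form on the base. -/
def sectionForm [IsManifold 𝓘(ℝ, EM) ∞ M] {τ : M → EM [⋀^Fin k]→L[ℝ] ℝ} (hτ : IsSmoothForm τ)
    (ξ : AdSection B) : AdForm B k :=
  ⟨fun p => ((ContinuousLinearMap.lsmul ℝ ℝ : ℝ →L[ℝ] EG →L[ℝ] EG).flip
      (ξ.1 p)).compContinuousAlternatingMap (pullback (E := EP) (E' := EM) B.proj τ p),
    { smooth := (hτ.pullback B.contMDiff_proj).bilin _ ξ.2.1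
      horizontal := fun p X h => by
        have := (isBasic_pullback_proj (B := B) hτ).horizontal p X h
        simp [this]
      equivariant := fun g p X => by
        have := (isBasic_pullback_proj (B := B) hτ).invariant g p X
        simp [this, ξ.2.2] }⟩

theorem sectionForm_apply [IsManifold 𝓘(ℝ, EM) ∞ M] {τ : M → EM [⋀^Fin k]→L[ℝ] ℝ}
    (hτ : IsSmoothForm τ) (ξ : AdSection B) (p : P) (X : Fin k → EP) :
    (sectionForm hτ ξ).form p X = pullback (E := EP) (E' := EM) B.proj τ p X • ξ.1 p := rfl

/-- Smooth invariant functions descend to the base. -/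
theorem exists_smooth_descend {f : P → ℝ} (hf : ContMDiff 𝓘(ℝ, EP) 𝓘(ℝ, ℝ) ∞ f)
    (hinv : ∀ p g, f (B.act p g) = f p) :
    ∃ u : M → ℝ, ContMDiff 𝓘(ℝ, EM) 𝓘(ℝ, ℝ) ∞ u ∧ ∀ p, u (B.proj p) = f p := by
  choose s hs using B.surjective_proj
  have hu : ∀ p, f (s (B.proj p)) = f p := fun p => by
    obtain ⟨g, hg⟩ := B.exists_act_eq (hs (B.proj p))
    exact (hinv (s (B.proj p)) g).symm.trans (congrArg f hg)
  refine ⟨fun m => f (s m), fun m => ?_, hu⟩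
  obtain ⟨T, hT⟩ := B.exists_localTriv m
  have h1 : ContMDiffAt 𝓘(ℝ, EM) 𝓘(ℝ, ℝ) ∞ (fun q => f (T.sec q)) m :=
    hf.contMDiffAt.comp m (T.contMDiffOn_sec.contMDiffAt (T.isOpen_base.mem_nhds hT))
  refine h1.congr_of_eventuallyEq ?_
  filter_upwards [T.isOpen_base.mem_nhds hT] with q hq
  rw [← hu (T.sec q), T.proj_sec q hq]

/-- Only convergence of order zero is used, through the chart at s y. For local sections s it
transfers convergence on P to forms on M. -/
theorem tendsto_pullback_plot [FiniteDimensional ℝ EP] {E' : Type*} [NormedAddCommGroup E']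
    [NormedSpace ℝ E'] {ι : Type*} {L : Filter ι} {η : ι → AdForm B k} {η₀ : AdForm B k}
    (h : Tendsto η L (𝓝 η₀)) {s : E' → P} {W : Set E'} (hW : IsOpen W)
    (hs : ContMDiffOn 𝓘(ℝ, E') 𝓘(ℝ, EP) ∞ s W) {y : E'} (hy : y ∈ W) :
    Tendsto (fun z : ι × E' => pullback (E := E') (E' := EP) s (η z.1).form z.2) (L ×ˢ 𝓝 y)
      (𝓝 (pullback (E := E') (E' := EP) s η₀.form y)) := by
  obtain ⟨U, hUW, hU, hyU, hmaps, hφ, heq⟩ := exists_pullback_eq_chartRep (V := EG) hW hs hy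
    (mem_extChartAt_source (I := 𝓘(ℝ, EP)) (s y))
  set c := extChartAt 𝓘(ℝ, EP) (s y) with hc
  have hφc : ContinuousAt (c ∘ s) y := hφ.continuousOn.continuousAt (hU.mem_nhds hyU)
  have hφd : ContinuousAt (fderiv ℝ (c ∘ s)) y :=
    ((contDiffOn_infty_iff_fderiv_of_isOpen hU).1 hφ).2.continuousOn.continuousAt (hU.mem_nhds hyU)
  have hcomp : Continuous fun z : (EP [⋀^Fin k]→L[ℝ] EG) × (E' →L[ℝ] EP) =>
      z.1.compContinuousLinearMap z.2 := by
    rw [← continuousOn_univ]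
    exact (contDiffOn_compContinuousLinearMap contDiff_fst.contDiffOn
      contDiff_snd.contDiffOn).continuousOn
  have h1 : Tendsto (fun z : ι × E' => chartRep (s y) (η z.1).form ((c ∘ s) z.2)) (L ×ˢ 𝓝 y)
      (𝓝 (chartRep (s y) η₀.form (c (s y)))) := by
    have h2 := (AdForm.tendsto_chartRep h (s y)).tendsto_apply (y := c (s y))
      (mem_extChartAt_target (s y))
    exact h2.comp (tendsto_fst.prodMk (hφc.tendsto.comp tendsto_snd))
  have h3 := (hcomp.tendsto (chartRep (s y) η₀.form (c (s y)), fderiv ℝ (c ∘ s) y)).comp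
    (h1.prodMk_nhds (hφd.tendsto.comp tendsto_snd))
  rw [heq k η₀.form y hyU]
  refine h3.congr' ?_
  filter_upwards [eventually_mem_prod_nhds hU hyU] with z hz
  exact (heq k (η z.1).form z.2 hz).symm

end TracePairings

/-! ### The form Ω and the integration pairing: linearity, invariance, continuity. -/

section IntegralPairings

variable {n : ℕ} {EG EP : Type*}
  [NormedAddCommGroup EG] [NormedSpace ℝ EG] [NormedAddCommGroup EP] [NormedSpace ℝ EP]
  {M G P : Type*} [TopologicalSpace M] [ChartedSpace (EuclideanSpace ℝ (Fin (2 * n))) M]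
  [IsManifold 𝓘(ℝ, EuclideanSpace ℝ (Fin (2 * n))) ∞ M] [T2Space M] [CompactSpace M]
  [TopologicalSpace G] [ChartedSpace EG G] [Group G]
  [TopologicalSpace P] [ChartedSpace EP P]
  [FiniteDimensional ℝ EG] [LieGroup 𝓘(ℝ, EG) ∞ G] [IsManifold 𝓘(ℝ, EP) ∞ P]

local notation "𝓔(" n ")" => EuclideanSpace ℝ (Fin (2 * n))

variable (hn : 1 ≤ n) (σ : SymplecticForm 𝓔(n) M) (tr : AdInvariantScalarProduct EG G)
  {B : PrincipalBundle 𝓔(n) EG EP M G P}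

/-- The top-degree form `τ ∧ σ^(n-1)`. -/
def wedgeSymplectic (τ : M → 𝓔(n) [⋀^Fin 2]→L[ℝ] ℝ) (m : M) : 𝓔(n) [⋀^Fin (2 * n)]→L[ℝ] ℝ :=
  castDegree (show 1 + 1 + 2 * (n - 1) = 2 * n by omega)
    (wedge (ContinuousLinearMap.mul ℝ ℝ) (τ m) (wedgePow (σ.form m) (n - 1)))

theorem atiyahBottForm_eq (Γ : Connection B) (α β : AdForm B 1) : atiyahBottForm hn σ tr B Γ α β =
    integral σ (wedgeSymplectic hn σ (descend B (traceWedge tr α β))) := rfl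

theorem integrationPairing_eq (η : AdForm B (2 * n)) (ξ : AdSection B) :
    integrationPairing σ tr B η ξ = integral σ (descend B (tracePair tr ξ η)) := rfl

theorem wedgeSymplectic_add (τ τ' : M → 𝓔(n) [⋀^Fin 2]→L[ℝ] ℝ) :
    wedgeSymplectic hn σ (τ + τ') = wedgeSymplectic hn σ τ + wedgeSymplectic hn σ τ' := by
  funext m
  have h : wedge (ContinuousLinearMap.mul ℝ ℝ) (τ m + τ' m) (wedgePow (σ.form m) (n - 1)) =
      wedge (ContinuousLinearMap.mul ℝ ℝ) (τ m) (wedgePow (σ.form m) (n - 1)) +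
      wedge (ContinuousLinearMap.mul ℝ ℝ) (τ' m) (wedgePow (σ.form m) (n - 1)) := by
    simp only [← wedgeCLM_apply, map_add, add_apply]
  exact (congrArg (castDegree _) h).trans (castDegree_add _ _ _)

theorem wedgeSymplectic_smul (c : ℝ) (τ : M → 𝓔(n) [⋀^Fin 2]→L[ℝ] ℝ) :
    wedgeSymplectic hn σ (c • τ) = c • wedgeSymplectic hn σ τ := by
  funext m
  exact (congrArg (castDegree _) (wedge_smul_left _ c (τ m) _)).trans (castDegree_smul _ _ _)

theorem isSmoothForm_wedgeSymplectic {τ : M → 𝓔(n) [⋀^Fin 2]→L[ℝ] ℝ} (hτ : IsSmoothForm τ) :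
    IsSmoothForm (wedgeSymplectic hn σ τ) :=
  (hτ.wedge _ (σ.smooth.wedgePow (n - 1))).castDegree _

theorem atiyahBottForm_add_left (Γ : Connection B) (α α' β : AdForm B 1) :
    atiyahBottForm hn σ tr B Γ (α + α') β =
      atiyahBottForm hn σ tr B Γ α β + atiyahBottForm hn σ tr B Γ α' β := by
  have h := isBasic_traceWedge tr α β
  have h' := isBasic_traceWedge tr α' β
  rw [atiyahBottForm_eq, traceWedge_add_left, descend_add h h', wedgeSymplectic_add,
    integral_add σ (isSmoothForm_wedgeSymplectic hn σ h.isSmoothForm_descend)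
      (isSmoothForm_wedgeSymplectic hn σ h'.isSmoothForm_descend)]
  rfl

theorem atiyahBottForm_smul_left (Γ : Connection B) (c : ℝ) (α β : AdForm B 1) :
    atiyahBottForm hn σ tr B Γ (c • α) β = c * atiyahBottForm hn σ tr B Γ α β := by
  rw [atiyahBottForm_eq, traceWedge_smul_left, descend_smul c (isBasic_traceWedge tr α β),
    wedgeSymplectic_smul, integral_smul]
  rfl

theorem atiyahBottForm_skew (Γ : Connection B) (α β : AdForm B 1) :
    atiyahBottForm hn σ tr B Γ α β = -atiyahBottForm hn σ tr B Γ β α := by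
  rw [atiyahBottForm_eq, traceWedge_swap, descend_smul _ (isBasic_traceWedge tr β α),
    wedgeSymplectic_smul, integral_smul, neg_one_mul]
  rfl

/-- The two-form tr(φα ∧ φβ) is the pull-back of the basic form tr(α ∧ β), hence equal to it,
already before integration. -/
theorem atiyahBottForm_smul_gauge (φ : GaugeTransformation B) (Γ : Connection B) (α β : AdForm B 1) :
    atiyahBottForm hn σ tr B (φ • Γ) (φ • α) (φ • β) = atiyahBottForm hn σ tr B Γ α β := by
  rw [atiyahBottForm_eq, traceWedge_smul_gauge,
    pullback_gauge_of_basic φ⁻¹ (isBasic_traceWedge tr α β)]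
  rfl

/-- The integral is continuous for locally uniform convergence of coefficients, so it suffices to
control the integrand in charts of M, where a local section makes it an explicit product. -/
theorem continuous_atiyahBottForm [FiniteDimensional ℝ EP] (Γ : Connection B) :
    Continuous fun z : AdForm B 1 × AdForm B 1 => atiyahBottForm hn σ tr B Γ z.1 z.2 := by
  refine continuous_iff_continuousAt.2 fun z => ?_
  have hsm : ∀ t : AdForm B 1 × AdForm B 1,
      IsSmoothForm (wedgeSymplectic hn σ (descend B (traceWedge tr t.1 t.2))) := fun t =>
    isSmoothForm_wedgeSymplectic hn σ (isBasic_traceWedge tr t.1 t.2).isSmoothForm_descend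
  refine tendsto_integral σ hsm (hsm z) fun x => ?_
  have hU := isOpen_extChartAt_target (I := 𝓘(ℝ, 𝓔(n))) x
  refine (tendstoLocallyUniformlyOn_iff_tendsto_prod (L := 𝓝 z)
    (F := fun t : AdForm B 1 × AdForm B 1 =>
      chartRep x (wedgeSymplectic hn σ (descend B (traceWedge tr t.1 t.2)))) hU
    ((hsm z) x).continuousOn).2 fun y hy => ?_
  obtain ⟨T, hT⟩ := B.exists_localTriv ((extChartAt 𝓘(ℝ, 𝓔(n)) x).symm y)
  have hW := isOpen_chart_target_inter (M := M) (EM := 𝓔(n)) T.isOpen_base x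
  have hs := contMDiffOn_section_chart T.contMDiffOn_sec x
  set W := (extChartAt 𝓘(ℝ, 𝓔(n)) x).target ∩ (extChartAt 𝓘(ℝ, 𝓔(n)) x).symm ⁻¹' T.base with hWdef
  set s := T.sec ∘ (extChartAt 𝓘(ℝ, 𝓔(n)) x).symm with hsdef
  have hyW : y ∈ W := ⟨hy, hT⟩
  -- Over the section the descended form is the wedge product of the pull-backs of α and β, a
  -- continuous expression in both.
  have hrep : ∀ (t : AdForm B 1 × AdForm B 1), ∀ w ∈ W,
      chartRep x (wedgeSymplectic hn σ (descend B (traceWedge tr t.1 t.2))) w =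
        castDegreeCLM (show 1 + 1 + 2 * (n - 1) = 2 * n by omega)
          (wedgeCLM 𝓔(n) (1 + 1) (2 * (n - 1)) (ContinuousLinearMap.mul ℝ ℝ)
            (wedgeCLM 𝓔(n) 1 1 tr.toBilin (pullback (E := 𝓔(n)) (E' := EP) s t.1.form w)
              (pullback (E := 𝓔(n)) (E' := EP) s t.2.form w))
            (chartRep x (fun m => wedgePow (σ.form m) (n - 1)) w)) := by
    intro t w hw
    have h1 := congrFun (pullback_castDegree (E := 𝓔(n)) (E' := 𝓔(n))
      (show 1 + 1 + 2 * (n - 1) = 2 * n by omega) (extChartAt 𝓘(ℝ, 𝓔(n)) x).symm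
      (fun m => wedge (ContinuousLinearMap.mul ℝ ℝ) (descend B (traceWedge tr t.1 t.2) m)
        (wedgePow (σ.form m) (n - 1)))) w
    refine h1.trans ?_
    rw [castDegreeCLM_apply]
    congr 1
    have h2 := congrFun (chartRep_wedge (ContinuousLinearMap.mul ℝ ℝ)
      (descend B (traceWedge tr t.1 t.2)) (fun m => wedgePow (σ.form m) (n - 1)) x) w
    refine h2.trans ?_
    rw [chartRep_eq_pullback_section T.isOpen_base T.contMDiffOn_sec T.proj_sec _ x hw.1 hw.2,
      pullback_proj_descend (isBasic_traceWedge tr t.1 t.2)]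
    have h3 := congrFun (pullback_wedge (E := 𝓔(n)) (E' := EP) tr.toBilin s t.1.form t.2.form) w
    exact congrArg (fun v => wedge (ContinuousLinearMap.mul ℝ ℝ) v
      (chartRep x (fun m => wedgePow (σ.form m) (n - 1)) w)) h3
  have ht1 := tendsto_pullback_plot (continuous_fst.tendsto z) hW hs hyW
  have ht2 := tendsto_pullback_plot (continuous_snd.tendsto z) hW hs hyW
  have ht3 : Tendsto (fun v : (AdForm B 1 × AdForm B 1) × 𝓔(n) =>
      chartRep x (fun m => wedgePow (σ.form m) (n - 1)) v.2) (𝓝 z ×ˢ 𝓝 y)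
      (𝓝 (chartRep x (fun m => wedgePow (σ.form m) (n - 1)) y)) :=
    (((σ.smooth.wedgePow (n - 1)) x).continuousOn.continuousAt (hU.mem_nhds hy)).tendsto.comp
      tendsto_snd
  have hc1 := ((wedgeCLM 𝓔(n) 1 1 tr.toBilin).continuous₂.tendsto _).comp (ht1.prodMk_nhds ht2)
  have hc2 := ((wedgeCLM 𝓔(n) (1 + 1) (2 * (n - 1))
    (ContinuousLinearMap.mul ℝ ℝ)).continuous₂.tendsto _).comp (hc1.prodMk_nhds ht3)
  have hc3 := ((castDegreeCLM (E := 𝓔(n)) (V := ℝ)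
    (show 1 + 1 + 2 * (n - 1) = 2 * n by omega)).continuous.tendsto _).comp hc2
  rw [hrep z y hyW]
  refine hc3.congr' ?_
  filter_upwards [eventually_mem_prod_nhds hW hyW] with v hv
  exact (hrep v.1 v.2 hv).symm

theorem integrationPairing_add_left (η η' : AdForm B (2 * n)) (ξ : AdSection B) :
    integrationPairing σ tr B (η + η') ξ =
      integrationPairing σ tr B η ξ + integrationPairing σ tr B η' ξ := by
  have h := isBasic_tracePair tr ξ η
  have h' := isBasic_tracePair tr ξ η'
  rw [integrationPairing_eq, tracePair_add_right, descend_add h h',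
    integral_add σ h.isSmoothForm_descend h'.isSmoothForm_descend]
  rfl

theorem integrationPairing_smul_left (c : ℝ) (η : AdForm B (2 * n)) (ξ : AdSection B) :
    integrationPairing σ tr B (c • η) ξ = c * integrationPairing σ tr B η ξ := by
  rw [integrationPairing_eq, tracePair_smul_right, descend_smul c (isBasic_tracePair tr ξ η),
    integral_smul]
  rfl

theorem integrationPairing_add_right (η : AdForm B (2 * n)) (ξ ξ' : AdSection B) :
    integrationPairing σ tr B η (ξ + ξ') =
      integrationPairing σ tr B η ξ + integrationPairing σ tr B η ξ' := by
  have h := isBasic_tracePair tr ξ η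
  have h' := isBasic_tracePair tr ξ' η
  rw [integrationPairing_eq, tracePair_add_left, descend_add h h',
    integral_add σ h.isSmoothForm_descend h'.isSmoothForm_descend]
  rfl

theorem integrationPairing_smul_right (c : ℝ) (η : AdForm B (2 * n)) (ξ : AdSection B) :
    integrationPairing σ tr B η (c • ξ) = c * integrationPairing σ tr B η ξ := by
  rw [integrationPairing_eq, tracePair_smul_left, descend_smul c (isBasic_tracePair tr ξ η),
    integral_smul]
  rfl

theorem integrationPairing_smul_gauge (φ : GaugeTransformation B) (η : AdForm B (2 * n))
    (ξ ξ' : AdSection B) (h : ∀ p, ξ'.1 p = ξ.1 (φ⁻¹.toDiffeo p)) :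
    integrationPairing σ tr B (φ • η) ξ' = integrationPairing σ tr B η ξ := by
  have h1 : tracePair tr ξ' (φ • η) =
      pullback (E := EP) (E' := EP) φ⁻¹.toDiffeo (tracePair tr ξ η) := by
    funext p
    ext X
    rw [tracePair_apply, h, pullback_apply, tracePair_apply]
    rfl
  rw [integrationPairing_eq, h1, pullback_gauge_of_basic φ⁻¹ (isBasic_tracePair tr ξ η)]
  rfl

/-- Since Ω does not depend on the connection, the map is the diagonal of a continuous bilinear form
on triples, that is, a quadratic map. -/
theorem isBastianiSmooth_atiyahBottForm [FiniteDimensional ℝ EP] (Γ : Connection B) :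
    IsBastianiSmooth fun x : AdForm B 1 × AdForm B 1 × AdForm B 1 =>
      atiyahBottForm hn σ tr B (Γ.translate x.1) x.2.1 x.2.2 := by
  have add_right : ∀ α β β' : AdForm B 1, atiyahBottForm hn σ tr B Γ α (β + β') =
      atiyahBottForm hn σ tr B Γ α β + atiyahBottForm hn σ tr B Γ α β' := fun α β β' => by
    rw [atiyahBottForm_skew, atiyahBottForm_add_left, neg_add, ← atiyahBottForm_skew,
      ← atiyahBottForm_skew]
  have smul_right : ∀ (c : ℝ) (α β : AdForm B 1), atiyahBottForm hn σ tr B Γ α (c • β) =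
      c • atiyahBottForm hn σ tr B Γ α β := fun c α β => by
    rw [atiyahBottForm_skew, atiyahBottForm_smul_left, ← mul_neg, ← atiyahBottForm_skew, smul_eq_mul]
  have continuous := continuous_atiyahBottForm hn σ tr Γ
  have add_left := atiyahBottForm_add_left hn σ tr Γ
  have smul_left : ∀ (c : ℝ) (α β : AdForm B 1), atiyahBottForm hn σ tr B Γ (c • α) β =
      c • atiyahBottForm hn σ tr B Γ α β := atiyahBottForm_smul_left hn σ tr Γ
  have heq : (fun x : AdForm B 1 × AdForm B 1 × AdForm B 1 =>
      atiyahBottForm hn σ tr B (Γ.translate x.1) x.2.1 x.2.2) =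
      fun x => atiyahBottForm hn σ tr B Γ x.2.1 x.2.2 := rfl
  rw [heq]
  generalize atiyahBottForm hn σ tr B Γ = Ω at *
  refine IsQuadraticMap.isBastianiSmooth ⟨0, 0, LinearMap.mk₂ ℝ
    (fun x y : AdForm B 1 × AdForm B 1 × AdForm B 1 => Ω x.2.1 y.2.2)
    (fun x x' y => add_left x.2.1 x'.2.1 y.2.2) (fun c x y => smul_left c x.2.1 y.2.2)
    (fun x y y' => add_right x.2.1 y.2.2 y'.2.2) (fun c x y => smul_right c x.2.1 y.2.2),
    continuous_const, ?_, fun x => ?_⟩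
  · exact continuous.comp
      (by fun_prop : Continuous fun z : (AdForm B 1 × AdForm B 1 × AdForm B 1) ×
        (AdForm B 1 × AdForm B 1 × AdForm B 1) => (z.1.2.1, z.2.2.2))
  · rw [LinearMap.mk₂_apply]
    simp

/-- The action is affine, so the difference quotients are constant for t ≠ 0. -/
theorem hasVelocity_smul_translate (φ : GaugeTransformation B) (Γ : Connection B)
    (α : AdForm B 1) : Connection.HasVelocity (fun t => φ • Γ.translate (t • α)) (φ • α) := by
  refine tendsto_const_nhds.congr' ?_
  filter_upwards [self_mem_nhdsWithin] with t ht
  have ht' : t ≠ 0 := ht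
  have h1 : Connection.diff (φ • Γ.translate (t • α)) (φ • Γ.translate ((0 : ℝ) • α)) =
      t • φ • α := by
    refine AdForm.ext fun p => ?_
    ext X
    change (Γ.form _ + t • α.form _) _ + (-1 : ℝ) • (Γ.form _ + (0 : ℝ) • α.form _) _ =
      t • α.form _ _
    simp
  rw [h1, inv_smul_smul₀ ht']

end IntegralPairings

/-! ### Non-degeneracy of the pairings -/

section Nondegeneracy

variable {n : ℕ} {EG EP : Type*}
  [NormedAddCommGroup EG] [NormedSpace ℝ EG] [NormedAddCommGroup EP] [NormedSpace ℝ EP]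
  {M G P : Type*} [TopologicalSpace M] [ChartedSpace (EuclideanSpace ℝ (Fin (2 * n))) M]
  [IsManifold 𝓘(ℝ, EuclideanSpace ℝ (Fin (2 * n))) ∞ M]
  [TopologicalSpace G] [ChartedSpace EG G] [Group G]
  [TopologicalSpace P] [ChartedSpace EP P]
  [FiniteDimensional ℝ EG] [LieGroup 𝓘(ℝ, EG) ∞ G] [IsManifold 𝓘(ℝ, EP) ∞ P]

local notation "𝓔(" n ")" => EuclideanSpace ℝ (Fin (2 * n))

variable (σ : SymplecticForm 𝓔(n) M) (tr : AdInvariantScalarProduct EG G)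
  {B : PrincipalBundle 𝓔(n) EG EP M G P}

theorem wedge_mul_assoc {E : Type*} [NormedAddCommGroup E] [NormedSpace ℝ E] {k l m : ℕ}
    (α : E [⋀^Fin k]→L[ℝ] ℝ) (β : E [⋀^Fin l]→L[ℝ] ℝ) (γ : E [⋀^Fin m]→L[ℝ] ℝ) :
    castDegree (Nat.add_assoc k l m) (wedge (ContinuousLinearMap.mul ℝ ℝ)
      (wedge (ContinuousLinearMap.mul ℝ ℝ) α β) γ) =
      wedge (ContinuousLinearMap.mul ℝ ℝ) α (wedge (ContinuousLinearMap.mul ℝ ℝ) β γ) :=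
  wedge_assoc (fun u v w => by simp [mul_assoc]) α β γ

theorem castDegree_eq_zero {E V : Type*} [NormedAddCommGroup E] [NormedSpace ℝ E]
    [NormedAddCommGroup V] [NormedSpace ℝ V] {k l : ℕ} (h : k = l) {α : E [⋀^Fin k]→L[ℝ] V} :
    castDegree h α = 0 ↔ α = 0 := by
  subst h
  rfl

/-- Real forms of top degree are proportional; linear functionals, which separate points of V,
reduce the vector-valued case to this. -/
theorem exists_eq_smul_of_topDegree {V : Type*} [NormedAddCommGroup V] [NormedSpace ℝ V]
    (α : 𝓔(n) [⋀^Fin (2 * n)]→L[ℝ] V) {μ : 𝓔(n) [⋀^Fin (2 * n)]→L[ℝ] ℝ} (hμ : μ ≠ 0) :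
    ∃ v : V, ∀ X, α X = μ X • v := by
  have hμ' : topCoeff μ ≠ 0 := fun h => hμ (eq_zero_of_topCoeff_eq_zero h)
  refine ⟨(topCoeff μ)⁻¹ • α fun j => EuclideanSpace.single j 1, fun X => ?_⟩
  refine sub_eq_zero.1 (SeparatingDual.eq_zero_of_forall_dual_eq_zero (R := ℝ) fun L => ?_)
  have h : L.compContinuousAlternatingMap α -
      L ((topCoeff μ)⁻¹ • α fun j => EuclideanSpace.single j 1) • μ = 0 := by
    refine eq_zero_of_topCoeff_eq_zero ?_
    change L (α _) - L ((topCoeff μ)⁻¹ • α _) • topCoeff μ = 0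
    rw [map_smul, smul_eq_mul, smul_eq_mul, mul_right_comm, inv_mul_cancel₀ hμ', one_mul, sub_self]
  have h1 := DFunLike.congr_fun h X
  rw [map_sub, map_smul, smul_eq_mul, mul_comm (μ X)]
  exact h1

theorem exists_lift_tangent_proj (p : P) : ∃ S : 𝓔(n) →L[ℝ] EP,
    ∀ v, tangent (E := EP) (E' := 𝓔(n)) B.proj p (S v) = v := by
  obtain ⟨U, s, hU, hp, hs, hsp, hps⟩ := B.exists_section p
  have h := B.tangent_proj_section hU hs hps hp
  rw [hsp] at h
  exact ⟨tangent (E := 𝓔(n)) (E' := EP) s (B.proj p), fun v => DFunLike.congr_fun h v⟩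

theorem pullback_proj_comp_lift {k : ℕ} {p : P} {S : 𝓔(n) →L[ℝ] EP}
    (hS : ∀ v, tangent (E := EP) (E' := 𝓔(n)) B.proj p (S v) = v)
    (τ : M → 𝓔(n) [⋀^Fin k]→L[ℝ] ℝ) :
    (pullback (E := EP) (E' := 𝓔(n)) B.proj τ p).compContinuousLinearMap S = τ (B.proj p) := by
  ext X
  change τ (B.proj p) (fun i => tangent (E := EP) (E' := 𝓔(n)) B.proj p (S (X i))) = _
  simp only [hS]

/-- Every form of top degree with values in the adjoint bundle is the product of a section and
the volume form. -/
theorem exists_sectionForm_eq (η : AdForm B (2 * n)) :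
    ∃ ξ : AdSection B, sectionForm (isSmoothForm_volForm σ) ξ = η := by
  -- A right inverse S of dπ transports the form to the tangent space of M, where it is a multiple
  -- of σ^n; horizontality brings the identity back to P.
  have hpt : ∀ p, ∃ v : EG, ∀ X, η.form p X =
      pullback (E := EP) (E' := 𝓔(n)) B.proj (volForm σ) p X • v := fun p => by
    obtain ⟨S, hS⟩ := exists_lift_tangent_proj (B := B) p
    obtain ⟨v, hv⟩ := exists_eq_smul_of_topDegree ((η.form p).compContinuousLinearMap S)
      (volForm_ne_zero σ (B.proj p))
    refine ⟨v, fun X => ?_⟩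
    have h1 := hv fun i => tangent (E := EP) (E' := 𝓔(n)) B.proj p (X i)
    rw [pullback_apply, ← h1]
    exact B.horizontal_congr (η.isTensorial.horizontal p) fun i => (hS _).symm
  have hne : ∀ p, ∃ X, pullback (E := EP) (E' := 𝓔(n)) B.proj (volForm σ) p X ≠ 0 := fun p => by
    by_contra! h
    obtain ⟨S, hS⟩ := exists_lift_tangent_proj (B := B) p
    refine volForm_ne_zero σ (B.proj p) (ContinuousAlternatingMap.ext fun X => ?_)
    have h1 := h fun i => S (X i)
    rw [pullback_apply] at h1
    simp only [hS] at h1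
    exact h1
  choose ξ hξ using hpt
  have hsmooth : ContMDiff 𝓘(ℝ, EP) 𝓘(ℝ, EG) ∞ ξ := fun p => by
    have hT : IsOpen (extChartAt 𝓘(ℝ, EP) p).target := isOpen_extChartAt_target p
    have hpT := mem_extChartAt_target (I := 𝓘(ℝ, EP)) p
    set c := extChartAt 𝓘(ℝ, EP) p with hc
    have hvol : IsSmoothForm (pullback (E := EP) (E' := 𝓔(n)) B.proj (volForm σ)) :=
      (isSmoothForm_volForm σ).pullback B.contMDiff_proj
    obtain ⟨X, hX⟩ := hne p
    -- With these vectors held constant in the chart, ξ is locally a quotient of smooth functions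
    -- with denominator non-zero at p.
    set Y : Fin (2 * n) → EP := fun i => tangent (E := EP) (E' := EP) c p (X i) with hY
    have ha : ContDiffOn ℝ ∞ (fun y => chartRep p (pullback (E := EP) (E' := 𝓔(n)) B.proj
        (volForm σ)) y Y) c.target :=
      (ContinuousAlternatingMap.apply ℝ EP ℝ Y).contDiff.comp_contDiffOn (hvol p)
    have hb : ContDiffOn ℝ ∞ (fun y => chartRep p η.form y Y) c.target :=
      (ContinuousAlternatingMap.apply ℝ EP EG Y).contDiff.comp_contDiffOn (η.isTensorial.smooth p)
    have hab : ∀ y, chartRep p η.form y Y = chartRep p (pullback (E := EP) (E' := 𝓔(n)) B.proj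
        (volForm σ)) y Y • ξ (c.symm y) := fun y => hξ _ _
    have h0 : chartRep p (pullback (E := EP) (E' := 𝓔(n)) B.proj (volForm σ)) (c p) Y ≠ 0 := by
      have h1 := DFunLike.congr_fun (chartRep_comp_tangent (pullback (E := EP) (E' := 𝓔(n)) B.proj
        (volForm σ)) (mem_extChartAt_source (I := 𝓘(ℝ, EP)) p)) X
      rw [← h1] at hX
      exact hX
    have hat := (ha.contDiffAt (hT.mem_nhds hpT))
    have hdiv := (hat.inv h0).smul (hb.contDiffAt (hT.mem_nhds hpT))
    have hcomp : ContMDiffAt 𝓘(ℝ, EP) 𝓘(ℝ, EG) ∞ (fun q => ((chartRep p (pullback (E := EP)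
        (E' := 𝓔(n)) B.proj (volForm σ)) (c q) Y)⁻¹ • chartRep p η.form (c q) Y)) p :=
      hdiv.contMDiffAt.comp p (contMDiffAt_extChartAt (I := 𝓘(ℝ, EP)))
    refine hcomp.congr_of_eventuallyEq ?_
    have hev := (hat.continuousAt.comp (continuousAt_extChartAt (I := 𝓘(ℝ, EP)) p)).eventually_ne h0
    filter_upwards [hev, extChartAt_source_mem_nhds (I := 𝓘(ℝ, EP)) p] with q hq hqs
    have h2 := hab (c q)
    rw [c.left_inv hqs] at h2
    rw [h2]
    exact (inv_smul_smul₀ hq _).symm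
  refine ⟨⟨ξ, hsmooth, fun g p => ?_⟩, AdForm.ext fun p => ContinuousAlternatingMap.ext fun X =>
    (hξ p X).symm⟩
  obtain ⟨X, hX⟩ := hne p
  have h1 := η.isTensorial.equivariant g p X
  rw [hξ, hξ, (isBasic_pullback_proj (B := B) (isSmoothForm_volForm σ)).invariant g p X,
    map_smul] at h1
  exact smul_right_injective _ hX h1

variable [T2Space M] [CompactSpace M]

/-- The pairing is the integral of tr(ξ, ξ) σ^n, where tr(ξ, ξ) ≥ 0 is invariant and so descends to
a smooth function on M. It serves for both sides of non-degeneracy. -/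
theorem eq_zero_of_integrationPairing_sectionForm (ξ : AdSection B)
    (h : integrationPairing σ tr B (sectionForm (isSmoothForm_volForm σ) ξ) ξ = 0) : ξ = 0 := by
  have hnn : ∀ v, 0 ≤ tr.toBilin v v := fun v => by
    rcases eq_or_ne v 0 with rfl | hv
    · simp
    · exact (tr.pos v hv).le
  have hsm : ContMDiff 𝓘(ℝ, EP) 𝓘(ℝ, ℝ) ∞ fun p => tr.toBilin (ξ.1 p) (ξ.1 p) :=
    (tr.toBilin.contDiff.contMDiff.comp ξ.2.1).clm_apply ξ.2.1
  obtain ⟨u, hu, hup⟩ := exists_smooth_descend (B := B) hsm fun p g => by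
    rw [ξ.2.2, tr.invariant]
  have h1 : descend B (tracePair tr ξ (sectionForm (isSmoothForm_volForm σ) ξ)) =
      fun m => u m • volForm σ m := by
    refine descend_eq (funext fun p => ContinuousAlternatingMap.ext fun X => ?_)
    rw [tracePair_apply, sectionForm_apply, map_smul, pullback_apply, pullback_apply, ← hup]
    exact mul_comm _ _
  rw [integrationPairing_eq, h1] at h
  have h2 : ∀ m, 0 ≤ u m := fun m => by
    obtain ⟨p, rfl⟩ := B.surjective_proj m
    rw [hup]
    exact hnn _
  refine Subtype.ext (funext fun p => ?_)
  by_contra hne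
  have h3 := eq_zero_of_integral_smul_volForm σ hu h2 h (B.proj p)
  rw [hup] at h3
  exact (tr.pos _ hne).ne' h3

theorem isCoadjointPairing_integrationPairing : IsCoadjointPairing (integrationPairing σ tr B) where
  add_left := integrationPairing_add_left σ tr
  smul_left := integrationPairing_smul_left σ tr
  add_right := integrationPairing_add_right σ tr
  smul_right := integrationPairing_smul_right σ tr
  separating_left η h := by
    obtain ⟨ξ, rfl⟩ := exists_sectionForm_eq σ η
    rw [eq_zero_of_integrationPairing_sectionForm σ tr ξ (h ξ)]
    exact AdForm.ext fun p => ContinuousAlternatingMap.ext fun X => smul_zero _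
  separating_right ξ h := eq_zero_of_integrationPairing_sectionForm σ tr ξ (h _)
  invariant := integrationPairing_smul_gauge σ tr

/-- A bump function times the covector in a chart. Differentials of global functions thus realise
every covector at a point and serve as test forms. -/
theorem exists_tangent_eq {E : Type*} [NormedAddCommGroup E] [NormedSpace ℝ E]
    [FiniteDimensional ℝ E] {N : Type*} [TopologicalSpace N] [ChartedSpace E N]
    [IsManifold 𝓘(ℝ, E) ∞ N] [T2Space N] (m : N) (b : E →L[ℝ] ℝ) :
    ∃ h : N → ℝ, ContMDiff 𝓘(ℝ, E) 𝓘(ℝ, ℝ) ∞ h ∧ tangent (E := E) (E' := ℝ) h m = b := by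
  obtain ⟨f⟩ : Nonempty (SmoothBumpFunction 𝓘(ℝ, E) m) := inferInstance
  refine ⟨fun x => f x • b (extChartAt 𝓘(ℝ, E) m x), f.contMDiff_smul
    (b.contDiff.contMDiff.comp_contMDiffOn contMDiffOn_extChartAt), ?_⟩
  have hev : (fun x => f x • b (extChartAt 𝓘(ℝ, E) m x)) =ᶠ[𝓝 m] b ∘ extChartAt 𝓘(ℝ, E) m := by
    filter_upwards [f.eventuallyEq_one] with x hx
    simp [hx]
  rw [tangent_congr hev, tangent_comp b.mdifferentiableAt
    (mdifferentiableAt_chart (mem_extChartAt_source m)), tangent_chart_self,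
    ContinuousLinearMap.comp_id, tangent_eq_fderiv, b.fderiv]

theorem traceWedge_sectionForm {τ : M → 𝓔(n) [⋀^Fin 1]→L[ℝ] ℝ} (hτ : IsSmoothForm τ)
    (α : AdForm B 1) (ξ : AdSection B) (p : P) : traceWedge tr α (sectionForm hτ ξ) p =
      wedge (ContinuousLinearMap.mul ℝ ℝ) (tracePair tr ξ α p)
        (pullback (E := EP) (E' := 𝓔(n)) B.proj τ p) := by
  ext X
  rw [traceWedge_apply]
  refine Eq.trans ?_ (wedge_one_one_apply _ _ _ X).symm
  simp only [sectionForm_apply, tracePair_apply, map_smul, ContinuousLinearMap.mul_apply',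
    smul_eq_mul, tr.symm (ξ.1 p)]
  ring

variable (hn : 1 ≤ n)

theorem pullback_wedgeSymplectic_descend {η : P → EP [⋀^Fin 2]→L[ℝ] ℝ} (hη : IsBasic B η) :
    pullback (E := EP) (E' := 𝓔(n)) B.proj (wedgeSymplectic hn σ (descend B η)) = fun p =>
      castDegree (show 1 + 1 + 2 * (n - 1) = 2 * n by omega) (wedge (ContinuousLinearMap.mul ℝ ℝ)
        (η p) (pullback (E := EP) (E' := 𝓔(n)) B.proj (fun m => wedgePow (σ.form m) (n - 1)) p)) := by
  have h1 := pullback_castDegree (E := EP) (E' := 𝓔(n))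
    (show 1 + 1 + 2 * (n - 1) = 2 * n by omega) B.proj fun m =>
      wedge (ContinuousLinearMap.mul ℝ ℝ) (descend B η m) (wedgePow (σ.form m) (n - 1))
  refine h1.trans (funext fun p => congrArg (castDegree _) ?_)
  have h2 := congrFun (pullback_wedge (E := EP) (E' := 𝓔(n)) (ContinuousLinearMap.mul ℝ ℝ) B.proj
    (descend B η) fun m => wedgePow (σ.form m) (n - 1)) p
  rw [pullback_proj_descend hη] at h2
  exact h2

theorem isSmoothForm_wedge_wedgePow {τ : M → 𝓔(n) [⋀^Fin 1]→L[ℝ] ℝ} (hτ : IsSmoothForm τ) :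
    IsSmoothForm fun m => wedge (ContinuousLinearMap.mul ℝ ℝ) (τ m)
      (wedgePow (σ.form m) (n - 1)) :=
  hτ.wedge _ (σ.smooth.wedgePow (n - 1))

/-- Associativity regroups tr(α, ξ) ∧ τ ∧ σ^(n-1), so that non-degeneracy of Ω is reduced to that of
the pairing, without any localisation of α. -/
theorem atiyahBottForm_sectionForm {τ : M → 𝓔(n) [⋀^Fin 1]→L[ℝ] ℝ} (hτ : IsSmoothForm τ)
    (Γ : Connection B) (α : AdForm B 1) (ξ : AdSection B) :
    atiyahBottForm hn σ tr B Γ α (sectionForm hτ ξ) = integrationPairing σ tr B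
      (AdForm.cast (show 1 + (1 + 2 * (n - 1)) = 2 * n by omega)
        (wedgeBase (isSmoothForm_wedge_wedgePow σ hτ) α)) ξ := by
  rw [atiyahBottForm_eq, integrationPairing_eq]
  congr 1
  refine (descend_eq ?_).symm
  rw [pullback_wedgeSymplectic_descend σ hn (isBasic_traceWedge tr _ _), tracePair_cast,
    tracePair_wedgeBase]
  funext p
  have h1 := congrFun (pullback_wedge (E := EP) (E' := 𝓔(n)) (ContinuousLinearMap.mul ℝ ℝ) B.proj
    τ fun m => wedgePow (σ.form m) (n - 1)) p
  beta_reduce at h1 ⊢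
  rw [h1, traceWedge_sectionForm, ← wedge_mul_assoc, castDegree_trans]

/-- Test forms df ⊗ ξ and the non-degenerate pairing give α ∧ df ∧ σ^(n-1) = 0 for all f. If v =
α(Y) were non-zero at p, the scalar product with v would reduce this to a ∧ b ∧ σ^(n-1) = 0 for all
covectors b at π(p), whence a = 0 by symplectic linear algebra. -/
theorem eq_zero_of_atiyahBottForm (Γ : Connection B) (α : AdForm B 1)
    (h : ∀ β, atiyahBottForm hn σ tr B Γ α β = 0) : α = 0 := by
  obtain ⟨j, rfl⟩ : ∃ j, n = j + 1 := ⟨n - 1, by omega⟩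
  refine AdForm.ext fun p => ContinuousAlternatingMap.ext fun Y => ?_
  obtain ⟨S, hS⟩ := exists_lift_tangent_proj (B := B) p
  by_contra hne
  set v : EG := α.form p Y with hv
  -- The covector w ↦ tr(v, α(S w)), with S a right inverse of dπ. Its value on the projection of Y
  -- is tr(v, v), by horizontality of α.
  set a : 𝓔(j + 1) →L[ℝ] ℝ := (ContinuousAlternatingMap.ofSubsingletonLIE (𝕜 := ℝ) (E := 𝓔(j + 1))
    (F := ℝ) (0 : Fin 1)).symm ((tr.toBilin v).compContinuousAlternatingMap
      ((α.form p).compContinuousLinearMap S)) with ha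
  have hcov : covectorForm a = (tr.toBilin v).compContinuousAlternatingMap
      ((α.form p).compContinuousLinearMap S) :=
    LinearIsometryEquiv.apply_symm_apply (ContinuousAlternatingMap.ofSubsingletonLIE (𝕜 := ℝ)
      (E := 𝓔(j + 1)) (F := ℝ) (0 : Fin 1)) _
  have ha0 : a = 0 := by
    refine eq_zero_of_wedge_wedgePow_eq_zero (j := j) (by simp) (σ.nondegenerate (B.proj p)) a
      fun b => ?_
    obtain ⟨f, hf, hfb⟩ := exists_tangent_eq (B.proj p) b
    have hτ : IsSmoothForm (dForm 𝓔(j + 1) f) := isSmoothForm_dForm hf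
    have h0 := (isCoadjointPairing_integrationPairing σ tr (B := B)).separating_left _ fun ξ =>
      (atiyahBottForm_sectionForm σ tr hn hτ Γ α ξ).symm.trans (h _)
    have h1 : wedge (ContinuousLinearMap.lsmul ℝ ℝ : ℝ →L[ℝ] EG →L[ℝ] EG).flip (α.form p)
        (pullback (E := EP) (E' := 𝓔(j + 1)) B.proj (fun m => wedge (ContinuousLinearMap.mul ℝ ℝ)
          (dForm 𝓔(j + 1) f m) (wedgePow (σ.form m) j)) p) = 0 :=
      (castDegree_eq_zero _).1 (congrFun (congrArg AdForm.form h0) p)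
    have h2 : (pullback (E := EP) (E' := 𝓔(j + 1)) B.proj (fun m =>
        wedge (ContinuousLinearMap.mul ℝ ℝ) (dForm 𝓔(j + 1) f m) (wedgePow (σ.form m) j))
          p).compContinuousLinearMap S = wedge (ContinuousLinearMap.mul ℝ ℝ) (covectorForm b)
            (wedgePow (σ.form (B.proj p)) j) := by
      have hd : dForm 𝓔(j + 1) f (B.proj p) = covectorForm b := by
        rw [← hfb]
        rfl
      rw [pullback_proj_comp_lift hS, hd]
    have h3 := congrArg (fun θ : EP [⋀^Fin (1 + (1 + 2 * j))]→L[ℝ] EG => (tr.toBilin v).compContinuousAlternatingMap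
      (ContinuousAlternatingMap.compContinuousLinearMap θ S)) h1
    beta_reduce at h3
    rw [wedge_compContinuousLinearMap, h2, compContinuousAlternatingMap_wedge (L := tr.toBilin v)
      (b := (ContinuousLinearMap.lsmul ℝ ℝ : ℝ →L[ℝ] EG →L[ℝ] EG).flip)
      (b' := ContinuousLinearMap.mul ℝ ℝ) (L₁ := tr.toBilin v) (L₂ := ContinuousLinearMap.id ℝ ℝ)
      (fun v w => by simp [mul_comm]), ← hcov] at h3
    refine (castDegree_eq_zero (Nat.add_assoc 1 1 (2 * j))).1 ?_
    rw [wedge_mul_assoc]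
    refine Eq.trans h3 (ContinuousAlternatingMap.ext fun X => map_zero (tr.toBilin v))
  have h2 : tr.toBilin v v = 0 := by
    have h3 := DFunLike.congr_fun hcov fun i => tangent (E := EP) (E' := 𝓔(j + 1)) B.proj p (Y i)
    rw [covectorForm_apply, ha0] at h3
    have h4 : α.form p (fun i => S (tangent (E := EP) (E' := 𝓔(j + 1)) B.proj p (Y i))) = v :=
      B.horizontal_congr (α.isTensorial.horizontal p) fun i => hS _
    have h5 : 0 = tr.toBilin v (α.form p fun i =>
      S (tangent (E := EP) (E' := 𝓔(j + 1)) B.proj p (Y i))) := h3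
    rw [h4] at h5
    exact h5.symm
  exact (tr.pos v hne).ne' h2

end Nondegeneracy

/-! ### The symplectic structure and the momentum map -/

section Momentum

variable {n : ℕ} {EG EP : Type*}
  [NormedAddCommGroup EG] [NormedSpace ℝ EG] [NormedAddCommGroup EP] [NormedSpace ℝ EP]
  {M G P : Type*} [TopologicalSpace M] [ChartedSpace (EuclideanSpace ℝ (Fin (2 * n))) M]
  [IsManifold 𝓘(ℝ, EuclideanSpace ℝ (Fin (2 * n))) ∞ M] [T2Space M] [CompactSpace M]
  [TopologicalSpace G] [ChartedSpace EG G] [Group G]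
  [TopologicalSpace P] [ChartedSpace EP P]
  [FiniteDimensional ℝ EG] [LieGroup 𝓘(ℝ, EG) ∞ G] [IsManifold 𝓘(ℝ, EP) ∞ P]

local notation "𝓔(" n ")" => EuclideanSpace ℝ (Fin (2 * n))

variable (hn : 1 ≤ n) (σ : SymplecticForm 𝓔(n) M) (tr : AdInvariantScalarProduct EG G)
  {B : PrincipalBundle 𝓔(n) EG EP M G P}

theorem isSymplecticStructure_atiyahBottForm [FiniteDimensional ℝ EP] :
    IsSymplecticStructure (atiyahBottForm hn σ tr B) where
  add_left := atiyahBottForm_add_left hn σ tr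
  smul_left := atiyahBottForm_smul_left hn σ tr
  skew := atiyahBottForm_skew hn σ tr
  smooth := isBastianiSmooth_atiyahBottForm hn σ tr
  closed Γ α β γ := by
    -- Ω has constant coefficients, so each of the three derivatives vanishes.
    have h : ∀ α β γ : AdForm B 1,
        deriv (fun t : ℝ => atiyahBottForm hn σ tr B (Γ.translate (t • α)) β γ) 0 = 0 :=
      fun α β γ => deriv_const 0 (atiyahBottForm hn σ tr B Γ β γ)
    rw [h, h, h]
    simp
  nondegenerate := eq_zero_of_atiyahBottForm σ tr hn

variable (B) in
/-- Multiplication by `σ^(n-1)`. -/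
def mulSymplectic : AdForm B 2 →ₗ[ℝ] AdForm B (2 * n) :=
  AdForm.cast (show 2 + 2 * (n - 1) = 2 * n by omega) ∘ₗ wedgeBase (σ.smooth.wedgePow (n - 1))

/-- The momentum map `Γ ↦ curv Γ ∧ σ^(n-1)`. -/
def momentumMap (Γ : Connection B) : AdForm B (2 * n) := mulSymplectic hn σ B Γ.curvatureAd

theorem momentumMap_form (Γ : Connection B) :
    (momentumMap hn σ Γ).form = curvatureWedge hn σ B Γ := rfl

theorem momentumMap_translate (Γ : Connection B) (α : AdForm B 1) :
    momentumMap hn σ (Γ.translate α) = momentumMap hn σ Γ + mulSymplectic hn σ B (Γ.covD α) +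
      (1 / 2 : ℝ) • mulSymplectic hn σ B (Connection.bracketForm α α) := by
  rw [momentumMap, Connection.curvatureAd_translate, map_add, map_add, map_smul]
  rfl

/-- As a function of α, the momentum map is a constant plus d_Γ α ∧ σ^(n-1) plus ½ [α ∧ α] ∧
σ^(n-1), all continuous. -/
theorem isBastianiSmooth_momentumMap [FiniteDimensional ℝ EP] (Γ : Connection B) :
    IsBastianiSmooth fun α : AdForm B 1 => momentumMap hn σ (Γ.translate α) := by
  have hK : Continuous (mulSymplectic hn σ B) :=
    (AdForm.continuous_cast _).comp (continuous_wedgeBase _)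
  refine IsQuadraticMap.isBastianiSmooth ⟨momentumMap hn σ Γ,
    mulSymplectic hn σ B ∘ₗ Γ.covDLinear, LinearMap.mk₂ ℝ
      (fun α β => (1 / 2 : ℝ) • mulSymplectic hn σ B (Connection.bracketForm α β))
      (fun α α' β => by rw [Connection.bracketForm_add_left, map_add, smul_add])
      (fun c α β => by rw [Connection.bracketForm_smul_left, map_smul, smul_comm])
      (fun α β β' => by rw [Connection.bracketForm_add_right, map_add, smul_add])
      (fun c α β => by rw [Connection.bracketForm_smul_right, map_smul, smul_comm]),
    hK.comp Γ.continuous_covD, ?_, fun α => momentumMap_translate hn σ Γ α⟩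
  exact (hK.comp Connection.continuous_bracketForm).const_smul (1 / 2 : ℝ)

/-- The curvature is natural, and the factor π^* σ^(n-1) is fixed by gauge transformations. -/
theorem momentumMap_smul (φ : GaugeTransformation B) (Γ : Connection B) :
    momentumMap hn σ (φ • Γ) = φ • momentumMap hn σ Γ := by
  refine AdForm.ext fun p => ?_
  have h1 := congrFun (pullback_castDegree (E := EP) (E' := EP)
    (show 2 + 2 * (n - 1) = 2 * n by omega) φ⁻¹.toDiffeo fun p =>
      wedge (ContinuousLinearMap.lsmul ℝ ℝ : ℝ →L[ℝ] EG →L[ℝ] EG).flip (Γ.curvature p)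
        (pullback (E := EP) (E' := 𝓔(n)) B.proj (fun m => wedgePow (σ.form m) (n - 1)) p)) p
  refine Eq.trans ?_ h1.symm
  have h2 := congrFun (pullback_wedge (E := EP) (E' := EP)
    (ContinuousLinearMap.lsmul ℝ ℝ : ℝ →L[ℝ] EG →L[ℝ] EG).flip φ⁻¹.toDiffeo Γ.curvature
      (pullback (E := EP) (E' := 𝓔(n)) B.proj fun m => wedgePow (σ.form m) (n - 1))) p
  rw [pullback_gauge_proj] at h2
  refine Eq.trans ?_ (congrArg (castDegree _) h2.symm)
  rw [momentumMap_form, curvatureWedge, Connection.curvature_smul]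
  rfl

theorem integrationPairing_mulSymplectic (γ : AdForm B 2) (ξ : AdSection B) :
    integrationPairing σ tr B (mulSymplectic hn σ B γ) ξ =
      integral σ (wedgeSymplectic hn σ (descend B (tracePair tr ξ γ))) := by
  rw [integrationPairing_eq]
  congr 1
  refine descend_eq ?_
  rw [pullback_wedgeSymplectic_descend σ hn (isBasic_tracePair tr ξ γ), mulSymplectic,
    LinearMap.comp_apply, tracePair_cast, tracePair_wedgeBase]

/-- As σ^(n-1) is closed, dθ ∧ σ^(n-1) = d(θ ∧ σ^(n-1)), and Stokes' theorem applies. -/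
theorem integral_wedgeSymplectic_extD {θ : M → 𝓔(n) [⋀^Fin 1]→L[ℝ] ℝ} (hθ : IsSmoothForm θ) :
    integral σ (wedgeSymplectic hn σ (extD θ)) = 0 := by
  have h := integral_extD σ (show 1 + 2 * (n - 1) + 1 = 2 * n by omega)
    (isSmoothForm_wedge_wedgePow σ hθ)
  rw [extD_wedge_of_closed _ hθ (σ.smooth.wedgePow (n - 1))
    (extD_wedgePow σ.smooth σ.closed (n - 1))] at h
  simp only [castDegree_trans] at h
  exact h

/-- The ordinary Leibniz rule; the bracket terms hidden in the two covariant derivatives cancel by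
infinitesimal invariance of `tr`. -/
theorem extD_tracePair (Γ : Connection B) (ξ : AdSection B) (β : AdForm B 1) :
    extD (tracePair tr ξ β) = tracePair tr ξ (Γ.covD β) + traceWedge tr (Γ.covSection ξ) β := by
  have h := extD_bilin tr.toBilin ξ.2.1 β.smooth
  refine h.trans (funext fun p => ContinuousAlternatingMap.ext fun X => ?_)
  have h1 := wedge_one_one_apply tr.toBilin (dForm EP ξ.1 p) (β.form p) X
  have h2 : (Γ.covD β).form p X = extD β.form p X +
      (lieBracket EG G (Γ.form p fun _ => X 0) (β.form p fun _ => X 1) -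
        lieBracket EG G (Γ.form p fun _ => X 1) (β.form p fun _ => X 0)) :=
    congrArg (extD β.form p X + ·) (wedge_one_one_apply (lieBracket EG G) (Γ.form p) (β.form p) X)
  have h3 := tr.lieBracket_invariant (Γ.form p fun _ => X 0) (ξ.1 p) (β.form p fun _ => X 1)
  have h4 := tr.lieBracket_invariant (Γ.form p fun _ => X 1) (ξ.1 p) (β.form p fun _ => X 0)
  change wedge tr.toBilin (dForm EP ξ.1 p) (β.form p) X + tr.toBilin (ξ.1 p) (extD β.form p X) =
    tracePair tr ξ (Γ.covD β) p X + traceWedge tr (Γ.covSection ξ) β p X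
  rw [h1, tracePair_apply, h2, traceWedge_apply, Connection.covSection_apply,
    Connection.covSection_apply, dForm_apply, dForm_apply]
  simp only [map_add, map_sub, add_apply]
  linarith

/-- Integration by parts: the exact form d tr(ξ, β), wedged with σ^(n-1), integrates to zero and is
the sum of the integrands of the two sides, up to sign. -/
theorem integrationPairing_covD (Γ : Connection B) (ξ : AdSection B) (β : AdForm B 1) :
    integrationPairing σ tr B (mulSymplectic hn σ B (Γ.covD β)) ξ =
      atiyahBottForm hn σ tr B Γ (-Γ.covSection ξ) β := by
  have hb := isBasic_tracePair tr ξ β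
  have hc := isBasic_tracePair tr ξ (Γ.covD β)
  have hw := isBasic_traceWedge tr (Γ.covSection ξ) β
  have h1 : extD (descend B (tracePair tr ξ β)) =
      descend B (tracePair tr ξ (Γ.covD β)) + descend B (traceWedge tr (Γ.covSection ξ) β) := by
    rw [← descend_add hc hw, ← extD_tracePair]
    refine (descend_eq ?_).symm
    rw [← extD_pullback B.contMDiff_proj hb.isSmoothForm_descend, pullback_proj_descend hb]
  have h2 := integral_wedgeSymplectic_extD hn σ hb.isSmoothForm_descend
  rw [h1, wedgeSymplectic_add, integral_add σ
    (isSmoothForm_wedgeSymplectic hn σ hc.isSmoothForm_descend)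
    (isSmoothForm_wedgeSymplectic hn σ hw.isSmoothForm_descend),
    ← integrationPairing_mulSymplectic, ← atiyahBottForm_eq hn σ tr Γ] at h2
  rw [← neg_one_smul ℝ (Γ.covSection ξ), atiyahBottForm_smul_left]
  linarith

theorem isMomentumMap_momentumMap [FiniteDimensional ℝ EP] :
    IsMomentumMap (atiyahBottForm hn σ tr B) (integrationPairing σ tr B) (momentumMap hn σ) where
  smooth := isBastianiSmooth_momentumMap hn σ
  momentum Γ ξ := by
    refine ⟨-Γ.covSection ξ, isFundamentalVector_neg_covSection Γ ξ, fun β => ?_⟩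
    set a := integrationPairing σ tr B (momentumMap hn σ Γ) ξ
    set b := integrationPairing σ tr B (mulSymplectic hn σ B (Connection.bracketForm β β)) ξ
    -- Along the line Γ + tβ the pairing is a quadratic polynomial in t, whose linear coefficient is
    -- the required value of Ω.
    have h : (fun t : ℝ => integrationPairing σ tr B (momentumMap hn σ (Γ.translate (t • β))) ξ) =
        fun t => a + t * atiyahBottForm hn σ tr B Γ (-Γ.covSection ξ) β + t ^ 2 * (b / 2) := by
      funext t
      have h1 : Γ.covD (t • β) = t • Γ.covD β := map_smul Γ.covDLinear t β
      rw [momentumMap_translate, h1, Connection.bracketForm_smul_left, Connection.bracketForm_smul_right, map_smul,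
        map_smul, map_smul, integrationPairing_add_left, integrationPairing_add_left,
        integrationPairing_smul_left, integrationPairing_smul_left, integrationPairing_smul_left,
        integrationPairing_smul_left, integrationPairing_covD]
      ring
    rw [h]
    have h2 := (((hasDerivAt_id (0 : ℝ)).mul_const
      (atiyahBottForm hn σ tr B Γ (-Γ.covSection ξ) β)).const_add a).add
        (((hasDerivAt_id (0 : ℝ)).pow 2).mul_const (b / 2))
    refine HasDerivAt.congr_deriv h2 ?_
    simp

end Momentum

end GaugeTheory

end

open GaugeTheory in
theorem mainTheorem12 {n : ℕ} (hn : 1 ≤ n)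
    {M : Type*} [TopologicalSpace M] [ChartedSpace (EuclideanSpace ℝ (Fin (2 * n))) M]
    [IsManifold 𝓘(ℝ, EuclideanSpace ℝ (Fin (2 * n))) ∞ M] [T2Space M] [CompactSpace M]
    (σ : SymplecticForm (EuclideanSpace ℝ (Fin (2 * n))) M)
    {EG : Type*} [NormedAddCommGroup EG] [NormedSpace ℝ EG] [FiniteDimensional ℝ EG]
    {G : Type*} [TopologicalSpace G] [ChartedSpace EG G] [Group G] [LieGroup 𝓘(ℝ, EG) ∞ G]
    [T2Space G] [CompactSpace G] (tr : AdInvariantScalarProduct EG G)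
    {EP : Type*} [NormedAddCommGroup EP] [NormedSpace ℝ EP] [FiniteDimensional ℝ EP]
    {P : Type*} [TopologicalSpace P] [ChartedSpace EP P] [IsManifold 𝓘(ℝ, EP) ∞ P] [T2Space P]
    (B : PrincipalBundle (EuclideanSpace ℝ (Fin (2 * n))) EG EP M G P) :
    IsSymplecticStructure (atiyahBottForm hn σ tr B) ∧
    (∀ (φ : GaugeTransformation B) (Γ : Connection B) (α β : AdForm B 1),
      Connection.HasVelocity (fun t => φ • Γ.translate (t • α)) (φ • α) ∧
      atiyahBottForm hn σ tr B (φ • Γ) (φ • α) (φ • β) = atiyahBottForm hn σ tr B Γ α β) ∧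
    (∀ Γ : Connection B, IsTensorial B Γ.curvature) ∧
    IsCoadjointPairing (integrationPairing σ tr B) ∧
    ∃ J : Connection B → AdForm B (2 * n),
      (∀ Γ, (J Γ).form = curvatureWedge hn σ B Γ) ∧
      IsMomentumMap (atiyahBottForm hn σ tr B) (integrationPairing σ tr B) J ∧
      ∀ (φ : GaugeTransformation B) (Γ : Connection B), J (φ • Γ) = φ • J Γ := by
  exact ⟨isSymplecticStructure_atiyahBottForm hn σ tr,
    fun φ Γ α β => ⟨hasVelocity_smul_translate φ Γ α, atiyahBottForm_smul_gauge hn σ tr φ Γ α β⟩,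
    fun Γ => Γ.isTensorial_curvature, isCoadjointPairing_integrationPairing σ tr,
    momentumMap hn σ, momentumMap_form hn σ, isMomentumMap_momentumMap hn σ tr,
    momentumMap_smul hn σ⟩
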